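/- **Setting.** Let $\Psi$ be a lattice of secrecy levels ($\sqsubseteq$, $\sqcup$). Channels $y_\alpha$ consist of a base name and a generation $\alpha\in\mathbb N$ (often not displayed). Session types are $A,B ::= 1 \mid \oplus\{\ell{:}A_\ell\}_{\ell\in I} \mid \&\{\ell{:}A_\ell\}_{\ell\in I} \mid A\otimes B \mid A\multimap B$ ($I$ a finite set of labels). A context $\Delta$ is a finite multiset of assumptions $y{:}A[c]$ with pairwise distinct channels; $c\in\Psi$ is the maximal secrecy of $y$. Process terms (up to renaming of bound channel variables) are $P,Q ::= y\leftarrow x \mid (x^{d}\leftarrow P)@d_2;Q \mid \mathbf{close}\,y \mid \mathbf{wait}\,x;Q \mid x.k;P \mid \mathbf{case}\,x(\ell\Rightarrow Q_\ell)_{\ell\in I} \mid \mathbf{send}\,z\,y;P \mid z\leftarrow\mathbf{recv}\,x;P$, where $x$ is bound in $P,Q$ in the second form and $z$ in $P$ in the last. **Term typing** $\Delta\vdash P@d_1::y{:}C[c]$ ($d_1$ is the running secrecy) is defined inductively by the rules (bound variables are chosen fresh; $K$ denotes an arbitrary succedent $y{:}C[c']$): - $\Delta\vdash (y.k;P)@d_1::y{:}\oplus\{\ell{:}A_\ell\}_{I}[c]$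 if $k\in I$ and $\Delta\vdash P@d_1::y{:}A_k[c]$; and $\Delta,x{:}\oplus\{\ell{:}A_\ell\}_{I}[c]\vdash(\mathbf{case}\,x(\ell\Rightarrow Q_\ell)_{I})@d_1::K$ if $\Delta,x{:}A_k[c]\vdash Q_k@(c\sqcup d_1)::K$ for all $k\in I$. - $\Delta\vdash(\mathbf{case}\,y(\ell\Rightarrow Q_\ell)_{I})@d_1::y{:}\&\{\ell{:}A_\ell\}_{I}[c]$ if $\Delta\vdash Q_k@c::y{:}A_k[c]$ for all $k\in I$; and $\Delta,x{:}\&\{\ell{:}A_\ell\}_{I}[c]\vdash(x.k;P)@d_1::K$ if $d_1\sqsubseteq c$, $k\in I$ and $\Delta,x{:}A_k[c]\vdash P@d_1::K$. - $\Delta,z{:}A[c]\vdash(\mathbf{send}\,z\,y;P)@d_1::y{:}A\otimes B[c]$ if $\Delta\vdash P@d_1::y{:}B[c]$; and $\Delta,x{:}A\otimes B[c]\vdash(z\leftarrow\mathbf{recv}\,x;P)@d_1::K$ if $\Delta,z{:}A[c],x{:}B[c]\vdash P@(c\sqcup d_1)::K$. - $\Delta\vdash(z\leftarrow\mathbf{recv}\,y;P)@d_1::y{:}A\multimap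 B[c]$ if $\Delta,z{:}A[c]\vdash P@c::y{:}B[c]$; and $\Delta,z{:}A[d],x{:}A\multimap B[d]\vdash(\mathbf{send}\,z\,x;P)@d_1::K$ if $d_1\sqsubseteq d$ and $\Delta,x{:}B[d]\vdash P@d_1::K$. - $\cdot\vdash(\mathbf{close}\,y)@d_1::y{:}1[c]$; and $\Delta,x{:}1[c]\vdash(\mathbf{wait}\,x;Q)@d_1::K$ if $\Delta\vdash Q@(c\sqcup d_1)::K$. - $x{:}A[c]\vdash(y\leftarrow x)@d_1::y{:}A[c]$; and $\Delta_1,\Delta_2\vdash((x^{d'}\leftarrow P)@d_2;Q)@d_1::y{:}C[d]$ if $d_1\sqsubseteq d_2\sqsubseteq d'\sqsubseteq d$, all levels in $\Delta_1$ are $\sqsubseteq d'$, $\Delta_1\vdash P@d_2::x{:}B[d']$ and $x{:}B[d'],\Delta_2\vdash Q@d_1::y{:}C[d]$. **Configurations** are finite multisets of processes $\mathbf{proc}(y[c],P@d)$ and messages: the positive messages $\mathbf{msg}(\mathbf{close}\,y)$, $\mathbf{msg}(y.k;y\leftarrow u)$, $\mathbf{msg}(\mathbf{send}\,x\,y;y\leftarrow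 u)$, which record the level of $y$, and the negative messages $\mathbf{msg}(y.k;u\leftarrow y)$, $\mathbf{msg}(\mathbf{send}\,x\,y;u\leftarrow y)$. A process $\mathbf{proc}(y[c],\cdot)$ and a positive message along $y$ offer $y$; a negative message offers $u$. The judgment $\Delta\Vdash\mathcal C::\Delta'$ is derived by: $x{:}A[d]\Vdash\cdot::x{:}A[d]$; $\cdot\Vdash\cdot::\cdot$; $\Delta_0,\Delta_0'\Vdash\mathcal C,\mathcal C_1::\Delta,x{:}A[d]$ from $\Delta_0\Vdash\mathcal C::\Delta$ and $\Delta_0'\Vdash\mathcal C_1::x{:}A[d]$; and, when $\Delta_0\Vdash\mathcal C::\Delta$ and all levels in $\Delta_0',\Delta$ are $\sqsubseteq d$: $\Delta_0,\Delta_0'\Vdash\mathcal C,\mathbf{proc}(x[d],P@d_1)::x{:}A[d]$ from $d_1\sqsubseteq d$ and $\Delta_0',\Delta\vdash P@d_1::x{:}A[d]$, and $\Delta_0,\Delta_0'\Vdash\mathcal C,\mathbf{msg}(P)::x{:}A[d]$ from $\Delta_0',\Delta\vdash P@d::x{:}A[d]$ (a recorded level must be $d$). It is required throughout that the channels of $\Delta$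 and those offered by the nodes of $\mathcal C$ are pairwise distinct. A succedent $\cdot$ (for a tree) stands for $z{:}1[c]$ with $z$ and $c$ disregarded, or for nothing ($\cdot\Vdash\cdot::\cdot$). **Dynamics** $\mathcal C\mapsto_{\Delta\Vdash\Delta'}\mathcal C'$ is multiset rewriting (the remaining nodes are unchanged, except in the first rule); an allocated channel is not in use anywhere in the surrounding closed configuration, $x_0$ has generation $0$, and $y'$ denotes a later generation of $y$: - $\mathbf{proc}(y[c],(y\leftarrow x)@d_1),\mathcal G\mapsto[x/y]\mathcal G$ if $y\notin\Delta'$; - $\mathbf{proc}(y[c],((x^d\leftarrow P)@d_2;Q)@d_1)\mapsto\mathbf{proc}(x_0[d],[x_0/x]P@d_2),\mathbf{proc}(y[c],[x_0/x]Q@d_1)$; - $\mathbf{proc}(y[c],\mathbf{close}\,y@d_1)\mapsto\mathbf{msg}(\mathbf{close}\,y)$; and $\mathbf{msg}(\mathbf{close}\,y),\mathbf{proc}(x[c'],(\mathbf{wait}\,y;Q)@d_1)\mapsto\mathbf{proc}(x[c'],Q@(d_1\sqcup c))$, $c$ being the level of $y$; - $\mathbf{proc}(y[c],(y.k;P)@d_1)\mapsto\mathbf{proc}(y'[c],[y'/y]P@d_1),\mathbf{msg}(y.k;y\leftarrow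 y')$; and $\mathbf{msg}(y.k;y\leftarrow v),\mathbf{proc}(w[c'],\mathbf{case}\,y(\ell\Rightarrow Q_\ell)_I@d_1)\mapsto\mathbf{proc}(w[c'],[v/y]Q_k@(d_1\sqcup c))$; - for $x\ne y$, $\mathbf{proc}(y[c],(x.k;P)@d_1)\mapsto\mathbf{msg}(x.k;x'\leftarrow x),\mathbf{proc}(y[c],[x'/x]P@d_1)$; and $\mathbf{proc}(y[c],\mathbf{case}\,y(\ell\Rightarrow Q_\ell)_I@d_1),\mathbf{msg}(y.k;v\leftarrow y)\mapsto\mathbf{proc}(v[c],[v/y]Q_k@c)$; - $\mathbf{proc}(y[c],(\mathbf{send}\,x\,y;P)@d_1)\mapsto\mathbf{proc}(y'[c],[y'/y]P@d_1),\mathbf{msg}(\mathbf{send}\,x\,y;y\leftarrow y')$; and $\mathbf{msg}(\mathbf{send}\,x\,y;y\leftarrow v),\mathbf{proc}(w[c'],(z\leftarrow\mathbf{recv}\,y;P)@d_1)\mapsto\mathbf{proc}(w[c'],[x/z][v/y]P@(d_1\sqcup c))$; - for $w\ne y$, $\mathbf{proc}(y[c],(\mathbf{send}\,x\,w;P)@d_1)\mapsto\mathbf{msg}(\mathbf{send}\,x\,w;w'\leftarrow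 w),\mathbf{proc}(y[c],[w'/w]P@d_1)$; and $\mathbf{proc}(y[c],(z\leftarrow\mathbf{recv}\,y;P)@d_1),\mathbf{msg}(\mathbf{send}\,x\,y;v\leftarrow y)\mapsto\mathbf{proc}(v[c],[x/z][v/y]P@c)$. A configuration $\Delta\Vdash\mathcal C::\Delta'$ is *poised* if it is empty, or it cannot step and one of its nodes attempts to communicate along a channel of $\Delta$ or $\Delta'$. **Logical relation.** Let $K$ be $x{:}A[c]$ or $\cdot$. A split $\mathcal C|\mathcal D|\mathcal F$ is in $\mathrm{Tree}(\Delta\Vdash K)$ if $\cdot\Vdash\mathcal C::\Delta$, $\Delta\Vdash\mathcal D::K$, $K\Vdash\mathcal F::\cdot$, and the nodes of $\mathcal C\mathcal D\mathcal F$ offer pairwise distinct channels. $\mathcal E_\Psi\llbracket\Delta\Vdash K\rrbracket$ is the least relation such that $(\mathcal B_1,\mathcal B_2)\in\mathcal E_\Psi\llbracket\Delta\Vdash K\rrbracket$ iff $\mathcal B_i=\mathcal C_i\mathcal D_i\mathcal F_i$ for some splits in $\mathrm{Tree}(\Delta\Vdash K)$ such that, for $i=1,2$, $\mathcal C_i$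 and $\mathcal F_i$ can run (under $\mapsto_{\cdot\Vdash\Delta}$, $\mapsto_{K\Vdash\cdot}$) to poised configurations, and for all poised $\mathcal C_i',\mathcal F_i'$ so reached there are poised $\mathcal D_i'$, reached from $\mathcal D_i$ under $\mapsto_{\Delta\Vdash K}$, with $(\mathcal C_1'|\mathcal D_1'|\mathcal F_1';\mathcal C_2'|\mathcal D_2'|\mathcal F_2')\in\mathcal V_\Psi\llbracket\Delta\Vdash K\rrbracket$. A pair of splits $(\mathcal C_1|\mathcal D_1|\mathcal F_1;\mathcal C_2|\mathcal D_2|\mathcal F_2)$ is in $\mathcal V_\Psi\llbracket\Delta\Vdash K\rrbracket$ iff both are in $\mathrm{Tree}(\Delta\Vdash K)$ and all of the following hold, where $\mathcal B_i=\mathcal C_i\mathcal D_i\mathcal F_i$: *Right.* Let $K=y{:}T[c]$. - $T=1$: if $\mathcal D_1$ or $\mathcal D_2$ contains $\mathbf{msg}(\mathbf{close}\,y)$, then $\mathcal D_1=\mathcal D_2=\mathbf{msg}(\mathbf{close}\,y)$, $\Delta=\cdot$ and $\mathcal C_1=\mathcal C_2=\cdot$. - $T=\oplus\{\ell{:}A_\ell\}_I$: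 if $\mathcal D_1$ or $\mathcal D_2$ contains $\mathbf{msg}(y.k;y\leftarrow u)$, then both do, $k\in I$ and $(\mathcal B_1,\mathcal B_2)\in\mathcal E\llbracket\Delta\Vdash u{:}A_k[c]\rrbracket$. - $T=\&\{\ell{:}A_\ell\}_I$: if $\mathcal F_1$ and $\mathcal F_2$ contain $\mathbf{msg}(y.k;u\leftarrow y)$, then $k\in I$ and $(\mathcal B_1,\mathcal B_2)\in\mathcal E\llbracket\Delta\Vdash u{:}A_k[c]\rrbracket$. - $T=A\otimes B$: if $\mathcal D_1$ or $\mathcal D_2$ contains $\mathbf{msg}(\mathbf{send}\,x\,y;y\leftarrow u)$, then both do, and for some $\Delta=\Delta',\Delta''$: $(\mathcal B_1,\mathcal B_2)\in\mathcal E\llbracket\Delta''\Vdash x{:}A[c]\rrbracket$ and $(\mathcal B_1,\mathcal B_2)\in\mathcal E\llbracket\Delta'\Vdash u{:}B[c]\rrbracket$. - $T=A\multimap B$: if $\mathcal F_1$ and $\mathcal F_2$ contain $\mathbf{msg}(\mathbf{send}\,x\,y;u\leftarrow y)$, then $(\mathcal B_1,\mathcal B_2)\in\mathcal E\llbracket\Delta,x{:}A[c]\Vdash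 u{:}B[c]\rrbracket$. - any $T$: if $\mathcal D_1$ or $\mathcal D_2$ contains a forward $\mathbf{proc}(y[c],(y\leftarrow x)@d)$, then $\mathcal D_i=\mathcal D_i',\mathbf{proc}(y[c],(y\leftarrow x)@d_i)$ for $i=1,2$ and $([x/y](\mathcal C_1\mathcal D_1'\mathcal F_1),[x/y](\mathcal C_2\mathcal D_2'\mathcal F_2))\in\mathcal E\llbracket\Delta\Vdash x{:}T[c]\rrbracket$. *Left.* Let $\Delta=\Delta_0,y{:}T[c]$, for each choice of $y{:}T[c]$ in $\Delta$. - $T=1$: if $\mathcal C_1$ and $\mathcal C_2$ contain $\mathbf{msg}(\mathbf{close}\,y)$, then $(\mathcal B_1,\mathcal B_2)\in\mathcal E\llbracket\Delta_0\Vdash K\rrbracket$. - $T=\oplus\{\ell{:}A_\ell\}_I$: if $\mathcal C_1$ and $\mathcal C_2$ contain $\mathbf{msg}(y.k;y\leftarrow u)$, then $k\in I$ and $(\mathcal B_1,\mathcal B_2)\in\mathcal E\llbracket\Delta_0,u{:}A_k[c]\Vdash K\rrbracket$. - $T=\&\{\ell{:}A_\ell\}_I$: if $\mathcal D_1$ or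 $\mathcal D_2$ contains $\mathbf{msg}(y.k;u\leftarrow y)$, then both do, $k\in I$ and $(\mathcal B_1,\mathcal B_2)\in\mathcal E\llbracket\Delta_0,u{:}A_k[c]\Vdash K\rrbracket$. - $T=A\otimes B$: if $\mathcal C_1$ and $\mathcal C_2$ contain $\mathbf{msg}(\mathbf{send}\,x\,y;y\leftarrow u)$, then $(\mathcal B_1,\mathcal B_2)\in\mathcal E\llbracket\Delta_0,x{:}A[c],u{:}B[c]\Vdash K\rrbracket$. - $T=A\multimap B$: if $\mathcal D_1$ or $\mathcal D_2$ contains $\mathbf{msg}(\mathbf{send}\,x\,y;u\leftarrow y)$, then both do, and for some $\Delta_0=\Delta',\Delta''$: $(\mathcal B_1,\mathcal B_2)\in\mathcal E\llbracket\Delta''\Vdash x{:}A[c]\rrbracket$ and $(\mathcal B_1,\mathcal B_2)\in\mathcal E\llbracket\Delta',u{:}B[c]\Vdash K\rrbracket$. - any $T$: if $\mathcal C_i=\mathcal C_i',\mathbf{proc}(y[c],(y\leftarrow x)@d_i)$ for $i=1,2$, then $([x/y](\mathcal C_1'\mathcal D_1\mathcal F_1),[x/y](\mathcal C_2'\mathcal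 D_2\mathcal F_2))\in\mathcal E\llbracket\Delta_0,x{:}T[c]\Vdash[x/y]K\rrbracket$. **Equivalence up to observable messages.** For $\xi\in\Psi$ let $\Delta\Downarrow\xi$ consist of the assumptions of $\Delta$ with level $\sqsubseteq\xi$, and let $(x{:}A[c])\Downarrow\xi$ be $x{:}A[c]$ if $c\sqsubseteq\xi$ and $\cdot$ otherwise. $(\Delta_1\Vdash\mathcal D_1::k_1)\equiv^\Psi_\xi(\Delta_2\Vdash\mathcal D_2::k_2)$ means: $\Delta_i\Vdash\mathcal D_i::k_i$ for $i=1,2$; $\Delta_1\Downarrow\xi=\Delta_2\Downarrow\xi=:\Delta$; $k_1\Downarrow\xi=k_2\Downarrow\xi=:K$; and for all $\mathcal C_i,\mathcal F_i$ with $\cdot\Vdash\mathcal C_i::\Delta_i$ and $k_i\Vdash\mathcal F_i::\cdot$, such that the nodes of $\mathcal C_i\mathcal D_i\mathcal F_i$ offer pairwise distinct channels ($i=1,2$), $(\mathcal C_1\mathcal D_1\mathcal F_1,\mathcal C_2\mathcal D_2\mathcal F_2)\in\mathcal E_\Psi\llbracket\Delta\Vdash K\rrbracket$. **Theorem (Noninterference).**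 For every level $\xi\in\Psi$ and every well-typed open configuration $\Delta\Vdash\mathcal D::x{:}T[c]$, $$(\Delta\Vdash\mathcal D::x{:}T[c])\ \equiv^\Psi_\xi\ (\Delta\Vdash\mathcal D::x{:}T[c]).$$ -/

import Mathlib

namespace IFC

universe u

/-! ### Channels, labels, session types, contexts -/

/-- A channel `y_α`: a base name `y` together with a generation `α`. -/
abbrev Chan := ℕ × ℕ

abbrev Label := ℕ

/-- Session types `1`, `⊕{ℓ : A_ℓ}`, `&{ℓ : A_ℓ}`, `A ⊗ B`, `A ⊸ B`
(finite label sets). -/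
inductive Ty : Type
  | one : Ty
  | plus (I : Finset Label) (A : {k // k ∈ I} → Ty) : Ty
  | wth (I : Finset Label) (A : {k // k ∈ I} → Ty) : Ty
  | tensor (A B : Ty) : Ty
  | lolli (A B : Ty) : Ty

/-- An assumption `y : A[c]`: channel, session type, maximal secrecy. -/
structure Decl (L : Type u) where
  ch : Chan
  ty : Ty
  lvl : L

/-- Linear contexts; distinctness of the channels is imposed in `CfgOk`. -/
abbrev Ctx (L : Type u) := Multiset (Decl L)

def Ctx.names {L : Type u} (Δ : Ctx L) : Multiset Chan := Δ.map Decl.ch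

/-! ### Terms (locally nameless: bound channel variables are de Bruijn indices) -/

/-- A reference to a channel in a term: a channel, or a bound channel variable. -/
inductive Ref : Type
  | fv (a : Chan) : Ref
  | bv (n : ℕ) : Ref

inductive Proc (L : Type u) : Type u
  /-- `y ← x` -/
  | fwd (y x : Ref) : Proc L
  /-- `(x^d ← P)@d₂; Q`, with `x` bound in `P` and in `Q` -/
  | cut (d d₂ : L) (P Q : Proc L) : Proc L
  /-- `close y` -/
  | close (y : Ref) : Proc L
  /-- `wait x; Q` -/
  | wait (x : Ref) (Q : Proc L) : Proc L
  /-- `x.k; P` -/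
  | lab (x : Ref) (k : Label) (P : Proc L) : Proc L
  /-- `case x (ℓ ⇒ Q_ℓ)_{ℓ ∈ I}` -/
  | branch (x : Ref) (I : Finset Label) (Q : {k // k ∈ I} → Proc L) : Proc L
  /-- `send z y; P` -/
  | send (z y : Ref) (P : Proc L) : Proc L
  /-- `z ← recv x; P`, with `z` bound in `P` -/
  | recv (x : Ref) (P : Proc L) : Proc L

/-- Replace the bound variable `n` by the channel `a`. -/
def Ref.inst (n : ℕ) (a : Chan) : Ref → Ref
  | .fv b => .fv b
  | .bv m => if m = n then .fv a else .bv m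

/-- Replace the bound variable `n` by the channel `a`. -/
def Proc.inst {L : Type u} (n : ℕ) (a : Chan) : Proc L → Proc L
  | .fwd y x => .fwd (y.inst n a) (x.inst n a)
  | .cut d d₂ P Q => .cut d d₂ (P.inst (n + 1) a) (Q.inst (n + 1) a)
  | .close y => .close (y.inst n a)
  | .wait x Q => .wait (x.inst n a) (Q.inst n a)
  | .lab x k P => .lab (x.inst n a) k (P.inst n a)
  | .branch x I Q => .branch (x.inst n a) I (fun k => (Q k).inst n a)
  | .send z y P => .send (z.inst n a) (y.inst n a) (P.inst n a)
  | .recv x P => .recv (x.inst n a) (P.inst (n + 1) a)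

/-- The substitution `[b/a]` on channels. -/
def Chan.rename (a b : Chan) (e : Chan) : Chan := if e = a then b else e

def Ref.rename (a b : Chan) : Ref → Ref
  | .fv e => .fv (Chan.rename a b e)
  | .bv m => .bv m

/-- The substitution `[b/a]P`. -/
def Proc.rename {L : Type u} (a b : Chan) : Proc L → Proc L
  | .fwd y x => .fwd (y.rename a b) (x.rename a b)
  | .cut d d₂ P Q => .cut d d₂ (P.rename a b) (Q.rename a b)
  | .close y => .close (y.rename a b)
  | .wait x Q => .wait (x.rename a b) (Q.rename a b)
  | .lab x k P => .lab (x.rename a b) k (P.rename a b)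
  | .branch x I Q => .branch (x.rename a b) I (fun k => (Q k).rename a b)
  | .send z y P => .send (z.rename a b) (y.rename a b) (P.rename a b)
  | .recv x P => .recv (x.rename a b) (P.rename a b)

/-- The channel `a` occurs in the term. -/
def Proc.Uses {L : Type u} (a : Chan) : Proc L → Prop
  | .fwd y x => y = .fv a ∨ x = .fv a
  | .cut _ _ P Q => P.Uses a ∨ Q.Uses a
  | .close y => y = .fv a
  | .wait x Q => x = .fv a ∨ Q.Uses a
  | .lab x _ P => x = .fv a ∨ P.Uses a
  | .branch x _ Q => x = .fv a ∨ ∃ k, (Q k).Uses a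
  | .send z y P => z = .fv a ∨ y = .fv a ∨ P.Uses a
  | .recv x P => x = .fv a ∨ P.Uses a

/-- The channel along which the term attempts to communicate next (none for `cut`). -/
def Proc.subject {L : Type u} : Proc L → Option Ref
  | .fwd y _ => some y
  | .cut _ _ _ _ => none
  | .close y => some y
  | .wait x _ => some x
  | .lab x _ _ => some x
  | .branch x _ _ => some x
  | .send _ y _ => some y
  | .recv x _ => some x

/-! ### Typing of terms -/

/-- `Typed Δ P d₁ (y : C[c])` is the judgment `Ψ; Δ ⊢ P@d₁ :: y : C[c]`, where `Ψ` is the security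
lattice `L`. A channel received along a channel of maximal secrecy `c` has a level `ψ` that is
constrained by `ψ = c`; the rules `tensorL` and `lolliR` write `c` for it. Bound variables are
instantiated with all channels outside a finite set. -/
inductive Typed {L : Type u} [Lattice L] : Ctx L → Proc L → L → Decl L → Prop
  | plusR {Δ : Ctx L} {P : Proc L} {d₁ c : L} {y : Chan} {I : Finset Label}
      {A : {k // k ∈ I} → Ty} (k : {k // k ∈ I}) :
      Typed Δ P d₁ ⟨y, A k, c⟩ →
      Typed Δ (.lab (.fv y) k.1 P) d₁ ⟨y, .plus I A, c⟩
  | plusL {Δ : Ctx L} {x : Chan} {I : Finset Label} {A : {k // k ∈ I} → Ty}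
      {Q : {k // k ∈ I} → Proc L} {d₁ c : L} {K : Decl L} :
      (∀ k, Typed (⟨x, A k, c⟩ ::ₘ Δ) (Q k) (c ⊔ d₁) K) →
      Typed (⟨x, .plus I A, c⟩ ::ₘ Δ) (.branch (.fv x) I Q) d₁ K
  | withR {Δ : Ctx L} {y : Chan} {I : Finset Label} {A : {k // k ∈ I} → Ty}
      {Q : {k // k ∈ I} → Proc L} {d₁ c : L} :
      (∀ k, Typed Δ (Q k) c ⟨y, A k, c⟩) →
      Typed Δ (.branch (.fv y) I Q) d₁ ⟨y, .wth I A, c⟩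
  | withL {Δ : Ctx L} {x : Chan} {P : Proc L} {d₁ c : L} {I : Finset Label}
      {A : {k // k ∈ I} → Ty} {K : Decl L} (k : {k // k ∈ I}) :
      d₁ ≤ c →
      Typed (⟨x, A k, c⟩ ::ₘ Δ) P d₁ K →
      Typed (⟨x, .wth I A, c⟩ ::ₘ Δ) (.lab (.fv x) k.1 P) d₁ K
  | tensorR {Δ : Ctx L} {z y : Chan} {P : Proc L} {d₁ c : L} {A B : Ty} :
      Typed Δ P d₁ ⟨y, B, c⟩ →
      Typed (⟨z, A, c⟩ ::ₘ Δ) (.send (.fv z) (.fv y) P) d₁ ⟨y, .tensor A B, c⟩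
  | tensorL {Δ : Ctx L} {x : Chan} {P : Proc L} {d₁ c : L} {A B : Ty} {K : Decl L}
      (S : Finset Chan) :
      (∀ z, z ∉ S → Typed (⟨z, A, c⟩ ::ₘ ⟨x, B, c⟩ ::ₘ Δ) (P.inst 0 z) (c ⊔ d₁) K) →
      Typed (⟨x, .tensor A B, c⟩ ::ₘ Δ) (.recv (.fv x) P) d₁ K
  | lolliR {Δ : Ctx L} {y : Chan} {P : Proc L} {d₁ c : L} {A B : Ty} (S : Finset Chan) :
      (∀ z, z ∉ S → Typed (⟨z, A, c⟩ ::ₘ Δ) (P.inst 0 z) c ⟨y, B, c⟩) →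
      Typed Δ (.recv (.fv y) P) d₁ ⟨y, .lolli A B, c⟩
  | lolliL {Δ : Ctx L} {z x : Chan} {P : Proc L} {d₁ d : L} {A B : Ty} {K : Decl L} :
      d₁ ≤ d →
      Typed (⟨x, B, d⟩ ::ₘ Δ) P d₁ K →
      Typed (⟨z, A, d⟩ ::ₘ ⟨x, .lolli A B, d⟩ ::ₘ Δ) (.send (.fv z) (.fv x) P) d₁ K
  | oneR {y : Chan} {d₁ c : L} :
      Typed 0 (.close (.fv y)) d₁ ⟨y, .one, c⟩
  | oneL {Δ : Ctx L} {x : Chan} {Q : Proc L} {d₁ c : L} {K : Decl L} :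
      Typed Δ Q (c ⊔ d₁) K →
      Typed (⟨x, .one, c⟩ ::ₘ Δ) (.wait (.fv x) Q) d₁ K
  | fwd {x y : Chan} {A : Ty} {d₁ c : L} :
      Typed {⟨x, A, c⟩} (.fwd (.fv y) (.fv x)) d₁ ⟨y, A, c⟩
  | cut {Δ₁ Δ₂ : Ctx L} {P Q : Proc L} {d₁ d₂ d' : L} {B : Ty} {K : Decl L}
      (S : Finset Chan) :
      d₁ ≤ d₂ → d₂ ≤ d' →
      (∀ b ∈ Δ₁, b.lvl ≤ d') →
      (∀ x, x ∉ S → Typed Δ₁ (P.inst 0 x) d₂ ⟨x, B, d'⟩) →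
      d' ≤ K.lvl →
      (∀ x, x ∉ S → Typed (⟨x, B, d'⟩ ::ₘ Δ₂) (Q.inst 0 x) d₁ K) →
      Typed (Δ₁ + Δ₂) (.cut d' d₂ P Q) d₁ K

/-! ### Configurations -/

/-- Messages in transit. A positive message, sent by the provider of its carrier channel `y`,
records the maximal secrecy `c` of `y`. -/
inductive Msg (L : Type u) : Type u
  /-- `close y` -/
  | close (c : L) (y : Chan) : Msg L
  /-- `y.k; y ← u` (positive) -/
  | posLab (c : L) (y : Chan) (k : Label) (u : Chan) : Msg L
  /-- `y.k; u ← y` (negative: sent by the client of `y`) -/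
  | negLab (y : Chan) (k : Label) (u : Chan) : Msg L
  /-- `send x y; y ← u` (positive) -/
  | posSend (c : L) (x y u : Chan) : Msg L
  /-- `send x y; u ← y` (negative: sent by the client of `y`) -/
  | negSend (x y u : Chan) : Msg L

/-- The term that a message stands for. -/
def Msg.toProc {L : Type u} : Msg L → Proc L
  | .close _ y => .close (.fv y)
  | .posLab _ y k u => .lab (.fv y) k (.fwd (.fv y) (.fv u))
  | .negLab y k u => .lab (.fv y) k (.fwd (.fv u) (.fv y))
  | .posSend _ x y u => .send (.fv x) (.fv y) (.fwd (.fv y) (.fv u))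
  | .negSend x y u => .send (.fv x) (.fv y) (.fwd (.fv u) (.fv y))

/-- The channel that the message offers to its parent. -/
def Msg.provided {L : Type u} : Msg L → Chan
  | .close _ y => y
  | .posLab _ y _ _ => y
  | .negLab _ _ u => u
  | .posSend _ _ y _ => y
  | .negSend _ _ u => u

/-- The recorded secrecy, if there is one, is `d`. -/
def Msg.HasLevel {L : Type u} (d : L) : Msg L → Prop
  | .close c _ => c = d
  | .posLab c _ _ _ => c = d
  | .negLab _ _ _ => True
  | .posSend c _ _ _ => c = d
  | .negSend _ _ _ => True

def Msg.rename {L : Type u} (a b : Chan) : Msg L → Msg L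
  | .close c y => .close c (Chan.rename a b y)
  | .posLab c y k u => .posLab c (Chan.rename a b y) k (Chan.rename a b u)
  | .negLab y k u => .negLab (Chan.rename a b y) k (Chan.rename a b u)
  | .posSend c x y u =>
      .posSend c (Chan.rename a b x) (Chan.rename a b y) (Chan.rename a b u)
  | .negSend x y u =>
      .negSend (Chan.rename a b x) (Chan.rename a b y) (Chan.rename a b u)

/-- The nodes of a configuration: processes `proc(y[c], P@d)` and messages `msg(m)`. -/
inductive Node (L : Type u) : Type u
  | proc (y : Chan) (c : L) (P : Proc L) (d : L) : Node L
  | msg (m : Msg L) : Node L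

/-- The channel that the node offers to its parent. -/
def Node.provided {L : Type u} : Node L → Chan
  | .proc y _ _ _ => y
  | .msg m => m.provided

def Node.rename {L : Type u} (a b : Chan) : Node L → Node L
  | .proc y c P d => .proc (Chan.rename a b y) c (P.rename a b) d
  | .msg m => .msg (m.rename a b)

/-- The channel `a` occurs in the node. -/
def Node.Uses {L : Type u} (a : Chan) : Node L → Prop
  | .proc y _ P _ => a = y ∨ P.Uses a
  | .msg m => m.toProc.Uses a

/-- The node attempts to communicate along `a`. -/
def Node.Attempts {L : Type u} (a : Chan) : Node L → Prop
  | .proc _ _ P _ => P.subject = some (.fv a)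
  | .msg m => m.toProc.subject = some (.fv a)

/-- Configurations, up to reordering of their nodes. -/
abbrev Config (L : Type u) := Multiset (Node L)

def Config.provided {L : Type u} (C : Config L) : Multiset Chan := C.map Node.provided

/-- The substitution `[b/a]C`. -/
def Config.rename {L : Type u} (a b : Chan) (C : Config L) : Config L := C.map (Node.rename a b)

/-- The channels that occur in a configuration. -/
def Config.used {L : Type u} (C : Config L) : Set Chan := {a | ∃ o ∈ C, o.Uses a}

/-- The rules for `Ψ; Δ ⊩ C :: Δ'`. -/
inductive CfgTyped {L : Type u} [Lattice L] : Ctx L → Config L → Ctx L → Prop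
  | emp₁ (k : Decl L) : CfgTyped {k} 0 {k}
  | emp₂ : CfgTyped 0 0 0
  | proc {Δ₀ Δ₀' Δ : Ctx L} {C : Config L} {P : Proc L} {x : Chan} {A : Ty} {d d₁ : L} :
      d₁ ≤ d →
      (∀ b ∈ Δ₀' + Δ, b.lvl ≤ d) →
      CfgTyped Δ₀ C Δ →
      Typed (Δ₀' + Δ) P d₁ ⟨x, A, d⟩ →
      CfgTyped (Δ₀ + Δ₀') (.proc x d P d₁ ::ₘ C) {⟨x, A, d⟩}
  | msg {Δ₀ Δ₀' Δ : Ctx L} {C : Config L} {m : Msg L} {x : Chan} {A : Ty} {d : L} :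
      m.HasLevel d →
      (∀ b ∈ Δ₀' + Δ, b.lvl ≤ d) →
      CfgTyped Δ₀ C Δ →
      Typed (Δ₀' + Δ) m.toProc d ⟨x, A, d⟩ →
      CfgTyped (Δ₀ + Δ₀') (.msg m ::ₘ C) {⟨x, A, d⟩}
  | comp {Δ₀ Δ₀' Δ : Ctx L} {C C₁ : Config L} {k : Decl L} :
      CfgTyped Δ₀ C Δ →
      CfgTyped Δ₀' C₁ {k} →
      CfgTyped (Δ₀ + Δ₀') (C + C₁) (k ::ₘ Δ)

/-- `Ψ; Δ ⊩ C :: Δ'` together with the naming convention that the channels of `Δ` and the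
channels offered by the nodes of `C` are pairwise distinct. -/
def CfgOk {L : Type u} [Lattice L] (Δ : Ctx L) (C : Config L) (Δ' : Ctx L) : Prop :=
  CfgTyped Δ C Δ' ∧ (Δ.names + C.provided).Nodup

/-! ### Asynchronous dynamics -/

/-- `Step used out C C'` is a step `C ↦_{Δ ⊩ Δ'} C'`, where `out` is the set of channels of `Δ'`
(forwards to these are not executed) and `used` is the set of channels in use, which newly
allocated channels have to avoid. A spawn allocates a channel of generation `0`; a send along `y`
allocates a later generation of `y`. -/
inductive Step {L : Type u} [Lattice L] (used out : Set Chan) : Config L → Config L → Prop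
  | fwd {y x : Chan} {c d₁ : L} {G : Config L} :
      y ∉ out →
      Step used out (.proc y c (.fwd (.fv y) (.fv x)) d₁ ::ₘ G) (G.rename y x)
  | cut {y x : Chan} {c d d₁ d₂ : L} {P Q : Proc L} {G : Config L} :
      x ∉ used → x.2 = 0 →
      Step used out (.proc y c (.cut d d₂ P Q) d₁ ::ₘ G)
        (.proc x d (P.inst 0 x) d₂ ::ₘ .proc y c (Q.inst 0 x) d₁ ::ₘ G)
  | oneSend {y : Chan} {c d₁ : L} {G : Config L} :
      Step used out (.proc y c (.close (.fv y)) d₁ ::ₘ G) (.msg (.close c y) ::ₘ G)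
  | oneRecv {y x : Chan} {c c' d₁ : L} {Q : Proc L} {G : Config L} :
      Step used out (.msg (.close c y) ::ₘ .proc x c' (.wait (.fv y) Q) d₁ ::ₘ G)
        (.proc x c' Q (d₁ ⊔ c) ::ₘ G)
  | plusSend {y y' : Chan} {c d₁ : L} {k : Label} {P : Proc L} {G : Config L} :
      y' ∉ used → y'.1 = y.1 → y.2 < y'.2 →
      Step used out (.proc y c (.lab (.fv y) k P) d₁ ::ₘ G)
        (.proc y' c (P.rename y y') d₁ ::ₘ .msg (.posLab c y k y') ::ₘ G)
  | plusRecv {y v w : Chan} {c c' d₁ : L} {I : Finset Label} {k : {k // k ∈ I}}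
      {Q : {k // k ∈ I} → Proc L} {G : Config L} :
      Step used out (.msg (.posLab c y k.1 v) ::ₘ .proc w c' (.branch (.fv y) I Q) d₁ ::ₘ G)
        (.proc w c' ((Q k).rename y v) (d₁ ⊔ c) ::ₘ G)
  | withSend {y x x' : Chan} {c d₁ : L} {k : Label} {P : Proc L} {G : Config L} :
      x ≠ y → x' ∉ used → x'.1 = x.1 → x.2 < x'.2 →
      Step used out (.proc y c (.lab (.fv x) k P) d₁ ::ₘ G)
        (.msg (.negLab x k x') ::ₘ .proc y c (P.rename x x') d₁ ::ₘ G)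
  | withRecv {y v : Chan} {c d₁ : L} {I : Finset Label} {k : {k // k ∈ I}}
      {Q : {k // k ∈ I} → Proc L} {G : Config L} :
      Step used out (.proc y c (.branch (.fv y) I Q) d₁ ::ₘ .msg (.negLab y k.1 v) ::ₘ G)
        (.proc v c ((Q k).rename y v) c ::ₘ G)
  | tensorSend {y y' x : Chan} {c d₁ : L} {P : Proc L} {G : Config L} :
      y' ∉ used → y'.1 = y.1 → y.2 < y'.2 →
      Step used out (.proc y c (.send (.fv x) (.fv y) P) d₁ ::ₘ G)
        (.proc y' c (P.rename y y') d₁ ::ₘ .msg (.posSend c x y y') ::ₘ G)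
  | tensorRecv {y v w x : Chan} {c c' d₁ : L} {P : Proc L} {G : Config L} :
      Step used out (.msg (.posSend c x y v) ::ₘ .proc w c' (.recv (.fv y) P) d₁ ::ₘ G)
        (.proc w c' ((P.rename y v).inst 0 x) (d₁ ⊔ c) ::ₘ G)
  | lolliSend {y w w' x : Chan} {c d₁ : L} {P : Proc L} {G : Config L} :
      w ≠ y → w' ∉ used → w'.1 = w.1 → w.2 < w'.2 →
      Step used out (.proc y c (.send (.fv x) (.fv w) P) d₁ ::ₘ G)
        (.msg (.negSend x w w') ::ₘ .proc y c (P.rename w w') d₁ ::ₘ G)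
  | lolliRecv {y v x : Chan} {c d₁ : L} {P : Proc L} {G : Config L} :
      Step used out (.proc y c (.recv (.fv y) P) d₁ ::ₘ .msg (.negSend x y v) ::ₘ G)
        (.proc v c ((P.rename y v).inst 0 x) c ::ₘ G)

/-- `Ψ; Δ ⊩ C :: Δ'` is poised: it is empty, or it cannot take a step and some node attempts to
communicate along a channel of `Δ` or `Δ'`. -/
def Poised {L : Type u} [Lattice L] (used : Set Chan) (Δ : Ctx L) (C : Config L) (Δ' : Ctx L) :
    Prop :=
  C = 0 ∨
    ((¬ ∃ C', Step used {a | a ∈ Δ'.names} C C') ∧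
      ∃ o ∈ C, ∃ a, (a ∈ Δ.names ∨ a ∈ Δ'.names) ∧ o.Attempts a)

/-! ### Closed configurations with an interface `Δ ⊩ K` -/

/-- The right end of an interface: a channel `x : A[c]`, or `·`. -/
abbrev Goal (L : Type u) := Option (Decl L)

/-- `K` as a context of resources. -/
def Goal.ctx {L : Type u} : Goal L → Ctx L
  | none => 0
  | some k => {k}

/-- The contexts that may be offered where `K` is written on the right: `·` stands for a
terminating channel `z : 1[c]` whose name and level are disregarded, or for nothing at all. -/
def Goal.Offers {L : Type u} (K : Goal L) (Γ : Ctx L) : Prop :=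
  match K with
  | some k => Γ = {k}
  | none => Γ = 0 ∨ ∃ (z : Chan) (c : L), Γ = {⟨z, .one, c⟩}

def Goal.rename {L : Type u} (a b : Chan) (K : Goal L) : Goal L :=
  K.map (fun k => ⟨Chan.rename a b k.ch, k.ty, k.lvl⟩)

/-- A closed configuration split as `C | D | F`, with the contexts offered by `D` and `F`. -/
structure Split (L : Type u) where
  C : Config L
  D : Config L
  F : Config L
  offD : Ctx L
  offF : Ctx L

/-- The configuration `C D F`. -/
def Split.all {L : Type u} (s : Split L) : Config L := s.C + s.D + s.F

/-- One of the two components of `Tree_Ψ(Δ ⊩ K)`. -/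
def InTree {L : Type u} [Lattice L] (Δ : Ctx L) (K : Goal L) (s : Split L) : Prop :=
  K.Offers s.offD ∧ Goal.Offers none s.offF ∧
  CfgOk 0 s.C Δ ∧ CfgOk Δ s.D s.offD ∧ CfgOk K.ctx s.F s.offF ∧ s.all.provided.Nodup

/-- A step of one of the closing configurations `C`, `F`. -/
def EnvStep {L : Type u} [Lattice L] (Δ : Ctx L) (s s' : Split L) : Prop :=
  (∃ C', Step s.all.used {a | a ∈ Δ.names} s.C C' ∧ s' = { s with C := C' }) ∨
  (∃ F', Step s.all.used {a | a ∈ s.offF.names} s.F F' ∧ s' = { s with F := F' })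

/-- A step of the program `D`. -/
def ProgStep {L : Type u} [Lattice L] (s s' : Split L) : Prop :=
  ∃ D', Step s.all.used {a | a ∈ s.offD.names} s.D D' ∧ s' = { s with D := D' }

/-- The closing configurations run until they are poised. -/
def EnvRun {L : Type u} [Lattice L] (Δ : Ctx L) (K : Goal L) (s s' : Split L) : Prop :=
  Relation.ReflTransGen (EnvStep Δ) s s' ∧
    Poised s'.all.used 0 s'.C Δ ∧ Poised s'.all.used K.ctx s'.F s'.offF

/-- The program runs until it is poised. -/
def ProgRun {L : Type u} [Lattice L] (Δ : Ctx L) (s s' : Split L) : Prop :=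
  Relation.ReflTransGen ProgStep s s' ∧ Poised s'.all.used Δ s'.D s'.offD

/-! ### The logical relation -/

/-- Candidates `R Δ K B₁ B₂` for the term relation. -/
abbrev Rel (L : Type u) := Ctx L → Goal L → Config L → Config L → Prop

/-- The part of the value relation that concerns the right channel `K = y : T[c]`. A message
that one of the programs has ready is asserted to be ready in the other; messages
of the closing configurations are assumed to agree. Handing a node over from the program to the
closing configurations, or back, changes the interface but not the configuration `C D F`. -/
def RightRel {L : Type u} (R : Rel L) (Δ : Ctx L) (y : Chan) (T : Ty) (c : L)
    (s t : Split L) : Prop :=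
  (match T with
    | .one =>
        (.msg (.close c y) ∈ s.D ∨ .msg (.close c y) ∈ t.D) →
          Δ = 0 ∧ s.C = 0 ∧ t.C = 0 ∧ s.D = {.msg (.close c y)} ∧ t.D = {.msg (.close c y)}
    | .plus I A => ∀ k u,
        (.msg (.posLab c y k u) ∈ s.D ∨ .msg (.posLab c y k u) ∈ t.D) →
          .msg (.posLab c y k u) ∈ s.D ∧ .msg (.posLab c y k u) ∈ t.D ∧
          ∃ h : k ∈ I, R Δ (some ⟨u, A ⟨k, h⟩, c⟩) s.all t.all
    | .wth I A => ∀ k u,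
        .msg (.negLab y k u) ∈ s.F → .msg (.negLab y k u) ∈ t.F →
          ∃ h : k ∈ I, R Δ (some ⟨u, A ⟨k, h⟩, c⟩) s.all t.all
    | .tensor A B => ∀ x u,
        (.msg (.posSend c x y u) ∈ s.D ∨ .msg (.posSend c x y u) ∈ t.D) →
          .msg (.posSend c x y u) ∈ s.D ∧ .msg (.posSend c x y u) ∈ t.D ∧
          ∃ Δ' Δ'', Δ = Δ' + Δ'' ∧
            R Δ'' (some ⟨x, A, c⟩) s.all t.all ∧ R Δ' (some ⟨u, B, c⟩) s.all t.all
    | .lolli A B => ∀ x u,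
        .msg (.negSend x y u) ∈ s.F → .msg (.negSend x y u) ∈ t.F →
          R (⟨x, A, c⟩ ::ₘ Δ) (some ⟨u, B, c⟩) s.all t.all) ∧
  ∀ x : Chan,
    ((∃ d, .proc y c (.fwd (.fv y) (.fv x)) d ∈ s.D) ∨
      (∃ d, .proc y c (.fwd (.fv y) (.fv x)) d ∈ t.D)) →
    ∃ (d₁ d₂ : L) (D₁ D₂ : Config L),
      s.D = .proc y c (.fwd (.fv y) (.fv x)) d₁ ::ₘ D₁ ∧
      t.D = .proc y c (.fwd (.fv y) (.fv x)) d₂ ::ₘ D₂ ∧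
      R Δ (some ⟨x, T, c⟩) (Config.rename y x (s.C + D₁ + s.F))
        (Config.rename y x (t.C + D₂ + t.F))

/-- The part of the value relation that concerns a left channel `y : T[c]`; the remaining left
channels are `Δ`. -/
def LeftRel {L : Type u} (R : Rel L) (Δ : Ctx L) (K : Goal L) (y : Chan) (T : Ty) (c : L)
    (s t : Split L) : Prop :=
  (match T with
    | .one =>
        .msg (.close c y) ∈ s.C → .msg (.close c y) ∈ t.C → R Δ K s.all t.all
    | .plus I A => ∀ k u,
        .msg (.posLab c y k u) ∈ s.C → .msg (.posLab c y k u) ∈ t.C →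
          ∃ h : k ∈ I, R (⟨u, A ⟨k, h⟩, c⟩ ::ₘ Δ) K s.all t.all
    | .wth I A => ∀ k u,
        (.msg (.negLab y k u) ∈ s.D ∨ .msg (.negLab y k u) ∈ t.D) →
          .msg (.negLab y k u) ∈ s.D ∧ .msg (.negLab y k u) ∈ t.D ∧
          ∃ h : k ∈ I, R (⟨u, A ⟨k, h⟩, c⟩ ::ₘ Δ) K s.all t.all
    | .tensor A B => ∀ x u,
        .msg (.posSend c x y u) ∈ s.C → .msg (.posSend c x y u) ∈ t.C →
          R (⟨x, A, c⟩ ::ₘ ⟨u, B, c⟩ ::ₘ Δ) K s.all t.all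
    | .lolli A B => ∀ x u,
        (.msg (.negSend x y u) ∈ s.D ∨ .msg (.negSend x y u) ∈ t.D) →
          .msg (.negSend x y u) ∈ s.D ∧ .msg (.negSend x y u) ∈ t.D ∧
          ∃ Δ' Δ'', Δ = Δ' + Δ'' ∧
            R Δ'' (some ⟨x, A, c⟩) s.all t.all ∧ R (⟨u, B, c⟩ ::ₘ Δ') K s.all t.all) ∧
  ∀ (x : Chan) (d₁ d₂ : L) (C₁ C₂ : Config L),
    s.C = .proc y c (.fwd (.fv y) (.fv x)) d₁ ::ₘ C₁ →
    t.C = .proc y c (.fwd (.fv y) (.fv x)) d₂ ::ₘ C₂ →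
    R (⟨x, T, c⟩ ::ₘ Δ) (Goal.rename y x K)
      (Config.rename y x (C₁ + s.D + s.F)) (Config.rename y x (C₂ + t.D + t.F))

/-- The value relation `V⟦Δ ⊩ K⟧`, given the term relation `R`. -/
def ValRel {L : Type u} [Lattice L] (R : Rel L) (Δ : Ctx L) (K : Goal L) (s t : Split L) : Prop :=
  InTree Δ K s ∧ InTree Δ K t ∧
  (∀ y T c, K = some ⟨y, T, c⟩ → RightRel R Δ y T c s t) ∧
  (∀ y T c Δ₀, Δ = ⟨y, T, c⟩ ::ₘ Δ₀ → LeftRel R Δ₀ K y T c s t)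

/-- The defining clause of the term relation. The closing configurations run to poised states,
with any choice of newly allocated channels; the programs then run to poised states, and the results
are related as values. -/
def TermClause {L : Type u} [Lattice L] (R : Rel L) : Rel L := fun Δ K B₁ B₂ =>
  ∃ s t : Split L, B₁ = s.all ∧ B₂ = t.all ∧ InTree Δ K s ∧ InTree Δ K t ∧
    (∃ s', EnvRun Δ K s s') ∧ (∃ t', EnvRun Δ K t t') ∧
    ∀ s' t', EnvRun Δ K s s' → EnvRun Δ K t t' →
      ∃ s'' t'', ProgRun Δ s' s'' ∧ ProgRun Δ t' t'' ∧ ValRel R Δ K s'' t''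

/-- The term relation `E_Ψ⟦Δ ⊩ K⟧`: the least relation closed under the clause `TermClause`, which
is monotone in `R`. -/
inductive TermRel {L : Type u} [Lattice L] : Ctx L → Goal L → Config L → Config L → Prop
  | mk (R : Rel L) (Δ : Ctx L) (K : Goal L) (B₁ B₂ : Config L)
      (hR : ∀ Δ' K' B₁' B₂', R Δ' K' B₁' B₂' → TermRel Δ' K' B₁' B₂')
      (h : TermClause R Δ K B₁ B₂) : TermRel Δ K B₁ B₂

/-! ### Equivalence up to observable messages -/

open Classical in
/-- The projection `Δ ⇓ ξ`. -/
noncomputable def Ctx.proj {L : Type u} [Lattice L] (ξ : L) (Δ : Ctx L) : Ctx L :=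
  Δ.filter (fun b => b.lvl ≤ ξ)

open Classical in
/-- The projection `x : A[c] ⇓ ξ`. -/
noncomputable def Decl.proj {L : Type u} [Lattice L] (ξ : L) (k : Decl L) : Goal L :=
  if k.lvl ≤ ξ then some k else none

/-- `(Δ₁ ⊩ D₁ :: k₁) ≡^Ψ_ξ (Δ₂ ⊩ D₂ :: k₂)`. The closing configurations are such that the nodes
of each closed configuration still offer pairwise distinct channels. -/
def ObsEquiv {L : Type u} [Lattice L] (ξ : L) (Δ₁ : Ctx L) (D₁ : Config L) (k₁ : Decl L)
    (Δ₂ : Ctx L) (D₂ : Config L) (k₂ : Decl L) : Prop :=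
  CfgOk Δ₁ D₁ {k₁} ∧ CfgOk Δ₂ D₂ {k₂} ∧
  Ctx.proj ξ Δ₁ = Ctx.proj ξ Δ₂ ∧ k₁.proj ξ = k₂.proj ξ ∧
  ∀ (C₁ C₂ F₁ F₂ : Config L) (Γ₁ Γ₂ : Ctx L),
    CfgOk 0 C₁ Δ₁ → CfgOk 0 C₂ Δ₂ →
    Goal.Offers none Γ₁ → Goal.Offers none Γ₂ →
    CfgOk {k₁} F₁ Γ₁ → CfgOk {k₂} F₂ Γ₂ →
    (Config.provided (C₁ + D₁ + F₁)).Nodup → (Config.provided (C₂ + D₂ + F₂)).Nodup →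
    TermRel (Ctx.proj ξ Δ₁) (k₁.proj ξ) (C₁ + D₁ + F₁) (C₂ + D₂ + F₂)

end IFC

namespace IFC

set_option linter.unusedSectionVars false
set_option linter.unusedSimpArgs false

universe u

open Multiset (count)

section
variable {L : Type u}

/-! ### Renaming of channels by arbitrary functions -/

def Ref.map (f : Chan → Chan) : Ref → Ref
  | .fv a => .fv (f a)
  | .bv n => .bv n

def Proc.map (f : Chan → Chan) : Proc L → Proc L
  | .fwd y x => .fwd (y.map f) (x.map f)
  | .cut d d₂ P Q => .cut d d₂ (P.map f) (Q.map f)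
  | .close y => .close (y.map f)
  | .wait x Q => .wait (x.map f) (Q.map f)
  | .lab x k P => .lab (x.map f) k (P.map f)
  | .branch x I Q => .branch (x.map f) I (fun k => (Q k).map f)
  | .send z y P => .send (z.map f) (y.map f) (P.map f)
  | .recv x P => .recv (x.map f) (P.map f)

def Msg.map (f : Chan → Chan) : Msg L → Msg L
  | .close c y => .close c (f y)
  | .posLab c y k u => .posLab c (f y) k (f u)
  | .negLab y k u => .negLab (f y) k (f u)
  | .posSend c x y u => .posSend c (f x) (f y) (f u)
  | .negSend x y u => .negSend (f x) (f y) (f u)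

def Node.map (f : Chan → Chan) : Node L → Node L
  | .proc y c P d => .proc (f y) c (P.map f) d
  | .msg m => .msg (m.map f)

def Decl.map (f : Chan → Chan) (b : Decl L) : Decl L := ⟨f b.ch, b.ty, b.lvl⟩

@[simp] theorem Decl.map_ch (f : Chan → Chan) (b : Decl L) : (b.map f).ch = f b.ch := rfl
@[simp] theorem Decl.map_ty (f : Chan → Chan) (b : Decl L) : (b.map f).ty = b.ty := rfl
@[simp] theorem Decl.map_lvl (f : Chan → Chan) (b : Decl L) : (b.map f).lvl = b.lvl := rfl
@[simp] theorem Decl.map_mk (f : Chan → Chan) (a : Chan) (A : Ty) (c : L) :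
    (Decl.mk a A c).map f = ⟨f a, A, c⟩ := rfl

theorem Decl.ext' {b b' : Decl L} (h₁ : b.ch = b'.ch) (h₂ : b.ty = b'.ty)
    (h₃ : b.lvl = b'.lvl) : b = b' := by
  cases b; cases b'; simp_all

theorem Decl.map_map (f g : Chan → Chan) (b : Decl L) : (b.map f).map g = b.map (g ∘ f) := rfl

@[simp] theorem Decl.map_id (b : Decl L) : b.map id = b := rfl

theorem Ref.map_map (f g : Chan → Chan) (r : Ref) : (r.map f).map g = r.map (g ∘ f) := by
  cases r <;> rfl

theorem Proc.map_map (f g : Chan → Chan) (P : Proc L) : (P.map f).map g = P.map (g ∘ f) := by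
  induction P <;> simp_all [Proc.map, Ref.map_map]

theorem Ref.map_id (r : Ref) : r.map id = r := by cases r <;> rfl

theorem Proc.map_id (P : Proc L) : P.map id = P := by
  induction P <;> simp_all [Proc.map, Ref.map_id]

theorem Msg.map_map (f g : Chan → Chan) (m : Msg L) : (m.map f).map g = m.map (g ∘ f) := by
  cases m <;> rfl

theorem Msg.map_id (m : Msg L) : m.map id = m := by cases m <;> rfl

theorem Node.map_map (f g : Chan → Chan) (o : Node L) : (o.map f).map g = o.map (g ∘ f) := by
  cases o <;> simp [Node.map, Proc.map_map, Msg.map_map]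

theorem Node.map_id (o : Node L) : o.map id = o := by
  cases o <;> simp [Node.map, Proc.map_id, Msg.map_id]

theorem Ref.rename_eq (a b : Chan) (r : Ref) : r.rename a b = r.map (Chan.rename a b) := by
  cases r <;> rfl

theorem Proc.rename_eq (a b : Chan) (P : Proc L) : P.rename a b = P.map (Chan.rename a b) := by
  induction P <;> simp_all [Proc.map, Proc.rename, Ref.rename_eq]

theorem Msg.rename_eq (a b : Chan) (m : Msg L) : m.rename a b = m.map (Chan.rename a b) := by
  cases m <;> rfl

theorem Node.rename_eq (a b : Chan) (o : Node L) : o.rename a b = o.map (Chan.rename a b) := by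
  cases o <;> simp [Node.map, Node.rename, Proc.rename_eq, Msg.rename_eq]

theorem Msg.toProc_map (f : Chan → Chan) (m : Msg L) : (m.map f).toProc = m.toProc.map f := by
  cases m <;> rfl

@[simp] theorem Chan.rename_self (a b : Chan) : Chan.rename a b a = b := by simp [Chan.rename]

theorem Chan.rename_of_ne {a e : Chan} (b : Chan) (h : e ≠ a) : Chan.rename a b e = e := by
  simp [Chan.rename, h]

theorem Ref.map_inst (f : Chan → Chan) (n : ℕ) (a : Chan) (r : Ref) :
    (r.inst n a).map f = (r.map f).inst n (f a) := by
  cases r with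
  | fv e => rfl
  | bv m => by_cases h : m = n <;> simp [Ref.inst, Ref.map, h]

theorem Proc.map_inst (f : Chan → Chan) (a : Chan) (P : Proc L) :
    ∀ n, (P.inst n a).map f = (P.map f).inst n (f a) := by
  induction P <;> intro n <;> simp_all [Proc.map, Proc.inst, Ref.map_inst]

/-- Renamings that agree on the channels of a term act on it in the same way. -/
theorem Proc.map_congr {f g : Chan → Chan} (P : Proc L) (h : ∀ a, P.Uses a → f a = g a) :
    P.map f = P.map g := by
  have hr : ∀ r : Ref, (∀ a, r = .fv a → f a = g a) → r.map f = r.map g := by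
    intro r hr
    cases r with
    | fv a => simp [Ref.map, hr a rfl]
    | bv n => rfl
  induction P with
  | fwd y x =>
    simp only [Proc.map]
    rw [hr y fun a e => h a (Or.inl e), hr x fun a e => h a (Or.inr e)]
  | cut d d₂ P Q ihP ihQ =>
    simp only [Proc.map]
    rw [ihP fun a e => h a (Or.inl e), ihQ fun a e => h a (Or.inr e)]
  | close y => simp only [Proc.map]; rw [hr y fun a e => h a e]
  | wait x Q ih =>
    simp only [Proc.map]
    rw [hr x fun a e => h a (Or.inl e), ih fun a e => h a (Or.inr e)]
  | lab x k P ih =>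
    simp only [Proc.map]
    rw [hr x fun a e => h a (Or.inl e), ih fun a e => h a (Or.inr e)]
  | branch x I Q ih =>
    simp only [Proc.map]
    rw [hr x fun a e => h a (Or.inl e)]
    congr 1
    funext k
    exact ih k fun a e => h a (Or.inr ⟨k, e⟩)
  | send z y P ih =>
    simp only [Proc.map]
    rw [hr z fun a e => h a (Or.inl e), hr y fun a e => h a (Or.inr (Or.inl e)),
      ih fun a e => h a (Or.inr (Or.inr e))]
  | recv x P ih =>
    simp only [Proc.map]
    rw [hr x fun a e => h a (Or.inl e), ih fun a e => h a (Or.inr e)]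

theorem Ref.finite_fv (r : Ref) : {a | r = .fv a}.Finite := by
  cases r with
  | fv a =>
    refine (Set.finite_singleton a).subset fun b hb => ?_
    cases hb; rfl
  | bv n => simp

theorem Proc.finite_uses (P : Proc L) : {a | P.Uses a}.Finite := by
  induction P with
  | fwd y x => exact y.finite_fv.union x.finite_fv
  | cut d d₂ P Q ihP ihQ => exact ihP.union ihQ
  | close y => exact y.finite_fv
  | wait x Q ih => exact x.finite_fv.union ih
  | lab x k P ih => exact x.finite_fv.union ih
  | branch x I Q ih =>
    refine (x.finite_fv.union (Set.finite_iUnion ih)).subset ?_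
    rintro a (h | ⟨k, h⟩)
    · exact Or.inl h
    · exact Or.inr (Set.mem_iUnion.2 ⟨k, h⟩)
  | send z y P ih => exact z.finite_fv.union (y.finite_fv.union ih)
  | recv x P ih => exact x.finite_fv.union ih

theorem Node.finite_uses (o : Node L) : {a | o.Uses a}.Finite := by
  cases o with
  | proc y c P d => exact (Set.finite_singleton y).union P.finite_uses
  | msg m => exact m.toProc.finite_uses

theorem Config.finite_used (C : Config L) : C.used.Finite := by
  have : C.used = ⋃ o ∈ {o | o ∈ C}, {a | o.Uses a} := by
    ext a; simp [Config.used]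
  rw [this]
  exact Set.Finite.biUnion (Multiset.finite_toSet C) fun o _ => o.finite_uses

theorem Node.uses_provided (o : Node L) : o.Uses o.provided := by
  cases o with
  | proc y c P d => exact Or.inl rfl
  | msg m => cases m <;> simp [Node.Uses, Node.provided, Msg.provided, Msg.toProc, Proc.Uses]

/-! ### Renaming preserves typing -/

theorem Ctx.map_congr {f g : Chan → Chan} {Δ : Ctx L} (h : ∀ a ∈ Δ.names, f a = g a) :
    Δ.map (Decl.map f) = Δ.map (Decl.map g) := by
  refine Multiset.map_congr rfl fun b hb => ?_
  simp [Decl.map, h b.ch (Multiset.mem_map_of_mem _ hb)]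

theorem Ctx.map_eq_self {f : Chan → Chan} {Δ : Ctx L} (h : ∀ a ∈ Δ.names, f a = a) :
    Δ.map (Decl.map f) = Δ := by
  conv_rhs => rw [← Multiset.map_id Δ]
  exact Ctx.map_congr h

theorem Decl.map_congr {f g : Chan → Chan} {b : Decl L} (h : f b.ch = g b.ch) :
    b.map f = b.map g := by
  simp [Decl.map, h]

theorem exists_fresh (S : Set Chan) (hS : S.Finite) : ∃ z, z ∉ S :=
  hS.exists_notMem

theorem Ctx.finite_names (Δ : Ctx L) : {a | a ∈ Δ.names}.Finite :=
  Multiset.finite_toSet _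

/-- Renamings `f` and `g` agree on everything but `z` that occurs in the judgment. -/
theorem exists_generic (f : Chan → Chan) (z : Chan) (S : Finset Chan) (Δ : Ctx L) (P Q : Proc L)
    (k : Decl L) :
    ∃ (z₀ : Chan) (g : Chan → Chan), z₀ ∉ S ∧ g z₀ = z ∧
      Δ.map (Decl.map g) = Δ.map (Decl.map f) ∧ (∀ a, P.Uses a → g a = f a) ∧
      P.map g = P.map f ∧ Q.map g = Q.map f ∧ k.map g = k.map f := by
  obtain ⟨z₀, h⟩ := exists_fresh (↑S ∪ ({a | P.Uses a} ∪ ({a | Q.Uses a} ∪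
    ({a | a ∈ Δ.names} ∪ {k.ch}))))
    (S.finite_toSet.union (P.finite_uses.union (Q.finite_uses.union (Δ.finite_names.union
      (Set.finite_singleton _)))))
  simp only [Set.mem_union, Finset.mem_coe, Set.mem_ofPred_eq, Set.mem_singleton_iff, not_or] at h
  obtain ⟨h₁, h₂, h₃, h₄, h₅⟩ := h
  have ne : ∀ a, z₀ ≠ a → Function.update f z₀ z a = f a :=
    fun a ha => Function.update_of_ne (Ne.symm ha) _ _
  have hP : ∀ a, P.Uses a → Function.update f z₀ z a = f a :=
    fun a ha => ne a (by rintro rfl; exact h₂ ha)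
  refine ⟨z₀, Function.update f z₀ z, h₁, Function.update_self .., ?_, hP, ?_, ?_, ?_⟩
  · exact Ctx.map_congr fun a ha => ne a (by rintro rfl; exact h₄ ha)
  · exact Proc.map_congr P hP
  · exact Proc.map_congr Q fun a ha => ne a (by rintro rfl; exact h₃ ha)
  · exact Decl.map_congr (ne _ h₅)

variable [Lattice L]

theorem Typed.map {Δ : Ctx L} {P : Proc L} {d : L} {K : Decl L} (h : Typed Δ P d K) :
    ∀ f : Chan → Chan, Typed (Δ.map (Decl.map f)) (P.map f) d (K.map f) := by
  induction h with
  | plusR k _ ih => intro f; exact Typed.plusR k (ih f)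
  | plusL _ ih =>
    intro f
    rw [Multiset.map_cons]
    refine Typed.plusL fun k => ?_
    simpa using ih k f
  | withR _ ih => intro f; exact Typed.withR fun k => ih k f
  | withL k hd _ ih =>
    intro f
    rw [Multiset.map_cons]
    refine Typed.withL k hd ?_
    simpa using ih f
  | tensorR _ ih =>
    intro f
    rw [Multiset.map_cons]
    exact Typed.tensorR (ih f)
  | @tensorL Δ x P d₁ c A B K S _ ih =>
    intro f
    rw [Multiset.map_cons]
    refine Typed.tensorL ∅ fun z _ => ?_
    obtain ⟨z₀, g, h₁, h₂, h₃, -, h₄, -, h₅⟩ :=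
      exists_generic f z S (⟨x, B, c⟩ ::ₘ Δ) P P K
    have := ih z₀ h₁ g
    rw [Multiset.map_cons, h₃, Proc.map_inst, h₄, h₅, Decl.map_mk, h₂, Multiset.map_cons] at this
    exact this
  | @lolliR Δ y P d₁ c A B S _ ih =>
    intro f
    refine Typed.lolliR ∅ fun z _ => ?_
    obtain ⟨z₀, g, h₁, h₂, h₃, -, h₄, -, h₅⟩ := exists_generic f z S Δ P P ⟨y, B, c⟩
    have := ih z₀ h₁ g
    rw [Multiset.map_cons, h₃, Proc.map_inst, h₄, h₅, Decl.map_mk, h₂] at this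
    exact this
  | lolliL hd _ ih =>
    intro f
    rw [Multiset.map_cons, Multiset.map_cons]
    refine Typed.lolliL hd ?_
    simpa using ih f
  | oneR => intro f; exact Typed.oneR
  | oneL _ ih => intro f; rw [Multiset.map_cons]; exact Typed.oneL (ih f)
  | fwd => intro f; exact Typed.fwd
  | @cut Δ₁ Δ₂ P Q d₁ d₂ d' B K S h₁ h₂ h₃ _ h₄ _ ihP ihQ =>
    intro f
    rw [Multiset.map_add]
    refine Typed.cut (B := B) ∅ h₁ h₂ ?_ (fun z _ => ?_) h₄ (fun z _ => ?_)
    · intro b hb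
      obtain ⟨b', hb', rfl⟩ := Multiset.mem_map.1 hb
      exact h₃ b' hb'
    · obtain ⟨z₀, g, g₁, g₂, g₃, -, g₄, -, g₅⟩ := exists_generic f z S Δ₁ P P K
      have := ihP z₀ g₁ g
      rw [g₃, Proc.map_inst, g₄, Decl.map_mk, g₂] at this
      exact this
    · obtain ⟨z₀, g, g₁, g₂, g₃, -, g₄, -, g₅⟩ := exists_generic f z S Δ₂ Q Q K
      have := ihQ z₀ g₁ g
      rw [Multiset.map_cons, g₃, Proc.map_inst, g₄, Decl.map_mk, g₂, g₅] at this
      exact this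

/-! ### Inversion of typing -/

theorem Typed.fwd_inv {Δ : Ctx L} {r r' : Ref} {d : L} {K : Decl L}
    (h : Typed Δ (.fwd r r') d K) :
    ∃ x, r = .fv K.ch ∧ r' = .fv x ∧ Δ = {⟨x, K.ty, K.lvl⟩} := by
  cases h with
  | fwd => exact ⟨_, rfl, rfl, rfl⟩

theorem Typed.close_inv {Δ : Ctx L} {r : Ref} {d : L} {K : Decl L}
    (h : Typed Δ (.close r) d K) : r = .fv K.ch ∧ Δ = 0 ∧ K.ty = .one := by
  cases h with
  | oneR => exact ⟨rfl, rfl, rfl⟩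

theorem Typed.cut_inv {Δ : Ctx L} {P Q : Proc L} {d₁ d₂ d' : L} {K : Decl L}
    (h : Typed Δ (.cut d' d₂ P Q) d₁ K) :
    ∃ (Δ₁ Δ₂ : Ctx L) (B : Ty) (S : Finset Chan), Δ = Δ₁ + Δ₂ ∧
      d₁ ≤ d₂ ∧ d₂ ≤ d' ∧ (∀ b ∈ Δ₁, b.lvl ≤ d') ∧ d' ≤ K.lvl ∧
      (∀ x, x ∉ S → Typed Δ₁ (P.inst 0 x) d₂ ⟨x, B, d'⟩) ∧
      (∀ x, x ∉ S → Typed (⟨x, B, d'⟩ ::ₘ Δ₂) (Q.inst 0 x) d₁ K) := by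
  cases h with
  | cut S h₁ h₂ h₃ hP h₄ hQ => exact ⟨_, _, _, S, rfl, h₁, h₂, h₃, h₄, hP, hQ⟩

theorem Typed.wait_inv {Δ : Ctx L} {r : Ref} {Q : Proc L} {d : L} {K : Decl L}
    (h : Typed Δ (.wait r Q) d K) :
    ∃ (x : Chan) (c : L) (Δ' : Ctx L), r = .fv x ∧ Δ = ⟨x, .one, c⟩ ::ₘ Δ' ∧
      Typed Δ' Q (c ⊔ d) K := by
  cases h with
  | oneL h => exact ⟨_, _, _, rfl, rfl, h⟩

theorem Typed.lab_inv {Δ : Ctx L} {r : Ref} {k : Label} {P : Proc L} {d : L} {K : Decl L}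
    (h : Typed Δ (.lab r k P) d K) :
    (∃ (y : Chan) (I : Finset Label) (A : {k // k ∈ I} → Ty) (c : L) (hk : k ∈ I),
      r = .fv y ∧ K = ⟨y, .plus I A, c⟩ ∧ Typed Δ P d ⟨y, A ⟨k, hk⟩, c⟩) ∨
    (∃ (x : Chan) (I : Finset Label) (A : {k // k ∈ I} → Ty) (c : L) (hk : k ∈ I)
      (Δ' : Ctx L), r = .fv x ∧ Δ = ⟨x, .wth I A, c⟩ ::ₘ Δ' ∧ d ≤ c ∧
      Typed (⟨x, A ⟨k, hk⟩, c⟩ ::ₘ Δ') P d K) := by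
  cases h with
  | plusR k h => exact Or.inl ⟨_, _, _, _, k.2, rfl, rfl, h⟩
  | withL k hd h => exact Or.inr ⟨_, _, _, _, k.2, _, rfl, rfl, hd, h⟩

theorem Typed.branch_inv {Δ : Ctx L} {r : Ref} {I : Finset Label}
    {Q : {k // k ∈ I} → Proc L} {d : L} {K : Decl L} (h : Typed Δ (.branch r I Q) d K) :
    (∃ (x : Chan) (A : {k // k ∈ I} → Ty) (c : L) (Δ' : Ctx L),
      r = .fv x ∧ Δ = ⟨x, .plus I A, c⟩ ::ₘ Δ' ∧
      ∀ k, Typed (⟨x, A k, c⟩ ::ₘ Δ') (Q k) (c ⊔ d) K) ∨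
    (∃ (y : Chan) (A : {k // k ∈ I} → Ty) (c : L),
      r = .fv y ∧ K = ⟨y, .wth I A, c⟩ ∧ ∀ k, Typed Δ (Q k) c ⟨y, A k, c⟩) := by
  cases h with
  | plusL h => exact Or.inl ⟨_, _, _, _, rfl, rfl, h⟩
  | withR h => exact Or.inr ⟨_, _, _, rfl, rfl, h⟩

theorem Typed.send_inv {Δ : Ctx L} {s r : Ref} {P : Proc L} {d : L} {K : Decl L}
    (h : Typed Δ (.send s r P) d K) :
    (∃ (z y : Chan) (A B : Ty) (c : L) (Δ' : Ctx L),
      s = .fv z ∧ r = .fv y ∧ K = ⟨y, .tensor A B, c⟩ ∧ Δ = ⟨z, A, c⟩ ::ₘ Δ' ∧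
      Typed Δ' P d ⟨y, B, c⟩) ∨
    (∃ (z x : Chan) (A B : Ty) (c : L) (Δ' : Ctx L),
      s = .fv z ∧ r = .fv x ∧ Δ = ⟨z, A, c⟩ ::ₘ ⟨x, .lolli A B, c⟩ ::ₘ Δ' ∧ d ≤ c ∧
      Typed (⟨x, B, c⟩ ::ₘ Δ') P d K) := by
  cases h with
  | tensorR h => exact Or.inl ⟨_, _, _, _, _, _, rfl, rfl, rfl, rfl, h⟩
  | lolliL hd h => exact Or.inr ⟨_, _, _, _, _, _, rfl, rfl, rfl, hd, h⟩

theorem Typed.recv_inv {Δ : Ctx L} {r : Ref} {P : Proc L} {d : L} {K : Decl L}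
    (h : Typed Δ (.recv r P) d K) :
    (∃ (x : Chan) (A B : Ty) (c : L) (Δ' : Ctx L) (S : Finset Chan),
      r = .fv x ∧ Δ = ⟨x, .tensor A B, c⟩ ::ₘ Δ' ∧
      ∀ z, z ∉ S → Typed (⟨z, A, c⟩ ::ₘ ⟨x, B, c⟩ ::ₘ Δ') (P.inst 0 z) (c ⊔ d) K) ∨
    (∃ (y : Chan) (A B : Ty) (c : L) (S : Finset Chan),
      r = .fv y ∧ K = ⟨y, .lolli A B, c⟩ ∧
      ∀ z, z ∉ S → Typed (⟨z, A, c⟩ ::ₘ Δ) (P.inst 0 z) c ⟨y, B, c⟩) := by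
  cases h with
  | tensorL S h => exact Or.inl ⟨_, _, _, _, _, S, rfl, rfl, h⟩
  | lolliR S h => exact Or.inr ⟨_, _, _, _, S, rfl, rfl, h⟩

end

section
variable {L : Type u}

/-! ### Typed nodes and flat configurations -/

/-- A node together with the channels it uses and the channel it offers. -/
structure TNode (L : Type u) where
  ctx : Ctx L
  node : Node L
  dec : Decl L

def TNode.map (f : Chan → Chan) (n : TNode L) : TNode L :=
  ⟨n.ctx.map (Decl.map f), n.node.map f, n.dec.map f⟩

@[simp] theorem TNode.map_ctx (f : Chan → Chan) (n : TNode L) :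
    (n.map f).ctx = n.ctx.map (Decl.map f) := rfl
@[simp] theorem TNode.map_node (f : Chan → Chan) (n : TNode L) :
    (n.map f).node = n.node.map f := rfl
@[simp] theorem TNode.map_dec (f : Chan → Chan) (n : TNode L) :
    (n.map f).dec = n.dec.map f := rfl

theorem TNode.map_map (f g : Chan → Chan) (n : TNode L) : (n.map f).map g = n.map (g ∘ f) := by
  simp [TNode.map, Node.map_map, Multiset.map_map, Function.comp_def, Decl.map_map]

theorem TNode.map_id (n : TNode L) : n.map id = n := by
  cases n with
  | mk ctx node dec =>
    have : (Decl.map id : Decl L → Decl L) = id := rfl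
    simp [TNode.map, Node.map_id, this]

def nodes (T : Multiset (TNode L)) : Config L := T.map TNode.node
def ctxs (T : Multiset (TNode L)) : Ctx L := T.bind TNode.ctx
def decs (T : Multiset (TNode L)) : Ctx L := T.map TNode.dec

section
variable (n : TNode L) (S T : Multiset (TNode L)) (f : Chan → Chan)

@[simp] theorem nodes_zero : nodes (0 : Multiset (TNode L)) = 0 := rfl
@[simp] theorem nodes_cons : nodes (n ::ₘ T) = n.node ::ₘ nodes T := Multiset.map_cons ..
@[simp] theorem nodes_add : nodes (S + T) = nodes S + nodes T := Multiset.map_add ..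
@[simp] theorem nodes_singleton : nodes {n} = {n.node} := rfl
@[simp] theorem ctxs_zero : ctxs (0 : Multiset (TNode L)) = 0 := rfl
@[simp] theorem ctxs_cons : ctxs (n ::ₘ T) = n.ctx + ctxs T := Multiset.cons_bind ..
@[simp] theorem ctxs_add : ctxs (S + T) = ctxs S + ctxs T := Multiset.add_bind ..
@[simp] theorem ctxs_singleton : ctxs {n} = n.ctx := Multiset.singleton_bind ..
@[simp] theorem decs_zero : decs (0 : Multiset (TNode L)) = 0 := rfl
@[simp] theorem decs_cons : decs (n ::ₘ T) = n.dec ::ₘ decs T := Multiset.map_cons ..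
@[simp] theorem decs_add : decs (S + T) = decs S + decs T := Multiset.map_add ..
@[simp] theorem decs_singleton : decs {n} = {n.dec} := rfl

variable {n S T}

theorem mem_ctxs {b : Decl L} : b ∈ ctxs T ↔ ∃ n ∈ T, b ∈ n.ctx := Multiset.mem_bind
theorem mem_decs {b : Decl L} : b ∈ decs T ↔ ∃ n ∈ T, n.dec = b := Multiset.mem_map
theorem dec_mem_decs (h : n ∈ T) : n.dec ∈ decs T := Multiset.mem_map_of_mem _ h
theorem node_mem_nodes (h : n ∈ T) : n.node ∈ nodes T := Multiset.mem_map_of_mem _ h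
theorem ctx_mem_ctxs {b : Decl L} (h : n ∈ T) (hb : b ∈ n.ctx) : b ∈ ctxs T :=
  mem_ctxs.2 ⟨n, h, hb⟩

theorem nodes_map : nodes (T.map (TNode.map f)) = (nodes T).map (Node.map f) := by
  simp [nodes, Multiset.map_map, Function.comp_def]

theorem decs_map : decs (T.map (TNode.map f)) = (decs T).map (Decl.map f) := by
  simp [decs, Multiset.map_map, Function.comp_def]

theorem ctxs_map : ctxs (T.map (TNode.map f)) = (ctxs T).map (Decl.map f) := by
  simp [ctxs, Multiset.map_bind, Multiset.bind_map]

end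

@[simp] theorem Ctx.names_add (Γ Δ : Ctx L) :
    Ctx.names (Γ + Δ) = Ctx.names Γ + Ctx.names Δ := Multiset.map_add ..
@[simp] theorem Ctx.names_cons (b : Decl L) (Δ : Ctx L) :
    Ctx.names (b ::ₘ Δ) = b.ch ::ₘ Ctx.names Δ := Multiset.map_cons ..
@[simp] theorem Ctx.names_zero : Ctx.names (0 : Ctx L) = 0 := rfl
@[simp] theorem Ctx.names_singleton (b : Decl L) : Ctx.names {b} = {b.ch} := rfl

theorem Ctx.mem_names {a : Chan} {Δ : Ctx L} : a ∈ Δ.names ↔ ∃ b ∈ Δ, b.ch = a :=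
  Multiset.mem_map
theorem Ctx.mem_names_of {b : Decl L} {Δ : Ctx L} (h : b ∈ Δ) : b.ch ∈ Δ.names :=
  Multiset.mem_map_of_mem _ h

theorem Ctx.eq_of_nodup {Δ : Ctx L} (h : Δ.names.Nodup) {b b' : Decl L} (hb : b ∈ Δ)
    (hb' : b' ∈ Δ) (e : b.ch = b'.ch) : b = b' :=
  Multiset.inj_on_of_nodup_map h b hb b' hb' e

theorem Ctx.names_mono {Γ Δ : Ctx L} (h : Γ ≤ Δ) : Γ.names ≤ Δ.names := Multiset.map_le_map h

variable [Lattice L]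

/-- The node is well typed when it uses `Γ` and offers `k`. -/
inductive NodeOk : Ctx L → Node L → Decl L → Prop
  | proc {Γ : Ctx L} {x : Chan} {A : Ty} {P : Proc L} {d d₁ : L} :
      d₁ ≤ d → (∀ b ∈ Γ, b.lvl ≤ d) → Typed Γ P d₁ ⟨x, A, d⟩ →
      NodeOk Γ (.proc x d P d₁) ⟨x, A, d⟩
  | msg {Γ : Ctx L} {m : Msg L} {k : Decl L} :
      m.HasLevel k.lvl → (∀ b ∈ Γ, b.lvl ≤ k.lvl) → Typed Γ m.toProc k.lvl k →
      NodeOk Γ (.msg m) k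

def TNode.Ok (n : TNode L) : Prop := NodeOk n.ctx n.node n.dec

theorem Msg.HasLevel.map {m : Msg L} {d : L} (h : m.HasLevel d) (f : Chan → Chan) :
    (m.map f).HasLevel d := by
  cases m <;> exact h

theorem NodeOk.map {Γ : Ctx L} {o : Node L} {k : Decl L} (h : NodeOk Γ o k) (f : Chan → Chan) :
    NodeOk (Γ.map (Decl.map f)) (o.map f) (k.map f) := by
  have hl : ∀ d : L, (∀ b ∈ Γ, b.lvl ≤ d) → ∀ b ∈ Γ.map (Decl.map f), b.lvl ≤ d := by
    intro d h b hb
    obtain ⟨b', hb', rfl⟩ := Multiset.mem_map.1 hb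
    exact h b' hb'
  cases h with
  | proc h₁ h₂ h₃ => exact .proc h₁ (hl _ h₂) (h₃.map f)
  | msg h₁ h₂ h₃ =>
    exact .msg (h₁.map f) (hl _ h₂) (by rw [Msg.toProc_map]; exact h₃.map f)

theorem TNode.Ok.map {n : TNode L} (h : n.Ok) (f : Chan → Chan) : (n.map f).Ok := NodeOk.map h f

theorem NodeOk.provided {Γ : Ctx L} {o : Node L} {k : Decl L} (h : NodeOk Γ o k) :
    o.provided = k.ch := by
  cases h with
  | proc => rfl
  | @msg m _ h₁ h₂ h₃ =>
    cases m with
    | close c y =>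
      have := h₃.close_inv.1
      simp only [Ref.fv.injEq] at this
      exact this
    | posLab c y k u =>
      rcases h₃.lab_inv with ⟨y', I, A, c', hk, e, rfl, -⟩ | ⟨x, I, A, c', hk, Δ', -, -, -, h⟩
      · simp only [Ref.fv.injEq] at e
        exact e
      · have := h.fwd_inv
        simp only [Ref.fv.injEq] at this
        exact this.choose_spec.1
    | negLab y k u =>
      rcases h₃.lab_inv with ⟨y', I, A, c', hk, e, rfl, h⟩ | ⟨x, I, A, c', hk, Δ', -, -, -, h⟩
      · have := h.fwd_inv
        simp only [Ref.fv.injEq] at this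
        exact this.choose_spec.1
      · have := h.fwd_inv
        simp only [Ref.fv.injEq] at this
        exact this.choose_spec.1
    | posSend c x y u =>
      rcases h₃.send_inv with ⟨z, y', A, B, c', Δ', -, e, rfl, -, -⟩ |
        ⟨z, y', A, B, c', Δ', -, -, -, -, h⟩
      · simp only [Ref.fv.injEq] at e
        exact e
      · have := h.fwd_inv
        simp only [Ref.fv.injEq] at this
        exact this.choose_spec.1
    | negSend x y u =>
      rcases h₃.send_inv with ⟨z, y', A, B, c', Δ', -, e, rfl, -, h⟩ |
        ⟨z, y', A, B, c', Δ', -, -, -, -, h⟩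
      · have := h.fwd_inv
        simp only [Ref.fv.injEq] at this
        exact this.choose_spec.1
      · have := h.fwd_inv
        simp only [Ref.fv.injEq] at this
        exact this.choose_spec.1

/-! ### Typing of messages that do not use the channel they offer -/

theorem NodeOk.close_inv {Γ : Ctx L} {c : L} {y : Chan} {k : Decl L}
    (h : NodeOk Γ (.msg (.close c y)) k) : Γ = 0 ∧ k = ⟨y, .one, c⟩ := by
  cases h with
  | msg h₁ h₂ h₃ =>
    obtain ⟨e, h, e'⟩ := h₃.close_inv
    simp only [Ref.fv.injEq] at e
    exact ⟨h, Decl.ext' e.symm e' h₁.symm⟩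

theorem NodeOk.posLab_inv {Γ : Ctx L} {c : L} {y u : Chan} {l : Label} {k : Decl L}
    (h : NodeOk Γ (.msg (.posLab c y l u)) k) (hk : k.ch ∉ Γ.names) :
    ∃ (I : Finset Label) (A : {k // k ∈ I} → Ty) (hl : l ∈ I),
      Γ = {⟨u, A ⟨l, hl⟩, c⟩} ∧ k = ⟨y, .plus I A, c⟩ := by
  cases h with
  | msg h₁ h₂ h₃ =>
    rcases h₃.lab_inv with ⟨y', I, A, c', hl, e, rfl, h⟩ | ⟨x, I, A, c', hl, Δ', e, rfl, -, h⟩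
    · obtain ⟨x, e₁, e₂, rfl⟩ := h.fwd_inv
      simp only [Ref.fv.injEq] at e e₂
      subst e e₂
      have h₁ : c = c' := h₁
      subst h₁
      exact ⟨I, A, hl, rfl, rfl⟩
    · obtain ⟨x', e₁, e₂, -⟩ := h.fwd_inv
      simp only [Ref.fv.injEq] at e e₁
      simp [← e, e₁] at hk

theorem NodeOk.negLab_inv {Γ : Ctx L} {y u : Chan} {l : Label} {k : Decl L}
    (h : NodeOk Γ (.msg (.negLab y l u)) k) (hk : k.ch ∉ Γ.names) :
    ∃ (I : Finset Label) (A : {k // k ∈ I} → Ty) (hl : l ∈ I) (c : L),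
      Γ = {⟨y, .wth I A, c⟩} ∧ k = ⟨u, A ⟨l, hl⟩, c⟩ := by
  cases h with
  | msg h₁ h₂ h₃ =>
    rcases h₃.lab_inv with ⟨y', I, A, c', hl, e, rfl, h⟩ | ⟨x, I, A, c', hl, Δ', e, rfl, -, h⟩
    · obtain ⟨x, e₁, e₂, rfl⟩ := h.fwd_inv
      simp only [Ref.fv.injEq] at e e₂
      simp [← e, ← e₂] at hk
    · obtain ⟨x', e₁, e₂, e₃⟩ := h.fwd_inv
      simp only [Ref.fv.injEq] at e e₁ e₂
      obtain ⟨e₄, rfl⟩ := (Multiset.singleton_eq_cons_iff _).1 e₃.symm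
      simp only [Decl.mk.injEq] at e₄
      refine ⟨I, A, hl, c', ?_, Decl.ext' e₁.symm e₄.2.1 e₄.2.2⟩
      rw [e]; rfl

theorem NodeOk.posSend_inv {Γ : Ctx L} {c : L} {x y u : Chan} {k : Decl L}
    (h : NodeOk Γ (.msg (.posSend c x y u)) k) (hk : k.ch ∉ Γ.names) :
    ∃ A B : Ty, Γ = ⟨x, A, c⟩ ::ₘ {⟨u, B, c⟩} ∧ k = ⟨y, .tensor A B, c⟩ := by
  cases h with
  | msg h₁ h₂ h₃ =>
    rcases h₃.send_inv with ⟨z, y', A, B, c', Δ', e, e', rfl, rfl, h⟩ |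
      ⟨z, y', A, B, c', Δ', e, e', rfl, -, h⟩
    · obtain ⟨x', e₁, e₂, rfl⟩ := h.fwd_inv
      simp only [Ref.fv.injEq] at e e' e₂
      subst e e' e₂
      have h₁ : c = c' := h₁
      subst h₁
      exact ⟨A, B, rfl, rfl⟩
    · obtain ⟨x', e₁, e₂, -⟩ := h.fwd_inv
      simp only [Ref.fv.injEq] at e' e₁
      simp [← e', e₁] at hk

theorem NodeOk.negSend_inv {Γ : Ctx L} {x y u : Chan} {k : Decl L}
    (h : NodeOk Γ (.msg (.negSend x y u)) k) (hk : k.ch ∉ Γ.names) :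
    ∃ (A B : Ty) (c : L), Γ = ⟨x, A, c⟩ ::ₘ {⟨y, .lolli A B, c⟩} ∧ k = ⟨u, B, c⟩ := by
  cases h with
  | msg h₁ h₂ h₃ =>
    rcases h₃.send_inv with ⟨z, y', A, B, c', Δ', e, e', rfl, rfl, h⟩ |
      ⟨z, y', A, B, c', Δ', e, e', rfl, -, h⟩
    · obtain ⟨x', e₁, e₂, rfl⟩ := h.fwd_inv
      simp only [Ref.fv.injEq] at e' e₂
      simp [← e', ← e₂] at hk
    · obtain ⟨x', e₁, e₂, e₃⟩ := h.fwd_inv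
      simp only [Ref.fv.injEq] at e e' e₁ e₂
      obtain ⟨e₄, rfl⟩ := (Multiset.singleton_eq_cons_iff _).1 e₃.symm
      simp only [Decl.mk.injEq] at e₄
      refine ⟨A, B, c', ?_, Decl.ext' e₁.symm e₄.2.1 e₄.2.2⟩
      rw [e, e']; rfl

/-! ### Balanced and well-formed flat configurations -/

/-- Every channel is offered once and used once, where `Θ` and `Θ'` are the ends. -/
def Bal (Θ : Ctx L) (T : Multiset (TNode L)) (Θ' : Ctx L) : Prop := ctxs T + Θ' = Θ + decs T

def RankOk (r : Chan → ℕ) (T : Multiset (TNode L)) : Prop :=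
  ∀ n ∈ T, ∀ b ∈ n.ctx, r b.ch < r n.dec.ch

structure Good (T : Multiset (TNode L)) : Prop where
  ok : ∀ n ∈ T, n.Ok
  nodup : (decs T).names.Nodup
  rank : ∃ r, RankOk r T
  closed : ctxs T ≤ decs T

theorem names_decs {T : Multiset (TNode L)} (h : ∀ n ∈ T, n.Ok) :
    (decs T).names = (nodes T).provided := by
  simp only [decs, nodes, Ctx.names, Config.provided, Multiset.map_map]
  exact Multiset.map_congr rfl fun n hn => ((h n hn).provided).symm

namespace Good
variable {S T : Multiset (TNode L)}

theorem decl_eq (h : Good T) {b b' : Decl L} (hb : b ∈ decs T) (hb' : b' ∈ decs T)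
    (e : b.ch = b'.ch) : b = b' := Ctx.eq_of_nodup h.nodup hb hb' e

theorem ctx_mem (h : Good T) {n : TNode L} (hn : n ∈ T) {b : Decl L} (hb : b ∈ n.ctx) :
    b ∈ decs T := Multiset.mem_of_le h.closed (ctx_mem_ctxs hn hb)

theorem dec_not_mem (h : Good T) {n : TNode L} (hn : n ∈ T) : n.dec.ch ∉ n.ctx.names := by
  intro hc
  obtain ⟨b, hb, e⟩ := Ctx.mem_names.1 hc
  obtain ⟨r, hr⟩ := h.rank
  have := hr n hn b hb
  rw [e] at this
  exact lt_irrefl _ this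

theorem ctx_nodup (h : Good T) {n : TNode L} (hn : n ∈ T) : n.ctx.names.Nodup := by
  refine Multiset.nodup_of_le (Ctx.names_mono ?_) h.nodup
  exact (Multiset.le_bind T hn).trans h.closed

theorem ctxs_nodup (h : Good T) : (ctxs T).names.Nodup :=
  Multiset.nodup_of_le (Ctx.names_mono h.closed) h.nodup

theorem node_eq (h : Good T) {n n' : TNode L} (hn : n ∈ T) (hn' : n' ∈ T)
    (e : n.dec.ch = n'.dec.ch) : n = n' := by
  have : (T.map fun n => n.dec.ch).Nodup := by
    have := h.nodup
    rwa [Ctx.names, decs, Multiset.map_map] at this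
  exact Multiset.inj_on_of_nodup_map this n hn n' hn' e

end Good

end

section
variable {L : Type u} [Lattice L]

theorem TNode.Ok.lvl_le {n : TNode L} (h : n.Ok) {b : Decl L} (hb : b ∈ n.ctx) :
    b.lvl ≤ n.dec.lvl := by
  obtain ⟨Γ, o, k⟩ := n
  cases h with
  | proc _ h _ => exact h b hb
  | msg _ h _ => exact h b hb

/-- Every channel of a flat configuration lies below a channel of its right end. -/
theorem Bal.climb {Θ Θ' : Ctx L} {T : Multiset (TNode L)} (hB : Bal Θ T Θ') {r : Chan → ℕ}
    (hr : RankOk r T) (hok : ∀ n ∈ T, n.Ok) {b : Decl L} (hb : b ∈ Θ + decs T) :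
    ∃ b' ∈ Θ', r b.ch ≤ r b'.ch ∧ b.lvl ≤ b'.lvl := by
  classical
  by_contra hc
  set V := (Θ + decs T).filter fun b => ¬ ∃ b' ∈ Θ', r b.ch ≤ r b'.ch ∧ b.lvl ≤ b'.lvl with hV
  have hbV : b ∈ V := Multiset.mem_filter.2 ⟨hb, hc⟩
  obtain ⟨m, hm, hmax⟩ := Multiset.exists_max_image (fun b : Decl L => r b.ch)
    (s := V) (by rintro h; simp [h] at hbV)
  obtain ⟨hm₁, hm₂⟩ := Multiset.mem_filter.1 hm
  rw [← hB, Multiset.mem_add] at hm₁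
  rcases hm₁ with h | h
  · obtain ⟨n, hn, hmn⟩ := mem_ctxs.1 h
    have hlt := hr n hn m hmn
    have hn' : n.dec ∈ Θ + decs T := Multiset.mem_add.2 (Or.inr (dec_mem_decs hn))
    by_cases hx : ∃ b' ∈ Θ', r n.dec.ch ≤ r b'.ch ∧ n.dec.lvl ≤ b'.lvl
    · obtain ⟨b', h₁, h₂, h₃⟩ := hx
      exact hm₂ ⟨b', h₁, hlt.le.trans h₂, ((hok n hn).lvl_le hmn).trans h₃⟩
    · have := hmax n.dec (Multiset.mem_filter.2 ⟨hn', hx⟩)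
      omega
  · exact hm₂ ⟨m, h, le_rfl, le_rfl⟩

theorem Bal.eq_zero {Θ : Ctx L} {T : Multiset (TNode L)} (hB : Bal Θ T 0) {r : Chan → ℕ}
    (hr : RankOk r T) (hok : ∀ n ∈ T, n.Ok) : Θ = 0 ∧ T = 0 := by
  have h : ∀ b, b ∉ Θ + decs T := by
    intro b hb
    obtain ⟨b', h, -⟩ := hB.climb hr hok hb
    simp at h
  constructor
  · exact Multiset.eq_zero_of_forall_notMem fun b hb => h b (Multiset.mem_add.2 (Or.inl hb))
  · exact Multiset.eq_zero_of_forall_notMem fun n hn =>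
      h n.dec (Multiset.mem_add.2 (Or.inr (dec_mem_decs hn)))

/-! ### From trees to flat configurations and back -/

theorem CfgTyped.extract {Θ Ω : Ctx L} {G : Config L} (h : CfgTyped Θ G Ω) :
    ∀ (a : Decl L) (Ω' : Ctx L), Ω = a ::ₘ Ω' → ∃ (G₁ G₂ : Config L) (Θ₁ Θ₂ : Ctx L),
      G = G₁ + G₂ ∧ Θ = Θ₁ + Θ₂ ∧ CfgTyped Θ₁ G₁ {a} ∧ CfgTyped Θ₂ G₂ Ω' := by
  have single : ∀ {Θ : Ctx L} {G : Config L} {k : Decl L}, CfgTyped Θ G {k} →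
      ∀ (a : Decl L) (Ω' : Ctx L), {k} = a ::ₘ Ω' → ∃ (G₁ G₂ : Config L) (Θ₁ Θ₂ : Ctx L),
      G = G₁ + G₂ ∧ Θ = Θ₁ + Θ₂ ∧ CfgTyped Θ₁ G₁ {a} ∧ CfgTyped Θ₂ G₂ Ω' := by
    intro Θ G k h a Ω' e
    obtain ⟨rfl, rfl⟩ := (Multiset.singleton_eq_cons_iff _).1 e
    exact ⟨G, 0, Θ, 0, by simp, by simp, h, .emp₂⟩
  induction h with
  | emp₁ k => exact single (.emp₁ k)
  | emp₂ => intro a Ω' e; simp at e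
  | proc h₁ h₂ h₃ h₄ ih => exact single (.proc h₁ h₂ h₃ h₄)
  | msg h₁ h₂ h₃ h₄ ih => exact single (.msg h₁ h₂ h₃ h₄)
  | @comp Δ₀ Δ₀' Δ C C₁ k h₁ h₂ ih₁ ih₂ =>
    intro a Ω' e
    rcases Multiset.cons_eq_cons.1 e with ⟨rfl, rfl⟩ | ⟨-, cs, rfl, rfl⟩
    · exact ⟨C₁, C, Δ₀', Δ₀, add_comm .., add_comm .., h₂, h₁⟩
    · obtain ⟨G₁, G₂, Θ₁, Θ₂, rfl, rfl, h₃, h₄⟩ := ih₁ a cs rfl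
      exact ⟨G₁, G₂ + C₁, Θ₁, Θ₂ + Δ₀', add_assoc .., add_assoc .., h₃, .comp h₄ h₂⟩

theorem CfgTyped.split {Ω' : Ctx L} (Ω : Ctx L) :
    ∀ {Θ : Ctx L} {G : Config L}, CfgTyped Θ G (Ω + Ω') →
    ∃ (G₁ G₂ : Config L) (Θ₁ Θ₂ : Ctx L), G = G₁ + G₂ ∧ Θ = Θ₁ + Θ₂ ∧
      CfgTyped Θ₁ G₁ Ω ∧ CfgTyped Θ₂ G₂ Ω' := by
  induction Ω using Multiset.induction_on with
  | empty =>
    intro Θ G h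
    exact ⟨0, G, 0, Θ, by simp, by simp, .emp₂, by simpa using h⟩
  | cons a Ω ih =>
    intro Θ G h
    rw [Multiset.cons_add] at h
    obtain ⟨G₁, G₂, Θ₁, Θ₂, rfl, rfl, h₁, h₂⟩ := h.extract _ _ rfl
    obtain ⟨G₃, G₄, Θ₃, Θ₄, rfl, rfl, h₃, h₄⟩ := ih h₂
    exact ⟨G₃ + G₁, G₄, Θ₃ + Θ₁, Θ₄, by abel, by abel, .comp h₃ h₁, h₄⟩

theorem CfgTyped.emp (Ω : Ctx L) : CfgTyped Ω 0 Ω := by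
  induction Ω using Multiset.induction_on with
  | empty => exact .emp₂
  | cons a Ω ih =>
    have := CfgTyped.comp ih (CfgTyped.emp₁ a)
    rwa [add_zero, add_comm, Multiset.singleton_add] at this

theorem Bal.toCfgTyped {r : Chan → ℕ} :
    ∀ {T : Multiset (TNode L)} {Θ Θ' : Ctx L}, Bal Θ T Θ' → RankOk r T → (∀ n ∈ T, n.Ok) →
      CfgTyped Θ (nodes T) Θ' := by
  intro T
  induction hc : T.card generalizing T with
  | zero =>
    intro Θ Θ' hB hr hok
    obtain rfl := Multiset.card_eq_zero.1 hc
    simp only [Bal, ctxs_zero, decs_zero, zero_add, add_zero] at hB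
    subst hB
    exact .emp _
  | succ c ih =>
    intro Θ Θ' hB hr hok
    obtain ⟨n, hn, hmax⟩ := Multiset.exists_max_image (fun n : TNode L => r n.dec.ch)
      (s := T) (by rintro rfl; simp at hc)
    have hn' : n.dec ∈ Θ' := by
      have : n.dec ∈ ctxs T + Θ' := by
        rw [hB]; exact Multiset.mem_add.2 (Or.inr (dec_mem_decs hn))
      rcases Multiset.mem_add.1 this with h | h
      · obtain ⟨n', hn', hb⟩ := mem_ctxs.1 h
        have h₁ := hr n' hn' _ hb
        have h₂ := hmax n' hn'
        omega
      · exact h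
    obtain ⟨T', rfl⟩ := Multiset.exists_cons_of_mem hn
    obtain ⟨Θ'', rfl⟩ := Multiset.exists_cons_of_mem hn'
    have hB' : Bal Θ T' (n.ctx + Θ'') := by
      classical
      ext b
      have := congrArg (count b) hB
      simp only [ctxs_add, decs_add, ctxs_singleton, decs_singleton, ← Multiset.singleton_add, Multiset.count_add] at this ⊢
      omega
    rw [Multiset.card_cons, Nat.succ_inj] at hc
    have := ih hc hB' (fun m hm => hr m (Multiset.mem_cons_of_mem hm))
      (fun m hm => hok m (Multiset.mem_cons_of_mem hm))
    obtain ⟨G₁, G₂, Θ₁, Θ₂, hG, rfl, h₁, h₂⟩ := this.split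
    rw [nodes_cons, hG, add_comm G₁, ← Multiset.add_cons, add_comm Θ₁]
    refine .comp h₂ ?_
    have hno := hok n hn
    obtain ⟨Γ, o, k⟩ := n
    rw [← add_zero Θ₁]
    cases hno with
    | proc h₃ h₄ h₅ => exact .proc h₃ (by simpa using h₄) h₁ (by simpa using h₅)
    | msg h₃ h₄ h₅ => exact .msg h₃ (by simpa using h₄) h₁ (by simpa using h₅)

theorem Bal.mem_of_mem_ctx {Θ Θ' : Ctx L} {T : Multiset (TNode L)} (hB : Bal Θ T Θ')
    {n : TNode L} (hn : n ∈ T) {b : Decl L} (hb : b ∈ n.ctx) : b ∈ Θ + decs T := by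
  rw [← hB]
  exact Multiset.mem_add.2 (Or.inl (ctx_mem_ctxs hn hb))

/-- Ranks that agree on the channels of a configuration. -/
theorem RankOk.congr {Θ Θ' : Ctx L} {T : Multiset (TNode L)} {r r' : Chan → ℕ} (hr : RankOk r T)
    (hB : Bal Θ T Θ') (h : ∀ b ∈ Θ + decs T, r' b.ch = r b.ch) : RankOk r' T := by
  intro n hn b hb
  rw [h b (hB.mem_of_mem_ctx hn hb), h n.dec (Multiset.mem_add.2 (Or.inr (dec_mem_decs hn)))]
  exact hr n hn b hb

theorem sum_lt_rank (r : Chan → ℕ) (Γ : Ctx L) {b : Decl L} (hb : b ∈ Γ) :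
    r b.ch < (Γ.map fun b => r b.ch).sum + 1 :=
  Nat.lt_succ_of_le (Multiset.single_le_sum (fun _ _ => Nat.zero_le _) _
    (Multiset.mem_map_of_mem _ hb))

theorem flatten_cons {Δ₀ Δ₀' Δ : Ctx L} {C : Config L} {n : TNode L} (hn : n.Ok)
    (hctx : n.ctx = Δ₀' + Δ)
    (hd : ((Δ₀ + Δ₀').names + Config.provided (n.node ::ₘ C)).Nodup)
    (ih : ∃ T : Multiset (TNode L), nodes T = C ∧ (∀ n ∈ T, n.Ok) ∧ Bal Δ₀ T Δ ∧
      ∀ r₀ : Chan → ℕ, ∃ r : Chan → ℕ, (∀ a, a ∉ Config.provided C → r a = r₀ a) ∧ RankOk r T) :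
    ∃ T : Multiset (TNode L), nodes T = n.node ::ₘ C ∧ (∀ n ∈ T, n.Ok) ∧
      Bal (Δ₀ + Δ₀') T {n.dec} ∧ ∀ r₀ : Chan → ℕ, ∃ r : Chan → ℕ,
        (∀ a, a ∉ Config.provided (n.node ::ₘ C) → r a = r₀ a) ∧ RankOk r T := by
  classical
  obtain ⟨T, rfl, hok, hB, hr⟩ := ih
  refine ⟨n ::ₘ T, nodes_cons .., ?_, ?_, ?_⟩
  · intro m hm
    rcases Multiset.mem_cons.1 hm with rfl | hm
    exacts [hn, hok m hm]
  · ext b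
    have := congrArg (count b) hB
    simp only [ctxs_add, decs_add, ctxs_singleton, decs_singleton, hctx, ← Multiset.singleton_add, Multiset.count_add] at this ⊢
    omega
  · intro r₀
    obtain ⟨r, h₁, h₂⟩ := hr r₀
    set x := n.dec.ch
    have hp : n.node.provided = x := NodeOk.provided hn
    have hd' : (Ctx.names Δ₀ + Ctx.names Δ₀' + (x ::ₘ (decs T).names)).Nodup := by
      rw [names_decs hok, ← hp]
      simpa [Config.provided] using hd
    rw [Multiset.add_cons, Multiset.nodup_cons] at hd'
    simp only [Multiset.mem_add, not_or] at hd'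
    obtain ⟨⟨⟨hx₁, hx₂⟩, hx₃⟩, -⟩ := hd'
    have hΔ : ∀ b ∈ Δ, b.ch ≠ x := by
      intro b hb e
      have : b ∈ Δ₀ + decs T := by rw [← hB]; exact Multiset.mem_add.2 (Or.inr hb)
      rcases Multiset.mem_add.1 this with h | h
      · exact hx₁ (e ▸ Ctx.mem_names_of h)
      · exact hx₃ (e ▸ Ctx.mem_names_of h)
    refine ⟨Function.update r x ((n.ctx.map fun b => r b.ch).sum + 1), ?_, ?_⟩
    · intro a ha
      simp only [Config.provided, Multiset.map_cons, Multiset.mem_cons, not_or, hp] at ha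
      rw [Function.update_of_ne ha.1]
      exact h₁ a ha.2
    · intro m hm
      rcases Multiset.mem_cons.1 hm with rfl | hm
      · intro b hb
        rw [Function.update_self, Function.update_of_ne]
        · exact sum_lt_rank r _ hb
        · rw [hctx, Multiset.mem_add] at hb
          rcases hb with hb | hb
          · rintro e; exact hx₂ (e ▸ Ctx.mem_names_of hb)
          · exact hΔ b hb
      · refine RankOk.congr h₂ hB (fun b hb => ?_) m hm
        rw [Function.update_of_ne]
        rintro e
        rcases Multiset.mem_add.1 hb with h | h
        · exact hx₁ (e ▸ Ctx.mem_names_of h)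
        · exact hx₃ (e ▸ Ctx.mem_names_of h)

theorem CfgTyped.flatten {Θ Θ' : Ctx L} {G : Config L} (h : CfgTyped Θ G Θ') :
    (Θ.names + G.provided).Nodup → ∃ T : Multiset (TNode L), nodes T = G ∧ (∀ n ∈ T, n.Ok) ∧
      Bal Θ T Θ' ∧ ∀ r₀ : Chan → ℕ, ∃ r : Chan → ℕ,
        (∀ a, a ∉ G.provided → r a = r₀ a) ∧ RankOk r T := by
  induction h with
  | emp₁ k =>
    exact fun _ => ⟨0, rfl, by simp, by simp [Bal], fun r₀ => ⟨r₀, by simp, by simp [RankOk]⟩⟩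
  | emp₂ =>
    exact fun _ => ⟨0, rfl, by simp, by simp [Bal], fun r₀ => ⟨r₀, by simp, by simp [RankOk]⟩⟩
  | @proc Δ₀ Δ₀' Δ C P x A d d₁ h₁ h₂ h₃ h₄ ih =>
    intro hd
    refine flatten_cons (n := ⟨Δ₀' + Δ, .proc x d P d₁, ⟨x, A, d⟩⟩) (.proc h₁ h₂ h₄) rfl hd
      (ih (Multiset.nodup_of_le ?_ hd))
    rw [Ctx.names_add]
    exact add_le_add (Multiset.le_add_right _ _) (Multiset.map_le_map (Multiset.le_cons_self _ _))
  | @msg Δ₀ Δ₀' Δ C m x A d h₁ h₂ h₃ h₄ ih =>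
    intro hd
    refine flatten_cons (n := ⟨Δ₀' + Δ, .msg m, ⟨x, A, d⟩⟩) (.msg h₁ h₂ h₄) rfl hd
      (ih (Multiset.nodup_of_le ?_ hd))
    rw [Ctx.names_add]
    exact add_le_add (Multiset.le_add_right _ _) (Multiset.map_le_map (Multiset.le_cons_self _ _))
  | @comp Δ₀ Δ₀' Δ C C₁ k h₁ h₂ ih₁ ih₂ =>
    intro hd
    have hd' : (Ctx.names Δ₀ + Config.provided C + (Ctx.names Δ₀' + Config.provided C₁)).Nodup := by
      have e : Ctx.names Δ₀ + Config.provided C + (Ctx.names Δ₀' + Config.provided C₁) =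
        Ctx.names (Δ₀ + Δ₀') + Config.provided (C + C₁) := by
        simp only [Config.provided, Multiset.map_add, Ctx.names_add]; abel
      rwa [e]
    obtain ⟨hd₁, hd₂, hdis⟩ := Multiset.nodup_add.1 hd'
    obtain ⟨T₁, rfl, hok₁, hB₁, hr₁⟩ := ih₁ hd₁
    obtain ⟨T₂, rfl, hok₂, hB₂, hr₂⟩ := ih₂ hd₂
    refine ⟨T₁ + T₂, nodes_add .., ?_, ?_, fun r₀ => ?_⟩
    · intro n hn
      rcases Multiset.mem_add.1 hn with h | h
      exacts [hok₁ n h, hok₂ n h]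
    · classical
      ext b
      have e₁ := congrArg (count b) hB₁
      have e₂ := congrArg (count b) hB₂
      simp only [ctxs_add, decs_add, ← Multiset.singleton_add, Multiset.count_add] at e₁ e₂ ⊢
      omega
    · obtain ⟨r₁, a₁, b₁⟩ := hr₁ r₀
      obtain ⟨r₂, a₂, b₂⟩ := hr₂ r₁
      refine ⟨r₂, fun a ha => ?_, fun n hn => ?_⟩
      · simp only [Config.provided, Multiset.map_add, Multiset.mem_add, not_or] at ha
        rw [a₂ a ha.2, a₁ a ha.1]
      · rcases Multiset.mem_add.1 hn with h | h
        · refine RankOk.congr b₁ hB₁ (fun b hb => a₂ _ fun hc => ?_) n h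
          have hm : b.ch ∈ Ctx.names Δ₀ + Config.provided (nodes T₁) := by
            rw [← names_decs hok₁, ← Ctx.names_add]
            exact Ctx.mem_names_of hb
          exact Multiset.disjoint_left.1 hdis hm (Multiset.mem_add.2 (Or.inr hc))
        · exact b₂ n h

/-! ### Extraction of the subtrees below some channels -/

/-- Two configurations contain related nodes in `L₁` and `L₂`, the nodes below a channel in `Ξ`
belong to them, and related nodes along such channels have the same interface. Then the subtrees
below `Ξ` can be taken out of both. -/
theorem extract_joint {ρ : TNode L → TNode L → Prop} {lo : Decl L → Prop}
    (hρ : ∀ n₁ n₂, ρ n₁ n₂ → lo n₁.dec → n₂.dec = n₁.dec ∧ n₂.ctx = n₁.ctx ∧ ∀ b ∈ n₁.ctx, lo b)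
    (A B : Ctx L) : ∀ (L₁ L₂ : Multiset (TNode L)) (Ξ Δ : Ctx L),
    ctxs L₁ + Ξ + A = Δ + decs L₁ + B → (∀ b ∈ Ξ, lo b ∧ b ∉ B) →
    (∀ b ∈ ctxs L₁, lo b → b ∉ B) → Multiset.Rel ρ L₁ L₂ →
    ∃ (S₁ R₁ S₂ R₂ : Multiset (TNode L)) (Δ₁ Δ₂ : Ctx L), L₁ = S₁ + R₁ ∧ L₂ = S₂ + R₂ ∧
      Δ = Δ₁ + Δ₂ ∧ Multiset.Rel ρ S₁ S₂ ∧ Multiset.Rel ρ R₁ R₂ ∧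
      Bal Δ₁ S₁ Ξ ∧ Bal Δ₁ S₂ Ξ := by
  classical
  intro L₁
  induction hc : L₁.card using Nat.strong_induction_on generalizing L₁ with
  | _ c ihc =>
  intro L₂ Ξ
  induction Ξ using Multiset.induction_on with
  | empty =>
    intro Δ _ _ _ hR
    exact ⟨0, L₁, 0, L₂, 0, Δ, by simp, by simp, by simp, .zero, hR, by simp [Bal], by simp [Bal]⟩
  | cons b Ξ ih =>
    intro Δ hE hΞ hL hR
    have hb : b ∈ Δ + decs L₁ + B := by
      rw [← hE]; simp
    rcases Multiset.mem_add.1 hb with hb | hb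
    · rcases Multiset.mem_add.1 hb with hb | hb
      · obtain ⟨Δ, rfl⟩ := Multiset.exists_cons_of_mem hb
        obtain ⟨S₁, R₁, S₂, R₂, Δ₁, Δ₂, h₁, h₂, rfl, h₃, h₄, h₅, h₆⟩ := ih Δ (by
          ext a
          have := congrArg (count a) hE
          simp only [← Multiset.singleton_add, Multiset.count_add] at this ⊢
          omega) (fun b hb => hΞ b (Multiset.mem_cons_of_mem hb)) hL hR
        refine ⟨S₁, R₁, S₂, R₂, b ::ₘ Δ₁, Δ₂, h₁, h₂, by simp, h₃, h₄, ?_, ?_⟩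
        · rw [Bal, Multiset.add_cons, h₅, Multiset.cons_add]
        · rw [Bal, Multiset.add_cons, h₆, Multiset.cons_add]
      · obtain ⟨n₁, hn₁, rfl⟩ := mem_decs.1 hb
        obtain ⟨L₁, rfl⟩ := Multiset.exists_cons_of_mem hn₁
        obtain ⟨n₂, L₂', hn, hR', rfl⟩ := Multiset.rel_cons_left.1 hR
        obtain ⟨e₁, e₂, hlo⟩ := hρ n₁ n₂ hn (hΞ _ (Multiset.mem_cons_self _ _)).1
        obtain ⟨S₁, R₁, S₂, R₂, Δ₁, Δ₂, rfl, rfl, rfl, h₃, h₄, h₅, h₆⟩ :=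
          ihc L₁.card (by rw [← hc]; simp) L₁ rfl L₂' (Ξ + n₁.ctx) Δ (by
            ext a
            have := congrArg (count a) hE
            simp only [ctxs_add, decs_add, ctxs_singleton, decs_singleton, ← Multiset.singleton_add, Multiset.count_add]
              at this ⊢
            omega) (by
            intro b hb
            rcases Multiset.mem_add.1 hb with hb | hb
            · exact hΞ b (Multiset.mem_cons_of_mem hb)
            · exact ⟨hlo b hb, hL b (by simp [hb]) (hlo b hb)⟩)
            (fun b hb => hL b (by simp [hb])) hR'
        refine ⟨n₁ ::ₘ S₁, R₁, n₂ ::ₘ S₂, R₂, Δ₁, Δ₂, by simp, by simp, rfl, .cons hn h₃, h₄,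
          ?_, ?_⟩
        · ext a
          have := congrArg (count a) h₅
          simp only [ctxs_add, decs_add, ctxs_singleton, decs_singleton, ← Multiset.singleton_add, Multiset.count_add] at this ⊢
          omega
        · ext a
          have := congrArg (count a) h₆
          simp only [ctxs_add, decs_add, ctxs_singleton, decs_singleton, e₁, e₂, ← Multiset.singleton_add,
            Multiset.count_add] at this ⊢
          omega
    · exact absurd hb (hΞ b (Multiset.mem_cons_self _ _)).2

theorem Bal.split {Θ Ξ Θ' : Ctx L} {T : Multiset (TNode L)} (h : Bal Θ T (Ξ + Θ')) :
    ∃ (S R : Multiset (TNode L)) (Θ₁ Θ₂ : Ctx L), T = S + R ∧ Θ = Θ₁ + Θ₂ ∧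
      Bal Θ₁ S Ξ ∧ Bal Θ₂ R Θ' := by
  classical
  obtain ⟨S₁, R₁, -, -, Δ₁, Δ₂, rfl, -, rfl, -, -, hS, -⟩ :=
    extract_joint (ρ := Eq) (lo := fun _ => True) (by rintro n _ rfl; simp) Θ' 0 T T Ξ Θ
      (by rw [add_assoc, h, add_zero]) (by simp) (by simp) (Multiset.rel_eq.2 rfl)
  refine ⟨S₁, R₁, Δ₁, Δ₂, rfl, rfl, hS, ?_⟩
  ext a
  have e₁ := congrArg (count a) h
  have e₂ := congrArg (count a) hS
  simp only [ctxs_add, decs_add, Multiset.count_add] at e₁ e₂ ⊢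
  omega

end

section
variable {L : Type u} [Lattice L]

/-! ### Local form of the dynamics -/

/-- Steps of a single process, other than forwards. -/
inductive Step1 (U : Set Chan) : Node L → Config L → Prop
  | cut {y x : Chan} {c d d₁ d₂ : L} {P Q : Proc L} : x ∉ U → x.2 = 0 →
      Step1 U (.proc y c (.cut d d₂ P Q) d₁)
        (.proc x d (P.inst 0 x) d₂ ::ₘ {.proc y c (Q.inst 0 x) d₁})
  | close {y : Chan} {c d₁ : L} {r : Ref} : r = .fv y →
      Step1 U (.proc y c (.close r) d₁) {.msg (.close c y)}
  | labUp {y y' : Chan} {c d₁ : L} {k : Label} {P : Proc L} {r : Ref} : r = .fv y →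
      y' ∉ U → y'.1 = y.1 → y.2 < y'.2 →
      Step1 U (.proc y c (.lab r k P) d₁)
        (.proc y' c (P.rename y y') d₁ ::ₘ {.msg (.posLab c y k y')})
  | labDown {y x x' : Chan} {c d₁ : L} {k : Label} {P : Proc L} {r : Ref} : r = .fv x →
      x ≠ y → x' ∉ U → x'.1 = x.1 → x.2 < x'.2 →
      Step1 U (.proc y c (.lab r k P) d₁)
        (.msg (.negLab x k x') ::ₘ {.proc y c (P.rename x x') d₁})
  | sendUp {y y' x : Chan} {c d₁ : L} {P : Proc L} {s r : Ref} : s = .fv x → r = .fv y →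
      y' ∉ U → y'.1 = y.1 → y.2 < y'.2 →
      Step1 U (.proc y c (.send s r P) d₁)
        (.proc y' c (P.rename y y') d₁ ::ₘ {.msg (.posSend c x y y')})
  | sendDown {y w w' x : Chan} {c d₁ : L} {P : Proc L} {s r : Ref} : s = .fv x → r = .fv w →
      w ≠ y → w' ∉ U → w'.1 = w.1 → w.2 < w'.2 →
      Step1 U (.proc y c (.send s r P) d₁)
        (.msg (.negSend x w w') ::ₘ {.proc y c (P.rename w w') d₁})

/-- Steps in which a process receives a message. -/
inductive Step2 : Msg L → Node L → Node L → Prop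
  | one {y x : Chan} {c c' d₁ : L} {Q : Proc L} {r : Ref} : r = .fv y →
      Step2 (.close c y) (.proc x c' (.wait r Q) d₁) (.proc x c' Q (d₁ ⊔ c))
  | plus {y v w : Chan} {c c' d₁ : L} {I : Finset Label} {k : Label}
      {Q : {k // k ∈ I} → Proc L} {r : Ref} (hk : k ∈ I) : r = .fv y →
      Step2 (.posLab c y k v) (.proc w c' (.branch r I Q) d₁)
        (.proc w c' ((Q ⟨k, hk⟩).rename y v) (d₁ ⊔ c))
  | wth {y v : Chan} {c d₁ : L} {I : Finset Label} {k : Label} {Q : {k // k ∈ I} → Proc L}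
      {r : Ref} (hk : k ∈ I) : r = .fv y →
      Step2 (.negLab y k v) (.proc y c (.branch r I Q) d₁)
        (.proc v c ((Q ⟨k, hk⟩).rename y v) c)
  | tensor {y v w x : Chan} {c c' d₁ : L} {P : Proc L} {r : Ref} : r = .fv y →
      Step2 (.posSend c x y v) (.proc w c' (.recv r P) d₁)
        (.proc w c' ((P.rename y v).inst 0 x) (d₁ ⊔ c))
  | lolli {y v x : Chan} {c d₁ : L} {P : Proc L} {r : Ref} : r = .fv y →
      Step2 (.negSend x y v) (.proc y c (.recv r P) d₁)
        (.proc v c ((P.rename y v).inst 0 x) c)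

theorem Step1.step {U : Set Chan} {o : Node L} {os : Config L} (h : Step1 U o os) (out : Set Chan)
    (G : Config L) : Step U out (o ::ₘ G) (os + G) := by
  cases h with
  | cut h₁ h₂ => simpa using Step.cut h₁ h₂
  | close e => subst e; simpa using Step.oneSend
  | labUp e h₁ h₂ h₃ => subst e; simpa using Step.plusSend h₁ h₂ h₃
  | labDown e h₀ h₁ h₂ h₃ => subst e; simpa using Step.withSend h₀ h₁ h₂ h₃
  | sendUp e e' h₁ h₂ h₃ => subst e e'; simpa using Step.tensorSend h₁ h₂ h₃
  | sendDown e e' h₀ h₁ h₂ h₃ => subst e e'; simpa using Step.lolliSend h₀ h₁ h₂ h₃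

theorem Step2.step {m : Msg L} {p q : Node L} (h : Step2 m p q) (U out : Set Chan)
    (G : Config L) : Step U out (.msg m ::ₘ p ::ₘ G) (q ::ₘ G) := by
  cases h with
  | one e => subst e; exact Step.oneRecv
  | plus hk e => subst e; exact Step.plusRecv (k := ⟨_, hk⟩)
  | wth hk e => subst e; rw [Multiset.cons_swap]; exact Step.withRecv (k := ⟨_, hk⟩)
  | tensor e => subst e; exact Step.tensorRecv
  | lolli e => subst e; rw [Multiset.cons_swap]; exact Step.lolliRecv

theorem Step.local_cases {U out : Set Chan} {C C' : Config L} (h : Step U out C C') :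
    (∃ (y x : Chan) (c d : L) (G : Config L), y ∉ out ∧
      C = .proc y c (.fwd (.fv y) (.fv x)) d ::ₘ G ∧ C' = G.rename y x) ∨
    (∃ (o : Node L) (os G : Config L), C = o ::ₘ G ∧ C' = os + G ∧ Step1 U o os) ∨
    (∃ (m : Msg L) (p q : Node L) (G : Config L), C = .msg m ::ₘ p ::ₘ G ∧ C' = q ::ₘ G ∧
      Step2 m p q) := by
  cases h with
  | fwd h => exact Or.inl ⟨_, _, _, _, _, h, rfl, rfl⟩
  | @cut _ _ _ _ _ _ _ _ G h₁ h₂ =>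
    exact Or.inr (Or.inl ⟨_, _, G, rfl, by simp, .cut h₁ h₂⟩)
  | @oneSend _ _ _ G => exact Or.inr (Or.inl ⟨_, _, G, rfl, by simp, .close rfl⟩)
  | oneRecv => exact Or.inr (Or.inr ⟨_, _, _, _, rfl, rfl, .one rfl⟩)
  | @plusSend _ _ _ _ _ _ G h₁ h₂ h₃ =>
    exact Or.inr (Or.inl ⟨_, _, G, rfl, by simp, .labUp rfl h₁ h₂ h₃⟩)
  | plusRecv => exact Or.inr (Or.inr ⟨_, _, _, _, rfl, rfl, .plus (Subtype.property _) rfl⟩)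
  | @withSend _ _ _ _ _ _ _ G h₀ h₁ h₂ h₃ =>
    exact Or.inr (Or.inl ⟨_, _, G, rfl, by simp, .labDown rfl h₀ h₁ h₂ h₃⟩)
  | withRecv =>
    exact Or.inr (Or.inr ⟨_, _, _, _, Multiset.cons_swap .., rfl, .wth (Subtype.property _) rfl⟩)
  | @tensorSend _ _ _ _ _ _ G h₁ h₂ h₃ =>
    exact Or.inr (Or.inl ⟨_, _, G, rfl, by simp, .sendUp rfl rfl h₁ h₂ h₃⟩)
  | tensorRecv => exact Or.inr (Or.inr ⟨_, _, _, _, rfl, rfl, .tensor rfl⟩)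
  | @lolliSend _ _ _ _ _ _ _ G h₀ h₁ h₂ h₃ =>
    exact Or.inr (Or.inl ⟨_, _, G, rfl, by simp, .sendDown rfl rfl h₀ h₁ h₂ h₃⟩)
  | lolliRecv => exact Or.inr (Or.inr ⟨_, _, _, _, Multiset.cons_swap .., rfl, .lolli rfl⟩)

theorem exists_generation {U : Set Chan} (hU : U.Finite) (y : Chan) :
    ∃ y' : Chan, y' ∉ U ∧ y'.1 = y.1 ∧ y.2 < y'.2 := by
  have : {n : ℕ | ∃ a ∈ U, a.2 = n}.Finite := (hU.image Prod.snd).subset (by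
    rintro n ⟨a, ha, rfl⟩; exact ⟨a, ha, rfl⟩)
  obtain ⟨N, hN⟩ := (this.union (Set.finite_singleton y.2)).bddAbove
  refine ⟨(y.1, N + 1), fun h => ?_, rfl, ?_⟩
  · have := hN (Or.inl ⟨_, h, rfl⟩ : N + 1 ∈ _)
    omega
  · have := hN (Or.inr rfl : y.2 ∈ _)
    change y.2 < N + 1
    omega

theorem exists_base {U : Set Chan} (hU : U.Finite) : ∃ x : Chan, x ∉ U ∧ x.2 = 0 := by
  obtain ⟨n, hn⟩ := (hU.image Prod.fst).exists_notMem
  exact ⟨(n, 0), fun h => hn ⟨_, h, rfl⟩, rfl⟩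

/-- Fresh channels can be chosen outside any finite set. -/
theorem Step1.refresh {U U' : Set Chan} {o : Node L} {os : Config L} (h : Step1 U o os)
    (hU : U'.Finite) : ∃ os', Step1 U' o os' := by
  cases h with
  | cut h₁ h₂ =>
    obtain ⟨x, h₁, h₂⟩ := exists_base hU
    exact ⟨_, .cut h₁ h₂⟩
  | close e => exact ⟨_, .close e⟩
  | @labUp y _ _ _ _ _ _ e h₁ h₂ h₃ =>
    obtain ⟨y', h₁, h₂, h₃⟩ := exists_generation hU y
    exact ⟨_, .labUp e h₁ h₂ h₃⟩
  | @labDown _ x _ _ _ _ _ _ e h₀ h₁ h₂ h₃ =>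
    obtain ⟨y', h₁, h₂, h₃⟩ := exists_generation hU x
    exact ⟨_, .labDown e h₀ h₁ h₂ h₃⟩
  | @sendUp y _ _ _ _ _ _ _ e e' h₁ h₂ h₃ =>
    obtain ⟨y', h₁, h₂, h₃⟩ := exists_generation hU y
    exact ⟨_, .sendUp e e' h₁ h₂ h₃⟩
  | @sendDown _ x _ _ _ _ _ _ _ e e' h₀ h₁ h₂ h₃ =>
    obtain ⟨y', h₁, h₂, h₃⟩ := exists_generation hU x
    exact ⟨_, .sendDown e e' h₀ h₁ h₂ h₃⟩

theorem Step1.mono {U U' : Set Chan} {o : Node L} {os : Config L} (h : Step1 U' o os)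
    (hU : U ⊆ U') : Step1 U o os := by
  cases h with
  | cut h₁ h₂ => exact .cut (fun h => h₁ (hU h)) h₂
  | close e => exact .close e
  | labUp e h₁ h₂ h₃ => exact .labUp e (fun h => h₁ (hU h)) h₂ h₃
  | labDown e h₀ h₁ h₂ h₃ => exact .labDown e h₀ (fun h => h₁ (hU h)) h₂ h₃
  | sendUp e e' h₁ h₂ h₃ => exact .sendUp e e' (fun h => h₁ (hU h)) h₂ h₃
  | sendDown e e' h₀ h₁ h₂ h₃ => exact .sendDown e e' h₀ (fun h => h₁ (hU h)) h₂ h₃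

theorem Step.refresh {U U' out : Set Chan} {C C' : Config L} (h : Step U out C C')
    (hU : U'.Finite) : ∃ C'', Step U' out C C'' := by
  rcases h.local_cases with ⟨y, x, c, d, G, hs, rfl, rfl⟩ | ⟨o, os, G, rfl, rfl, hs⟩ |
    ⟨m, p, q, G, rfl, rfl, hs⟩
  · exact ⟨_, .fwd hs⟩
  · obtain ⟨os', h'⟩ := hs.refresh hU
    exact ⟨_, h'.step out G⟩
  · exact ⟨_, hs.step U' out G⟩

theorem Step.mono {U U' out : Set Chan} {C C' : Config L} (h : Step U' out C C')
    (hU : U ⊆ U') : Step U out C C' := by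
  rcases h.local_cases with ⟨y, x, c, d, G, hs, rfl, rfl⟩ | ⟨o, os, G, rfl, rfl, hs⟩ |
    ⟨m, p, q, G, rfl, rfl, hs⟩
  · exact .fwd hs
  · exact (hs.mono hU).step out G
  · exact hs.step U out G

/-! ### Every step decreases the size -/

def Proc.size : Proc L → ℕ
  | .fwd _ _ => 1
  | .cut _ _ P Q => P.size + Q.size + 1
  | .close _ => 2
  | .wait _ Q => Q.size + 1
  | .lab _ _ P => P.size + 2
  | .branch _ I Q => (∑ k : {k // k ∈ I}, (Q k).size) + 1
  | .send _ _ P => P.size + 2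
  | .recv _ P => P.size + 1

def Node.size : Node L → ℕ
  | .proc _ _ P _ => P.size
  | .msg _ => 1

def Config.size (C : Config L) : ℕ := (C.map Node.size).sum

@[simp] theorem Config.size_zero : Config.size (0 : Config L) = 0 := rfl

@[simp] theorem Config.size_cons (o : Node L) (C : Config L) :
    Config.size (o ::ₘ C) = o.size + C.size := by simp [Config.size]

@[simp] theorem Config.size_add (C C' : Config L) :
    Config.size (C + C') = C.size + C'.size := by simp [Config.size]

@[simp] theorem Config.size_singleton (o : Node L) : Config.size {o} = o.size := by
  simp [Config.size]

theorem Proc.size_map (f : Chan → Chan) (P : Proc L) : (P.map f).size = P.size := by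
  induction P <;> simp_all [Proc.map, Proc.size]

theorem Proc.size_inst (a : Chan) (P : Proc L) : ∀ n, (P.inst n a).size = P.size := by
  induction P <;> intro n <;> simp_all [Proc.inst, Proc.size]

theorem Proc.size_rename (a b : Chan) (P : Proc L) : (P.rename a b).size = P.size := by
  rw [Proc.rename_eq, Proc.size_map]

theorem Node.size_map (f : Chan → Chan) (o : Node L) : (o.map f).size = o.size := by
  cases o
  · exact Proc.size_map f _
  · rfl

theorem Config.size_map (f : Chan → Chan) (C : Config L) :
    Config.size (C.map (Node.map f)) = C.size := by
  simp [Config.size, Multiset.map_map, Node.size_map]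

theorem Config.rename_eq (a b : Chan) (C : Config L) :
    C.rename a b = C.map (Node.map (Chan.rename a b)) :=
  Multiset.map_congr rfl fun o _ => Node.rename_eq a b o

theorem Step1.size_lt {U : Set Chan} {o : Node L} {os : Config L} (h : Step1 U o os) :
    os.size < o.size := by
  cases h <;> simp [Node.size, Proc.size, Proc.size_inst, Proc.size_rename] <;> omega

theorem Step2.size_lt {m : Msg L} {p q : Node L} (h : Step2 m p q) : q.size < p.size + 1 := by
  cases h with
  | @plus _ _ _ _ _ _ I k Q _ hk =>
    simp only [Node.size, Proc.size, Proc.size_rename]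
    have := Finset.single_le_sum (f := fun k => (Q k).size) (fun _ _ => Nat.zero_le _)
      (Finset.mem_univ (⟨k, hk⟩ : {k // k ∈ I}))
    omega
  | @wth _ _ _ _ I k Q _ hk =>
    simp only [Node.size, Proc.size, Proc.size_rename]
    have := Finset.single_le_sum (f := fun k => (Q k).size) (fun _ _ => Nat.zero_le _)
      (Finset.mem_univ (⟨k, hk⟩ : {k // k ∈ I}))
    omega
  | _ => simp [Node.size, Proc.size, Proc.size_inst, Proc.size_rename]; try omega

theorem Step.size_lt {U out : Set Chan} {C C' : Config L} (h : Step U out C C') :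
    C'.size < C.size := by
  rcases h.local_cases with ⟨y, x, c, d, G, hs, rfl, rfl⟩ | ⟨o, os, G, rfl, rfl, hs⟩ |
    ⟨m, p, q, G, rfl, rfl, hs⟩
  · simp [Config.rename_eq, Config.size_map, Node.size, Proc.size]
  · have := hs.size_lt
    simp only [Config.size_cons, Config.size_add]; omega
  · have := hs.size_lt
    simp only [Config.size_cons]
    change q.size + G.size < 1 + (p.size + G.size)
    omega

end

section
variable {L : Type u} [Lattice L]

/-! ### Typed reducts -/

def TNode.Wf (n : TNode L) : Prop := n.dec.ch ∉ n.ctx.names ∧ n.ctx.names.Nodup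

theorem Good.wf {T : Multiset (TNode L)} (h : Good T) {n : TNode L} (hn : n ∈ T) : n.Wf :=
  ⟨h.dec_not_mem hn, h.ctx_nodup hn⟩

/-- The running secrecy of the node, if it is a process, is at least `d`, and so is its level. -/
def TNode.Above (d : L) (n : TNode L) : Prop :=
  d ≤ n.dec.lvl ∧ ∀ y c P d', n.node = .proc y c P d' → d ≤ d'

/-- The typed nodes `ns` replace the typed process `n` in a step of `n`. -/
structure Reduct (U : Set Chan) (n : TNode L) (ns : Multiset (TNode L)) : Prop where
  net : n.ctx + decs ns = ctxs ns + {n.dec}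
  fresh : ∃ e, e ∉ U ∧ ∀ n' ∈ ns, (n'.dec.ch = n.dec.ch ∨ n'.dec.ch = e) ∧
    ∀ b ∈ n'.ctx, b ∈ n.ctx ∨ (b.ch = e ∧ n'.dec.ch = n.dec.ch)
  nodup : (decs ns).names.Nodup
  above : ∀ y c P d, n.node = .proc y c P d → ∀ n' ∈ ns, n'.Above d

/-- The typed process `q` replaces the message `m` and the process `p` that receives it. -/
structure Reduct2 (m p q : TNode L) : Prop where
  net : m.ctx + p.ctx + {q.dec} = q.ctx + {m.dec} + {p.dec}
  ctx : ∀ b ∈ q.ctx, b ∈ m.ctx ∨ b ∈ p.ctx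
  comm : (q.dec = p.dec ∧ m.dec ∈ p.ctx) ∨ (q.dec = m.dec ∧ p.dec ∈ m.ctx)
  lvl : ∀ b ∈ m.ctx, b.lvl = m.dec.lvl
  above : q.Above m.dec.lvl
  above' : m.dec ∈ p.ctx → ∀ y c P d, p.node = .proc y c P d → q.Above d

theorem TNode.Ok.run_le {n : TNode L} (h : n.Ok) {y : Chan} {c d : L} {P : Proc L}
    (e : n.node = .proc y c P d) : d ≤ n.dec.lvl := by
  obtain ⟨Γ, o, k⟩ := n
  cases h with
  | proc h _ _ => cases e; exact h
  | msg => cases e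

section
variable {U : Set Chan}

theorem reduct_cut {Δ₁ Δ₂ : Ctx L} {y x : Chan} {c d d₁ d₂ : L} {P Q P' Q' : Proc L} {A B : Ty}
    (hU : y ∈ U) (hx : x ∉ U) (h₁ : d₁ ≤ d₂) (h₂ : d₂ ≤ d) (h₃ : d ≤ c) :
    Reduct U ⟨Δ₁ + Δ₂, .proc y c (.cut d d₂ P Q) d₁, ⟨y, A, c⟩⟩
      (⟨Δ₁, .proc x d P' d₂, ⟨x, B, d⟩⟩ ::ₘ
        {⟨⟨x, B, d⟩ ::ₘ Δ₂, .proc y c Q' d₁, ⟨y, A, c⟩⟩}) where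
  net := by simp only [decs_add, ctxs_add, ctxs_singleton, decs_singleton,
    ← Multiset.singleton_add]; abel
  fresh := by
    refine ⟨x, hx, ?_⟩
    simp only [Multiset.mem_cons, Multiset.mem_singleton]
    rintro n (rfl | rfl)
    · exact ⟨Or.inr rfl, fun b hb => Or.inl (Multiset.mem_add.2 (Or.inl hb))⟩
    · refine ⟨Or.inl rfl, fun b hb => ?_⟩
      rcases Multiset.mem_cons.1 hb with rfl | hb
      · exact Or.inr ⟨rfl, rfl⟩
      · exact Or.inl (Multiset.mem_add.2 (Or.inr hb))
  nodup := by
    simp only [decs_cons, decs_singleton, Ctx.names_cons, Ctx.names_singleton,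
      Multiset.nodup_cons, Multiset.mem_singleton, Multiset.nodup_singleton, and_true]
    rintro rfl; exact hx hU
  above := by
    rintro _ _ _ _ ⟨⟩
    simp only [Multiset.mem_cons, Multiset.mem_singleton]
    rintro n (rfl | rfl)
    · exact ⟨h₁.trans h₂, by rintro _ _ _ _ ⟨⟩; exact h₁⟩
    · exact ⟨(h₁.trans h₂).trans h₃, by rintro _ _ _ _ ⟨⟩; exact le_rfl⟩

theorem reduct_close {y e : Chan} {c d₁ : L} {r : Ref} (he : e ∉ U) (hd : d₁ ≤ c) :
    Reduct U ⟨0, .proc y c (.close r) d₁, ⟨y, .one, c⟩⟩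
      {⟨0, .msg (.close c y), ⟨y, .one, c⟩⟩} where
  net := by simp
  fresh := ⟨e, he, by simp⟩
  nodup := by simp
  above := by
    rintro _ _ _ _ ⟨⟩
    simp only [Multiset.mem_singleton]
    rintro n rfl
    exact ⟨hd, by rintro _ _ _ _ ⟨⟩⟩

/-- A process sends a message `m`, carrying `Γ`, along the channel that it offers. -/
theorem reduct_up {Γ Δ : Ctx L} {y y' : Chan} {c d₁ : L} {P P' : Proc L} {m : Msg L} {A B : Ty}
    (hU : y ∈ U) (hy : y' ∉ U) (hd : d₁ ≤ c) :
    Reduct U ⟨Γ + Δ, .proc y c P d₁, ⟨y, A, c⟩⟩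
      (⟨Δ, .proc y' c P' d₁, ⟨y', B, c⟩⟩ ::ₘ
        {⟨Γ + {⟨y', B, c⟩}, .msg m, ⟨y, A, c⟩⟩}) where
  net := by simp only [decs_add, ctxs_add, ctxs_singleton, decs_singleton,
    ← Multiset.singleton_add]; abel
  fresh := by
    refine ⟨y', hy, ?_⟩
    simp only [Multiset.mem_cons, Multiset.mem_singleton]
    rintro n (rfl | rfl)
    · exact ⟨Or.inr rfl, fun b hb => Or.inl (Multiset.mem_add.2 (Or.inr hb))⟩
    · refine ⟨Or.inl rfl, fun b hb => ?_⟩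
      rcases Multiset.mem_add.1 hb with hb | hb
      · exact Or.inl (Multiset.mem_add.2 (Or.inl hb))
      · obtain rfl := Multiset.mem_singleton.1 hb
        exact Or.inr ⟨rfl, rfl⟩
  nodup := by
    simp only [decs_cons, decs_singleton, Ctx.names_cons, Ctx.names_singleton,
      Multiset.nodup_cons, Multiset.mem_singleton, Multiset.nodup_singleton, and_true]
    rintro rfl; exact hy hU
  above := by
    rintro _ _ _ _ ⟨⟩
    simp only [Multiset.mem_cons, Multiset.mem_singleton]
    rintro n (rfl | rfl)
    · exact ⟨hd, by rintro _ _ _ _ ⟨⟩; exact le_rfl⟩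
    · exact ⟨hd, by rintro _ _ _ _ ⟨⟩⟩

/-- A process sends a message `m`, carrying `Γ`, along a channel that it uses. -/
theorem reduct_down {Γ Δ : Ctx L} {y x' : Chan} {c c' d₁ : L} {P P' : Proc L} {m : Msg L}
    {A B : Ty} {k : Decl L} (hU : y ∈ U) (hx : x' ∉ U) (hd : d₁ ≤ c) (hd' : d₁ ≤ c') :
    Reduct U ⟨Γ + k ::ₘ Δ, .proc y c P d₁, ⟨y, A, c⟩⟩
      (⟨Γ + {k}, .msg m, ⟨x', B, c'⟩⟩ ::ₘ
        {⟨⟨x', B, c'⟩ ::ₘ Δ, .proc y c P' d₁, ⟨y, A, c⟩⟩}) where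
  net := by simp only [decs_add, ctxs_add, ctxs_singleton, decs_singleton,
    ← Multiset.singleton_add]; abel
  fresh := by
    refine ⟨x', hx, ?_⟩
    simp only [Multiset.mem_cons, Multiset.mem_singleton]
    rintro n (rfl | rfl)
    · refine ⟨Or.inr rfl, fun b hb => Or.inl ?_⟩
      simp only [Multiset.mem_add, Multiset.mem_singleton, Multiset.mem_cons] at hb ⊢
      tauto
    · refine ⟨Or.inl rfl, fun b hb => ?_⟩
      rcases Multiset.mem_cons.1 hb with rfl | hb
      · exact Or.inr ⟨rfl, rfl⟩
      · exact Or.inl (by simp [hb])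
  nodup := by
    simp only [decs_cons, decs_singleton, Ctx.names_cons, Ctx.names_singleton,
      Multiset.nodup_cons, Multiset.mem_singleton, Multiset.nodup_singleton, and_true]
    rintro rfl; exact hx hU
  above := by
    rintro _ _ _ _ ⟨⟩
    simp only [Multiset.mem_cons, Multiset.mem_singleton]
    rintro n (rfl | rfl)
    · exact ⟨hd', by rintro _ _ _ _ ⟨⟩⟩
    · exact ⟨hd, by rintro _ _ _ _ ⟨⟩; exact le_rfl⟩

end

/-! ### Nodes that agree up to renaming of unobservable channels -/

/-- The nodes arise from a common one by renamings that agree on the channels whose level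
satisfies `lo`. -/
def NodeSim (lo : L → Prop) (n₁ n₂ : TNode L) : Prop :=
  ∃ (n₀ : TNode L) (f₁ f₂ : Chan → Chan), n₀.Ok ∧ n₁ = n₀.map f₁ ∧ n₂ = n₀.map f₂ ∧
    ∀ b ∈ n₀.dec ::ₘ n₀.ctx, lo b.lvl → f₁ b.ch = f₂ b.ch

namespace NodeSim
variable {lo : L → Prop} {n₁ n₂ : TNode L}

theorem refl {n : TNode L} (h : n.Ok) : NodeSim lo n n :=
  ⟨n, id, id, h, n.map_id.symm, n.map_id.symm, fun _ _ _ => rfl⟩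

theorem of_ok {Γ : Ctx L} {o : Node L} {k : Decl L} {f₁ f₂ : Chan → Chan} (h : NodeOk Γ o k)
    (hlo : ∀ b ∈ k ::ₘ Γ, lo b.lvl → f₁ b.ch = f₂ b.ch) :
    NodeSim lo (TNode.map f₁ ⟨Γ, o, k⟩) (TNode.map f₂ ⟨Γ, o, k⟩) :=
  ⟨⟨Γ, o, k⟩, f₁, f₂, h, rfl, rfl, hlo⟩

theorem symm (h : NodeSim lo n₁ n₂) : NodeSim lo n₂ n₁ := by
  obtain ⟨n₀, f₁, f₂, h, h₁, h₂, h₃⟩ := h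
  exact ⟨n₀, f₂, f₁, h, h₂, h₁, fun b hb hl => (h₃ b hb hl).symm⟩

theorem ok_left (h : NodeSim lo n₁ n₂) : n₁.Ok := by
  obtain ⟨n₀, f₁, f₂, h, rfl, -, -⟩ := h
  exact h.map f₁

theorem ok_right (h : NodeSim lo n₁ n₂) : n₂.Ok := h.symm.ok_left

/-- Renamings can be applied to both sides if they agree on the observable channels. -/
theorem map (h : NodeSim lo n₁ n₂) {g₁ g₂ : Chan → Chan}
    (hg : ∀ b ∈ n₁.dec ::ₘ n₁.ctx, lo b.lvl → g₁ b.ch = g₂ b.ch) :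
    NodeSim lo (n₁.map g₁) (n₂.map g₂) := by
  obtain ⟨n₀, f₁, f₂, h, rfl, rfl, h₃⟩ := h
  refine ⟨n₀, g₁ ∘ f₁, g₂ ∘ f₂, h, TNode.map_map .., TNode.map_map .., fun b hb hl => ?_⟩
  have hb' : b.map f₁ ∈ (n₀.map f₁).dec ::ₘ (n₀.map f₁).ctx := by
    rcases Multiset.mem_cons.1 hb with rfl | hb
    · exact Multiset.mem_cons_self _ _
    · exact Multiset.mem_cons_of_mem (Multiset.mem_map_of_mem _ hb)
  have := hg _ hb' hl
  simp only [Function.comp_apply, ← h₃ b hb hl]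
  exact this

theorem dec_lvl (h : NodeSim lo n₁ n₂) : n₂.dec.lvl = n₁.dec.lvl := by
  obtain ⟨n₀, f₁, f₂, h, rfl, rfl, h₃⟩ := h
  rfl

theorem dec_eq (h : NodeSim lo n₁ n₂) (hl : lo n₁.dec.lvl) : n₂.dec = n₁.dec := by
  obtain ⟨n₀, f₁, f₂, h, rfl, rfl, h₃⟩ := h
  exact Decl.map_congr (h₃ _ (Multiset.mem_cons_self _ _) hl).symm

theorem ctx_eq (h : NodeSim lo n₁ n₂) (hl : ∀ b ∈ n₁.ctx, lo b.lvl) : n₂.ctx = n₁.ctx := by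
  obtain ⟨n₀, f₁, f₂, h, rfl, rfl, h₃⟩ := h
  refine Multiset.map_congr rfl fun b hb => Decl.map_congr (h₃ b ?_ ?_).symm
  · exact Multiset.mem_cons_of_mem hb
  · exact hl (b.map f₁) (Multiset.mem_map_of_mem (Decl.map f₁) hb)

theorem mem_ctx (h : NodeSim lo n₁ n₂) {b : Decl L} (hb : b ∈ n₁.ctx) (hl : lo b.lvl) :
    b ∈ n₂.ctx := by
  obtain ⟨n₀, f₁, f₂, h, rfl, rfl, h₃⟩ := h
  obtain ⟨b₀, hb₀, rfl⟩ := Multiset.mem_map.1 hb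
  rw [Decl.map_congr (h₃ b₀ (Multiset.mem_cons_of_mem hb₀) hl)]
  exact Multiset.mem_map_of_mem _ hb₀

end NodeSim

theorem names_map (f : Chan → Chan) (Δ : Ctx L) :
    Ctx.names (Δ.map (Decl.map f)) = Δ.names.map f := by
  simp only [Ctx.names, Multiset.map_map]; rfl

theorem Ctx.map_rename_comp {f : Chan → Chan} {a b : Chan} {Δ : Ctx L}
    (h : a ∉ Ctx.names (Δ.map (Decl.map f))) :
    Δ.map (Decl.map (Chan.rename a b ∘ f)) = Δ.map (Decl.map f) := by
  refine Ctx.map_congr fun x hx => Chan.rename_of_ne _ ?_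
  rintro rfl
  exact h (by rw [names_map]; exact Multiset.mem_map_of_mem f hx)

theorem Proc.map_rename (f : Chan → Chan) (a b : Chan) (P : Proc L) :
    (P.map f).rename a b = P.map (Chan.rename a b ∘ f) := by
  rw [Proc.rename_eq, Proc.map_map]

/-- A generation for the second of two channels, the same as for the first if they agree. -/
theorem exists_generation_pair {U : Set Chan} (hU : U.Finite) {p : Prop} {y₁ y₂ y' : Chan}
    (hp : p → y₁ = y₂) (h₁ : y' ∉ U) (h₂ : y'.1 = y₁.1) (h₃ : y₁.2 < y'.2) :
    ∃ y'' : Chan, y'' ∉ U ∧ y''.1 = y₂.1 ∧ y₂.2 < y''.2 ∧ (p → y' = y'') := by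
  by_cases h : p
  · obtain rfl := hp h
    exact ⟨y', h₁, h₂, h₃, fun _ => rfl⟩
  · obtain ⟨y'', h₁, h₂, h₃⟩ := exists_generation hU y₂
    exact ⟨y'', h₁, h₂, h₃, fun h' => absurd h' h⟩

theorem rel_pair {ρ : TNode L → TNode L → Prop} {a b a' b' : TNode L} (h : ρ a a')
    (h' : ρ b b') : Multiset.Rel ρ (a ::ₘ {b}) (a' ::ₘ {b'}) :=
  .cons h (.cons h' .zero)

theorem update_agree {lo : L → Prop} {f₁ f₂ : Chan → Chan} {Δ : Ctx L} {z a₁ a₂ : Chan} {p : Prop}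
    (h : ∀ b ∈ Δ, lo b.lvl → b.ch ≠ z → f₁ b.ch = f₂ b.ch)
    (hz : ∀ b ∈ Δ, lo b.lvl → b.ch = z → p) (ha : p → a₁ = a₂) :
    ∀ b ∈ Δ, lo b.lvl → Function.update f₁ z a₁ b.ch = Function.update f₂ z a₂ b.ch := by
  intro b hb hl
  by_cases e : b.ch = z
  · rw [e, Function.update_self, Function.update_self]
    exact ha (hz b hb hl e)
  · rw [Function.update_of_ne e, Function.update_of_ne e]
    exact h b hb hl e

end

section
variable {L : Type u} [Lattice L]

theorem map_update_of_notMem {f : Chan → Chan} {z a : Chan} {Δ : Ctx L} (h : z ∉ Δ.names) :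
    Δ.map (Decl.map (Function.update f z a)) = Δ.map (Decl.map f) :=
  Ctx.map_congr fun x hx => Function.update_of_ne (by rintro rfl; exact h hx) _ _

theorem Proc.map_update_of_not_uses {f : Chan → Chan} {z a : Chan} {P : Proc L}
    (h : ¬ P.Uses z) : P.map (Function.update f z a) = P.map f :=
  P.map_congr fun x hx => Function.update_of_ne (by rintro rfl; exact h hx) _ _

/-- What related active processes step to. -/
def Simulates (lo : L → Prop) (U : Set Chan) (n₁ n₂ : TNode L) (os : Config L) : Prop :=
  ∃ ns₁ ns₂ : Multiset (TNode L), nodes ns₁ = os ∧ Step1 U n₂.node (nodes ns₂) ∧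
    Multiset.Rel (NodeSim lo) ns₁ ns₂ ∧ Reduct U n₁ ns₁ ∧ Reduct U n₂ ns₂

variable {lo : L → Prop} {U : Set Chan} {f₁ f₂ : Chan → Chan}

theorem simulates_cut {Γ₀ : Ctx L} {y : Chan} {d d' d₁ d₂ : L} {P Q : Proc L} {A : Ty}
    {os : Config L} (h₁ : d₁ ≤ d) (h₂ : ∀ b ∈ Γ₀, b.lvl ≤ d)
    (h₃ : Typed Γ₀ (.cut d' d₂ P Q) d₁ ⟨y, A, d⟩)
    (hlo : ∀ b ∈ ⟨y, A, d⟩ ::ₘ Γ₀, lo b.lvl → f₁ b.ch = f₂ b.ch)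
    (hU₁ : f₁ y ∈ U) (hU₂ : f₂ y ∈ U)
    (st : Step1 U (.proc (f₁ y) d (.cut d' d₂ (P.map f₁) (Q.map f₁)) d₁) os) :
    Simulates lo U (TNode.map f₁ ⟨Γ₀, .proc y d (.cut d' d₂ P Q) d₁, ⟨y, A, d⟩⟩)
      (TNode.map f₂ ⟨Γ₀, .proc y d (.cut d' d₂ P Q) d₁, ⟨y, A, d⟩⟩) os := by
  obtain ⟨Δ₁, Δ₂, B, S, rfl, g₁, g₂, g₃, g₄, hP, hQ⟩ := h₃.cut_inv
  cases st with
  | @cut _ x _ _ _ _ _ _ hx hx' =>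
    obtain ⟨z, hz⟩ := exists_fresh (↑S ∪ ({a | P.Uses a} ∪ ({a | Q.Uses a} ∪
      ({a | a ∈ Ctx.names (Δ₁ + Δ₂)} ∪ {y}))))
      (S.finite_toSet.union (P.finite_uses.union (Q.finite_uses.union
        ((Δ₁ + Δ₂).finite_names.union (Set.finite_singleton _)))))
    simp only [Set.mem_union, Finset.mem_coe, Set.mem_ofPred_eq, Set.mem_singleton_iff,
      not_or, Ctx.names_add, Multiset.mem_add] at hz
    obtain ⟨z₁, z₂, z₃, ⟨z₄, z₅⟩, z₆⟩ := hz
    have key : ∀ f : Chan → Chan,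
        (TNode.mk Δ₁ (.proc z d' (P.inst 0 z) d₂) ⟨z, B, d'⟩).map (Function.update f z x) =
          ⟨Δ₁.map (Decl.map f), .proc x d' ((P.map f).inst 0 x) d₂, ⟨x, B, d'⟩⟩ ∧
        (TNode.mk (⟨z, B, d'⟩ ::ₘ Δ₂) (.proc y d (Q.inst 0 z) d₁) ⟨y, A, d⟩).map
          (Function.update f z x) =
          ⟨⟨x, B, d'⟩ ::ₘ Δ₂.map (Decl.map f), .proc (f y) d ((Q.map f).inst 0 x) d₁,
            ⟨f y, A, d⟩⟩ := by
      intro f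
      have hy : Function.update f z x y = f y := Function.update_of_ne (Ne.symm z₆) _ _
      constructor
      · simp only [TNode.map, Node.map, Decl.map_mk, map_update_of_notMem z₄, Proc.map_inst,
          Proc.map_update_of_not_uses z₂, Function.update_self]
      · simp only [TNode.map, Node.map, Decl.map_mk, map_update_of_notMem z₅, Proc.map_inst,
          Proc.map_update_of_not_uses z₃, Function.update_self, hy, Multiset.map_cons]
    have red : ∀ f : Chan → Chan, f y ∈ U → Reduct U
        (TNode.map f ⟨Δ₁ + Δ₂, .proc y d (.cut d' d₂ P Q) d₁, ⟨y, A, d⟩⟩)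
        (⟨Δ₁.map (Decl.map f), .proc x d' ((P.map f).inst 0 x) d₂, ⟨x, B, d'⟩⟩ ::ₘ
        {⟨⟨x, B, d'⟩ ::ₘ Δ₂.map (Decl.map f), .proc (f y) d ((Q.map f).inst 0 x) d₁,
            ⟨f y, A, d⟩⟩}) := by
      intro f hf
      simp only [TNode.map, Multiset.map_add]
      exact reduct_cut hf hx g₁ g₂ g₄
    refine ⟨_, _, ?_, ?_, rel_pair (a := _) (b := _) (a' := _) (b' := _) ?_ ?_,
      red f₁ hU₁, red f₂ hU₂⟩
    · rfl
    · exact Step1.cut hx hx'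
    · rw [← (key f₁).1, ← (key f₂).1]
      refine .of_ok (.proc g₂ g₃ (hP z z₁)) ?_
      refine update_agree (p := True) ?_ (fun _ _ _ _ => trivial) fun _ => rfl
      intro b hb hl hne
      refine hlo b ?_ hl
      rcases Multiset.mem_cons.1 hb with rfl | hb
      · exact absurd rfl hne
      · simp [hb]
    · rw [← (key f₁).2, ← (key f₂).2]
      refine .of_ok (.proc h₁ ?_ (hQ z z₁)) ?_
      · intro b hb
        rcases Multiset.mem_cons.1 hb with rfl | hb
        · exact g₄
        · exact h₂ b (by simp [hb])
      · refine update_agree (p := True) ?_ (fun _ _ _ _ => trivial) fun _ => rfl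
        intro b hb hl hne
        refine hlo b ?_ hl
        simp only [Multiset.mem_cons, Multiset.mem_add] at hb ⊢
        rcases hb with rfl | rfl | hb
        · exact Or.inl rfl
        · exact absurd rfl hne
        · exact Or.inr (Or.inr hb)

theorem simulates_close {Γ₀ : Ctx L} {y : Chan} {d d₁ : L} {r : Ref} {A : Ty}
    {os : Config L} (hU : U.Finite) (h₁ : d₁ ≤ d)
    (h₃ : Typed Γ₀ (.close r) d₁ ⟨y, A, d⟩)
    (hlo : ∀ b ∈ ⟨y, A, d⟩ ::ₘ Γ₀, lo b.lvl → f₁ b.ch = f₂ b.ch)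
    (st : Step1 U (.proc (f₁ y) d (.close (r.map f₁)) d₁) os) :
    Simulates lo U (TNode.map f₁ ⟨Γ₀, .proc y d (.close r) d₁, ⟨y, A, d⟩⟩)
      (TNode.map f₂ ⟨Γ₀, .proc y d (.close r) d₁, ⟨y, A, d⟩⟩) os := by
  obtain ⟨rfl, rfl, e⟩ := h₃.close_inv
  simp only at e
  subst e
  obtain ⟨e, he⟩ := exists_fresh U hU
  cases st with
  | close =>
    refine ⟨{TNode.map f₁ ⟨0, .msg (.close d y), ⟨y, .one, d⟩⟩},
      {TNode.map f₂ ⟨0, .msg (.close d y), ⟨y, .one, d⟩⟩}, rfl, .close rfl,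
      .cons (.of_ok (.msg rfl (by simp) .oneR) hlo) .zero,
      reduct_close he h₁, reduct_close he h₁⟩

theorem simulates_up {Γ Δ : Ctx L} {y z : Chan} {d d₁ : L} {P P₀ : Proc L} {A B : Ty}
    {m : Msg L} {os : Config L} (hU : U.Finite) (h₁ : d₁ ≤ d) (h₂ : ∀ b ∈ Γ + Δ, b.lvl ≤ d)
    (hP : Typed Δ P d₁ ⟨y, B, d⟩) (hlo : ∀ b ∈ ⟨y, A, d⟩ ::ₘ (Γ + Δ), lo b.lvl → f₁ b.ch = f₂ b.ch)
    (hU₁ : f₁ y ∈ U) (hU₂ : f₂ y ∈ U)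
    (hw₁ : f₁ y ∉ Ctx.names ((Γ + Δ).map (Decl.map f₁)))
    (hw₂ : f₂ y ∉ Ctx.names ((Γ + Δ).map (Decl.map f₂)))
    (hz : z ≠ y) (hz' : z ∉ Γ.names) (hm : NodeOk (Γ + {⟨z, B, d⟩}) (.msg m) ⟨y, A, d⟩)
    (hs : ∀ f : Chan → Chan, ∀ y', y' ∉ U → y'.1 = (f y).1 → (f y).2 < y'.2 →
      Step1 U (.proc (f y) d (P₀.map f) d₁) (.proc y' d ((P.map f).rename (f y) y') d₁ ::ₘ
        {.msg (m.map (Function.update f z y'))}))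
    {y' : Chan} (hy : y' ∉ U) (hy' : y'.1 = (f₁ y).1) (hy'' : (f₁ y).2 < y'.2)
    (ho : os = (.proc y' d ((P.map f₁).rename (f₁ y) y') d₁ ::ₘ
        {.msg (m.map (Function.update f₁ z y'))})) :
    Simulates lo U (TNode.map f₁ ⟨Γ + Δ, .proc y d P₀ d₁, ⟨y, A, d⟩⟩)
      (TNode.map f₂ ⟨Γ + Δ, .proc y d P₀ d₁, ⟨y, A, d⟩⟩) os := by
  subst ho
  have hyl : lo d → f₁ y = f₂ y := hlo _ (Multiset.mem_cons_self _ _)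
  obtain ⟨y₂', q₁, q₂, q₃, q₄⟩ := exists_generation_pair hU hyl hy hy' hy''
  have key : ∀ (f : Chan → Chan) (y' : Chan),
      f y ∉ Ctx.names ((Γ + Δ).map (Decl.map f)) →
      (TNode.mk Δ (.proc y d P d₁) ⟨y, B, d⟩).map (Chan.rename (f y) y' ∘ f) =
        ⟨Δ.map (Decl.map f), .proc y' d ((P.map f).rename (f y) y') d₁, ⟨y', B, d⟩⟩ ∧
      (TNode.mk (Γ + {⟨z, B, d⟩}) (.msg m) ⟨y, A, d⟩).map (Function.update f z y') =
        ⟨Γ.map (Decl.map f) + {⟨y', B, d⟩}, .msg (m.map (Function.update f z y')),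
          ⟨f y, A, d⟩⟩ := by
    intro f y' hw
    rw [Multiset.map_add, Ctx.names_add, Multiset.mem_add, not_or] at hw
    constructor
    · simp only [TNode.map, Node.map, Ctx.map_rename_comp hw.2, Decl.map_mk,
        Function.comp_apply, Chan.rename_self, Proc.map_rename]
    · simp only [TNode.map, Node.map, Multiset.map_add, Multiset.map_singleton, Decl.map_mk,
        map_update_of_notMem hz', Function.update_self, Function.update_of_ne (Ne.symm hz)]
  have red : ∀ (f : Chan → Chan) (y' : Chan), f y ∈ U → y' ∉ U → Reduct U
      (TNode.map f ⟨Γ + Δ, .proc y d P₀ d₁, ⟨y, A, d⟩⟩)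
      (⟨Δ.map (Decl.map f), .proc y' d ((P.map f).rename (f y) y') d₁, ⟨y', B, d⟩⟩ ::ₘ
        {⟨Γ.map (Decl.map f) + {⟨y', B, d⟩}, .msg (m.map (Function.update f z y')),
          ⟨f y, A, d⟩⟩}) := by
    intro f y' hf hy'
    simp only [TNode.map, Multiset.map_add]
    exact reduct_up hf hy' h₁
  refine ⟨_, _, ?_, ?_, rel_pair (a := _) (b := _) (a' := _) (b' := _) ?_ ?_,
      red f₁ y' hU₁ hy, red f₂ y₂' hU₂ q₁⟩
  · rfl
  · exact hs f₂ y₂' q₁ q₂ q₃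
  · rw [← (key f₁ y' hw₁).1, ← (key f₂ y₂' hw₂).1]
    refine .of_ok (.proc h₁ (fun b hb => h₂ b (by simp [hb])) hP) ?_
    intro b hb hl
    rcases Multiset.mem_cons.1 hb with rfl | hb
    · simp only [Function.comp_apply, Chan.rename_self]
      exact q₄ hl
    · have e := hlo b (by simp [hb]) hl
      have hb₁ : b.map f₁ ∈ (Γ + Δ).map (Decl.map f₁) :=
        Multiset.mem_map_of_mem _ (by simp [hb])
      have hb₂ : b.map f₂ ∈ (Γ + Δ).map (Decl.map f₂) :=
        Multiset.mem_map_of_mem _ (by simp [hb])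
      simp only [Function.comp_apply]
      rw [Chan.rename_of_ne, Chan.rename_of_ne, e]
      · intro h; exact hw₂ (h ▸ Ctx.mem_names_of hb₂)
      · intro h; exact hw₁ (h ▸ Ctx.mem_names_of hb₁)
  · rw [← (key f₁ y' hw₁).2, ← (key f₂ y₂' hw₂).2]
    refine .of_ok hm ?_
    refine update_agree (p := lo d) ?_ ?_ q₄
    · intro b hb hl hne
      refine hlo b ?_ hl
      simp only [Multiset.mem_cons, Multiset.mem_add, Multiset.mem_singleton] at hb ⊢
      rcases hb with rfl | hb | rfl
      · exact Or.inl rfl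
      · exact Or.inr (Or.inl hb)
      · exact absurd rfl hne
    · intro b hb hl e
      simp only [Multiset.mem_cons, Multiset.mem_add, Multiset.mem_singleton] at hb
      rcases hb with rfl | hb | rfl
      · exact absurd e.symm hz
      · exact absurd (e ▸ Ctx.mem_names_of hb) hz'
      · exact hl

theorem simulates_down {Γ Δ : Ctx L} {x y z : Chan} {c d d₁ : L} {P P₀ : Proc L} {A B C : Ty}
    {m : Msg L} {os : Config L} (hU : U.Finite) (h₁ : d₁ ≤ d) (h₁' : d₁ ≤ c)
    (h₂ : ∀ b ∈ Γ + ⟨x, C, c⟩ ::ₘ Δ, b.lvl ≤ d)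
    (hP : Typed (⟨x, B, c⟩ ::ₘ Δ) P d₁ ⟨y, A, d⟩)
    (hlo : ∀ b ∈ ⟨y, A, d⟩ ::ₘ (Γ + ⟨x, C, c⟩ ::ₘ Δ), lo b.lvl → f₁ b.ch = f₂ b.ch)
    (hU₁ : f₁ y ∈ U) (hU₂ : f₂ y ∈ U)
    (hw₁ : TNode.Wf (TNode.map f₁ ⟨Γ + ⟨x, C, c⟩ ::ₘ Δ, .proc y d P₀ d₁, ⟨y, A, d⟩⟩))
    (hw₂ : TNode.Wf (TNode.map f₂ ⟨Γ + ⟨x, C, c⟩ ::ₘ Δ, .proc y d P₀ d₁, ⟨y, A, d⟩⟩))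
    (hz : z ≠ x) (hz' : z ∉ Γ.names) (hm : NodeOk (Γ + {⟨x, C, c⟩}) (.msg m) ⟨z, B, c⟩)
    (hs : ∀ f : Chan → Chan, ∀ x', f x ≠ f y → x' ∉ U → x'.1 = (f x).1 → (f x).2 < x'.2 →
      Step1 U (.proc (f y) d (P₀.map f) d₁) (.msg (m.map (Function.update f z x')) ::ₘ
        {.proc (f y) d ((P.map f).rename (f x) x') d₁}))
    {x' : Chan} (hx : x' ∉ U) (hx' : x'.1 = (f₁ x).1) (hx'' : (f₁ x).2 < x'.2)
    (ho : os = (.msg (m.map (Function.update f₁ z x')) ::ₘ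
        {.proc (f₁ y) d ((P.map f₁).rename (f₁ x) x') d₁})) :
    Simulates lo U (TNode.map f₁ ⟨Γ + ⟨x, C, c⟩ ::ₘ Δ, .proc y d P₀ d₁, ⟨y, A, d⟩⟩)
      (TNode.map f₂ ⟨Γ + ⟨x, C, c⟩ ::ₘ Δ, .proc y d P₀ d₁, ⟨y, A, d⟩⟩) os := by
  subst ho
  have hxl : lo c → f₁ x = f₂ x := hlo ⟨x, C, c⟩ (by simp)
  obtain ⟨x₂', q₁, q₂, q₃, q₄⟩ := exists_generation_pair hU hxl hx hx' hx''
  have wf : ∀ f : Chan → Chan,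
      TNode.Wf (TNode.map f ⟨Γ + ⟨x, C, c⟩ ::ₘ Δ, .proc y d P₀ d₁, ⟨y, A, d⟩⟩) →
      f x ≠ f y ∧ f x ∉ Ctx.names (Δ.map (Decl.map f)) := by
    rintro f ⟨w₁, w₂⟩
    simp only [TNode.map, Decl.map_mk, Multiset.map_add, Multiset.map_cons, Ctx.names_add,
      Ctx.names_cons, Multiset.mem_add, Multiset.mem_cons, not_or, Multiset.add_cons,
      Multiset.nodup_cons] at w₁ w₂
    exact ⟨fun e => w₁.1 e.symm, w₂.1.2⟩
  have key : ∀ (f : Chan → Chan) (x' : Chan), f x ≠ f y →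
      f x ∉ Ctx.names (Δ.map (Decl.map f)) →
      (TNode.mk (Γ + {⟨x, C, c⟩}) (.msg m) ⟨z, B, c⟩).map (Function.update f z x') =
        ⟨Γ.map (Decl.map f) + {⟨f x, C, c⟩}, .msg (m.map (Function.update f z x')),
          ⟨x', B, c⟩⟩ ∧
      (TNode.mk (⟨x, B, c⟩ ::ₘ Δ) (.proc y d P d₁) ⟨y, A, d⟩).map (Chan.rename (f x) x' ∘ f) =
        ⟨⟨x', B, c⟩ ::ₘ Δ.map (Decl.map f), .proc (f y) d ((P.map f).rename (f x) x') d₁,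
          ⟨f y, A, d⟩⟩ := by
    intro f x' hxy hw
    constructor
    · simp only [TNode.map, Node.map, Multiset.map_add, Multiset.map_singleton, Decl.map_mk,
        map_update_of_notMem hz', Function.update_self, Function.update_of_ne (Ne.symm hz)]
    · simp only [TNode.map, Node.map, Ctx.map_rename_comp hw, Decl.map_mk, Multiset.map_cons,
        Function.comp_apply, Chan.rename_self, Proc.map_rename,
        Chan.rename_of_ne _ (Ne.symm hxy)]
  have red : ∀ (f : Chan → Chan) (x' : Chan), f y ∈ U → x' ∉ U → Reduct U
      (TNode.map f ⟨Γ + ⟨x, C, c⟩ ::ₘ Δ, .proc y d P₀ d₁, ⟨y, A, d⟩⟩)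
      (⟨Γ.map (Decl.map f) + {⟨f x, C, c⟩}, .msg (m.map (Function.update f z x')),
          ⟨x', B, c⟩⟩ ::ₘ
        {⟨⟨x', B, c⟩ ::ₘ Δ.map (Decl.map f), .proc (f y) d ((P.map f).rename (f x) x') d₁,
          ⟨f y, A, d⟩⟩}) := by
    intro f y' hf hy'
    simp only [TNode.map, Multiset.map_add, Multiset.map_cons]
    exact reduct_down hf hy' h₁ h₁'
  obtain ⟨hxy₁, hxn₁⟩ := wf f₁ hw₁
  obtain ⟨hxy₂, hxn₂⟩ := wf f₂ hw₂
  refine ⟨_, _, ?_, ?_, rel_pair (a := _) (b := _) (a' := _) (b' := _) ?_ ?_,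
      red f₁ x' hU₁ hx, red f₂ x₂' hU₂ q₁⟩
  · rfl
  · exact hs f₂ x₂' hxy₂ q₁ q₂ q₃
  · rw [← (key f₁ x' hxy₁ hxn₁).1, ← (key f₂ x₂' hxy₂ hxn₂).1]
    refine .of_ok hm ?_
    refine update_agree (p := lo c) ?_ ?_ q₄
    · intro b hb hl hne
      refine hlo b ?_ hl
      simp only [Multiset.mem_cons, Multiset.mem_add, Multiset.mem_singleton] at hb ⊢
      rcases hb with rfl | hb | rfl
      · exact absurd rfl hne
      · exact Or.inr (Or.inl hb)
      · exact Or.inr (Or.inr (Or.inl rfl))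
    · intro b hb hl e
      simp only [Multiset.mem_cons, Multiset.mem_add, Multiset.mem_singleton] at hb
      rcases hb with rfl | hb | rfl
      · exact hl
      · exact absurd (e ▸ Ctx.mem_names_of hb) hz'
      · exact absurd e.symm hz
  · rw [← (key f₁ x' hxy₁ hxn₁).2, ← (key f₂ x₂' hxy₂ hxn₂).2]
    refine .of_ok (.proc h₁ ?_ hP) ?_
    · intro b hb
      rcases Multiset.mem_cons.1 hb with rfl | hb
      · exact h₂ ⟨x, C, c⟩ (by simp)
      · exact h₂ b (by simp [hb])
    · intro b hb hl
      simp only [Multiset.mem_cons] at hb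
      simp only [Function.comp_apply]
      rcases hb with rfl | rfl | hb
      · rw [Chan.rename_of_ne _ (Ne.symm hxy₁), Chan.rename_of_ne _ (Ne.symm hxy₂)]
        exact hlo _ (Multiset.mem_cons_self _ _) hl
      · simp only [Chan.rename_self]
        exact q₄ hl
      · have e := hlo b (by simp [hb]) hl
        rw [Chan.rename_of_ne, Chan.rename_of_ne, e]
        · intro h
          exact hxn₂ (h ▸ Ctx.mem_names_of (Multiset.mem_map_of_mem (Decl.map f₂) hb))
        · intro h
          exact hxn₁ (h ▸ Ctx.mem_names_of (Multiset.mem_map_of_mem (Decl.map f₁) hb))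

end

section
variable {L : Type u} [Lattice L] {lo : L → Prop} {U : Set Chan}

theorem exists_ne_notMem (y : Chan) (Γ : Ctx L) : ∃ z, z ≠ y ∧ z ∉ Γ.names := by
  obtain ⟨z, hz⟩ := exists_fresh ({y} ∪ {a | a ∈ Γ.names})
    ((Set.finite_singleton y).union Γ.finite_names)
  simp only [Set.mem_union, Set.mem_singleton_iff, Set.mem_ofPred_eq, not_or] at hz
  exact ⟨z, hz⟩

/-- Related processes step to related nodes. -/
theorem NodeSim.step1 {n₁ n₂ : TNode L} {os : Config L} (h : NodeSim lo n₁ n₂) (hU : U.Finite)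
    (hw₁ : n₁.Wf) (hw₂ : n₂.Wf) (hU₁ : n₁.dec.ch ∈ U) (hU₂ : n₂.dec.ch ∈ U)
    (st : Step1 U n₁.node os) : Simulates lo U n₁ n₂ os := by
  obtain ⟨⟨Γ, o, k⟩, f₁, f₂, hok, rfl, rfl, hlo⟩ := h
  have hok : NodeOk Γ o k := hok
  have hlo : ∀ b ∈ k ::ₘ Γ, lo b.lvl → f₁ b.ch = f₂ b.ch := hlo
  cases hok with
  | msg => cases st
  | @proc y A P d d₁ h₁ h₂ h₃ =>
  cases P with
  | fwd => cases st
  | wait => cases st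
  | branch => cases st
  | recv => cases st
  | cut d' d₂ P Q => exact simulates_cut h₁ h₂ h₃ hlo hU₁ hU₂ st
  | close r => exact simulates_close hU h₁ h₃ hlo st
  | lab r l P =>
    rcases h₃.lab_inv with ⟨y', I, A, c, hl, rfl, e, hP⟩ | ⟨x, I, B, c, hl, Δ, rfl, rfl, hd, hP⟩
    · cases e
      obtain ⟨z, hz, -⟩ := exists_ne_notMem y Γ
      have hmap : ∀ (f : Chan → Chan) (y' : Chan),
          (Msg.posLab d y l z).map (Function.update f z y') = .posLab d (f y) l y' := by
        intro f y'
        simp [Msg.map, Function.update_of_ne (Ne.symm hz)]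
      have := fun {y' : Chan} => simulates_up (lo := lo) (U := U) (os := os) (f₁ := f₁) (f₂ := f₂)
        (Γ := 0) (Δ := Γ) (y := y) (z := z) (P₀ := .lab (.fv y) l P) (A := .plus I A)
        (m := .posLab d y l z) (y' := y') hU h₁ (by simpa using h₂) hP (by simpa using hlo)
        hU₁ hU₂ (by simpa using hw₁.1) (by simpa using hw₂.1) hz (by simp)
        (.msg rfl (by simp) (.plusR ⟨l, hl⟩ (by simpa using Typed.fwd)))
        (fun f y' g₁ g₂ g₃ => by rw [hmap]; exact .labUp rfl g₁ g₂ g₃)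
      simp only [zero_add] at this
      cases st with
      | labUp e g₁ g₂ g₃ => exact this g₁ g₂ g₃ (by rw [hmap])
      | labDown e g₀ =>
        exact absurd (by simpa [Ref.map] using e.symm) g₀
    · obtain ⟨z, hz, -⟩ := exists_ne_notMem x Δ
      have hmap : ∀ (f : Chan → Chan) (x' : Chan),
          (Msg.negLab x l z).map (Function.update f z x') = (.negLab (f x) l x' : Msg L) := by
        intro f y'
        simp [Msg.map, Function.update_of_ne (Ne.symm hz)]
      have := fun {x' : Chan} => simulates_down (lo := lo) (U := U) (os := os) (f₁ := f₁)
        (f₂ := f₂) (Γ := 0) (Δ := Δ) (x := x) (y := y) (z := z) (P₀ := .lab (.fv x) l P) (A := A)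
        (C := .wth I B) (m := .negLab x l z) (x' := x') hU h₁ hd (by simpa using h₂) hP
        (by simpa using hlo) hU₁ hU₂ (by simpa using hw₁) (by simpa using hw₂) hz (by simp)
        (.msg trivial (by simp) (.withL ⟨l, hl⟩ le_rfl .fwd))
        (fun f y' g₀ g₁ g₂ g₃ => by rw [hmap]; exact .labDown rfl g₀ g₁ g₂ g₃)
      simp only [zero_add] at this
      cases st with
      | labUp e =>
        refine absurd ?_ hw₁.1
        simp only [Ref.map, Ref.fv.injEq] at e
        simp [TNode.map, e]
      | labDown e g₀ g₁ g₂ g₃ =>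
        simp only [Ref.map, Ref.fv.injEq] at e
        subst e
        exact this g₁ g₂ g₃ (by rw [hmap])
  | send s r P =>
    rcases h₃.send_inv with ⟨w, y', A, B, c, Δ, rfl, rfl, e, rfl, hP⟩ |
      ⟨w, x, C, B, c, Δ, rfl, rfl, rfl, hd, hP⟩
    · cases e
      obtain ⟨z, hz, hz'⟩ := exists_ne_notMem y (⟨w, A, d⟩ ::ₘ Δ)
      simp only [Ctx.names_cons, Multiset.mem_cons, not_or] at hz'
      have hmap : ∀ (f : Chan → Chan) (y' : Chan),
          (Msg.posSend d w y z).map (Function.update f z y') = .posSend d (f w) (f y) y' := by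
        intro f y'
        simp [Msg.map, Function.update_of_ne (Ne.symm hz), Function.update_of_ne (Ne.symm hz'.1)]
      have := fun {y' : Chan} => simulates_up (lo := lo) (U := U) (os := os) (f₁ := f₁) (f₂ := f₂)
        (Γ := {⟨w, A, d⟩}) (Δ := Δ) (y := y) (z := z) (P₀ := .send (.fv w) (.fv y) P)
        (A := .tensor A B) (m := .posSend d w y z) (y' := y') hU h₁ (by simpa using h₂) hP
        (by simpa using hlo) hU₁ hU₂ (by simpa using hw₁.1) (by simpa using hw₂.1) hz
        (by simp [hz'.1]) (.msg rfl (by simp) (.tensorR .fwd))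
        (fun f y' g₁ g₂ g₃ => by rw [hmap]; exact .sendUp rfl rfl g₁ g₂ g₃)
      simp only [Multiset.singleton_add] at this
      cases st with
      | sendUp e' e g₁ g₂ g₃ =>
        simp only [Ref.map, Ref.fv.injEq] at e'
        subst e'
        exact this g₁ g₂ g₃ (by rw [hmap])
      | sendDown e' e g₀ =>
        exact absurd (by simpa [Ref.map] using e.symm) g₀
    · obtain ⟨z, hz, hz'⟩ := exists_ne_notMem x (⟨w, C, c⟩ ::ₘ Δ)
      simp only [Ctx.names_cons, Multiset.mem_cons, not_or] at hz'
      have hmap : ∀ (f : Chan → Chan) (x' : Chan),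
          (Msg.negSend w x z).map (Function.update f z x') =
            (.negSend (f w) (f x) x' : Msg L) := by
        intro f y'
        simp [Msg.map, Function.update_of_ne (Ne.symm hz), Function.update_of_ne (Ne.symm hz'.1)]
      have := fun {x' : Chan} => simulates_down (lo := lo) (U := U) (os := os) (f₁ := f₁)
        (f₂ := f₂) (Γ := {⟨w, C, c⟩}) (Δ := Δ) (x := x) (y := y) (z := z)
        (P₀ := .send (.fv w) (.fv x) P) (A := A) (C := .lolli C B) (m := .negSend w x z)
        (x' := x') hU h₁ hd (by simpa using h₂) hP (by simpa only [Multiset.singleton_add] using hlo) hU₁ hU₂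
        (by simpa only [Multiset.singleton_add] using hw₁)
        (by simpa only [Multiset.singleton_add] using hw₂) hz
        (by simp [hz'.1]) (.msg trivial (by simp) (.lolliL le_rfl .fwd))
        (fun f y' g₀ g₁ g₂ g₃ => by rw [hmap]; exact .sendDown rfl rfl g₀ g₁ g₂ g₃)
      simp only [Multiset.singleton_add] at this
      cases st with
      | sendUp e' e =>
        refine absurd ?_ hw₁.1
        simp only [Ref.map, Ref.fv.injEq] at e
        simp [TNode.map, e]
      | sendDown e' e g₀ g₁ g₂ g₃ =>
        simp only [Ref.map, Ref.fv.injEq] at e e'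
        subst e e'
        exact this g₁ g₂ g₃ (by rw [hmap])

/-! ### Receiving -/

theorem reduct2_pos {Γ Δ : Ctx L} {m : Msg L} {y w : Chan} {c d d₁ : L} {T : Ty} {P P' : Proc L}
    {k : Decl L} (hΓ : ∀ b ∈ Γ, b.lvl = c) (hc : c ≤ k.lvl) (hd : d₁ ≤ k.lvl) :
    Reduct2 ⟨Γ, .msg m, ⟨y, T, c⟩⟩ ⟨⟨y, T, c⟩ ::ₘ Δ, .proc w d P d₁, k⟩
      ⟨Γ + Δ, .proc w d P' (d₁ ⊔ c), k⟩ where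
  net := by simp only [← Multiset.singleton_add]; abel
  ctx b hb := by
    rcases Multiset.mem_add.1 hb with h | h
    · exact Or.inl h
    · exact Or.inr (Multiset.mem_cons_of_mem h)
  comm := Or.inl ⟨rfl, Multiset.mem_cons_self _ _⟩
  lvl := hΓ
  above := ⟨hc, by rintro _ _ _ _ ⟨⟩; exact le_sup_right⟩
  above' := by
    rintro - _ _ _ _ ⟨⟩
    exact ⟨hd, by rintro _ _ _ _ ⟨⟩; exact le_sup_left⟩

theorem reduct2_neg {Γ Δ : Ctx L} {m : Msg L} {y v : Chan} {c d₁ : L} {T B : Ty}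
    {P P' : Proc L} (hΓ : ∀ b ∈ Γ, b.lvl = c) (hd : d₁ ≤ c) :
    Reduct2 ⟨Γ + {⟨y, T, c⟩}, .msg m, ⟨v, B, c⟩⟩ ⟨Δ, .proc y c P d₁, ⟨y, T, c⟩⟩
      ⟨Γ + Δ, .proc v c P' c, ⟨v, B, c⟩⟩ where
  net := by simp only; abel
  ctx b hb := by
    rcases Multiset.mem_add.1 hb with h | h
    · exact Or.inl (Multiset.mem_add.2 (Or.inl h))
    · exact Or.inr h
  comm := Or.inr ⟨rfl, Multiset.mem_add.2 (Or.inr (Multiset.mem_singleton_self _))⟩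
  lvl b hb := by
    rcases Multiset.mem_add.1 hb with h | h
    · exact hΓ b h
    · obtain rfl := Multiset.mem_singleton.1 h; rfl
  above := ⟨le_rfl, by rintro _ _ _ _ ⟨⟩; exact le_rfl⟩
  above' := by
    rintro - _ _ _ _ ⟨⟩
    exact ⟨hd, by rintro _ _ _ _ ⟨⟩; exact hd⟩

/-- What related messages and processes receiving them step to. -/
def Simulates2 (lo : L → Prop) (m₁ m₂ p₁ p₂ : TNode L) (q : Node L) : Prop :=
  ∃ (q₁ q₂ : TNode L) (m' : Msg L), q₁.node = q ∧ m₂.node = .msg m' ∧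
    Step2 m' p₂.node q₂.node ∧ NodeSim lo q₁ q₂ ∧ Reduct2 m₁ p₁ q₁ ∧ Reduct2 m₂ p₂ q₂

def Compatible (m p : TNode L) : Prop :=
  ∀ b ∈ m.dec ::ₘ m.ctx, ∀ b' ∈ p.dec ::ₘ p.ctx, b.ch = b'.ch → b = b'

theorem map_mem_cons {f : Chan → Chan} {b k : Decl L} {Γ : Ctx L} (h : b ∈ k ::ₘ Γ) :
    b.map f ∈ k.map f ::ₘ Γ.map (Decl.map f) := by
  rw [← Multiset.map_cons]
  exact Multiset.mem_map_of_mem _ h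

section
variable {f₁ f₂ g₁ g₂ : Chan → Chan}

/-- A process that goes on with `P` after receiving along a channel `x`, which is renamed. -/
theorem map_recv_left {g : Chan → Chan} {x w : Chan} {c d e : L} {B A : Ty} {Δ : Ctx L}
    {P : Proc L} (v : Chan) (hxw : g w ≠ g x) (hx : g x ∉ Ctx.names (Δ.map (Decl.map g))) :
    (TNode.mk (⟨x, B, c⟩ ::ₘ Δ) (.proc w d P e) ⟨w, A, d⟩).map (Chan.rename (g x) v ∘ g) =
      ⟨⟨v, B, c⟩ ::ₘ Δ.map (Decl.map g), .proc (g w) d ((P.map g).rename (g x) v) e,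
        ⟨g w, A, d⟩⟩ := by
  simp only [TNode.map, Node.map, Multiset.map_cons, Ctx.map_rename_comp hx, Decl.map_mk,
    Function.comp_apply, Chan.rename_self, Chan.rename_of_ne _ hxw, Proc.map_rename]

theorem map_recv_right {g : Chan → Chan} {y : Chan} {d e : L} {A : Ty} {Δ : Ctx L}
    {P : Proc L} (v : Chan) (hy : g y ∉ Ctx.names (Δ.map (Decl.map g))) :
    (TNode.mk Δ (.proc y d P e) ⟨y, A, d⟩).map (Chan.rename (g y) v ∘ g) =
      ⟨Δ.map (Decl.map g), .proc v d ((P.map g).rename (g y) v) e, ⟨v, A, d⟩⟩ := by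
  simp only [TNode.map, Node.map, Ctx.map_rename_comp hy, Decl.map_mk,
    Function.comp_apply, Chan.rename_self, Proc.map_rename]

/-- The received channel replaces the bound variable. -/
theorem map_inst_update {h : Chan → Chan} {z : Chan} {c : L} {A : Ty} {Δ : Ctx L} {P : Proc L}
    {w : Chan} {d e : L} {k : Decl L} (x : Chan) (hP : ¬ P.Uses z) (hΔ : z ∉ Δ.names)
    (hw : z ≠ w) (hk : z ≠ k.ch) :
    (TNode.mk (⟨z, A, c⟩ ::ₘ Δ) (.proc w d (P.inst 0 z) e) k).map (Function.update h z x) =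
      ⟨⟨x, A, c⟩ ::ₘ Δ.map (Decl.map h), .proc (h w) d ((P.map h).inst 0 x) e, k.map h⟩ := by
  simp only [TNode.map, Node.map, Multiset.map_cons, Function.update_self,
    map_update_of_notMem hΔ, Proc.map_inst, Proc.map_update_of_not_uses hP,
    Function.update_of_ne (Ne.symm hw), Decl.map, Function.update_of_ne (Ne.symm hk)]

theorem rename_agree {Δ : Ctx L} {a₁ a₂ v₁ v₂ : Chan}
    (h : ∀ b ∈ Δ, lo b.lvl → g₁ b.ch = g₂ b.ch) (ha : a₁ = a₂) (hv : v₁ = v₂) :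
    ∀ b ∈ Δ, lo b.lvl → (Chan.rename a₁ v₁ ∘ g₁) b.ch = (Chan.rename a₂ v₂ ∘ g₂) b.ch := by
  intro b hb hl
  subst ha hv
  simp only [Function.comp_apply, h b hb hl]

end

end

section
variable {L : Type u} [Lattice L] {lo : L → Prop} {U : Set Chan}

section
variable {f₁ f₂ g₁ g₂ : Chan → Chan}

theorem wf_map_cons {g : Chan → Chan} {b k : Decl L} {Δ : Ctx L} {o : Node L}
    (h : TNode.Wf (TNode.map g ⟨b ::ₘ Δ, o, k⟩)) :
    g k.ch ≠ g b.ch ∧ g b.ch ∉ Ctx.names (Δ.map (Decl.map g)) ∧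
      g k.ch ∉ Ctx.names (Δ.map (Decl.map g)) := by
  obtain ⟨h₁, h₂⟩ := h
  simp only [TNode.map, Multiset.map_cons, Ctx.names_cons, Multiset.mem_cons, not_or,
    Multiset.nodup_cons, Decl.map_ch] at h₁ h₂
  exact ⟨h₁.1, h₂.1, h₁.2⟩

/-- Receiving a message along a channel `x` that the process uses. -/
theorem simulates_pos {Γ Δ Γq : Ctx L} {m : Msg L} {y x w : Chan} {c c' d d₁ : L} {T T' A : Ty}
    {P Pq : Proc L} {q : Node L} {h₁ h₂ : Chan → Chan}
    (hΓ : ∀ b ∈ Γ, b.lvl = c) (hlm : ∀ b ∈ ⟨y, T, c⟩ ::ₘ Γ, lo b.lvl → f₁ b.ch = f₂ b.ch)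
    (hlp : ∀ b ∈ ⟨w, A, d⟩ ::ₘ ⟨x, T', c'⟩ ::ₘ Δ, lo b.lvl → g₁ b.ch = g₂ b.ch)
    (hlo : lo c) (hc : c ≤ d) (hd : d₁ ≤ d) (he : f₁ y = g₁ x)
    (hT : T = T') (hcc : c = c')
    (hok : NodeOk Γq (.proc w d Pq (d₁ ⊔ c)) ⟨w, A, d⟩)
    (hmap : ∀ f g h, f y = g x → (f = f₁ ∧ g = g₁ ∧ h = h₁) ∨ (f = f₂ ∧ g = g₂ ∧ h = h₂) →
      (TNode.mk Γq (.proc w d Pq (d₁ ⊔ c)) ⟨w, A, d⟩).map h =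
        ⟨Γ.map (Decl.map f) + Δ.map (Decl.map g), .proc (g w) d (Pq.map h) (d₁ ⊔ c),
          ⟨g w, A, d⟩⟩)
    (hh : ∀ b ∈ ⟨w, A, d⟩ ::ₘ Γq, lo b.lvl → h₁ b.ch = h₂ b.ch)
    (hq : q = .proc (g₁ w) d (Pq.map h₁) (d₁ ⊔ c))
    (hs : f₂ y = g₂ x → Step2 (m.map f₂) (.proc (g₂ w) d (P.map g₂) d₁)
      (.proc (g₂ w) d (Pq.map h₂) (d₁ ⊔ c))) :
    Simulates2 lo (TNode.map f₁ ⟨Γ, .msg m, ⟨y, T, c⟩⟩) (TNode.map f₂ ⟨Γ, .msg m, ⟨y, T, c⟩⟩)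
      (TNode.map g₁ ⟨⟨x, T', c'⟩ ::ₘ Δ, .proc w d P d₁, ⟨w, A, d⟩⟩)
      (TNode.map g₂ ⟨⟨x, T', c'⟩ ::ₘ Δ, .proc w d P d₁, ⟨w, A, d⟩⟩) q := by
  subst hT hcc hq
  have e₁ : f₁ y = f₂ y := hlm _ (Multiset.mem_cons_self _ _) hlo
  have e₂ : g₁ x = g₂ x := hlp ⟨x, T, c⟩ (by simp) hlo
  have he' : f₂ y = g₂ x := by rw [← e₁, he, e₂]
  have k₁ := hmap f₁ g₁ h₁ he (Or.inl ⟨rfl, rfl, rfl⟩)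
  have k₂ := hmap f₂ g₂ h₂ he' (Or.inr ⟨rfl, rfl, rfl⟩)
  have red : ∀ (f g : Chan → Chan) (P' : Proc L), f y = g x → Reduct2
      (TNode.map f ⟨Γ, .msg m, ⟨y, T, c⟩⟩)
      (TNode.map g ⟨⟨x, T, c⟩ ::ₘ Δ, .proc w d P d₁, ⟨w, A, d⟩⟩)
      ⟨Γ.map (Decl.map f) + Δ.map (Decl.map g), .proc (g w) d P' (d₁ ⊔ c), ⟨g w, A, d⟩⟩ := by
    intro f g P' e
    simp only [TNode.map, Multiset.map_cons, Decl.map_mk, e]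
    refine reduct2_pos ?_ hc hd
    intro b hb
    obtain ⟨b', hb', rfl⟩ := Multiset.mem_map.1 hb
    exact hΓ b' hb'
  refine ⟨⟨Γ.map (Decl.map f₁) + Δ.map (Decl.map g₁), .proc (g₁ w) d (Pq.map h₁) (d₁ ⊔ c),
      ⟨g₁ w, A, d⟩⟩, ⟨Γ.map (Decl.map f₂) + Δ.map (Decl.map g₂),
      .proc (g₂ w) d (Pq.map h₂) (d₁ ⊔ c), ⟨g₂ w, A, d⟩⟩, m.map f₂, rfl, rfl, hs he', ?_,
      red f₁ g₁ _ he, red f₂ g₂ _ he'⟩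
  rw [← k₁, ← k₂]
  exact .of_ok hok hh

/-- Receiving a message along the channel `y` that the process offers. -/
theorem simulates_neg {Γ Δ Γq : Ctx L} {m : Msg L} {y x v : Chan} {c c' d₁ : L} {T T' B : Ty}
    {P Pq : Proc L} {q : Node L} {h₁ h₂ : Chan → Chan}
    (hΓ : ∀ b ∈ Γ, b.lvl = c)
    (hlm : ∀ b ∈ ⟨v, B, c⟩ ::ₘ (Γ + {⟨x, T, c⟩}), lo b.lvl → f₁ b.ch = f₂ b.ch)
    (hlp : ∀ b ∈ ⟨y, T', c'⟩ ::ₘ Δ, lo b.lvl → g₁ b.ch = g₂ b.ch)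
    (hlo : lo c) (hd : d₁ ≤ c') (he : f₁ x = g₁ y) (hT : T = T') (hcc : c = c')
    (hok : NodeOk Γq (.proc y c Pq c) ⟨y, B, c⟩)
    (hmap : ∀ f g h, f x = g y → (f = f₁ ∧ g = g₁ ∧ h = h₁) ∨ (f = f₂ ∧ g = g₂ ∧ h = h₂) →
      (TNode.mk Γq (.proc y c Pq c) ⟨y, B, c⟩).map h =
        ⟨Γ.map (Decl.map f) + Δ.map (Decl.map g), .proc (f v) c (Pq.map h) c, ⟨f v, B, c⟩⟩)
    (hh : ∀ b ∈ ⟨y, B, c⟩ ::ₘ Γq, lo b.lvl → h₁ b.ch = h₂ b.ch)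
    (hq : q = .proc (f₁ v) c (Pq.map h₁) c)
    (hs : f₂ x = g₂ y → Step2 (m.map f₂) (.proc (g₂ y) c (P.map g₂) d₁)
      (.proc (f₂ v) c (Pq.map h₂) c)) :
    Simulates2 lo (TNode.map f₁ ⟨Γ + {⟨x, T, c⟩}, .msg m, ⟨v, B, c⟩⟩)
      (TNode.map f₂ ⟨Γ + {⟨x, T, c⟩}, .msg m, ⟨v, B, c⟩⟩)
      (TNode.map g₁ ⟨Δ, .proc y c' P d₁, ⟨y, T', c'⟩⟩)
      (TNode.map g₂ ⟨Δ, .proc y c' P d₁, ⟨y, T', c'⟩⟩) q := by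
  subst hT hcc hq
  have e₁ : f₁ x = f₂ x := hlm ⟨x, T, c⟩ (by simp) hlo
  have e₂ : g₁ y = g₂ y := hlp _ (Multiset.mem_cons_self _ _) hlo
  have he' : f₂ x = g₂ y := by rw [← e₁, he, e₂]
  have k₁ := hmap f₁ g₁ h₁ he (Or.inl ⟨rfl, rfl, rfl⟩)
  have k₂ := hmap f₂ g₂ h₂ he' (Or.inr ⟨rfl, rfl, rfl⟩)
  have red : ∀ (f g : Chan → Chan) (P' : Proc L), f x = g y → Reduct2
      (TNode.map f ⟨Γ + {⟨x, T, c⟩}, .msg m, ⟨v, B, c⟩⟩)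
      (TNode.map g ⟨Δ, .proc y c P d₁, ⟨y, T, c⟩⟩)
      ⟨Γ.map (Decl.map f) + Δ.map (Decl.map g), .proc (f v) c P' c, ⟨f v, B, c⟩⟩ := by
    intro f g P' e
    simp only [TNode.map, Multiset.map_add, Multiset.map_singleton, Decl.map_mk, e]
    refine reduct2_neg ?_ hd
    intro b hb
    obtain ⟨b', hb', rfl⟩ := Multiset.mem_map.1 hb
    exact hΓ b' hb'
  refine ⟨⟨Γ.map (Decl.map f₁) + Δ.map (Decl.map g₁), .proc (f₁ v) c (Pq.map h₁) c,
      ⟨f₁ v, B, c⟩⟩, ⟨Γ.map (Decl.map f₂) + Δ.map (Decl.map g₂),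
      .proc (f₂ v) c (Pq.map h₂) c, ⟨f₂ v, B, c⟩⟩, m.map f₂, rfl, rfl, hs he', ?_,
      red f₁ g₁ _ he, red f₂ g₂ _ he'⟩
  rw [← k₁, ← k₂]
  exact .of_ok hok hh

end

theorem exists_binder (S : Finset Chan) (P : Proc L) (Δ : Ctx L) (x w : Chan) :
    ∃ z, z ∉ S ∧ ¬ P.Uses z ∧ z ∉ Δ.names ∧ z ≠ x ∧ z ≠ w := by
  obtain ⟨z, hz⟩ := exists_fresh (↑S ∪ ({a | P.Uses a} ∪ ({a | a ∈ Δ.names} ∪ {x, w})))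
    (S.finite_toSet.union (P.finite_uses.union (Δ.finite_names.union (Set.toFinite _))))
  simp only [Set.mem_union, Finset.mem_coe, Set.mem_ofPred_eq, Set.mem_insert_iff,
    Set.mem_singleton_iff, not_or] at hz
  exact ⟨z, hz.1, hz.2.1, hz.2.2.1, hz.2.2.2⟩

theorem notMem_names_of_map {f : Chan → Chan} {k : Decl L} {Γ : Ctx L} {o : Node L}
    (h : TNode.Wf (TNode.map f ⟨Γ, o, k⟩)) : k.ch ∉ Γ.names := by
  intro hk
  refine h.1 ?_
  simp only [TNode.map, names_map]
  exact Multiset.mem_map_of_mem f hk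


theorem Step2.exists_proc {m : Msg L} {p q : Node L} (h : Step2 m p q) :
    ∃ w c P d, p = .proc w c P d := by
  cases h <;> exact ⟨_, _, _, _, rfl⟩

theorem Step2.close_inv {c d d₁ : L} {y w : Chan} {P : Proc L} {q : Node L}
    (h : Step2 (.close c y) (.proc w d P d₁) q) :
    ∃ Q, P = .wait (.fv y) Q ∧ q = .proc w d Q (d₁ ⊔ c) := by
  cases h with
  | one e => subst e; exact ⟨_, rfl, rfl⟩

theorem Step2.posLab_inv {c d d₁ : L} {y v w : Chan} {l : Label} {P : Proc L} {q : Node L}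
    (h : Step2 (.posLab c y l v) (.proc w d P d₁) q) :
    ∃ (I : Finset Label) (Q : {k // k ∈ I} → Proc L) (hl : l ∈ I), P = .branch (.fv y) I Q ∧
      q = .proc w d ((Q ⟨l, hl⟩).rename y v) (d₁ ⊔ c) := by
  cases h with
  | plus hl e => subst e; exact ⟨_, _, hl, rfl, rfl⟩

theorem Step2.negLab_inv {d d₁ : L} {y v w : Chan} {l : Label} {P : Proc L} {q : Node L}
    (h : Step2 (.negLab y l v) (.proc w d P d₁) q) :
    ∃ (I : Finset Label) (Q : {k // k ∈ I} → Proc L) (hl : l ∈ I), w = y ∧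
      P = .branch (.fv y) I Q ∧ q = .proc v d ((Q ⟨l, hl⟩).rename y v) d := by
  cases h with
  | wth hl e => subst e; exact ⟨_, _, hl, rfl, rfl, rfl⟩

theorem Step2.posSend_inv {c d d₁ : L} {x y v w : Chan} {P : Proc L} {q : Node L}
    (h : Step2 (.posSend c x y v) (.proc w d P d₁) q) :
    ∃ Q, P = .recv (.fv y) Q ∧ q = .proc w d ((Q.rename y v).inst 0 x) (d₁ ⊔ c) := by
  cases h with
  | tensor e => subst e; exact ⟨_, rfl, rfl⟩

theorem Step2.negSend_inv {d d₁ : L} {x y v w : Chan} {P : Proc L} {q : Node L}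
    (h : Step2 (.negSend x y v) (.proc w d P d₁) q) :
    ∃ Q, w = y ∧ P = .recv (.fv y) Q ∧ q = .proc v d ((Q.rename y v).inst 0 x) d := by
  cases h with
  | lolli e => subst e; exact ⟨_, rfl, rfl, rfl⟩

theorem Ref.map_eq_fv {g : Chan → Chan} {r : Ref} {y : Chan} (h : r.map g = .fv y) :
    ∃ x, r = .fv x ∧ g x = y := by
  cases r with
  | fv x => exact ⟨x, rfl, by simpa [Ref.map] using h⟩
  | bv => cases h

theorem Proc.map_eq_wait {g : Chan → Chan} {P Q : Proc L} {y : Chan}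
    (h : P.map g = .wait (.fv y) Q) : ∃ x Q₀, P = .wait (.fv x) Q₀ ∧ g x = y ∧ Q = Q₀.map g := by
  cases P with
  | wait r Q₀ =>
    simp only [Proc.map, Proc.wait.injEq] at h
    obtain ⟨x, rfl, rfl⟩ := Ref.map_eq_fv h.1
    exact ⟨x, Q₀, rfl, rfl, h.2.symm⟩
  | _ => cases h

theorem Proc.map_eq_branch {g : Chan → Chan} {P : Proc L} {I : Finset Label}
    {Q : {k // k ∈ I} → Proc L} {y : Chan} (h : P.map g = .branch (.fv y) I Q) :
    ∃ x Q₀, P = .branch (.fv x) I Q₀ ∧ g x = y ∧ Q = fun k => (Q₀ k).map g := by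
  cases P with
  | branch r I' Q₀ =>
    simp only [Proc.map, Proc.branch.injEq] at h
    obtain ⟨x, rfl, rfl⟩ := Ref.map_eq_fv h.1
    obtain ⟨-, rfl, h⟩ := h
    exact ⟨x, Q₀, rfl, rfl, (eq_of_heq h).symm⟩
  | _ => cases h

theorem Proc.map_eq_recv {g : Chan → Chan} {P Q : Proc L} {y : Chan}
    (h : P.map g = .recv (.fv y) Q) : ∃ x Q₀, P = .recv (.fv x) Q₀ ∧ g x = y ∧ Q = Q₀.map g := by
  cases P with
  | recv r Q₀ =>
    simp only [Proc.map, Proc.recv.injEq] at h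
    obtain ⟨x, rfl, rfl⟩ := Ref.map_eq_fv h.1
    exact ⟨x, Q₀, rfl, rfl, h.2.symm⟩
  | _ => cases h

/-- Related processes receive related messages in the same way, along an observable channel. -/
theorem NodeSim.step2 {m₁ m₂ p₁ p₂ : TNode L} {m : Msg L} {q : Node L}
    (hm : NodeSim lo m₁ m₂) (hp : NodeSim lo p₁ p₂) (hmw : m₁.Wf) (hpw₁ : p₁.Wf)
    (hpw₂ : p₂.Wf) (hc : Compatible m₁ p₁) (hlo : lo m₁.dec.lvl) (e : m₁.node = .msg m)
    (st : Step2 m p₁.node q) : Simulates2 lo m₁ m₂ p₁ p₂ q := by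
  obtain ⟨⟨Γ, om, k⟩, f₁, f₂, hmok, rfl, rfl, hlm⟩ := hm
  obtain ⟨⟨Δ, op, k'⟩, g₁, g₂, hpok, rfl, rfl, hlp⟩ := hp
  replace hmok : NodeOk Γ om k := hmok
  replace hpok : NodeOk Δ op k' := hpok
  replace hlm : ∀ b ∈ k ::ₘ Γ, lo b.lvl → f₁ b.ch = f₂ b.ch := hlm
  replace hlp : ∀ b ∈ k' ::ₘ Δ, lo b.lvl → g₁ b.ch = g₂ b.ch := hlp
  have hkΓ := notMem_names_of_map hmw
  replace hlo : lo k.lvl := hlo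
  replace hc : ∀ b ∈ k ::ₘ Γ, ∀ b' ∈ k' ::ₘ Δ, f₁ b.ch = g₁ b'.ch →
      b.ty = b'.ty ∧ b.lvl = b'.lvl := by
    intro b hb b' hb' e
    have : b.map f₁ = b'.map g₁ :=
      hc _ (map_mem_cons (f := f₁) hb) _ (map_mem_cons (f := g₁) hb') e
    have e₁ : (b.map f₁).ty = (b'.map g₁).ty := congrArg _ this
    have e₂ : (b.map f₁).lvl = (b'.map g₁).lvl := congrArg _ this
    exact ⟨e₁, e₂⟩
  cases om with
  | proc => simp [TNode.map, Node.map] at e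
  | msg m₀ =>
  simp only [TNode.map, Node.map, Node.msg.injEq] at e
  subst e
  cases hpok with
  | msg => obtain ⟨_, _, _, _, h⟩ := st.exists_proc; cases h
  | @proc w A P d d₁ p₁ p₂ p₃ =>
  replace st : Step2 (m₀.map f₁) (.proc (g₁ w) d (P.map g₁) d₁) q := st
  cases m₀ with
  | close c y =>
    obtain ⟨rfl, rfl⟩ := hmok.close_inv
    obtain ⟨Q', hP, rfl⟩ := Step2.close_inv st
    obtain ⟨x, Q, rfl, e, rfl⟩ := Proc.map_eq_wait hP
    obtain ⟨x', c', Δ, e', rfl, hQ⟩ := p₃.wait_inv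
    cases e'
    obtain ⟨-, hcc⟩ := hc _ (Multiset.mem_cons_self _ _) ⟨x, .one, c'⟩ (by simp) e.symm
    simp only at hcc
    subst hcc
    have hcd : c ≤ d := p₂ _ (Multiset.mem_cons_self _ _)
    refine simulates_pos (h₁ := g₁) (h₂ := g₂) (Γq := Δ) (Pq := Q) (by simp) hlm hlp hlo
      hcd p₁ e.symm rfl rfl
      (.proc (sup_le p₁ hcd) (fun b hb => p₂ b (by simp [hb])) (by rwa [sup_comm]))
      ?_ (fun b hb hl => hlp b ?_ hl) rfl ?_
    · rintro f g h - (⟨rfl, rfl, rfl⟩ | ⟨rfl, rfl, rfl⟩) <;> simp [TNode.map, Node.map]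
    · simp only [Multiset.mem_cons] at hb ⊢; tauto
    · intro e'; exact .one (by simp [Ref.map, e'])
  | posLab c y l v =>
    obtain ⟨I, B, hl, rfl, rfl⟩ := hmok.posLab_inv hkΓ
    obtain ⟨I', Q', hl', hP, rfl⟩ := Step2.posLab_inv st
    obtain ⟨x, Q, rfl, e, rfl⟩ := Proc.map_eq_branch hP
    rcases p₃.branch_inv with ⟨x', B', c', Δ, e', rfl, hQ⟩ | ⟨y', B', c', e', e'', hQ⟩
    swap
    · cases e''
      cases e'
      have := (hc _ (Multiset.mem_cons_self _ _) _ (Multiset.mem_cons_self _ _) e.symm).1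
      cases this
    cases e'
    obtain ⟨hT, hcc⟩ := hc _ (Multiset.mem_cons_self _ _) ⟨x, .plus I' B', c'⟩ (by simp) e.symm
    simp only at hT hcc
    subst hcc
    cases hT
    have hcd : c ≤ d := p₂ ⟨x, .plus I B, c⟩ (Multiset.mem_cons_self _ _)
    obtain ⟨w₁, w₂, -⟩ := wf_map_cons hpw₁
    obtain ⟨w₁', w₂', -⟩ := wf_map_cons hpw₂
    have e₁ : g₁ x = g₂ x := hlp ⟨x, .plus I B, c⟩ (by simp) hlo
    have e₂ : f₁ v = f₂ v := hlm ⟨v, B ⟨l, hl⟩, c⟩ (by simp) hlo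
    refine simulates_pos (h₁ := Chan.rename (g₁ x) (f₁ v) ∘ g₁)
      (h₂ := Chan.rename (g₂ x) (f₂ v) ∘ g₂) (Γq := ⟨x, B ⟨l, hl⟩, c⟩ ::ₘ Δ) (Pq := Q ⟨l, hl⟩)
      (by simp) hlm hlp hlo hcd p₁ e.symm rfl rfl
      (.proc (sup_le p₁ hcd) ?_ (by rw [sup_comm]; exact hQ _)) ?_ ?_ ?_ ?_
    · intro b hb
      rcases Multiset.mem_cons.1 hb with rfl | hb
      · exact hcd
      · exact p₂ b (by simp [hb])
    · rintro f g h - (⟨rfl, rfl, rfl⟩ | ⟨rfl, rfl, rfl⟩)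
      · rw [map_recv_left _ w₁ w₂, Proc.map_rename]; simp
      · rw [map_recv_left _ w₁' w₂', Proc.map_rename]; simp
    · refine rename_agree (fun b hb hl => ?_) e₁ e₂
      simp only [Multiset.mem_cons] at hb
      rcases hb with rfl | rfl | hb
      · exact hlp _ (by simp) hl
      · exact e₁
      · exact hlp b (by simp [hb]) hl
    · rw [← Proc.map_rename, e]
    · intro e'
      rw [← Proc.map_rename, ← e']
      exact .plus (Q := fun k => (Q k).map g₂) hl (by simp [Ref.map, e'])
  | negLab y l v =>
    obtain ⟨I, B, hl, c, rfl, rfl⟩ := hmok.negLab_inv hkΓ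
    obtain ⟨I', Q', hl', hw, hP, rfl⟩ := Step2.negLab_inv st
    obtain ⟨x, Q, rfl, e, rfl⟩ := Proc.map_eq_branch hP
    rcases p₃.branch_inv with ⟨x', B', c', Δ, e', rfl, hQ⟩ | ⟨y', B', c', e', e'', hQ⟩
    · cases e'
      exact absurd (hw.trans e.symm) (wf_map_cons hpw₁).1
    cases e'
    cases e''
    obtain ⟨hT, hcc⟩ := hc ⟨y, .wth I B, c⟩ (by simp) _ (Multiset.mem_cons_self _ _) e.symm
    simp only at hT hcc
    subst hcc
    cases hT
    have e₁ : g₁ w = g₂ w := hlp ⟨w, .wth I B, c⟩ (by simp) hlo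
    have e₂ : f₁ v = f₂ v := hlm ⟨v, B ⟨l, hl⟩, c⟩ (by simp) hlo
    have := simulates_neg (Γ := 0) (P := .branch (.fv w) I Q) (m := .negLab y l v)
      (h₁ := Chan.rename (g₁ w) (f₁ v) ∘ g₁)
      (h₂ := Chan.rename (g₂ w) (f₂ v) ∘ g₂) (Γq := Δ) (Pq := Q ⟨l, hl⟩)
      (q := .proc (f₁ v) c (((Q ⟨l, hl⟩).map g₁).rename (f₁ y) (f₁ v)) c)
      (by simp) (by simpa using hlm) hlp hlo p₁ e.symm rfl rfl
      (.proc le_rfl p₂ (hQ _)) ?_ ?_ ?_ ?_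
    · simpa only [zero_add] using this
    · rintro f g h - (⟨rfl, rfl, rfl⟩ | ⟨rfl, rfl, rfl⟩)
      · rw [map_recv_right _ hpw₁.1, Proc.map_rename]; simp
      · rw [map_recv_right _ hpw₂.1, Proc.map_rename]; simp
    · refine rename_agree (fun b hb hl => ?_) e₁ e₂
      simp only [Multiset.mem_cons] at hb
      rcases hb with rfl | hb
      · exact hlp ⟨w, .wth I B, c⟩ (by simp) hl
      · exact hlp b (by simp [hb]) hl
    · rw [← Proc.map_rename, e]
    · intro e'
      rw [← Proc.map_rename]
      simp only [Msg.map, e']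
      exact .wth (Q := fun k => (Q k).map g₂) hl rfl
  | posSend c s y v =>
    obtain ⟨A₁, A₂, rfl, rfl⟩ := hmok.posSend_inv hkΓ
    obtain ⟨Q', hP, rfl⟩ := Step2.posSend_inv st
    obtain ⟨x, Q, rfl, e, rfl⟩ := Proc.map_eq_recv hP
    rcases p₃.recv_inv with ⟨x', B₁, B₂, c', Δ, S, e', rfl, hQ⟩ | ⟨y', B₁, B₂, c', S, e', e'', hQ⟩
    swap
    · cases e''
      cases e'
      have := (hc _ (Multiset.mem_cons_self _ _) _ (Multiset.mem_cons_self _ _) e.symm).1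
      cases this
    cases e'
    obtain ⟨hT, hcc⟩ := hc _ (Multiset.mem_cons_self _ _) ⟨x, .tensor B₁ B₂, c'⟩ (by simp) e.symm
    simp only at hT hcc
    subst hcc
    cases hT
    have hcd : c ≤ d := p₂ ⟨x, .tensor A₁ A₂, c⟩ (Multiset.mem_cons_self _ _)
    obtain ⟨w₁, w₂, -⟩ := wf_map_cons hpw₁
    obtain ⟨w₁', w₂', -⟩ := wf_map_cons hpw₂
    have e₁ : g₁ x = g₂ x := hlp ⟨x, .tensor A₁ A₂, c⟩ (by simp) hlo
    have e₂ : f₁ v = f₂ v := hlm ⟨v, A₂, c⟩ (by simp) hlo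
    have e₃ : f₁ s = f₂ s := hlm ⟨s, A₁, c⟩ (by simp) hlo
    obtain ⟨z, hzS, hzQ, hzΔ, hzx, hzw⟩ := exists_binder S Q Δ x w
    refine simulates_pos (h₁ := Function.update (Chan.rename (g₁ x) (f₁ v) ∘ g₁) z (f₁ s))
      (h₂ := Function.update (Chan.rename (g₂ x) (f₂ v) ∘ g₂) z (f₂ s))
      (Γq := ⟨z, A₁, c⟩ ::ₘ ⟨x, A₂, c⟩ ::ₘ Δ) (Pq := Q.inst 0 z)
      (by simp) hlm hlp hlo hcd p₁ e.symm rfl rfl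
      (.proc (sup_le p₁ hcd) ?_ (by rw [sup_comm]; exact hQ _ hzS)) ?_ ?_ ?_ ?_
    · intro b hb
      simp only [Multiset.mem_cons] at hb
      rcases hb with rfl | rfl | hb
      · exact hcd
      · exact hcd
      · exact p₂ b (by simp [hb])
    · have hzn : z ∉ Ctx.names (⟨x, A₂, c⟩ ::ₘ Δ) := by simp [hzx, hzΔ]
      rintro f g h - (⟨rfl, rfl, rfl⟩ | ⟨rfl, rfl, rfl⟩)
      · rw [map_inst_update _ hzQ hzn hzw hzw]
        simp only [Proc.map_inst, Proc.map_update_of_not_uses hzQ, Function.update_self,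
          Multiset.map_cons, Ctx.map_rename_comp w₂, Decl.map_mk, Function.comp_apply,
          Chan.rename_self, Chan.rename_of_ne _ w₁]
        simp
      · rw [map_inst_update _ hzQ hzn hzw hzw]
        simp only [Proc.map_inst, Proc.map_update_of_not_uses hzQ, Function.update_self,
          Multiset.map_cons, Ctx.map_rename_comp w₂', Decl.map_mk, Function.comp_apply,
          Chan.rename_self, Chan.rename_of_ne _ w₁']
        simp
    · refine update_agree (p := True) ?_ (fun _ _ _ _ => trivial) fun _ => e₃
      intro b hb hl hne
      refine rename_agree (Δ := {b}) (fun b' hb' hl => ?_) e₁ e₂ b (by simp) hl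
      obtain rfl := Multiset.mem_singleton.1 hb'
      simp only [Multiset.mem_cons] at hb
      rcases hb with rfl | rfl | rfl | hb
      · exact hlp _ (by simp) hl
      · exact absurd rfl hne
      · exact e₁
      · exact hlp b' (by simp [hb]) hl
    · simp only [Proc.map_inst, Proc.map_update_of_not_uses hzQ, Function.update_self,
        ← Proc.map_rename, e]
    · intro e'
      simp only [Proc.map_inst, Proc.map_update_of_not_uses hzQ, Function.update_self,
        ← Proc.map_rename, ← e']
      exact .tensor (by simp [Ref.map, e'])
  | negSend s y v =>
    obtain ⟨A₁, A₂, c, rfl, rfl⟩ := hmok.negSend_inv hkΓ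
    obtain ⟨Q', hw, hP, rfl⟩ := Step2.negSend_inv st
    obtain ⟨x, Q, rfl, e, rfl⟩ := Proc.map_eq_recv hP
    rcases p₃.recv_inv with ⟨x', B₁, B₂, c', Δ, S, e', rfl, hQ⟩ | ⟨y', B₁, B₂, c', S, e', e'', hQ⟩
    · cases e'
      exact absurd (hw.trans e.symm) (wf_map_cons hpw₁).1
    cases e'
    cases e''
    obtain ⟨hT, hcc⟩ := hc ⟨y, .lolli A₁ A₂, c⟩ (by simp) _ (Multiset.mem_cons_self _ _) e.symm
    simp only at hT hcc
    subst hcc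
    cases hT
    have e₁ : g₁ w = g₂ w := hlp ⟨w, .lolli A₁ A₂, c⟩ (by simp) hlo
    have e₂ : f₁ v = f₂ v := hlm ⟨v, A₂, c⟩ (by simp) hlo
    have e₃ : f₁ s = f₂ s := hlm ⟨s, A₁, c⟩ (by simp) hlo
    have w₁ : g₁ w ∉ Ctx.names (Δ.map (Decl.map g₁)) := hpw₁.1
    have w₂ : g₂ w ∉ Ctx.names (Δ.map (Decl.map g₂)) := hpw₂.1
    obtain ⟨z, hzS, hzQ, hzΔ, hzw, -⟩ := exists_binder S Q Δ w w
    refine simulates_neg (Γ := {⟨s, A₁, c⟩}) (P := .recv (.fv w) Q) (m := .negSend s y v)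
      (h₁ := Function.update (Chan.rename (g₁ w) (f₁ v) ∘ g₁) z (f₁ s))
      (h₂ := Function.update (Chan.rename (g₂ w) (f₂ v) ∘ g₂) z (f₂ s))
      (Γq := ⟨z, A₁, c⟩ ::ₘ Δ) (Pq := Q.inst 0 z)
      (by simp) (by simpa using hlm) hlp hlo p₁ e.symm rfl rfl
      (.proc le_rfl ?_ (hQ _ hzS)) ?_ ?_ ?_ ?_
    · intro b hb
      simp only [Multiset.mem_cons] at hb
      rcases hb with rfl | hb
      · exact le_rfl
      · exact p₂ b hb
    · rintro f g h - (⟨rfl, rfl, rfl⟩ | ⟨rfl, rfl, rfl⟩)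
      · rw [map_inst_update _ hzQ hzΔ hzw hzw]
        simp only [Proc.map_inst, Proc.map_update_of_not_uses hzQ, Function.update_self,
          Ctx.map_rename_comp w₁, Decl.map_mk, Function.comp_apply, Chan.rename_self]
        simp
      · rw [map_inst_update _ hzQ hzΔ hzw hzw]
        simp only [Proc.map_inst, Proc.map_update_of_not_uses hzQ, Function.update_self,
          Ctx.map_rename_comp w₂, Decl.map_mk, Function.comp_apply, Chan.rename_self]
        simp
    · refine update_agree (p := True) ?_ (fun _ _ _ _ => trivial) fun _ => e₃
      intro b hb hl hne
      refine rename_agree (Δ := {b}) (fun b' hb' hl => ?_) e₁ e₂ b (by simp) hl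
      obtain rfl := Multiset.mem_singleton.1 hb'
      simp only [Multiset.mem_cons] at hb
      rcases hb with rfl | rfl | hb
      · exact e₁
      · exact absurd rfl hne
      · exact hlp b' (by simp [hb]) hl
    · simp only [Proc.map_inst, Proc.map_update_of_not_uses hzQ, Function.update_self,
        ← Proc.map_rename, e]
    · intro e'
      simp only [Proc.map_inst, Proc.map_update_of_not_uses hzQ, Function.update_self,
        ← Proc.map_rename, Msg.map, e']
      exact .lolli rfl

end

section
variable {L : Type u} [Lattice L] {U : Set Chan}

/-! ### Preservation of well-formed flat configurations -/

theorem Good.compatible {T : Multiset (TNode L)} {m p : TNode L} (h : Good T) (hm : m ∈ T)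
    (hp : p ∈ T) : Compatible m p := by
  intro b hb b' hb' e
  refine h.decl_eq ?_ ?_ e
  · rcases Multiset.mem_cons.1 hb with rfl | hb
    · exact dec_mem_decs hm
    · exact h.ctx_mem hm hb
  · rcases Multiset.mem_cons.1 hb' with rfl | hb'
    · exact dec_mem_decs hp
    · exact h.ctx_mem hp hb'

theorem Good.notMem_of_mem {T : Multiset (TNode L)} {n : TNode L} (h : Good (n ::ₘ T)) :
    n.dec.ch ∉ (decs T).names := by
  have := h.nodup
  rw [decs_cons, Ctx.names_cons, Multiset.nodup_cons] at this
  exact this.1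

theorem Good.reduct {T ns : Multiset (TNode L)} {n : TNode L} (h : Good (n ::ₘ T))
    (hr : Reduct U n ns) (hU : ∀ b ∈ decs (n ::ₘ T), b.ch ∈ U) (hok : ∀ n' ∈ ns, n'.Ok) :
    Good (ns + T) where
  ok n' hn' := by
    rcases Multiset.mem_add.1 hn' with hn' | hn'
    · exact hok n' hn'
    · exact h.ok n' (Multiset.mem_cons_of_mem hn')
  nodup := by
    obtain ⟨e, he, hns⟩ := hr.fresh
    have h₁ := h.nodup
    rw [decs_cons, Ctx.names_cons, Multiset.nodup_cons] at h₁
    rw [decs_add, Ctx.names_add, Multiset.nodup_add]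
    refine ⟨hr.nodup, h₁.2, Multiset.disjoint_left.2 fun {a} ha ha' => ?_⟩
    obtain ⟨b, hb, rfl⟩ := Ctx.mem_names.1 ha
    obtain ⟨n', hn', rfl⟩ := mem_decs.1 hb
    rcases (hns n' hn').1 with e' | e'
    · exact h₁.1 (e' ▸ ha')
    · obtain ⟨b', hb', e''⟩ := Ctx.mem_names.1 ha'
      exact he (e' ▸ e'' ▸ hU b' (by simp [hb']))
  rank := by
    obtain ⟨e, he, hns⟩ := hr.fresh
    obtain ⟨r, hr⟩ := h.rank
    have hn : n.dec.ch ≠ e := by rintro rfl; exact he (hU _ (by simp))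
    have hold : ∀ n' ∈ n ::ₘ T, ∀ b ∈ n'.ctx, b.ch ≠ e := by
      rintro n' hn' b hb rfl
      exact he (hU b (h.ctx_mem hn' hb))
    refine ⟨fun a => if a = e then 2 * r n.dec.ch + 1 else 2 * r a + 2, fun n' hn' b hb => ?_⟩
    rcases Multiset.mem_add.1 hn' with hn' | hn'
    · obtain ⟨h₁, h₂⟩ := hns n' hn'
      rcases h₂ b hb with hb | ⟨hb, hb'⟩
      · have h₃ := hold n (Multiset.mem_cons_self _ _) b hb
        have := hr n (Multiset.mem_cons_self _ _) b hb
        rcases h₁ with h₁ | h₁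
        · simp only [h₁, if_neg hn, if_neg h₃]; omega
        · simp only [h₁, if_true, if_neg h₃]; omega
      · simp only [hb, hb', if_neg hn, if_true]; omega
    · have h₃ := hold n' (Multiset.mem_cons_of_mem hn') b hb
      have h₄ : n'.dec.ch ≠ e := by
        rintro rfl; exact he (hU _ (by simp [dec_mem_decs hn']))
      have := hr n' (Multiset.mem_cons_of_mem hn') b hb
      simp only [if_neg h₃, if_neg h₄]; omega
  closed := by
    classical
    rw [Multiset.le_iff_count]
    intro a
    have h₁ := Multiset.le_iff_count.1 h.closed a
    have h₂ := congrArg (count a) hr.net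
    simp only [ctxs_add, decs_add, ctxs_singleton, decs_singleton, ← Multiset.singleton_add,
      Multiset.count_add] at h₁ h₂ ⊢
    omega

theorem Good.reduct2 {T : Multiset (TNode L)} {m p q : TNode L} (h : Good (m ::ₘ p ::ₘ T))
    (hr : Reduct2 m p q) (hok : q.Ok) : Good (q ::ₘ T) where
  ok n' hn' := by
    rcases Multiset.mem_cons.1 hn' with rfl | hn'
    · exact hok
    · exact h.ok n' (by simp [hn'])
  nodup := by
    have h₁ := h.nodup
    simp only [decs_cons, Ctx.names_cons, Multiset.nodup_cons, Multiset.mem_cons, not_or] at h₁ ⊢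
    rcases hr.comm with ⟨e, -⟩ | ⟨e, -⟩ <;> rw [e]
    · exact h₁.2
    · exact ⟨h₁.1.2, h₁.2.2⟩
  rank := by
    obtain ⟨r, hrk⟩ := h.rank
    refine ⟨r, fun n' hn' b hb => ?_⟩
    rcases Multiset.mem_cons.1 hn' with rfl | hn'
    · have hm := hrk m (by simp)
      have hp := hrk p (by simp)
      rcases hr.comm with ⟨e, h₁⟩ | ⟨e, h₁⟩ <;> rw [e]
      · rcases hr.ctx b hb with hb | hb
        · exact (hm b hb).trans (hp _ h₁)
        · exact hp b hb
      · rcases hr.ctx b hb with hb | hb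
        · exact hm b hb
        · exact (hp b hb).trans (hm _ h₁)
    · exact hrk n' (by simp [hn']) b hb
  closed := by
    classical
    rw [Multiset.le_iff_count]
    intro a
    have h₁ := Multiset.le_iff_count.1 h.closed a
    have h₂ := congrArg (count a) hr.net
    simp only [ctxs_add, decs_add, ctxs_singleton, decs_singleton, ← Multiset.singleton_add,
      Multiset.count_add] at h₁ h₂ ⊢
    omega

/-- Renaming away a channel that does not occur. -/
theorem Ctx.map_rename_of_notMem {y x : Chan} {Δ : Ctx L} (h : y ∉ Δ.names) :
    Δ.map (Decl.map (Chan.rename y x)) = Δ :=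
  Ctx.map_eq_self fun _ hb => Chan.rename_of_ne _ (by rintro rfl; exact h hb)

/-- Executing a forward: `x` replaces `y` in the part `S`. -/
theorem Good.contract {S R : Multiset (TNode L)} {n : TNode L} {x y : Chan} {A : Ty} {c : L}
    (h : Good (n ::ₘ S + R)) (hn : n.ctx = {⟨x, A, c⟩}) (hn' : n.dec = ⟨y, A, c⟩)
    (hR : y ∉ (ctxs R).names) : Good (S.map (TNode.map (Chan.rename y x)) + R) := by
  have hd : ∀ n' ∈ S + R, n'.dec.map (Chan.rename y x) = n'.dec := by
    intro n' h'
    refine Decl.ext' (Chan.rename_of_ne _ ?_) rfl rfl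
    rintro rfl
    have h₁ := h.nodup
    rw [Multiset.cons_add, decs_cons, Ctx.names_cons, Multiset.nodup_cons] at h₁
    refine h₁.1 ?_
    rw [show n.dec.ch = n'.dec.ch by rw [hn']]
    exact Ctx.mem_names_of (dec_mem_decs h')
  have hS : decs (S.map (TNode.map (Chan.rename y x))) = decs S := by
    rw [decs, Multiset.map_map]
    exact Multiset.map_congr rfl fun n' h' => hd n' (by simp [h'])
  refine ⟨?_, ?_, ?_, ?_⟩
  · intro n' h'
    rcases Multiset.mem_add.1 h' with h' | h'
    · obtain ⟨n₀, h₀, rfl⟩ := Multiset.mem_map.1 h'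
      exact (h.ok n₀ (by simp [h₀])).map _
    · exact h.ok n' (by simp [h'])
  · have h₁ := h.nodup
    rw [Multiset.cons_add, decs_cons, Ctx.names_cons, Multiset.nodup_cons] at h₁
    rw [decs_add, hS, ← decs_add]
    exact h₁.2
  · obtain ⟨r, hr⟩ := h.rank
    have hxy : r x < r y := by
      have := hr n (by simp) ⟨x, A, c⟩ (by simp [hn])
      rwa [hn'] at this
    refine ⟨r, fun n' h' b hb => ?_⟩
    rcases Multiset.mem_add.1 h' with h' | h'
    · obtain ⟨n₀, h₀, rfl⟩ := Multiset.mem_map.1 h'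
      obtain ⟨b₀, hb₀, rfl⟩ := Multiset.mem_map.1 hb
      have := hr n₀ (by simp [h₀]) b₀ hb₀
      rw [TNode.map_dec, hd n₀ (by simp [h₀])]
      refine lt_of_le_of_lt ?_ this
      simp only [Decl.map_ch, Chan.rename]
      split_ifs with e
      · rw [e]; exact hxy.le
      · exact le_rfl
    · exact hr n' (by simp [h']) b hb
  · obtain ⟨Ω, hΩ⟩ := Multiset.le_iff_exists_add.1 h.closed
    have hk : Decl.map (Chan.rename y x) (⟨y, A, c⟩ : Decl L) = ⟨x, A, c⟩ := by simp
    have hk' : Decl.map (Chan.rename y x) (⟨x, A, c⟩ : Decl L) = ⟨x, A, c⟩ := by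
      refine Decl.ext' ?_ rfl rfl
      by_cases e : x = y
      · simp [e]
      · exact Chan.rename_of_ne _ e
    have := congrArg (Multiset.map (Decl.map (Chan.rename y x))) hΩ
    simp only [Multiset.cons_add, ctxs_cons, decs_cons, ctxs_add, decs_add, Multiset.map_add,
      Multiset.map_cons, hn, hn', Multiset.map_singleton, hk, hk', ← decs_map, hS,
      Ctx.map_rename_of_notMem hR, ← ctxs_map] at this
    have hdR : decs (R.map (TNode.map (Chan.rename y x))) = decs R := by
      rw [decs, Multiset.map_map]
      exact Multiset.map_congr rfl fun n' h' => hd n' (by simp [h'])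
    rw [hdR, ← Multiset.singleton_add, add_assoc, add_assoc, add_right_inj] at this
    rw [ctxs_add, decs_add, hS, this, ← add_assoc]
    exact Multiset.le_add_right _ _

theorem Bal.contract {Θ Θ' : Ctx L} {S : Multiset (TNode L)} {n : TNode L} {x y : Chan} {A : Ty}
    {c : L} (h : Bal Θ (n ::ₘ S) Θ') (hn : n.ctx = {⟨x, A, c⟩}) (hn' : n.dec = ⟨y, A, c⟩) :
    Bal (Θ.map (Decl.map (Chan.rename y x))) (S.map (TNode.map (Chan.rename y x)))
      (Θ'.map (Decl.map (Chan.rename y x))) := by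
  have hk : Decl.map (Chan.rename y x) (⟨y, A, c⟩ : Decl L) = ⟨x, A, c⟩ := by simp
  have hk' : Decl.map (Chan.rename y x) (⟨x, A, c⟩ : Decl L) = ⟨x, A, c⟩ := by
    refine Decl.ext' ?_ rfl rfl
    by_cases e : x = y
    · simp [e]
    · exact Chan.rename_of_ne _ e
  have := congrArg (Multiset.map (Decl.map (Chan.rename y x))) h
  simp only [ctxs_cons, decs_cons, Multiset.map_add, Multiset.map_cons, hn, hn',
    Multiset.map_singleton, hk, hk', ← decs_map, ← ctxs_map] at this
  rw [Multiset.add_cons, ← Multiset.singleton_add, add_assoc, add_right_inj] at this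
  exact this

theorem Good.step1 {T : Multiset (TNode L)} {n : TNode L} {os : Config L} (h : Good T)
    (hn : n ∈ T) (hU : U.Finite) (hU' : n.dec.ch ∈ U) (st : Step1 U n.node os) :
    ∃ ns, nodes ns = os ∧ Reduct U n ns ∧ ∀ n' ∈ ns, n'.Ok := by
  obtain ⟨ns₁, ns₂, e, -, hrel, hr, -⟩ := NodeSim.step1 (lo := fun _ => True)
    (.refl (h.ok n hn)) hU (h.wf hn) (h.wf hn) hU' hU' st
  refine ⟨ns₁, e, hr, fun n' hn' => ?_⟩
  obtain ⟨n'', -, h'⟩ := Multiset.exists_mem_of_rel_of_mem hrel hn'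
  exact h'.ok_left

theorem Good.step2 {T : Multiset (TNode L)} {n p : TNode L} {m : Msg L} {o : Node L}
    (h : Good T) (hn : n ∈ T) (hp : p ∈ T) (e : n.node = .msg m) (st : Step2 m p.node o) :
    ∃ q, q.node = o ∧ Reduct2 n p q ∧ q.Ok := by
  obtain ⟨q₁, q₂, m', e₁, -, -, hs, hr, -⟩ := NodeSim.step2 (lo := fun _ => True)
    (.refl (h.ok n hn)) (.refl (h.ok p hp)) (h.wf hn) (h.wf hp) (h.wf hp) (h.compatible hn hp)
    trivial e st
  exact ⟨q₁, e₁, hr, hs.ok_left⟩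

theorem NodeOk.fwd_inv {Γ : Ctx L} {k : Decl L} {y x : Chan} {c d : L}
    (h : NodeOk Γ (.proc y c (.fwd (.fv y) (.fv x)) d) k) :
    Γ = {⟨x, k.ty, c⟩} ∧ k = ⟨y, k.ty, c⟩ := by
  cases h with
  | proc h₁ h₂ h₃ =>
    obtain ⟨x', e, e', rfl⟩ := h₃.fwd_inv
    simp only [Ref.fv.injEq] at e'
    subst e'
    exact ⟨rfl, rfl⟩

theorem nodes_eq_cons {T : Multiset (TNode L)} {o : Node L} {G : Config L}
    (h : nodes T = o ::ₘ G) : ∃ n S, T = n ::ₘ S ∧ n.node = o ∧ nodes S = G := by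
  classical
  obtain ⟨n, hn, e, rfl⟩ := (Multiset.map_eq_cons _ _ _ _).2 h
  exact ⟨n, T.erase n, (Multiset.cons_erase hn).symm, e, rfl⟩

theorem nodes_contract {S : Multiset (TNode L)} (y x : Chan) :
    nodes (S.map (TNode.map (Chan.rename y x))) = (nodes S).rename y x := by
  rw [nodes_map, Config.rename_eq]

/-- A channel that a part offers and uses itself is not used elsewhere. -/
theorem Good.notMem_ctxs {S R : Multiset (TNode L)} {Θ Θ' : Ctx L} (h : Good (S + R))
    (hB : Bal Θ S Θ') {b : Decl L} (hb : b ∈ decs S) (hb' : b ∉ Θ') : b.ch ∉ (ctxs R).names := by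
  classical
  intro hc
  obtain ⟨b', hb'', e⟩ := Ctx.mem_names.1 hc
  obtain rfl : b' = b := h.decl_eq
    (Multiset.mem_of_le h.closed (by rw [ctxs_add]; exact Multiset.mem_add.2 (Or.inr hb'')))
    (by rw [decs_add]; exact Multiset.mem_add.2 (Or.inl hb)) e
  have h₁ := congrArg (count b') hB
  have h₂ := Multiset.le_iff_count.1 h.closed b'
  have h₃ := Multiset.nodup_iff_count_le_one.1 (Multiset.Nodup.of_map _ h.nodup) b'
  simp only [ctxs_add, decs_add, Multiset.count_add, Multiset.count_eq_zero_of_notMem hb']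
    at h₁ h₂ h₃
  have h₄ := Multiset.count_pos.2 hb
  have h₅ := Multiset.count_pos.2 hb''
  omega

theorem Bal.reduct {Θ Θ' : Ctx L} {S ns : Multiset (TNode L)} {n : TNode L}
    (h : Bal Θ (n ::ₘ S) Θ') (hr : Reduct U n ns) : Bal Θ (ns + S) Θ' := by
  classical
  ext a
  have h₁ := congrArg (count a) h
  have h₂ := congrArg (count a) hr.net
  simp only [ctxs_add, decs_add, ctxs_singleton, decs_singleton, ← Multiset.singleton_add,
    Multiset.count_add] at h₁ h₂ ⊢
  omega

theorem Bal.reduct2 {Θ Θ' : Ctx L} {S : Multiset (TNode L)} {m p q : TNode L}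
    (h : Bal Θ (m ::ₘ p ::ₘ S) Θ') (hr : Reduct2 m p q) : Bal Θ (q ::ₘ S) Θ' := by
  classical
  ext a
  have h₁ := congrArg (count a) h
  have h₂ := congrArg (count a) hr.net
  simp only [ctxs_add, decs_add, ctxs_singleton, decs_singleton, ← Multiset.singleton_add,
    Multiset.count_add] at h₁ h₂ ⊢
  omega

theorem Good.contract_part {S R : Multiset (TNode L)} {Θ Θ' : Ctx L} {n : TNode L} {x y : Chan}
    {A : Ty} {c : L} (h : Good (n ::ₘ S + R)) (hB : Bal Θ (n ::ₘ S) Θ')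
    (hΘ : ∀ b ∈ Θ, b ∈ decs R) (h₁ : n.ctx = {⟨x, A, c⟩}) (h₂ : n.dec = ⟨y, A, c⟩)
    (hy : y ∉ Θ'.names) :
    Bal Θ (S.map (TNode.map (Chan.rename y x))) Θ' ∧
      Good (S.map (TNode.map (Chan.rename y x)) + R) := by
  have hy' : n.dec ∉ Θ' := fun h' => hy (by rw [h₂] at h'; exact Ctx.mem_names_of h')
  have hR := h.notMem_ctxs hB (by simp) hy'
  rw [h₂] at hR
  refine ⟨?_, h.contract h₁ h₂ hR⟩
  have := hB.contract h₁ h₂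
  rwa [Ctx.map_rename_of_notMem, Ctx.map_rename_of_notMem hy] at this
  intro hyΘ
  obtain ⟨b, hb, e'⟩ := Ctx.mem_names.1 hyΘ
  rw [Multiset.cons_add] at h
  refine h.notMem_of_mem ?_
  rw [show n.dec.ch = b.ch from (congrArg Decl.ch h₂).trans e'.symm]
  exact Ctx.mem_names_of (by simp [hΘ b hb])

/-- A step of a part of a closed configuration. -/
theorem Good.step_part {S R : Multiset (TNode L)} {Θ Θ' : Ctx L} {G : Config L}
    (h : Good (S + R)) (hB : Bal Θ S Θ') (hΘ : ∀ b ∈ Θ, b ∈ decs R)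
    (hU : U.Finite) (hU' : ∀ b ∈ decs (S + R), b.ch ∈ U)
    (st : Step U {a | a ∈ Θ'.names} (nodes S) G) :
    ∃ S', nodes S' = G ∧ Bal Θ S' Θ' ∧ Good (S' + R) := by
  rcases st.local_cases with ⟨y, x, c, d, G, hy, e, rfl⟩ | ⟨o, os, G, e, rfl, hs⟩ |
    ⟨m, p, q, G, e, rfl, hs⟩
  · obtain ⟨n, S, rfl, hn, rfl⟩ := nodes_eq_cons e
    have hok := h.ok n (by simp)
    rw [TNode.Ok, hn] at hok
    obtain ⟨h₁, h₂⟩ := hok.fwd_inv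
    exact ⟨S.map (TNode.map (Chan.rename y x)), nodes_contract y x,
      h.contract_part hB hΘ h₁ h₂ hy⟩
  · obtain ⟨n, S, rfl, rfl, rfl⟩ := nodes_eq_cons e
    obtain ⟨ns, rfl, hr, hok⟩ := h.step1 (n := n) (by simp) hU (hU' _ (by simp)) hs
    refine ⟨ns + S, by simp, hB.reduct hr, ?_⟩
    rw [Multiset.cons_add] at h hU'
    rw [add_assoc]
    exact h.reduct hr hU' hok
  · obtain ⟨n, S, rfl, hn, e⟩ := nodes_eq_cons e
    obtain ⟨p, S, rfl, rfl, rfl⟩ := nodes_eq_cons e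
    obtain ⟨q, rfl, hr, hok⟩ := h.step2 (n := n) (p := p) (by simp) (by simp) hn hs
    refine ⟨q ::ₘ S, by simp, hB.reduct2 hr, ?_⟩
    rw [Multiset.cons_add, Multiset.cons_add] at h
    rw [Multiset.cons_add]
    exact h.reduct2 hr hok

/-! ### Progress -/

theorem Step1.exists_lab (hU : U.Finite) (y x : Chan) (c d : L) (l : Label) (P : Proc L) :
    ∃ os, Step1 U (.proc y c (.lab (.fv x) l P) d) os := by
  by_cases e : x = y
  · subst e
    obtain ⟨y', h₁, h₂, h₃⟩ := exists_generation hU x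
    exact ⟨_, .labUp rfl h₁ h₂ h₃⟩
  · obtain ⟨y', h₁, h₂, h₃⟩ := exists_generation hU x
    exact ⟨_, .labDown rfl e h₁ h₂ h₃⟩

theorem Step1.exists_send (hU : U.Finite) (y x w : Chan) (c d : L) (P : Proc L) :
    ∃ os, Step1 U (.proc y c (.send (.fv w) (.fv x) P) d) os := by
  by_cases e : x = y
  · subst e
    obtain ⟨y', h₁, h₂, h₃⟩ := exists_generation hU x
    exact ⟨_, .sendUp rfl rfl h₁ h₂ h₃⟩
  · obtain ⟨y', h₁, h₂, h₃⟩ := exists_generation hU x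
    exact ⟨_, .sendDown rfl rfl e h₁ h₂ h₃⟩

/-- How a node offers the channel `k`. -/
inductive Provides (k : Decl L) : Node L → Prop
  | fwd {x : Chan} {d : L} : Provides k (.proc k.ch k.lvl (.fwd (.fv k.ch) (.fv x)) d)
  | branch {I : Finset Label} {A : {k // k ∈ I} → Ty} {Q : {k // k ∈ I} → Proc L} {d : L} :
      k.ty = .wth I A → Provides k (.proc k.ch k.lvl (.branch (.fv k.ch) I Q) d)
  | recv {A B : Ty} {P : Proc L} {d : L} :
      k.ty = .lolli A B → Provides k (.proc k.ch k.lvl (.recv (.fv k.ch) P) d)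
  | close : k.ty = .one → Provides k (.msg (.close k.lvl k.ch))
  | posLab {I : Finset Label} {A : {k // k ∈ I} → Ty} {l : Label} {u : Chan} :
      k.ty = .plus I A → l ∈ I → Provides k (.msg (.posLab k.lvl k.ch l u))
  | posSend {A B : Ty} {x u : Chan} :
      k.ty = .tensor A B → Provides k (.msg (.posSend k.lvl x k.ch u))

/-- How a node uses the channel `k`. -/
inductive Awaits (k : Decl L) : Node L → Prop
  | wait {y : Chan} {c d : L} {Q : Proc L} :
      k.ty = .one → Awaits k (.proc y c (.wait (.fv k.ch) Q) d)
  | branch {I : Finset Label} {A : {k // k ∈ I} → Ty} {Q : {k // k ∈ I} → Proc L} {y : Chan}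
      {c d : L} : k.ty = .plus I A → Awaits k (.proc y c (.branch (.fv k.ch) I Q) d)
  | recv {A B : Ty} {P : Proc L} {y : Chan} {c d : L} :
      k.ty = .tensor A B → Awaits k (.proc y c (.recv (.fv k.ch) P) d)
  | negLab {I : Finset Label} {A : {k // k ∈ I} → Ty} {l : Label} {u : Chan} :
      k.ty = .wth I A → l ∈ I → Awaits k (.msg (.negLab k.ch l u))
  | negSend {A B : Ty} {x u : Chan} :
      k.ty = .lolli A B → Awaits k (.msg (.negSend x k.ch u))

theorem Provides.attempts {k : Decl L} {o : Node L} (h : Provides k o) : o.Attempts k.ch := by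
  cases h <;> rfl

theorem Awaits.attempts {k : Decl L} {o : Node L} (h : Awaits k o) : o.Attempts k.ch := by
  cases h <;> rfl

/-- A node takes a step, or it offers or awaits a message. -/
theorem TNode.Ok.cases {n : TNode L} (h : n.Ok) (hw : n.Wf) :
    (∀ U : Set Chan, U.Finite → ∃ os, Step1 U n.node os) ∨ Provides n.dec n.node ∨
      ∃ b ∈ n.ctx, Awaits b n.node := by
  obtain ⟨Γ, o, k⟩ := n
  obtain ⟨hw, -⟩ := hw
  replace h : NodeOk Γ o k := h
  simp only at hw ⊢
  cases o with
  | msg m =>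
    cases m with
    | close c y =>
      obtain ⟨rfl, rfl⟩ := h.close_inv
      exact Or.inr (Or.inl (.close (k := ⟨y, .one, c⟩) rfl))
    | posLab c y l u =>
      obtain ⟨I, A, hl, rfl, rfl⟩ := h.posLab_inv hw
      exact Or.inr (Or.inl (.posLab (k := ⟨y, .plus I A, c⟩) rfl hl))
    | negLab y l u =>
      obtain ⟨I, A, hl, c, rfl, rfl⟩ := h.negLab_inv hw
      exact Or.inr (Or.inr ⟨_, Multiset.mem_singleton_self _,
        .negLab (k := ⟨y, .wth I A, c⟩) rfl hl⟩)
    | posSend c x y u =>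
      obtain ⟨A, B, rfl, rfl⟩ := h.posSend_inv hw
      exact Or.inr (Or.inl (.posSend (k := ⟨y, .tensor A B, c⟩) rfl))
    | negSend x y u =>
      obtain ⟨A, B, c, rfl, rfl⟩ := h.negSend_inv hw
      exact Or.inr (Or.inr ⟨_, Multiset.mem_cons_of_mem (Multiset.mem_singleton_self _),
        .negSend (k := ⟨y, .lolli A B, c⟩) rfl⟩)
  | proc y c P d =>
    cases h with
    | @proc _ _ A _ _ h₁ h₂ h₃ =>
    cases P with
    | fwd r s =>
      obtain ⟨x, rfl, rfl, rfl⟩ := h₃.fwd_inv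
      exact Or.inr (Or.inl (.fwd (k := ⟨y, _, c⟩)))
    | cut d' d₂ P Q =>
      refine Or.inl fun U hU => ?_
      obtain ⟨x, h₁, h₂⟩ := exists_base hU
      exact ⟨_, .cut h₁ h₂⟩
    | close r =>
      obtain ⟨rfl, -, -⟩ := h₃.close_inv
      exact Or.inl fun U hU => ⟨_, .close rfl⟩
    | wait r Q =>
      obtain ⟨x, c', Δ, rfl, rfl, -⟩ := h₃.wait_inv
      exact Or.inr (Or.inr ⟨_, Multiset.mem_cons_self _ _, .wait (k := ⟨x, .one, c'⟩) rfl⟩)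
    | lab r l P =>
      have : ∃ x, r = .fv x := by
        rcases h₃.lab_inv with ⟨x, I, A, c, hl, rfl, -⟩ | ⟨x, I, B, c, hl, Δ, rfl, -⟩ <;>
          exact ⟨x, rfl⟩
      obtain ⟨x, rfl⟩ := this
      exact Or.inl fun U hU => Step1.exists_lab hU ..
    | branch r I Q =>
      rcases h₃.branch_inv with ⟨x, B, c', Δ, rfl, rfl, -⟩ | ⟨x, B, c', rfl, e, -⟩
      · exact Or.inr (Or.inr ⟨_, Multiset.mem_cons_self _ _,
          .branch (k := ⟨x, .plus I B, c'⟩) rfl⟩)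
      · cases e
        exact Or.inr (Or.inl (.branch (k := ⟨y, .wth I B, c⟩) rfl))
    | send s r P =>
      have : ∃ x z, r = .fv x ∧ s = .fv z := by
        rcases h₃.send_inv with ⟨w, x, A, B, c, Δ, rfl, rfl, -⟩ |
          ⟨w, x, C, B, c, Δ, rfl, rfl, -⟩ <;> exact ⟨x, w, rfl, rfl⟩
      obtain ⟨x, z, rfl, rfl⟩ := this
      exact Or.inl fun U hU => Step1.exists_send hU ..
    | recv r P =>
      rcases h₃.recv_inv with ⟨x, B₁, B₂, c', Δ, S, rfl, rfl, -⟩ | ⟨x, B₁, B₂, c', S, rfl, e, -⟩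
      · exact Or.inr (Or.inr ⟨_, Multiset.mem_cons_self _ _,
          .recv (k := ⟨x, .tensor B₁ B₂, c'⟩) rfl⟩)
      · cases e
        exact Or.inr (Or.inl (.recv (k := ⟨y, .lolli B₁ B₂, c⟩) rfl))

theorem Provides.step {k : Decl L} {o p : Node L} (h : Provides k o) (h' : Awaits k p)
    (out : Set Chan) (hout : k.ch ∉ out) (G : Config L) : ∃ G', Step U out (p ::ₘ o ::ₘ G) G' := by
  obtain ⟨y, T, c⟩ := k
  cases h with
  | fwd => exact ⟨_, by rw [Multiset.cons_swap]; exact .fwd hout⟩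
  | branch e =>
    simp only at e
    subst e
    cases h' with
    | wait e => cases e
    | branch e => cases e
    | recv e => cases e
    | negLab e hl => cases e; exact ⟨_, (Step2.wth hl rfl).step _ _ _⟩
    | negSend e => cases e
  | recv e =>
    simp only at e
    subst e
    cases h' with
    | wait e => cases e
    | branch e => cases e
    | recv e => cases e
    | negLab e hl => cases e
    | negSend e => exact ⟨_, (Step2.lolli rfl).step _ _ _⟩
  | close e =>
    simp only at e
    subst e
    cases h' with
    | wait e => exact ⟨_, by rw [Multiset.cons_swap]; exact (Step2.one rfl).step _ _ _⟩
    | branch e => cases e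
    | recv e => cases e
    | negLab e hl => cases e
    | negSend e => cases e
  | posLab e hl =>
    simp only at e
    subst e
    cases h' with
    | wait e => cases e
    | branch e =>
      cases e
      exact ⟨_, by rw [Multiset.cons_swap]; exact (Step2.plus hl rfl).step _ _ _⟩
    | recv e => cases e
    | negLab e hl => cases e
    | negSend e => cases e
  | posSend e =>
    simp only at e
    subst e
    cases h' with
    | wait e => cases e
    | branch e => cases e
    | recv e => exact ⟨_, by rw [Multiset.cons_swap]; exact (Step2.tensor rfl).step _ _ _⟩
    | negLab e hl => cases e
    | negSend e => cases e

/-- A part of a closed configuration is poised or takes a step. -/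
theorem Bal.progress {S : Multiset (TNode L)} {Θ Θ' : Ctx L} (hB : Bal Θ S Θ')
    (hok : ∀ n ∈ S, n.Ok) (hwf : ∀ n ∈ S, n.Wf) (hr : ∃ r, RankOk r S) (hU : U.Finite)
    (hst : ¬ ∃ G, Step U {a | a ∈ Θ'.names} (nodes S) G) : Poised U Θ (nodes S) Θ' := by
  classical
  obtain ⟨r, hr⟩ := hr
  by_cases h0 : S = 0
  · exact Or.inl (by rw [h0]; rfl)
  refine Or.inr ⟨hst, ?_⟩
  by_contra hatt
  have hcase : ∀ n ∈ S, Provides n.dec n.node ∨ ∃ b ∈ n.ctx, Awaits b n.node := by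
    intro n hn
    rcases (hok n hn).cases (hwf n hn) with h | h
    · obtain ⟨T, rfl⟩ := Multiset.exists_cons_of_mem hn
      obtain ⟨os, h⟩ := h U hU
      exact absurd ⟨_, by rw [nodes_cons]; exact h.step _ _⟩ hst
    · exact h
  by_cases hd : ∃ n ∈ S, ∃ b ∈ n.ctx, Awaits b n.node
  · have hne : S.filter (fun n => ∃ b ∈ n.ctx, Awaits b n.node) ≠ 0 := by
      obtain ⟨n, hn, h⟩ := hd
      exact fun e => Multiset.notMem_zero n (e ▸ Multiset.mem_filter.2 ⟨hn, h⟩)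
    obtain ⟨n, hn, hmin⟩ := Multiset.exists_min_image (fun n : TNode L => r n.dec.ch) hne
    obtain ⟨hn, b, hb, hab⟩ := Multiset.mem_filter.1 hn
    have := hB.mem_of_mem_ctx hn hb
    rcases Multiset.mem_add.1 this with h | h
    · exact hatt ⟨_, node_mem_nodes hn, _, Or.inl (Ctx.mem_names_of h), hab.attempts⟩
    · obtain ⟨n', hn', rfl⟩ := mem_decs.1 h
      have hlt := hr n hn _ hb
      rcases hcase n' hn' with h' | h'
      · have hnn : n ≠ n' := by rintro rfl; exact lt_irrefl _ hlt
        obtain ⟨T, rfl⟩ := Multiset.exists_cons_of_mem hn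
        rcases Multiset.mem_cons.1 hn' with e | hn'
        · exact hnn e.symm
        obtain ⟨T, rfl⟩ := Multiset.exists_cons_of_mem hn'
        by_cases hout : n'.dec.ch ∈ Θ'.names
        · exact hatt ⟨n.node, node_mem_nodes (by simp), _, Or.inr hout, hab.attempts⟩
        · exact hst (by rw [nodes_cons, nodes_cons]; exact h'.step hab _ hout _)
      · have := hmin n' (Multiset.mem_filter.2 ⟨hn', h'⟩)
        omega
  · obtain ⟨n, hn, hmax⟩ := Multiset.exists_max_image (fun n : TNode L => r n.dec.ch) h0
    have : n.dec ∈ ctxs S + Θ' := by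
      rw [hB]; exact Multiset.mem_add.2 (Or.inr (dec_mem_decs hn))
    rcases Multiset.mem_add.1 this with h | h
    · obtain ⟨n', hn', hb⟩ := mem_ctxs.1 h
      have := hmax n' hn'
      have := hr n' hn' _ hb
      omega
    · rcases hcase n hn with h' | h'
      · exact hatt ⟨_, node_mem_nodes hn, _, Or.inr (Ctx.mem_names_of h), h'.attempts⟩
      · exact hd ⟨n, hn, h'⟩

end

section
variable {L : Type u} [Lattice L] {U : Set Chan} {ξ : L}

/-! ### Communication along a channel -/

theorem Node.Attempts.unique {o : Node L} {a b : Chan} (h : o.Attempts a) (h' : o.Attempts b) :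
    a = b := by
  cases o with
  | proc => exact Ref.fv.inj (Option.some.inj (h.symm.trans h'))
  | msg => exact Ref.fv.inj (Option.some.inj (h.symm.trans h'))

theorem Step1.not_provides {o : Node L} {os : Config L} (h : Step1 U o os) (k : Decl L) :
    ¬ Provides k o := by
  intro h'
  cases h' <;> cases h

theorem Step1.not_awaits {o : Node L} {os : Config L} (h : Step1 U o os) (k : Decl L) :
    ¬ Awaits k o := by
  intro h'
  cases h' <;> cases h

theorem Step2.not_step1 {m : Msg L} {p q : Node L} (h : Step2 m p q) {os : Config L} :
    ¬ Step1 U p os := by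
  intro h'
  cases h <;> cases h'

theorem Step2.attempts {m : Msg L} {p q : Node L} (h : Step2 m p q) :
    ∃ a, (Node.msg m).Attempts a ∧ p.Attempts a := by
  cases h <;> subst_vars <;> exact ⟨_, rfl, rfl⟩

theorem Good.ctx_disjoint {T S R : Multiset (TNode L)} (h : Good T) (e : S + R ≤ T) {b b' : Decl L}
    (hb : b ∈ ctxs S) (hb' : b' ∈ ctxs R) : b.ch ≠ b'.ch := by
  obtain ⟨V, rfl⟩ := Multiset.le_iff_exists_add.1 e
  have := h.ctxs_nodup
  rw [ctxs_add, ctxs_add, Ctx.names_add, Ctx.names_add] at this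
  have := (Multiset.nodup_add.1 (Multiset.nodup_add.1 this).1).2.2
  intro e
  exact Multiset.disjoint_left.1 this (Ctx.mem_names_of hb) (e ▸ Ctx.mem_names_of hb')

theorem Good.dec_disjoint {T S R : Multiset (TNode L)} (h : Good T) (e : S + R ≤ T) {b b' : Decl L}
    (hb : b ∈ decs S) (hb' : b' ∈ decs R) : b.ch ≠ b'.ch := by
  obtain ⟨V, rfl⟩ := Multiset.le_iff_exists_add.1 e
  have := h.nodup
  rw [decs_add, decs_add, Ctx.names_add, Ctx.names_add] at this
  have := (Multiset.nodup_add.1 (Multiset.nodup_add.1 this).1).2.2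
  intro e
  exact Multiset.disjoint_left.1 this (Ctx.mem_names_of hb) (e ▸ Ctx.mem_names_of hb')

theorem TNode.Ok.msg_cases {n : TNode L} (h : n.Ok) (hw : n.Wf) {m : Msg L}
    (e : n.node = .msg m) : Provides n.dec n.node ∨ ∃ b ∈ n.ctx, Awaits b n.node := by
  rcases h.cases hw with h | h
  · obtain ⟨os, h⟩ := h ∅ Set.finite_empty
    rw [e] at h
    cases h
  · exact h

/-- A message and its recipient communicate along a channel that one of them offers to the
other. -/
theorem Good.comm {T : Multiset (TNode L)} {n p : TNode L} {m : Msg L} {o : Node L}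
    (h : Good (n ::ₘ p ::ₘ T)) (e : n.node = .msg m) (st : Step2 m p.node o) :
    (Provides n.dec n.node ∧ n.dec ∈ p.ctx ∧ Awaits n.dec p.node) ∨
      (Awaits p.dec n.node ∧ p.dec ∈ n.ctx ∧ Provides p.dec p.node) := by
  obtain ⟨a, h₁, h₂⟩ := st.attempts
  have hn : n ∈ n ::ₘ p ::ₘ T := by simp
  have hp : p ∈ n ::ₘ p ::ₘ T := by simp
  rw [← e] at h₁
  have hpc : Provides p.dec p.node ∨ ∃ b ∈ p.ctx, Awaits b p.node := by
    rcases (h.ok p hp).cases (h.wf hp) with h' | h'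
    · obtain ⟨os, h'⟩ := h' ∅ Set.finite_empty
      exact absurd h' st.not_step1
    · exact h'
  rcases (h.ok n hn).msg_cases (h.wf hn) e with h' | ⟨b, hb, h'⟩
  · rcases hpc with h'' | ⟨b, hb, h''⟩
    · have := h.node_eq hn hp ((h'.attempts.unique h₁).trans (h₂.unique h''.attempts))
      subst this
      obtain ⟨_, _, _, _, h⟩ := st.exists_proc
      rw [e] at h
      cases h
    · have : b = n.dec := h.decl_eq (h.ctx_mem hp hb) (dec_mem_decs hn)
        ((h''.attempts.unique h₂).trans (h₁.unique h'.attempts))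
      subst this
      exact Or.inl ⟨h', hb, h''⟩
  · rcases hpc with h'' | ⟨b', hb', h''⟩
    · have : b = p.dec := h.decl_eq (h.ctx_mem hn hb) (dec_mem_decs hp)
        ((h'.attempts.unique h₁).trans (h₂.unique h''.attempts))
      subst this
      exact Or.inr ⟨h', hb, h''⟩
    · refine absurd ((h'.attempts.unique h₁).trans (h₂.unique h''.attempts))
        (h.ctx_disjoint (S := {n}) (R := {p}) ?_ (by simpa using hb) (by simpa using hb'))
      rw [← Multiset.singleton_add n, ← Multiset.singleton_add p, ← add_assoc]
      exact Multiset.le_add_right _ _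

theorem NodeOk.msg_lvl {Γ : Ctx L} {m : Msg L} {k : Decl L} (h : NodeOk Γ (.msg m) k)
    (hk : k.ch ∉ Γ.names) : ∀ b ∈ Γ, b.lvl = k.lvl := by
  cases m with
  | close c y => obtain ⟨rfl, -⟩ := h.close_inv; simp
  | posLab c y l u => obtain ⟨I, A, hl, rfl, rfl⟩ := h.posLab_inv hk; simp
  | negLab y l u => obtain ⟨I, A, hl, c, rfl, rfl⟩ := h.negLab_inv hk; simp
  | posSend c x y u => obtain ⟨A, B, rfl, rfl⟩ := h.posSend_inv hk; simp
  | negSend x y u => obtain ⟨A, B, c, rfl, rfl⟩ := h.negSend_inv hk; simp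

theorem TNode.Ok.msg_lvl {n : TNode L} (h : n.Ok) (hw : n.Wf) {m : Msg L} (e : n.node = .msg m) :
    ∀ b ∈ n.ctx, b.lvl = n.dec.lvl := by
  obtain ⟨Γ, o, k⟩ := n
  simp only at e
  subst e
  exact NodeOk.msg_lvl h hw.1

theorem Provides.map {k : Decl L} {o : Node L} (h : Provides k o) (f : Chan → Chan) :
    Provides (k.map f) (o.map f) := by
  cases h with
  | fwd => exact .fwd
  | branch e => exact .branch e
  | recv e => exact .recv e
  | close e => exact .close e
  | posLab e h => exact .posLab e h
  | posSend e => exact .posSend e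

theorem Awaits.map {k : Decl L} {o : Node L} (h : Awaits k o) (f : Chan → Chan) :
    Awaits (k.map f) (o.map f) := by
  cases h with
  | wait e => exact .wait e
  | branch e => exact .branch e
  | recv e => exact .recv e
  | negLab e h => exact .negLab e h
  | negSend e => exact .negSend e

theorem Step1.not_provides_map {o : Node L} {os : Config L} (h : Step1 U o os) (f : Chan → Chan)
    (k : Decl L) : ¬ Provides k (o.map f) := by
  intro h'
  generalize e : o.map f = o' at h'
  cases h' <;> cases h <;> simp [Node.map, Proc.map] at e

theorem Step1.not_awaits_map {o : Node L} {os : Config L} (h : Step1 U o os) (f : Chan → Chan)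
    (k : Decl L) : ¬ Awaits k (o.map f) := by
  intro h'
  generalize e : o.map f = o' at h'
  cases h' <;> cases h <;> simp [Node.map, Proc.map] at e

/-! ### Nodes whose next action is not observable -/

/-- The node is a process that runs at an unobservable level, communicates along an unobservable
channel, or is a positive message. -/
inductive Hi (ξ : L) (n : TNode L) : Prop
  | run {y : Chan} {c d : L} {P : Proc L} : n.node = .proc y c P d → ¬ d ≤ ξ → Hi ξ n
  | provides : ¬ n.dec.lvl ≤ ξ → Provides n.dec n.node → Hi ξ n
  | awaits {b : Decl L} : b ∈ n.ctx → ¬ b.lvl ≤ ξ → Awaits b n.node → Hi ξ n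
  | msg {m : Msg L} : n.node = .msg m → Provides n.dec n.node → Hi ξ n

namespace Hi
variable {n n₁ n₂ : TNode L}

theorem map (h : Hi ξ n) (f : Chan → Chan) : Hi ξ (n.map f) := by
  cases h with
  | run e h => exact .run (by rw [TNode.map_node, e]; rfl) h
  | provides h h' => exact .provides h (h'.map f)
  | awaits hb h h' => exact .awaits (Multiset.mem_map_of_mem _ hb) h (h'.map f)
  | msg e h => exact .msg (by rw [TNode.map_node, e]; rfl) (h.map f)

theorem dec_high (h : Hi ξ n) (hok : n.Ok) {y : Chan} {c d : L} {P : Proc L}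
    (e : n.node = .proc y c P d) : ¬ n.dec.lvl ≤ ξ := by
  cases h with
  | run e' h => exact fun h' => h ((hok.run_le e').trans h')
  | provides h => exact h
  | awaits hb h => exact fun h' => h ((hok.lvl_le hb).trans h')
  | msg e' => rw [e] at e'; cases e'

theorem of_above (hok : n.Ok) (hw : n.Wf) {d : L} (h : n.Above d) (hd : ¬ d ≤ ξ) : Hi ξ n := by
  cases e : n.node with
  | proc y c P d' => exact .run e fun h' => hd ((h.2 _ _ _ _ e).trans h')
  | msg m =>
    rcases hok.msg_cases hw e with h' | ⟨b, hb, h'⟩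
    · exact .msg e h'
    · refine .awaits hb ?_ h'
      rw [hok.msg_lvl hw e b hb]
      exact fun h' => hd (h.1.trans h')

theorem run_of_step1 (h : Hi ξ n) {os : Config L} (st : Step1 U n.node os) :
    ∃ y c P d, n.node = .proc y c P d ∧ ¬ d ≤ ξ := by
  cases h with
  | run e h => exact ⟨_, _, _, _, e, h⟩
  | provides _ h => exact absurd h (st.not_provides _)
  | awaits _ _ h => exact absurd h (st.not_awaits _)
  | msg _ h => exact absurd h (st.not_provides _)

theorem run_of_awaits (h : Hi ξ n) (hw : n.Wf) {b : Decl L} (hb : b ∈ n.ctx) (hl : b.lvl ≤ ξ)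
    (ha : Awaits b n.node) : ∃ y c P d, n.node = .proc y c P d ∧ ¬ d ≤ ξ := by
  cases h with
  | run e h => exact ⟨_, _, _, _, e, h⟩
  | provides _ h =>
    exact absurd (Ctx.mem_names_of hb) (h.attempts.unique ha.attempts ▸ hw.1)
  | awaits hb' h h' =>
    exact absurd (Ctx.eq_of_nodup hw.2 hb hb' (ha.attempts.unique h'.attempts) ▸ hl) h
  | msg _ h => exact absurd (Ctx.mem_names_of hb) (h.attempts.unique ha.attempts ▸ hw.1)

theorem of_sim {lo : L → Prop} (h : Hi ξ n₁) (hs : NodeSim lo n₁ n₂) (hw : n₁.Wf) :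
    Hi ξ n₂ := by
  obtain ⟨n₀, f₁, f₂, hok, rfl, rfl, -⟩ := hs
  have hw₀ : n₀.Wf := by
    obtain ⟨h₁, h₂⟩ := hw
    simp only [TNode.map_ctx, names_map] at h₁ h₂
    exact ⟨fun h => h₁ (Multiset.mem_map_of_mem f₁ h), Multiset.Nodup.of_map _ h₂⟩
  cases hn : n₀.node with
  | proc y c P d =>
    by_cases hd : d ≤ ξ
    swap
    · exact .run (by rw [TNode.map_node, hn]; rfl) hd
    rcases hok.cases hw₀ with h' | h' | ⟨b, hb, h'⟩
    · obtain ⟨os, st⟩ := h' ∅ Set.finite_empty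
      cases h with
      | run e h =>
        rw [TNode.map_node, hn] at e
        cases e
        exact absurd hd h
      | provides _ h => exact absurd h (st.not_provides_map _ _)
      | awaits _ _ h => exact absurd h (st.not_awaits_map _ _)
      | msg _ h => exact absurd h (st.not_provides_map _ _)
    · exact .provides (h.dec_high (hok.map f₁) (by rw [TNode.map_node, hn]; rfl)) (h'.map f₂)
    · refine .awaits (Multiset.mem_map_of_mem _ hb) (fun hl => ?_) (h'.map f₂)
      obtain ⟨_, _, _, d', e, hd'⟩ := h.run_of_awaits hw
        (Multiset.mem_map_of_mem (Decl.map f₁) hb) hl (h'.map f₁)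
      rw [TNode.map_node, hn] at e
      cases e
      exact hd' hd
  | msg m =>
    rcases hok.msg_cases hw₀ hn with h' | ⟨b, hb, h'⟩
    · exact .msg (by rw [TNode.map_node, hn]; rfl) (h'.map f₂)
    · refine .awaits (Multiset.mem_map_of_mem _ hb) (fun hl => ?_) (h'.map f₂)
      obtain ⟨_, _, _, d', e, hd'⟩ := h.run_of_awaits hw
        (Multiset.mem_map_of_mem (Decl.map f₁) hb) hl (h'.map f₁)
      rw [TNode.map_node, hn] at e
      cases e

end Hi

/-! ### Projections -/

open Classical in
theorem Ctx.mem_proj {b : Decl L} {Δ : Ctx L} : b ∈ Ctx.proj ξ Δ ↔ b ∈ Δ ∧ b.lvl ≤ ξ :=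
  Multiset.mem_filter

open Classical in
theorem Ctx.proj_add (Γ Δ : Ctx L) : Ctx.proj ξ (Γ + Δ) = Ctx.proj ξ Γ + Ctx.proj ξ Δ :=
  Multiset.filter_add ..

open Classical in
theorem Ctx.proj_eq_zero {Δ : Ctx L} (h : ∀ b ∈ Δ, ¬ b.lvl ≤ ξ) : Ctx.proj ξ Δ = 0 :=
  Multiset.filter_eq_nil.2 h

open Classical in
theorem Ctx.proj_eq_self {Δ : Ctx L} (h : ∀ b ∈ Δ, b.lvl ≤ ξ) : Ctx.proj ξ Δ = Δ :=
  Multiset.filter_eq_self.2 h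

open Classical in
theorem Ctx.proj_map (f : Chan → Chan) (Δ : Ctx L) :
    Ctx.proj ξ (Δ.map (Decl.map f)) = (Ctx.proj ξ Δ).map (Decl.map f) :=
  Multiset.filter_map ..

/-! ### Closed configurations with an interface -/

/-- Typed nodes for a closed configuration `C | D | F`. -/
structure Core (Δ : Ctx L) (K : Goal L) (C D F : Multiset (TNode L)) (offD offF : Ctx L) : Prop where
  good : Good (C + D + F)
  balC : Bal 0 C Δ
  balD : Bal Δ D offD
  balF : Bal K.ctx F offF
  offersD : K.Offers offD
  offersF : Goal.Offers none offF
  none : K = none → F = 0 ∧ offF = 0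

namespace Core
variable {Δ : Ctx L} {K : Goal L} {C D F : Multiset (TNode L)} {offD offF : Ctx L}
  {n m p q : TNode L} {ns : Multiset (TNode L)}

theorem mem_decs_of_mem (h : Core Δ K C D F offD offF) {b : Decl L} (hb : b ∈ Δ) : b ∈ decs C := by
  have := h.balC
  rw [Bal, zero_add] at this
  rw [← this]
  exact Multiset.mem_add.2 (Or.inr hb)

theorem good_perm {S R : Multiset (TNode L)} (h : Core Δ K C D F offD offF) (e : C + D + F = S + R) :
    Good (S + R) := e ▸ h.good

theorem reduct (h : Core Δ K C (n ::ₘ D) F offD offF) (hr : Reduct U n ns)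
    (hU : ∀ b ∈ decs (C + n ::ₘ D + F), b.ch ∈ U) (hok : ∀ n' ∈ ns, n'.Ok) :
    Core Δ K C (ns + D) F offD offF := by
  refine { h with good := ?_, balD := h.balD.reduct hr }
  have hG := h.good
  rw [Multiset.add_cons, Multiset.cons_add] at hG hU
  rw [show C + (ns + D) + F = ns + (C + D + F) by abel]
  exact hG.reduct hr hU hok

theorem reduct2 (h : Core Δ K C (m ::ₘ p ::ₘ D) F offD offF) (hr : Reduct2 m p q) (hok : q.Ok) :
    Core Δ K C (q ::ₘ D) F offD offF := by
  refine { h with good := ?_, balD := h.balD.reduct2 hr }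
  have hG := h.good
  rw [Multiset.add_cons, Multiset.add_cons, Multiset.cons_add, Multiset.cons_add] at hG
  rw [Multiset.add_cons, Multiset.cons_add]
  exact hG.reduct2 hr hok

theorem contract (h : Core Δ K C (n ::ₘ D) F offD offF) {x y : Chan} {A : Ty} {c : L}
    (h₁ : n.ctx = {⟨x, A, c⟩}) (h₂ : n.dec = ⟨y, A, c⟩) (hy : y ∉ offD.names) :
    Core Δ K C (D.map (TNode.map (Chan.rename y x))) F offD offF := by
  have := (h.good_perm (S := n ::ₘ D) (R := C + F) (by abel)).contract_part h.balD
    (fun b hb => by simp [h.mem_decs_of_mem hb]) h₁ h₂ hy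
  refine { h with good := ?_, balD := this.1 }
  rw [show C + D.map (TNode.map (Chan.rename y x)) + F =
    D.map (TNode.map (Chan.rename y x)) + (C + F) by abel]
  exact this.2

theorem dec_used (h : Core Δ K C D F offD offF) {b : Decl L} (hb : b ∈ decs (C + D + F)) :
    b.ch ∈ Config.used (nodes C + nodes D + nodes F) := by
  obtain ⟨n, hn, rfl⟩ := mem_decs.1 hb
  refine ⟨n.node, ?_, ?_⟩
  · rw [← nodes_add, ← nodes_add]; exact node_mem_nodes hn
  · rw [← (h.good.ok n hn).provided]; exact Node.uses_provided _

end Core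

/-- Zones of a program: nodes that are shared with another program, nodes whose next action is not
observable, and nodes whose observable channels are private. -/
structure Zones (ξ : L) (K : Goal L) (S H M : Multiset (TNode L)) : Prop where
  hi : ∀ n ∈ H, Hi ξ n ∧ (n.dec.lvl ≤ ξ → n.dec ∉ ctxs S ∧ n.dec ∉ K.ctx)
  priv : Ctx.proj ξ (ctxs M) = Ctx.proj ξ (decs M)

namespace Zones
variable {K : Goal L} {S H M : Multiset (TNode L)} {n m p q : TNode L} {ns : Multiset (TNode L)}

theorem mem_decs_of_mem (h : Zones ξ K S H M) {b : Decl L} (hb : b ∈ ctxs M) (hl : b.lvl ≤ ξ) :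
    b ∈ decs M := by
  have : b ∈ Ctx.proj ξ (ctxs M) := Ctx.mem_proj.2 ⟨hb, hl⟩
  rw [h.priv] at this
  exact (Ctx.mem_proj.1 this).1

theorem mem_ctxs_of_mem (h : Zones ξ K S H M) {b : Decl L} (hb : b ∈ decs M) (hl : b.lvl ≤ ξ) :
    b ∈ ctxs M := by
  have : b ∈ Ctx.proj ξ (decs M) := Ctx.mem_proj.2 ⟨hb, hl⟩
  rw [← h.priv] at this
  exact (Ctx.mem_proj.1 this).1

theorem reduct_private (h : Zones ξ K S H (n ::ₘ M)) (hr : Reduct U n ns) :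
    Zones ξ K S H (ns + M) where
  hi := h.hi
  priv := by
    classical
    ext a
    have h₁ := congrArg (count a) (congrArg (Ctx.proj ξ) hr.net)
    have h₂ := congrArg (count a) h.priv
    simp only [ctxs_add, decs_add, ctxs_singleton, decs_singleton, ← Multiset.singleton_add,
      Ctx.proj_add, Multiset.count_add] at h₁ h₂ ⊢
    omega

theorem reduct2_private (h : Zones ξ K S H (m ::ₘ p ::ₘ M)) (hr : Reduct2 m p q) :
    Zones ξ K S H (q ::ₘ M) where
  hi := h.hi
  priv := by
    classical
    ext a
    have h₁ := congrArg (count a) (congrArg (Ctx.proj ξ) hr.net)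
    have h₂ := congrArg (count a) h.priv
    simp only [ctxs_add, decs_add, ctxs_singleton, decs_singleton, ← Multiset.singleton_add,
      Ctx.proj_add, Multiset.count_add] at h₁ h₂ ⊢
    omega

theorem reduct2_mixed (h : Zones ξ K S (m ::ₘ H) (p ::ₘ M)) (hr : Reduct2 m p q)
    (hl : ¬ m.dec.lvl ≤ ξ) : Zones ξ K S H (q ::ₘ M) where
  hi n hn := h.hi n (Multiset.mem_cons_of_mem hn)
  priv := by
    classical
    ext a
    have h₁ := congrArg (count a) (congrArg (Ctx.proj ξ) hr.net)
    have h₂ := congrArg (count a) h.priv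
    have h₃ : Ctx.proj ξ m.ctx = 0 := Ctx.proj_eq_zero fun b hb => by rwa [hr.lvl b hb]
    have h₄ : Ctx.proj ξ {m.dec} = 0 := Ctx.proj_eq_zero (by simpa using hl)
    simp only [ctxs_add, decs_add, ctxs_singleton, decs_singleton, ← Multiset.singleton_add,
      Ctx.proj_add, Multiset.count_add, h₃, h₄, Multiset.count_zero] at h₁ h₂ ⊢
    omega

theorem replace_hi {H' : Multiset (TNode L)} (h : Zones ξ K S (H' + H) M)
    (hns : ∀ n ∈ ns, Hi ξ n ∧ ¬ n.dec.lvl ≤ ξ) : Zones ξ K S (ns + H) M where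
  hi n hn := by
    rcases Multiset.mem_add.1 hn with hn | hn
    · exact ⟨(hns n hn).1, fun hl => absurd hl (hns n hn).2⟩
    · exact h.hi n (Multiset.mem_add.2 (Or.inr hn))
  priv := h.priv

/-- Replacing shared nodes. -/
theorem replace_shared {S' : Multiset (TNode L)} (h : Zones ξ K S H M)
    (hS : ∀ b ∈ ctxs S', b.lvl ≤ ξ → b ∈ ctxs S ∨ b ∉ decs H) : Zones ξ K S' H M where
  hi n hn := by
    refine ⟨(h.hi n hn).1, fun hl => ⟨fun hb => ?_, ((h.hi n hn).2 hl).2⟩⟩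
    rcases hS _ hb hl with h' | h'
    · exact ((h.hi n hn).2 hl).1 h'
    · exact h' (dec_mem_decs hn)
  priv := h.priv

/-- A shared node becomes one whose next action is not observable. -/
theorem share_to_hi (h : Zones ξ K (n ::ₘ S) H M) (hn : Hi ξ n)
    (hl : n.dec.lvl ≤ ξ → n.dec ∉ ctxs S ∧ n.dec ∉ K.ctx) : Zones ξ K S (n ::ₘ H) M where
  hi n' hn' := by
    rcases Multiset.mem_cons.1 hn' with rfl | hn'
    · exact ⟨hn, hl⟩
    · refine ⟨(h.hi n' hn').1, fun hl => ⟨fun hb => ?_, ((h.hi n' hn').2 hl).2⟩⟩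
      exact ((h.hi n' hn').2 hl).1 (by simp [hb])
  priv := h.priv

theorem private_to_hi (h : Zones ξ K S H (n ::ₘ M)) (hn : Hi ξ n) (hl : ¬ n.dec.lvl ≤ ξ)
    (hc : ∀ b ∈ n.ctx, ¬ b.lvl ≤ ξ) : Zones ξ K S (n ::ₘ H) M where
  hi n' hn' := by
    rcases Multiset.mem_cons.1 hn' with rfl | hn'
    · exact ⟨hn, fun h => absurd h hl⟩
    · exact h.hi n' hn'
  priv := by
    have := h.priv
    rw [ctxs_cons, decs_cons, ← Multiset.singleton_add, Ctx.proj_add, Ctx.proj_add,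
      Ctx.proj_eq_zero hc,
      Ctx.proj_eq_zero (Δ := {n.dec}) (by simpa using hl), zero_add, zero_add] at this
    exact this

end Zones

/-- A closed configuration whose program is divided into zones. -/
structure Side (L : Type u) where
  C : Multiset (TNode L)
  S : Multiset (TNode L)
  H : Multiset (TNode L)
  M : Multiset (TNode L)
  F : Multiset (TNode L)
  offD : Ctx L
  offF : Ctx L

def Side.split (s : Side L) : Split L :=
  ⟨nodes s.C, nodes (s.S + s.H + s.M), nodes s.F, s.offD, s.offF⟩

structure Side.Inv (ξ : L) (Δ : Ctx L) (K : Goal L) (s : Side L) : Prop where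
  core : Core Δ K s.C (s.S + s.H + s.M) s.F s.offD s.offF
  zones : Zones ξ K s.S s.H s.M
  high : K = none → ∀ b ∈ s.offD, ¬ b.lvl ≤ ξ

/-- Two closed configurations that share their observable nodes. -/
structure Pair (ξ : L) (Δ : Ctx L) (K : Goal L) (s t : Side L) : Prop where
  lowΔ : ∀ b ∈ Δ, b.lvl ≤ ξ
  lowK : ∀ b ∈ K.ctx, b.lvl ≤ ξ
  left : s.Inv ξ Δ K
  right : t.Inv ξ Δ K
  rel : Multiset.Rel (NodeSim (· ≤ ξ)) s.S t.S

theorem rel_symm {S T : Multiset (TNode L)} {lo : L → Prop} (h : Multiset.Rel (NodeSim lo) S T) :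
    Multiset.Rel (NodeSim lo) T S := by
  rw [← Multiset.rel_flip]
  exact h.mono fun _ _ _ _ h => h.symm

theorem Pair.symm {Δ : Ctx L} {K : Goal L} {s t : Side L} (h : Pair ξ Δ K s t) : Pair ξ Δ K t s :=
  ⟨h.lowΔ, h.lowK, h.right, h.left, rel_symm h.rel⟩

theorem mem_ctxs_of_rel {S T : Multiset (TNode L)} (h : Multiset.Rel (NodeSim (· ≤ ξ)) S T)
    {b : Decl L} (hb : b ∈ ctxs S) (hl : b.lvl ≤ ξ) : b ∈ ctxs T := by
  obtain ⟨n, hn, hb⟩ := mem_ctxs.1 hb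
  obtain ⟨n', hn', hs⟩ := Multiset.exists_mem_of_rel_of_mem h hn
  exact ctx_mem_ctxs hn' (hs.mem_ctx hb hl)

/-- The first program takes a step, which the second one matches. -/
def Advances (ξ : L) (Δ : Ctx L) (K : Goal L) (s t : Side L) : Prop :=
  ∃ s' t' : Side L, Pair ξ Δ K s' t' ∧ ProgStep s.split s'.split ∧
    Relation.ReflTransGen ProgStep t.split t'.split

theorem progStep_of {s s' : Side L} (hU : s.split.all.used ⊆ U) {G : Config L}
    (st : Step U {a | a ∈ s.offD.names} s.split.D G)
    (e : s'.split = { s.split with D := G }) : ProgStep s.split s'.split :=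
  ⟨G, st.mono hU, e⟩

section
variable {Δ : Ctx L} {K : Goal L} {C S H M F : Multiset (TNode L)} {offD offF : Ctx L}
  {n p : TNode L} {t : Side L}

theorem Pair.step_private (h : Pair ξ Δ K ⟨C, S, H, n ::ₘ M, F, offD, offF⟩ t) (hU : U.Finite)
    (hs : (Side.mk C S H (n ::ₘ M) F offD offF).split.all.used ⊆ U) {os : Config L}
    (st : Step1 U n.node os) : Advances ξ Δ K ⟨C, S, H, n ::ₘ M, F, offD, offF⟩ t := by
  have hc := h.left.core
  simp only [Multiset.add_cons] at hc
  have hU' : ∀ b ∈ decs (C + n ::ₘ (S + H + M) + F), b.ch ∈ U := fun b hb =>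
    hs (by simpa [Side.split, Split.all] using hc.dec_used hb)
  obtain ⟨ns, rfl, hr, hok⟩ := hc.good.step1 (n := n) (by simp) hU (hU' _ (by simp)) st
  refine ⟨⟨C, S, H, ns + M, F, offD, offF⟩, t, ⟨h.lowΔ, h.lowK, ⟨?_, h.left.zones.reduct_private hr,
    h.left.high⟩, h.right, h.rel⟩, progStep_of hs (G := nodes ns + nodes (S + H + M)) ?_ ?_, .refl⟩
  · rw [show S + H + (ns + M) = ns + (S + H + M) by abel]
    exact hc.reduct hr hU' hok
  · have := st.step {a | a ∈ offD.names} (nodes (S + H + M))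
    simpa [Side.split] using this
  · simp only [Side.split, Split.mk.injEq, nodes_add, true_and, and_true]; abel


theorem Pair.step_hi (h : Pair ξ Δ K ⟨C, S, n ::ₘ H, M, F, offD, offF⟩ t) (hU : U.Finite)
    (hs : (Side.mk C S (n ::ₘ H) M F offD offF).split.all.used ⊆ U) {os : Config L}
    (st : Step1 U n.node os) : Advances ξ Δ K ⟨C, S, n ::ₘ H, M, F, offD, offF⟩ t := by
  have hc := h.left.core
  simp only [Multiset.add_cons, Multiset.cons_add] at hc
  have hU' : ∀ b ∈ decs (C + n ::ₘ (S + H + M) + F), b.ch ∈ U := fun b hb =>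
    hs (by simpa [Side.split, Split.all] using hc.dec_used hb)
  obtain ⟨ns, rfl, hr, hok⟩ := hc.good.step1 (n := n) (by simp) hU (hU' _ (by simp)) st
  have hc' := hc.reduct hr hU' hok
  obtain ⟨y, c, P, d, e, hd⟩ := (h.left.zones.hi n (by simp)).1.run_of_step1 st
  refine ⟨⟨C, S, ns + H, M, F, offD, offF⟩, t, ⟨h.lowΔ, h.lowK, ⟨?_, ?_,
    h.left.high⟩, h.right, h.rel⟩, progStep_of hs (G := nodes ns + nodes (S + H + M)) ?_ ?_, .refl⟩
  · rw [show S + (ns + H) + M = ns + (S + H + M) by abel]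
    exact hc'
  · refine Zones.replace_hi (H' := {n}) (by simpa using h.left.zones) fun n' hn' => ?_
    have ha := hr.above _ _ _ _ e n' hn'
    exact ⟨.of_above (hok n' hn') (hc'.good.wf (by simp [hn'])) ha hd,
      fun h' => hd (ha.1.trans h')⟩
  · have := st.step {a | a ∈ offD.names} (nodes (S + H + M))
    simpa [Side.split] using this
  · simp only [Side.split, Split.mk.injEq, nodes_add, true_and, and_true]; abel

theorem Pair.step_shared (h : Pair ξ Δ K ⟨C, n ::ₘ S, H, M, F, offD, offF⟩ t) (hU : U.Finite)
    (hs : (Side.mk C (n ::ₘ S) H M F offD offF).split.all.used ⊆ U)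
    (ht : t.split.all.used ⊆ U) {os : Config L}
    (st : Step1 U n.node os) : Advances ξ Δ K ⟨C, n ::ₘ S, H, M, F, offD, offF⟩ t := by
  have hc := h.left.core
  simp only [Multiset.add_cons, Multiset.cons_add] at hc
  have hU' : ∀ b ∈ decs (C + n ::ₘ (S + H + M) + F), b.ch ∈ U := fun b hb =>
    hs (by simpa [Side.split, Split.all] using hc.dec_used hb)
  obtain ⟨n₂, S₂, hsim, hrel, e⟩ := Multiset.rel_cons_left.1 h.rel
  obtain ⟨C₂, S', H₂, M₂, F₂, offD₂, offF₂⟩ := t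
  simp only at e
  subst e
  have hc₂ := h.right.core
  simp only [Multiset.add_cons, Multiset.cons_add] at hc₂
  have hU₂ : ∀ b ∈ decs (C₂ + n₂ ::ₘ (S₂ + H₂ + M₂) + F₂), b.ch ∈ U := fun b hb =>
    ht (by simpa [Side.split, Split.all] using hc₂.dec_used hb)
  obtain ⟨ns, ns₂, rfl, st₂, hns, hr, hr₂⟩ := hsim.step1 hU (hc.good.wf (by simp))
    (hc₂.good.wf (by simp)) (hU' _ (by simp)) (hU₂ _ (by simp)) st
  have hok : ∀ n' ∈ ns, n'.Ok := fun n' hn' => by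
    obtain ⟨_, -, h'⟩ := Multiset.exists_mem_of_rel_of_mem hns hn'
    exact h'.ok_left
  have hok₂ : ∀ n' ∈ ns₂, n'.Ok := fun n' hn' => by
    obtain ⟨_, -, h'⟩ := Multiset.exists_mem_of_rel_of_mem (rel_symm hns) hn'
    exact h'.ok_left
  have shared : ∀ {n : TNode L} {ns S H M C F : Multiset (TNode L)},
      Reduct U n ns → (∀ b ∈ decs (C + n ::ₘ (S + H + M) + F), b.ch ∈ U) →
      ∀ b ∈ ctxs (ns + S), b.lvl ≤ ξ → b ∈ ctxs (n ::ₘ S) ∨ b ∉ decs H := by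
    intro n ns S H M C F hr hU b hb hl
    rw [ctxs_add] at hb
    rcases Multiset.mem_add.1 hb with hb | hb
    · obtain ⟨e, he, hf⟩ := hr.fresh
      obtain ⟨n', hn', hb⟩ := mem_ctxs.1 hb
      rcases (hf n' hn').2 b hb with h' | ⟨h', -⟩
      · exact Or.inl (by simp [h'])
      · exact Or.inr fun hb => he (h' ▸ hU b (by simp [hb]))
    · exact Or.inl (by simp [hb])
  refine ⟨⟨C, ns + S, H, M, F, offD, offF⟩, ⟨C₂, ns₂ + S₂, H₂, M₂, F₂, offD₂, offF₂⟩,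
    ⟨h.lowΔ, h.lowK, ⟨?_, h.left.zones.replace_shared (shared hr hU'), h.left.high⟩,
      ⟨?_, h.right.zones.replace_shared (shared hr₂ hU₂), h.right.high⟩,
      Multiset.Rel.add hns hrel⟩,
    progStep_of hs (G := nodes ns + nodes (S + H + M)) ?_ ?_,
    .single (progStep_of ht (G := nodes ns₂ + nodes (S₂ + H₂ + M₂)) ?_ ?_)⟩
  · rw [add_assoc, add_assoc, ← add_assoc S]
    exact hc.reduct hr hU' hok
  · rw [add_assoc, add_assoc, ← add_assoc S₂]
    exact hc₂.reduct hr₂ hU₂ hok₂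
  · have := st.step {a | a ∈ offD.names} (nodes (S + H + M))
    simpa [Side.split] using this
  · simp only [Side.split, Split.mk.injEq, nodes_add, true_and, and_true]; abel
  · have := st₂.step {a | a ∈ offD₂.names} (nodes (S₂ + H₂ + M₂))
    simpa [Side.split] using this
  · simp only [Side.split, Split.mk.injEq, nodes_add, true_and, and_true]; abel

end

section
variable {Δ : Ctx L} {K : Goal L} {C S H M F : Multiset (TNode L)} {offD offF : Ctx L}
  {n p : TNode L} {t : Side L} {m : Msg L} {o : Node L}

theorem Pair.recv_private (h : Pair ξ Δ K ⟨C, S, H, n ::ₘ p ::ₘ M, F, offD, offF⟩ t)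
    (e : n.node = .msg m) (st : Step2 m p.node o) :
    Advances ξ Δ K ⟨C, S, H, n ::ₘ p ::ₘ M, F, offD, offF⟩ t := by
  have hc := h.left.core
  simp only [Multiset.add_cons] at hc
  obtain ⟨q, rfl, hr, hok⟩ := hc.good.step2 (n := n) (p := p) (by simp) (by simp) e st
  refine ⟨⟨C, S, H, q ::ₘ M, F, offD, offF⟩, t, ⟨h.lowΔ, h.lowK, ⟨?_,
    h.left.zones.reduct2_private hr, h.left.high⟩, h.right, h.rel⟩,
    progStep_of subset_rfl (G := q.node ::ₘ nodes (S + H + M)) ?_ ?_, .refl⟩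
  · simp only [Multiset.add_cons]
    exact hc.reduct2 hr hok
  · have := st.step (Side.split ⟨C, S, H, n ::ₘ p ::ₘ M, F, offD, offF⟩).all.used
      {a | a ∈ offD.names} (nodes (S + H + M))
    simpa [Side.split, e] using this
  · simp [Side.split]

theorem Pair.recv_mixed (h : Pair ξ Δ K ⟨C, S, n ::ₘ H, p ::ₘ M, F, offD, offF⟩ t)
    (hl : ¬ n.dec.lvl ≤ ξ) (e : n.node = .msg m) (st : Step2 m p.node o) :
    Advances ξ Δ K ⟨C, S, n ::ₘ H, p ::ₘ M, F, offD, offF⟩ t := by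
  have hc := h.left.core
  simp only [Multiset.add_cons, Multiset.cons_add] at hc
  rw [Multiset.cons_swap] at hc
  obtain ⟨q, rfl, hr, hok⟩ := hc.good.step2 (n := n) (p := p) (by simp) (by simp) e st
  refine ⟨⟨C, S, H, q ::ₘ M, F, offD, offF⟩, t, ⟨h.lowΔ, h.lowK, ⟨?_,
    h.left.zones.reduct2_mixed hr hl, h.left.high⟩, h.right, h.rel⟩,
    progStep_of subset_rfl (G := q.node ::ₘ nodes (S + H + M)) ?_ ?_, .refl⟩
  · simp only [Multiset.add_cons]
    exact hc.reduct2 hr hok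
  · have := st.step (Side.split ⟨C, S, n ::ₘ H, p ::ₘ M, F, offD, offF⟩).all.used
      {a | a ∈ offD.names} (nodes (S + H + M))
    rw [Multiset.cons_swap] at this
    simpa [Side.split, e] using this
  · simp [Side.split]

theorem Pair.recv_hi (h : Pair ξ Δ K ⟨C, S, n ::ₘ p ::ₘ H, M, F, offD, offF⟩ t)
    (e : n.node = .msg m) (st : Step2 m p.node o)
    (hq : ∀ q : TNode L, Reduct2 n p q → ∃ d, ¬ d ≤ ξ ∧ q.Above d) :
    Advances ξ Δ K ⟨C, S, n ::ₘ p ::ₘ H, M, F, offD, offF⟩ t := by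
  have hc := h.left.core
  simp only [Multiset.add_cons, Multiset.cons_add] at hc
  obtain ⟨q, rfl, hr, hok⟩ := hc.good.step2 (n := n) (p := p) (by simp) (by simp) e st
  have hc' := hc.reduct2 hr hok
  obtain ⟨d, hd, ha⟩ := hq q hr
  refine ⟨⟨C, S, q ::ₘ H, M, F, offD, offF⟩, t, ⟨h.lowΔ, h.lowK, ⟨?_, ?_,
    h.left.high⟩, h.right, h.rel⟩,
    progStep_of subset_rfl (G := q.node ::ₘ nodes (S + H + M)) ?_ ?_, .refl⟩
  · simpa only [Multiset.add_cons, Multiset.cons_add] using hc'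
  · refine Zones.replace_hi (H' := {n, p}) (ns := {q}) (by simpa using h.left.zones) ?_
    intro n' hn'
    obtain rfl := Multiset.mem_singleton.1 hn'
    exact ⟨.of_above hok (hc'.good.wf (by simp)) ha hd, fun h' => hd (ha.1.trans h')⟩
  · have := st.step (Side.split ⟨C, S, n ::ₘ p ::ₘ H, M, F, offD, offF⟩).all.used
      {a | a ∈ offD.names} (nodes (S + H + M))
    simpa [Side.split, e] using this
  · simp [Side.split]

theorem Pair.recv_shared (h : Pair ξ Δ K ⟨C, n ::ₘ p ::ₘ S, H, M, F, offD, offF⟩ t)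
    (hl : n.dec.lvl ≤ ξ) (e : n.node = .msg m) (st : Step2 m p.node o) :
    Advances ξ Δ K ⟨C, n ::ₘ p ::ₘ S, H, M, F, offD, offF⟩ t := by
  have hc := h.left.core
  simp only [Multiset.add_cons, Multiset.cons_add] at hc
  obtain ⟨n₂, S₂, hsn, hrel, e₂⟩ := Multiset.rel_cons_left.1 h.rel
  obtain ⟨p₂, S₂, hsp, hrel', rfl⟩ := Multiset.rel_cons_left.1 hrel
  obtain ⟨C₂, S', H₂, M₂, F₂, offD₂, offF₂⟩ := t
  simp only at e₂
  subst e₂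
  have hc₂ := h.right.core
  simp only [Multiset.add_cons, Multiset.cons_add] at hc₂
  obtain ⟨q, q₂, m', rfl, e₂, st₂, hq, hr, hr₂⟩ := hsn.step2 hsp (hc.good.wf (by simp))
    (hc.good.wf (by simp)) (hc₂.good.wf (by simp)) (hc.good.compatible (by simp) (by simp)) hl e st
  have shared : ∀ {n p q : TNode L} {S H : Multiset (TNode L)}, Reduct2 n p q →
      ∀ b ∈ ctxs (q ::ₘ S), b.lvl ≤ ξ → b ∈ ctxs (n ::ₘ p ::ₘ S) ∨ b ∉ decs H := by
    intro n p q S H hr b hb _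
    left
    rw [ctxs_cons] at hb
    rcases Multiset.mem_add.1 hb with hb | hb
    · rcases hr.ctx b hb with h' | h' <;> simp [h']
    · simp [hb]
  refine ⟨⟨C, q ::ₘ S, H, M, F, offD, offF⟩, ⟨C₂, q₂ ::ₘ S₂, H₂, M₂, F₂, offD₂, offF₂⟩,
    ⟨h.lowΔ, h.lowK, ⟨?_, h.left.zones.replace_shared (shared hr), h.left.high⟩,
      ⟨?_, h.right.zones.replace_shared (shared hr₂), h.right.high⟩, .cons hq hrel'⟩,
    progStep_of subset_rfl (G := q.node ::ₘ nodes (S + H + M)) ?_ ?_,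
    .single (progStep_of subset_rfl (G := q₂.node ::ₘ nodes (S₂ + H₂ + M₂)) ?_ ?_)⟩
  · simpa only [Multiset.add_cons, Multiset.cons_add] using hc.reduct2 hr hq.ok_left
  · simpa only [Multiset.add_cons, Multiset.cons_add] using hc₂.reduct2 hr₂ hq.ok_right
  · have := st.step (Side.split ⟨C, n ::ₘ p ::ₘ S, H, M, F, offD, offF⟩).all.used
      {a | a ∈ offD.names} (nodes (S + H + M))
    simpa [Side.split, e] using this
  · simp [Side.split]
  · have := st₂.step (Side.split ⟨C₂, n₂ ::ₘ p₂ ::ₘ S₂, H₂, M₂, F₂, offD₂, offF₂⟩).all.used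
      {a | a ∈ offD₂.names} (nodes (S₂ + H₂ + M₂))
    simpa [Side.split, e₂] using this
  · simp [Side.split]

/-- A pair of shared nodes can be given up if their next action is not observable. -/
theorem Pair.share_to_hi (h : Pair ξ Δ K ⟨C, n ::ₘ S, H, M, F, offD, offF⟩ t) (hn : Hi ξ n)
    (hl : n.dec.lvl ≤ ξ → n.dec ∉ ctxs S ∧ n.dec ∉ K.ctx) :
    ∃ t' : Side L, t'.split = t.split ∧ Pair ξ Δ K ⟨C, S, n ::ₘ H, M, F, offD, offF⟩ t' := by
  obtain ⟨n₂, S₂, hsim, hrel, e⟩ := Multiset.rel_cons_left.1 h.rel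
  obtain ⟨C₂, S', H₂, M₂, F₂, offD₂, offF₂⟩ := t
  simp only at e
  subst e
  have hn₂ : Hi ξ n₂ := hn.of_sim hsim (h.left.core.good.wf (by simp))
  have hl₂ : n₂.dec.lvl ≤ ξ → n₂.dec ∉ ctxs S₂ ∧ n₂.dec ∉ K.ctx := by
    intro hl'
    rw [hsim.dec_lvl] at hl'
    rw [hsim.dec_eq hl']
    exact ⟨fun hb => (hl hl').1 (mem_ctxs_of_rel (rel_symm hrel) hb hl'), (hl hl').2⟩
  refine ⟨⟨C₂, S₂, n₂ ::ₘ H₂, M₂, F₂, offD₂, offF₂⟩, by simp [Side.split],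
    h.lowΔ, h.lowK, ⟨?_, h.left.zones.share_to_hi hn hl, h.left.high⟩,
    ⟨?_, h.right.zones.share_to_hi hn₂ hl₂, h.right.high⟩, hrel⟩
  · simpa only [Multiset.add_cons, Multiset.cons_add] using h.left.core
  · simpa only [Multiset.add_cons, Multiset.cons_add] using h.right.core

theorem Pair.private_to_hi (h : Pair ξ Δ K ⟨C, S, H, n ::ₘ M, F, offD, offF⟩ t) (hn : Hi ξ n)
    (hl : ¬ n.dec.lvl ≤ ξ) (hc : ∀ b ∈ n.ctx, ¬ b.lvl ≤ ξ) :
    Pair ξ Δ K ⟨C, S, n ::ₘ H, M, F, offD, offF⟩ t :=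
  ⟨h.lowΔ, h.lowK, ⟨by simpa only [Multiset.add_cons, Multiset.cons_add] using h.left.core,
    h.left.zones.private_to_hi hn hl hc, h.left.high⟩, h.right, h.rel⟩

end

theorem rel_map_left {lo : L → Prop} {S T : Multiset (TNode L)} {g : Chan → Chan}
    (h : Multiset.Rel (NodeSim lo) S T) (hd : ∀ b ∈ decs S, lo b.lvl → g b.ch = b.ch)
    (hc : ∀ b ∈ ctxs S, lo b.lvl → g b.ch = b.ch) :
    Multiset.Rel (NodeSim lo) (S.map (TNode.map g)) T := by
  rw [Multiset.rel_map_left]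
  refine h.mono fun n hn n' _ hs => ?_
  have := hs.map (g₁ := g) (g₂ := id) ?_
  · rwa [TNode.map_id] at this
  · intro b hb hl
    rcases Multiset.mem_cons.1 hb with rfl | hb
    · exact hd _ (dec_mem_decs hn) hl
    · exact hc _ (ctx_mem_ctxs hn hb) hl

theorem rel_map {lo : L → Prop} {S T : Multiset (TNode L)} (h : Multiset.Rel (NodeSim lo) S T)
    (g : Chan → Chan) :
    Multiset.Rel (NodeSim lo) (S.map (TNode.map g)) (T.map (TNode.map g)) := by
  rw [Multiset.rel_map]
  exact h.mono fun n _ n' _ hs => hs.map fun _ _ _ => rfl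

theorem Zones.contract {K : Goal L} {S S' H M : Multiset (TNode L)} {g : Chan → Chan}
    (hi : ∀ n ∈ H, Hi ξ n ∧ (n.dec.lvl ≤ ξ → n.dec ∉ ctxs S ∧ n.dec ∉ K.ctx))
    (hd : ∀ n ∈ H, n.dec.map g = n.dec) (hc : ∀ b ∈ ctxs S', b.lvl ≤ ξ → b.map g ∈ ctxs S)
    (hp : (Ctx.proj ξ (ctxs M)).map (Decl.map g) = (Ctx.proj ξ (decs M)).map (Decl.map g)) :
    Zones ξ K (S'.map (TNode.map g)) (H.map (TNode.map g)) (M.map (TNode.map g)) where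
  hi n hn' := by
    obtain ⟨n, hn, rfl⟩ := Multiset.mem_map.1 hn'
    refine ⟨(hi n hn).1.map g, ?_⟩
    rw [TNode.map_dec, hd n hn]
    refine fun hl => ⟨fun hb => ?_, ((hi n hn).2 hl).2⟩
    rw [ctxs_map] at hb
    obtain ⟨b, hb, e⟩ := Multiset.mem_map.1 hb
    have hl' : b.lvl ≤ ξ := by rw [← e] at hl; exact hl
    exact ((hi n hn).2 hl).1 (e ▸ hc b hb hl')
  priv := by rw [ctxs_map, decs_map, Ctx.proj_map, Ctx.proj_map, hp]

theorem Decl.map_rename_of_ne {b : Decl L} {y x : Chan} (h : b.ch ≠ y) :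
    b.map (Chan.rename y x) = b := Decl.ext' (Chan.rename_of_ne _ h) rfl rfl

theorem NodeSim.fwd {lo : L → Prop} {n₁ n₂ : TNode L} {y x : Chan} {c d : L}
    (h : NodeSim lo n₁ n₂) (e : n₁.node = .proc y c (.fwd (.fv y) (.fv x)) d) (hl : lo c) :
    n₂.node = n₁.node := by
  obtain ⟨⟨Γ, o, k⟩, f₁, f₂, hok, rfl, rfl, hf⟩ := h
  cases o with
  | msg m => cases e
  | proc y₀ c₀ P d₀ =>
    cases P with
    | fwd r s =>
      replace hok : NodeOk Γ (.proc y₀ c₀ (.fwd r s) d₀) k := hok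
      cases hok with
      | proc h₁ h₂ h₃ =>
        obtain ⟨x₀, rfl, rfl, rfl⟩ := h₃.fwd_inv
        simp only [TNode.map, Node.map, Node.proc.injEq] at e
        obtain ⟨-, rfl, -, -⟩ := e
        have e₁ := hf _ (Multiset.mem_cons_self _ _) hl
        have e₂ := hf ⟨x₀, _, c₀⟩ (Multiset.mem_cons_of_mem (Multiset.mem_singleton_self _)) hl
        simp only at e₁ e₂
        simp only [TNode.map, Node.map, Proc.map, Ref.map, e₁, e₂]
    | _ => cases e

section
variable {Δ : Ctx L} {K : Goal L} {C S H M F : Multiset (TNode L)} {offD offF : Ctx L}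
  {n : TNode L} {t : Side L} {y x : Chan} {c d : L}

theorem Core.fwd_inv (h : Core Δ K C (n ::ₘ S) F offD offF)
    (e : n.node = .proc y c (.fwd (.fv y) (.fv x)) d) :
    n.ctx = {⟨x, n.dec.ty, c⟩} ∧ n.dec = ⟨y, n.dec.ty, c⟩ := by
  have := h.good.ok n (by simp)
  rw [TNode.Ok, e] at this
  exact this.fwd_inv

theorem Core.offD_mem (h : Core Δ K C S F offD offF) {b : Decl L} (hb : b ∈ offD) :
    b ∈ decs (C + S + F) := by
  have : b ∈ Δ + decs S := by rw [← h.balD]; exact Multiset.mem_add.2 (Or.inr hb)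
  rcases Multiset.mem_add.1 this with h' | h'
  · simp [h.mem_decs_of_mem h']
  · simp [h']

theorem Core.ne_dec (h : Core Δ K C (n ::ₘ S) F offD offF) {b : Decl L} (hb : b ∈ decs S) :
    b.ch ≠ n.dec.ch := by
  have hG := h.good
  simp only [Multiset.add_cons, Multiset.cons_add] at hG
  intro e
  exact hG.notMem_of_mem (e ▸ Ctx.mem_names_of (by simp [hb]))

theorem Core.eq_dec (h : Core Δ K C (n ::ₘ S) F offD offF) {b : Decl L} (hb : b ∈ ctxs S)
    (e : b.ch = n.dec.ch) : b = n.dec :=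
  h.good.decl_eq (Multiset.mem_of_le h.good.closed (by simp [hb])) (by simp) e

/-- A forward that the other program does not execute. -/
theorem Pair.contract_left (h : Pair ξ Δ K ⟨C, S, H, M, F, offD, offF⟩ t) {S' H' M'}
    (hD : S + H + M = n ::ₘ (S' + H' + M')) (hS : S = S') (hH : H' ⊆ H)
    (e : n.node = .proc y c (.fwd (.fv y) (.fv x)) d) (hy : y ∉ offD.names)
    (hl : ∀ b ∈ ctxs S, b.lvl ≤ ξ → b.ch ≠ y)
    (hp : (Ctx.proj ξ (ctxs M')).map (Decl.map (Chan.rename y x)) =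
      (Ctx.proj ξ (decs M')).map (Decl.map (Chan.rename y x))) :
    Advances ξ Δ K ⟨C, S, H, M, F, offD, offF⟩ t := by
  subst hS
  have hc := h.left.core
  simp only [hD] at hc
  obtain ⟨h₁, h₂⟩ := hc.fwd_inv e
  have hyd : n.dec.ch = y := by rw [h₂]
  refine ⟨⟨C, S.map (TNode.map (Chan.rename y x)), H'.map (TNode.map (Chan.rename y x)),
    M'.map (TNode.map (Chan.rename y x)), F, offD, offF⟩, t, ⟨h.lowΔ, h.lowK, ⟨?_, ?_,
    h.left.high⟩, h.right, rel_map_left h.rel ?_ ?_⟩,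
    progStep_of subset_rfl (G := (nodes (S + H' + M')).rename y x) ?_ ?_, .refl⟩
  · have := hc.contract h₁ h₂ hy
    simpa only [Multiset.map_add] using this
  · refine Zones.contract (fun n' hn' => h.left.zones.hi n' (hH hn')) ?_ ?_ hp
    · intro n' hn'
      exact Decl.map_rename_of_ne (hyd ▸ hc.ne_dec (dec_mem_decs (by simp [hn'])))
    · intro b hb hb'
      rwa [Decl.map_rename_of_ne (hl b hb hb')]
  · intro b hb _
    exact Chan.rename_of_ne _ (hyd ▸ hc.ne_dec (by simp [hb]))
  · intro b hb hb'
    exact Chan.rename_of_ne _ (hl b hb hb')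
  · simp only [Side.split, hD, nodes_cons, e]
    exact .fwd hy
  · simp only [Side.split, ← nodes_contract, Multiset.map_add]

theorem Pair.fwd_hi (h : Pair ξ Δ K ⟨C, S, n ::ₘ H, M, F, offD, offF⟩ t)
    (e : n.node = .proc y c (.fwd (.fv y) (.fv x)) d) (hy : y ∉ offD.names) :
    Advances ξ Δ K ⟨C, S, n ::ₘ H, M, F, offD, offF⟩ t := by
  have hD : S + n ::ₘ H + M = n ::ₘ (S + H + M) := by
    simp only [Multiset.add_cons, Multiset.cons_add]
  have hc := h.left.core
  simp only [hD] at hc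
  obtain ⟨h₁, h₂⟩ := hc.fwd_inv e
  have hh := (h.left.zones.hi n (by simp)).1.dec_high (hc.good.ok n (by simp)) e
  refine h.contract_left hD rfl (fun _ h => Multiset.mem_cons_of_mem h) e hy ?_
    (congrArg _ h.left.zones.priv)
  rintro b hb hl rfl
  rw [← hc.eq_dec (b := b) (by simp [hb]) (by rw [h₂])] at hh
  exact hh hl

theorem Pair.fwd_private (h : Pair ξ Δ K ⟨C, S, H, n ::ₘ M, F, offD, offF⟩ t)
    (e : n.node = .proc y c (.fwd (.fv y) (.fv x)) d) (hy : y ∉ offD.names) :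
    Advances ξ Δ K ⟨C, S, H, n ::ₘ M, F, offD, offF⟩ t := by
  have hD : S + H + n ::ₘ M = n ::ₘ (S + H + M) := by simp only [Multiset.add_cons]
  have hG := h.left.core.good
  have hc := h.left.core
  simp only [hD] at hc
  obtain ⟨h₁, h₂⟩ := hc.fwd_inv e
  refine h.contract_left hD rfl (fun _ h => h) e hy ?_ ?_
  · rintro b hb hl rfl
    have hb' := hc.eq_dec (b := b) (by simp [hb]) (by rw [h₂])
    have := h.left.zones.mem_ctxs_of_mem (b := b) (by simp [hb']) hl
    refine hG.ctx_disjoint (S := S) (R := n ::ₘ M) ?_ hb this rfl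
    exact Multiset.le_iff_exists_add.2 ⟨C + H + F, by simp only; abel⟩
  · have := congrArg (Multiset.map (Decl.map (Chan.rename y x))) h.left.zones.priv
    have e₁ : Decl.map (Chan.rename y x) (⟨y, n.dec.ty, c⟩ : Decl L) = ⟨x, n.dec.ty, c⟩ := by simp
    have e₂ : Decl.map (Chan.rename y x) (⟨x, n.dec.ty, c⟩ : Decl L) = ⟨x, n.dec.ty, c⟩ := by
      refine Decl.ext' ?_ rfl rfl
      by_cases e : x = y
      · simp [e]
      · exact Chan.rename_of_ne _ e
    have e₃ : (Ctx.proj ξ {⟨x, n.dec.ty, c⟩}).map (Decl.map (Chan.rename y x)) =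
        (Ctx.proj ξ {⟨y, n.dec.ty, c⟩}).map (Decl.map (Chan.rename y x)) := by
      rw [← Ctx.proj_map, ← Ctx.proj_map, Multiset.map_singleton, Multiset.map_singleton, e₁, e₂]
    have h₃ : decs (n ::ₘ M) = {⟨y, n.dec.ty, c⟩} + decs M := by
      rw [← h₂, decs_cons, Multiset.singleton_add]
    rw [ctxs_cons, h₁, h₃, Ctx.proj_add, Ctx.proj_add, Multiset.map_add, Multiset.map_add, e₃]
      at this
    exact add_left_cancel this

theorem Pair.fwd_shared (h : Pair ξ Δ K ⟨C, n ::ₘ S, H, M, F, offD, offF⟩ t) (hl : c ≤ ξ)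
    (e : n.node = .proc y c (.fwd (.fv y) (.fv x)) d) (hy : y ∉ offD.names) :
    Advances ξ Δ K ⟨C, n ::ₘ S, H, M, F, offD, offF⟩ t := by
  obtain ⟨n₂, S₂, hsim, hrel, e₂⟩ := Multiset.rel_cons_left.1 h.rel
  obtain ⟨C₂, S', H₂, M₂, F₂, offD₂, offF₂⟩ := t
  simp only at e₂
  subst e₂
  have side : ∀ {C S H M F : Multiset (TNode L)} {offD offF : Ctx L} {n : TNode L},
      Side.Inv ξ Δ K ⟨C, n ::ₘ S, H, M, F, offD, offF⟩ →
      n.node = .proc y c (.fwd (.fv y) (.fv x)) d → y ∉ offD.names →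
      Side.Inv ξ Δ K ⟨C, S.map (TNode.map (Chan.rename y x)), H.map (TNode.map (Chan.rename y x)),
        M.map (TNode.map (Chan.rename y x)), F, offD, offF⟩ ∧
      ProgStep (Side.mk C (n ::ₘ S) H M F offD offF).split
        (Side.mk C (S.map (TNode.map (Chan.rename y x))) (H.map (TNode.map (Chan.rename y x)))
        (M.map (TNode.map (Chan.rename y x))) F offD offF).split := by
    intro C S H M F offD offF n h e hy
    have hD : n ::ₘ S + H + M = n ::ₘ (S + H + M) := by simp only [Multiset.cons_add]
    have hG := h.core.good
    have hc := h.core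
    simp only [hD] at hc
    obtain ⟨h₁, h₂⟩ := hc.fwd_inv e
    have hyd : n.dec.ch = y := by rw [h₂]
    refine ⟨⟨?_, ?_, h.high⟩, progStep_of subset_rfl (G := (nodes (S + H + M)).rename y x) ?_ ?_⟩
    · have := hc.contract h₁ h₂ hy
      simpa only [Multiset.map_add] using this
    · refine Zones.contract h.zones.hi ?_ ?_ (congrArg _ h.zones.priv)
      · intro n' hn'
        exact Decl.map_rename_of_ne (hyd ▸ hc.ne_dec (dec_mem_decs (by simp [hn'])))
      · intro b hb _
        by_cases hby : b.ch = y
        · have hb' := hc.eq_dec (b := b) (by simp [hb]) (hby.trans hyd.symm)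
          rw [hb', h₂, Decl.map_mk, Chan.rename_self, ctxs_cons, h₁]
          simp
        · rw [Decl.map_rename_of_ne hby]
          simp [hb]
    · simp only [Side.split, hD, nodes_cons, e]
      exact .fwd hy
    · simp only [Side.split, ← nodes_contract, Multiset.map_add]
  have e' : n₂.node = .proc y c (.fwd (.fv y) (.fv x)) d := (hsim.fwd e hl).trans e
  have hy₂ : y ∉ offD₂.names := by
    have h₁ := h.left.core.offersD
    have h₂ := h.right.core.offersD
    cases K with
    | some k => rw [show offD₂ = {k} from h₂]; rwa [show offD = {k} from h₁] at hy
    | none =>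
      intro hy'
      obtain ⟨b, hb, rfl⟩ := Ctx.mem_names.1 hy'
      have hc := h.right.core
      simp only [Multiset.cons_add] at hc
      have hdec := (hc.fwd_inv e').2
      have : b = n₂.dec := hc.good.decl_eq (hc.offD_mem hb) (by simp) (by rw [hdec])
      refine h.right.high rfl b hb ?_
      rw [this, hdec]
      exact hl
  exact ⟨_, _, ⟨h.lowΔ, h.lowK, (side h.left e hy).1, (side h.right e' hy₂).1,
    rel_map hrel _⟩, (side h.left e hy).2, .single (side h.right e' hy₂).2⟩

end

section
variable {Δ : Ctx L} {K : Goal L} {C S H M F : Multiset (TNode L)} {offD offF : Ctx L}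
  {n p : TNode L} {s t : Side L} {m : Msg L} {o : Node L}

theorem Advances.congr {s' t' : Side L} (h : Advances ξ Δ K s' t') (hs : s'.split = s.split)
    (ht : t'.split = t.split) : Advances ξ Δ K s t := by
  obtain ⟨s'', t'', h₁, h₂, h₃⟩ := h
  exact ⟨s'', t'', h₁, hs ▸ h₂, ht ▸ h₃⟩

theorem Core.notMem_ctxs (h : Core Δ K C S F offD offF) {b : Decl L} (hb : b ∈ offD) :
    b ∉ ctxs S := by
  classical
  intro hb'
  have h₁ := congrArg (count b) h.balD
  have h₂ := congrArg (count b) h.balC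
  have h₃ := Multiset.nodup_iff_count_le_one.1 (Multiset.Nodup.of_map _ h.good.nodup) b
  simp only [decs_add, Multiset.count_add, Multiset.count_zero] at h₁ h₂ h₃
  have h₄ := Multiset.count_pos.2 hb
  have h₅ := Multiset.count_pos.2 hb'
  omega

theorem Core.goal_mem (h : Core Δ K C S F offD offF) {b : Decl L} (hb : b ∈ K.ctx) :
    b ∈ offD := by
  have := h.offersD
  cases K with
  | none => simp [Goal.ctx] at hb
  | some k => rw [show offD = {k} from this]; exact hb

theorem Core.good_cons₂ {R : Multiset (TNode L)}
    (h : Core Δ K C (n ::ₘ p ::ₘ R) F offD offF) : Good (n ::ₘ p ::ₘ (C + R + F)) := by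
  have := h.good
  simpa only [Multiset.add_cons, Multiset.cons_add] using this

/-- Communication along an unobservable channel. -/
theorem Pair.recv_high (h : Pair ξ Δ K ⟨C, S, n ::ₘ H, M, F, offD, offF⟩ t)
    (hp : p ∈ S + H + M) (hl : ¬ n.dec.lvl ≤ ξ) (e : n.node = .msg m)
    (st : Step2 m p.node o) : Advances ξ Δ K ⟨C, S, n ::ₘ H, M, F, offD, offF⟩ t := by
  have key : ∀ q : TNode L, Reduct2 n p q → ∃ d, ¬ d ≤ ξ ∧ q.Above d :=
    fun q hr => ⟨_, hl, hr.above⟩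
  rcases Multiset.mem_add.1 hp with hp | hp
  · rcases Multiset.mem_add.1 hp with hp | hp
    · obtain ⟨S, rfl⟩ := Multiset.exists_cons_of_mem hp
      have hc := h.left.core
      simp only [Multiset.add_cons, Multiset.cons_add] at hc
      have hw := hc.good.wf (n := n) (by simp)
      have hok := hc.good.ok n (by simp)
      have hpok := hc.good.ok p (by simp)
      have hi : Hi ξ p ∧ ¬ p.dec.lvl ≤ ξ := by
        rcases hc.good_cons₂.comm e st with ⟨-, h₂, h₃⟩ | ⟨-, h₂, h₃⟩
        · exact ⟨.awaits h₂ hl h₃, fun h' => hl ((hpok.lvl_le h₂).trans h')⟩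
        · have : ¬ p.dec.lvl ≤ ξ := by rwa [hok.msg_lvl hw e _ h₂]
          exact ⟨.provides this h₃, this⟩
      obtain ⟨t', ht, h'⟩ := h.share_to_hi hi.1 fun h' => absurd h' hi.2
      rw [Multiset.cons_swap] at h'
      exact (h'.recv_hi e st key).congr (by simp [Side.split]) ht
    · obtain ⟨H, rfl⟩ := Multiset.exists_cons_of_mem hp
      exact h.recv_hi e st key
  · obtain ⟨M, rfl⟩ := Multiset.exists_cons_of_mem hp
    exact h.recv_mixed hl e st

/-- Communication along an observable channel with a process in the zone `H`. -/
theorem Pair.recv_low_hi (h : Pair ξ Δ K ⟨C, S, n ::ₘ p ::ₘ H, M, F, offD, offF⟩ t)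
    (hl : n.dec.lvl ≤ ξ) (h₂ : n.dec ∈ p.ctx) (h₃ : Awaits n.dec p.node) (e : n.node = .msg m)
    (st : Step2 m p.node o) : Advances ξ Δ K ⟨C, S, n ::ₘ p ::ₘ H, M, F, offD, offF⟩ t := by
  obtain ⟨y, c, P, d, e', hd⟩ := (h.left.zones.hi p (by simp)).1.run_of_awaits
    (h.left.core.good.wf (by simp)) h₂ hl h₃
  exact h.recv_hi e st fun q hr => ⟨d, hd, hr.above' h₂ _ _ _ _ e'⟩

theorem Pair.recv (h : Pair ξ Δ K ⟨C, S, H, M, F, offD, offF⟩ t) {R : Multiset (TNode L)}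
    (hD : S + H + M = n ::ₘ p ::ₘ R) (e : n.node = .msg m) (st : Step2 m p.node o) :
    Advances ξ Δ K ⟨C, S, H, M, F, offD, offF⟩ t := by
  have hG := h.left.core.good
  have hc := h.left.core
  simp only [hD] at hc
  have hw := hc.good.wf (n := n) (by simp)
  have hok := hc.good.ok n (by simp)
  have hpok := hc.good.ok p (by simp)
  have hn : n ∈ S + H + M := by simp [hD]
  have comm := hc.good_cons₂.comm e st
  have hpn : ∀ {S' H' M' : Multiset (TNode L)}, S + H + M = n ::ₘ (S' + H' + M') →
      p ∈ S' + H' + M' := by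
    intro S' H' M' e
    rw [hD] at e
    rw [← (Multiset.cons_inj_right _).1 e]
    simp
  by_cases hl : n.dec.lvl ≤ ξ
  swap
  · have hi : Hi ξ n := by
      rcases comm with ⟨h₁, -⟩ | ⟨h₁, h₂, -⟩
      · exact .msg e h₁
      · exact .awaits h₂ (by rwa [hok.msg_lvl hw e _ h₂]) h₁
    rcases Multiset.mem_add.1 hn with hn | hn
    · rcases Multiset.mem_add.1 hn with hn | hn
      · obtain ⟨S, rfl⟩ := Multiset.exists_cons_of_mem hn
        obtain ⟨t', ht, h'⟩ := h.share_to_hi hi fun h' => absurd h' hl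
        exact (h'.recv_high (hpn (by simp)) hl e st).congr (by simp [Side.split]) ht
      · obtain ⟨H, rfl⟩ := Multiset.exists_cons_of_mem hn
        exact h.recv_high (hpn (by simp)) hl e st
    · obtain ⟨M, rfl⟩ := Multiset.exists_cons_of_mem hn
      have h' := h.private_to_hi hi hl fun b hb => by rwa [hok.msg_lvl hw e b hb]
      exact (h'.recv_high (hpn (by simp)) hl e st).congr (by simp [Side.split]) rfl
  · have hp : p ∈ S + H + M := by simp [hD]
    have ctxSH : ∀ {b b' : Decl L}, b ∈ ctxs S → b' ∈ ctxs H → b.ch ≠ b'.ch := fun hb hb' =>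
      hG.ctx_disjoint (Multiset.le_iff_exists_add.2 ⟨C + M + F, by simp only; abel⟩) hb hb'
    have ctxSM : ∀ {b b' : Decl L}, b ∈ ctxs S → b' ∈ ctxs M → b.ch ≠ b'.ch := fun hb hb' =>
      hG.ctx_disjoint (Multiset.le_iff_exists_add.2 ⟨C + H + F, by simp only; abel⟩) hb hb'
    have ctxHM : ∀ {b b' : Decl L}, b ∈ ctxs H → b' ∈ ctxs M → b.ch ≠ b'.ch := fun hb hb' =>
      hG.ctx_disjoint (Multiset.le_iff_exists_add.2 ⟨C + S + F, by simp only; abel⟩) hb hb'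
    have decSM : ∀ {b b' : Decl L}, b ∈ decs S → b' ∈ decs M → b.ch ≠ b'.ch := fun hb hb' =>
      hG.dec_disjoint (Multiset.le_iff_exists_add.2 ⟨C + H + F, by simp only; abel⟩) hb hb'
    have decHM : ∀ {b b' : Decl L}, b ∈ decs H → b' ∈ decs M → b.ch ≠ b'.ch := fun hb hb' =>
      hG.dec_disjoint (Multiset.le_iff_exists_add.2 ⟨C + S + F, by simp only; abel⟩) hb hb'
    have hz := h.left.zones
    have hpl : p.dec ∈ n.ctx → p.dec.lvl ≤ ξ := fun h₂ => by rwa [hok.msg_lvl hw e _ h₂]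
    rcases Multiset.mem_add.1 hp with hp | hpM
    · rcases Multiset.mem_add.1 hp with hp | hpH
      · have hnS : n ∈ S := by
          rcases Multiset.mem_add.1 hn with hn | hn
          · rcases Multiset.mem_add.1 hn with hn | hn
            · exact hn
            · rcases comm with ⟨h₁, h₂, -⟩ | ⟨h₁, h₂, -⟩
              · exact absurd (ctx_mem_ctxs hp h₂) ((hz.hi n hn).2 hl).1
              · obtain ⟨_, _, _, _, e', -⟩ := (hz.hi n hn).1.run_of_awaits hw h₂ (hpl h₂) h₁
                rw [e] at e'; cases e'
          · rcases comm with ⟨h₁, h₂, -⟩ | ⟨h₁, h₂, -⟩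
            · exact absurd rfl (ctxSM (ctx_mem_ctxs hp h₂)
                (hz.mem_ctxs_of_mem (dec_mem_decs hn) hl))
            · exact absurd rfl (decSM (dec_mem_decs hp)
                (hz.mem_decs_of_mem (ctx_mem_ctxs hn h₂) (hpl h₂)))
        obtain ⟨S, rfl⟩ := Multiset.exists_cons_of_mem hnS
        have hpS : p ∈ S := by
          rcases Multiset.mem_cons.1 hp with rfl | hp
          · obtain ⟨_, _, _, _, e'⟩ := st.exists_proc
            rw [e] at e'; cases e'
          · exact hp
        obtain ⟨S, rfl⟩ := Multiset.exists_cons_of_mem hpS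
        exact h.recv_shared hl e st
      · rcases comm with ⟨h₁, h₂, h₃⟩ | ⟨h₁, h₂, h₃⟩
        swap
        · obtain ⟨_, _, _, _, e'⟩ := st.exists_proc
          exact absurd (hpl h₂) ((hz.hi p hpH).1.dec_high hpok e')
        rcases Multiset.mem_add.1 hn with hn | hn
        · rcases Multiset.mem_add.1 hn with hn | hn
          · obtain ⟨S, rfl⟩ := Multiset.exists_cons_of_mem hn
            obtain ⟨H, rfl⟩ := Multiset.exists_cons_of_mem hpH
            obtain ⟨t', ht, h'⟩ := h.share_to_hi (.msg e h₁) fun _ =>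
              ⟨fun hb => ctxSH (by simp [hb]) (ctx_mem_ctxs hpH h₂) rfl,
                fun hb => hc.notMem_ctxs (hc.goal_mem hb) (by simp [h₂])⟩
            exact (h'.recv_low_hi hl h₂ h₃ e st).congr
              (by simp [Side.split, Multiset.cons_swap n.node]) ht
          · obtain ⟨H, rfl⟩ := Multiset.exists_cons_of_mem hn
            have hpH : p ∈ H := by
              rcases Multiset.mem_cons.1 hpH with rfl | hp
              · obtain ⟨_, _, _, _, e'⟩ := st.exists_proc
                rw [e] at e'; cases e'
              · exact hp
            obtain ⟨H, rfl⟩ := Multiset.exists_cons_of_mem hpH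
            exact h.recv_low_hi hl h₂ h₃ e st
        · exact absurd rfl (ctxHM (ctx_mem_ctxs hpH h₂)
            (hz.mem_ctxs_of_mem (dec_mem_decs hn) hl))
    · have hnM : n ∈ M := by
        rcases Multiset.mem_add.1 hn with hn | hn
        · rcases comm with ⟨h₁, h₂, -⟩ | ⟨h₁, h₂, -⟩
          · have := hz.mem_decs_of_mem (ctx_mem_ctxs hpM h₂) hl
            rcases Multiset.mem_add.1 hn with hn | hn
            · exact absurd rfl (decSM (dec_mem_decs hn) this)
            · exact absurd rfl (decHM (dec_mem_decs hn) this)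
          · have := hz.mem_ctxs_of_mem (dec_mem_decs hpM) (hpl h₂)
            rcases Multiset.mem_add.1 hn with hn | hn
            · exact absurd rfl (ctxSM (ctx_mem_ctxs hn h₂) this)
            · exact absurd rfl (ctxHM (ctx_mem_ctxs hn h₂) this)
        · exact hn
      obtain ⟨M, rfl⟩ := Multiset.exists_cons_of_mem hnM
      have hpM : p ∈ M := by
        rcases Multiset.mem_cons.1 hpM with rfl | hp
        · obtain ⟨_, _, _, _, e'⟩ := st.exists_proc
          rw [e] at e'; cases e'
        · exact hp
      obtain ⟨M, rfl⟩ := Multiset.exists_cons_of_mem hpM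
      exact h.recv_private e st

theorem Pair.fwd (h : Pair ξ Δ K ⟨C, S, H, M, F, offD, offF⟩ t) {y x : Chan} {c d : L}
    (hn : n ∈ S + H + M) (e : n.node = .proc y c (.fwd (.fv y) (.fv x)) d)
    (hy : y ∉ offD.names) : Advances ξ Δ K ⟨C, S, H, M, F, offD, offF⟩ t := by
  have hok := h.left.core.good.ok n (by
    simp only [Multiset.mem_add] at hn ⊢; tauto)
  rw [TNode.Ok, e] at hok
  obtain ⟨-, h₂⟩ := hok.fwd_inv
  rcases Multiset.mem_add.1 hn with hn | hn
  · rcases Multiset.mem_add.1 hn with hn | hn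
    · obtain ⟨S, rfl⟩ := Multiset.exists_cons_of_mem hn
      by_cases hl : c ≤ ξ
      · exact h.fwd_shared hl e hy
      · have hl' : ¬ n.dec.lvl ≤ ξ := by rwa [h₂]
        obtain ⟨t', ht, h'⟩ := h.share_to_hi
          (.provides hl' (by rw [e, h₂]; exact .fwd)) fun h' => absurd h' hl'
        exact (h'.fwd_hi e hy).congr (by simp [Side.split]) ht
    · obtain ⟨H, rfl⟩ := Multiset.exists_cons_of_mem hn
      exact h.fwd_hi e hy
  · obtain ⟨M, rfl⟩ := Multiset.exists_cons_of_mem hn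
    exact h.fwd_private e hy

theorem Pair.step (h : Pair ξ Δ K s t) (hst : ∃ G, ProgStep s.split G) :
    Advances ξ Δ K s t := by
  obtain ⟨-, G, st, -⟩ := hst
  have hU : (s.split.all.used ∪ t.split.all.used).Finite :=
    (Config.finite_used _).union (Config.finite_used _)
  obtain ⟨G, st⟩ := st.refresh hU
  obtain ⟨C, S, H, M, F, offD, offF⟩ := s
  rcases st.local_cases with ⟨y, x, c, d, G, hy, e, rfl⟩ | ⟨o, os, G, e, rfl, hs⟩ |
    ⟨m, p, q, G, e, rfl, hs⟩
  · obtain ⟨n, T, e', hn, rfl⟩ := nodes_eq_cons e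
    exact h.fwd (n := n) (by simp only at e'; simp [e']) hn hy
  · obtain ⟨n, T, e', rfl, rfl⟩ := nodes_eq_cons e
    have hn : n ∈ S + H + M := by simp only at e'; simp [e']
    rcases Multiset.mem_add.1 hn with hn | hn
    · rcases Multiset.mem_add.1 hn with hn | hn
      · obtain ⟨S, rfl⟩ := Multiset.exists_cons_of_mem hn
        exact h.step_shared hU Set.subset_union_left Set.subset_union_right hs
      · obtain ⟨H, rfl⟩ := Multiset.exists_cons_of_mem hn
        exact h.step_hi hU Set.subset_union_left hs
    · obtain ⟨M, rfl⟩ := Multiset.exists_cons_of_mem hn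
      exact h.step_private hU Set.subset_union_left hs
  · obtain ⟨n, T, e', hn, e''⟩ := nodes_eq_cons e
    obtain ⟨p, T, rfl, rfl, rfl⟩ := nodes_eq_cons e''
    exact h.recv e' hn hs

end

/-! ### Running the programs -/

theorem ProgStep.size_lt {s s' : Split L} (h : ProgStep s s') : s'.all.size < s.all.size := by
  obtain ⟨D', h, rfl⟩ := h
  have := h.size_lt
  simp only [Split.all, Config.size_add]
  omega

theorem ProgStep.size_le {s s' : Split L} (h : Relation.ReflTransGen ProgStep s s') :
    s'.all.size ≤ s.all.size := by
  induction h with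
  | refl => exact le_rfl
  | tail _ h ih => exact h.size_lt.le.trans ih

theorem Side.Inv.poised {Δ : Ctx L} {K : Goal L} {s : Side L} (h : s.Inv ξ Δ K)
    (hst : ¬ ∃ G, ProgStep s.split G) :
    Poised s.split.all.used Δ s.split.D s.split.offD := by
  have hm : ∀ n ∈ s.S + s.H + s.M, n ∈ s.C + (s.S + s.H + s.M) + s.F := fun n hn => by
    simp only [Multiset.mem_add] at hn ⊢; tauto
  refine h.core.balD.progress (fun n hn => h.core.good.ok n (hm n hn))
    (fun n hn => h.core.good.wf (hm n hn)) ?_ (Config.finite_used _) ?_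
  · exact h.core.good.rank.imp fun r hr n hn => hr n (hm n hn)
  · rintro ⟨G, hG⟩
    exact hst ⟨_, G, hG, rfl⟩

/-- The programs run to poised configurations that are again related. -/
theorem Pair.run {Δ : Ctx L} {K : Goal L} : ∀ (N : ℕ) {s t : Side L}, Pair ξ Δ K s t →
    s.split.all.size + t.split.all.size ≤ N → ∃ s' t' : Side L, Pair ξ Δ K s' t' ∧
      ProgRun Δ s.split s'.split ∧ ProgRun Δ t.split t'.split := by
  intro N
  induction N using Nat.strong_induction_on with
  | _ N ih =>
  intro s t h hN
  by_cases hs : ∃ G, ProgStep s.split G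
  · obtain ⟨s', t', h', h₁, h₂⟩ := h.step hs
    have := h₁.size_lt
    have := ProgStep.size_le h₂
    obtain ⟨s'', t'', h'', r₁, r₂⟩ := ih (s'.split.all.size + t'.split.all.size)
      (by omega) h' le_rfl
    exact ⟨s'', t'', h'', ⟨.head h₁ r₁.1, r₁.2⟩, ⟨h₂.trans r₂.1, r₂.2⟩⟩
  by_cases ht : ∃ G, ProgStep t.split G
  · obtain ⟨t', s', h', h₁, h₂⟩ := h.symm.step ht
    have := h₁.size_lt
    have := ProgStep.size_le h₂
    obtain ⟨s'', t'', h'', r₁, r₂⟩ := ih (s'.split.all.size + t'.split.all.size)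
      (by omega) h'.symm le_rfl
    exact ⟨s'', t'', h'', ⟨h₂.trans r₁.1, r₁.2⟩, ⟨.head h₁ r₂.1, r₂.2⟩⟩
  exact ⟨s, t, h, ⟨.refl, h.left.poised hs⟩, ⟨.refl, h.right.poised ht⟩⟩

/-! ### Running the closing configurations -/

namespace Core
variable {Δ : Ctx L} {K : Goal L} {C D F : Multiset (TNode L)} {offD offF : Ctx L}

theorem Δ_le (h : Core Δ K C D F offD offF) : Δ ≤ decs C := by
  have := h.balC
  rw [Bal, zero_add] at this
  rw [← this]
  exact Multiset.le_add_left _ _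

theorem offD_le (h : Core Δ K C D F offD offF) : offD ≤ decs (C + D) := by
  have := h.balD
  rw [Bal] at this
  rw [decs_add]
  refine le_trans ?_ (add_le_add_left h.Δ_le _)
  rw [← this]
  exact Multiset.le_add_left _ _

theorem K_le (h : Core Δ K C D F offD offF) : K.ctx ≤ offD := by
  have := h.offersD
  cases K with
  | none => exact Multiset.zero_le _
  | some k => rw [show offD = {k} from this]; exact le_rfl

theorem inTree (h : Core Δ K C D F offD offF) :
    InTree Δ K ⟨nodes C, nodes D, nodes F, offD, offF⟩ := by
  obtain ⟨r, hr⟩ := h.good.rank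
  have hok := h.good.ok
  have hnd := h.good.nodup
  have okC : ∀ n ∈ C, n.Ok := fun n hn => hok n (by simp [hn])
  have okD : ∀ n ∈ D, n.Ok := fun n hn => hok n (by simp [hn])
  have okF : ∀ n ∈ F, n.Ok := fun n hn => hok n (by simp [hn])
  have rest : ∀ {V W : Ctx L}, V + W ≤ decs (C + D + F) → (V.names + W.names).Nodup := by
    intro V W hle
    rw [← Ctx.names_add]
    exact Multiset.nodup_of_le (Multiset.map_le_map hle) hnd
  refine ⟨h.offersD, h.offersF,
    ⟨h.balC.toCfgTyped (fun n hn => hr n (by simp [hn])) okC, ?_⟩,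
    ⟨h.balD.toCfgTyped (fun n hn => hr n (by simp [hn])) okD, ?_⟩,
    ⟨h.balF.toCfgTyped (fun n hn => hr n (by simp [hn])) okF, ?_⟩, ?_⟩
  · rw [← names_decs okC]
    exact rest (V := 0) (by simp only [zero_add, decs_add, add_assoc]; exact Multiset.le_add_right _ _)
  · rw [← names_decs okD]
    refine rest ((add_le_add_left h.Δ_le _).trans ?_)
    rw [decs_add, decs_add]; exact Multiset.le_add_right _ _
  · rw [← names_decs okF]
    refine rest ?_
    rw [decs_add]
    exact add_le_add_left (h.K_le.trans h.offD_le) _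
  · rw [names_decs hok] at hnd
    simpa [Split.all] using hnd

/-- Steps of the closing configurations preserve typing. -/
theorem envStep (h : Core Δ K C D F offD offF) {s' : Split L}
    (st : EnvStep Δ ⟨nodes C, nodes D, nodes F, offD, offF⟩ s') :
    ∃ C' F', s' = ⟨nodes C', nodes D, nodes F', offD, offF⟩ ∧ Core Δ K C' D F' offD offF := by
  have hU : ∀ b ∈ decs (C + D + F),
      b.ch ∈ (Split.mk (nodes C) (nodes D) (nodes F) offD offF).all.used := fun b hb => h.dec_used hb
  rcases st with ⟨G, st, rfl⟩ | ⟨G, st, rfl⟩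
  · obtain ⟨C', rfl, hB, hG⟩ := (h.good_perm (S := C) (R := D + F) (by abel)).step_part h.balC
      (by simp) (Config.finite_used _) (by rwa [← add_assoc]) st
    exact ⟨C', F, rfl, { h with good := by rwa [add_assoc], balC := hB }⟩
  · have hne : K ≠ .none := by
      intro e
      have hF : nodes F = 0 := by rw [(h.none e).1]; rfl
      simp only [hF] at st
      exact absurd st.size_lt (by simp)
    obtain ⟨F', rfl, hB, hG⟩ := (h.good_perm (S := F) (R := C + D) (by abel)).step_part h.balF
      (fun b hb => Multiset.mem_of_le (h.K_le.trans h.offD_le) hb) (Config.finite_used _)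
      (by rwa [add_comm F]) st
    exact ⟨C, F', rfl, { h with good := by rwa [add_comm], balF := hB, none := fun e => absurd e hne }⟩

theorem envSteps (h : Core Δ K C D F offD offF) {s' : Split L}
    (st : Relation.ReflTransGen (EnvStep Δ) ⟨nodes C, nodes D, nodes F, offD, offF⟩ s') :
    ∃ C' F', s' = ⟨nodes C', nodes D, nodes F', offD, offF⟩ ∧ Core Δ K C' D F' offD offF := by
  induction st with
  | refl => exact ⟨C, F, rfl, h⟩
  | tail _ st ih =>
    obtain ⟨C', F', rfl, h'⟩ := ih
    exact h'.envStep st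

end Core

theorem EnvStep.size_lt {Δ : Ctx L} {s s' : Split L} (h : EnvStep Δ s s') :
    s'.all.size < s.all.size := by
  rcases h with ⟨G, h, rfl⟩ | ⟨G, h, rfl⟩ <;>
  · have := h.size_lt
    simp only [Split.all, Config.size_add]
    omega

theorem EnvStep.size_le {Δ : Ctx L} {s s' : Split L}
    (h : Relation.ReflTransGen (EnvStep Δ) s s') : s'.all.size ≤ s.all.size := by
  induction h with
  | refl => exact le_rfl
  | tail _ h ih => exact h.size_lt.le.trans ih

theorem Core.exists_envRun {Δ : Ctx L} {K : Goal L} {D : Multiset (TNode L)} {offD offF : Ctx L} :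
    ∀ (N : ℕ) {C F : Multiset (TNode L)}, Core Δ K C D F offD offF →
      (Split.mk (nodes C) (nodes D) (nodes F) offD offF).all.size ≤ N →
      ∃ s', EnvRun Δ K ⟨nodes C, nodes D, nodes F, offD, offF⟩ s' := by
  intro N
  induction N using Nat.strong_induction_on with
  | _ N ih =>
  intro C F h hN
  by_cases hst : ∃ s', EnvStep Δ ⟨nodes C, nodes D, nodes F, offD, offF⟩ s'
  · obtain ⟨s', st⟩ := hst
    have := st.size_lt
    obtain ⟨C', F', rfl, h'⟩ := h.envStep st
    obtain ⟨s'', h''⟩ := ih _ (by omega) h' le_rfl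
    exact ⟨s'', .head st h''.1, h''.2⟩
  · have hm : ∀ n, n ∈ C ∨ n ∈ F → n ∈ C + D + F := fun n hn => by
      simp only [Multiset.mem_add]; tauto
    obtain ⟨r, hr⟩ := h.good.rank
    refine ⟨_, .refl, ?_, ?_⟩
    · refine h.balC.progress (fun n hn => h.good.ok n (hm n (.inl hn)))
        (fun n hn => h.good.wf (hm n (.inl hn))) ⟨r, fun n hn => hr n (hm n (.inl hn))⟩
        (Config.finite_used _) ?_
      rintro ⟨G, st⟩
      exact hst ⟨_, .inl ⟨G, st, rfl⟩⟩
    · refine h.balF.progress (fun n hn => h.good.ok n (hm n (.inr hn)))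
        (fun n hn => h.good.wf (hm n (.inr hn))) ⟨r, fun n hn => hr n (hm n (.inr hn))⟩
        (Config.finite_used _) ?_
      rintro ⟨G, st⟩
      exact hst ⟨_, .inr ⟨G, st, rfl⟩⟩

/-- Closing configurations that are replaced. -/
theorem Side.Inv.envRun {Δ : Ctx L} {K : Goal L} {s : Side L} (h : s.Inv ξ Δ K) {s' : Split L}
    (hr : EnvRun Δ K s.split s') :
    ∃ C' F', s' = (Side.mk C' s.S s.H s.M F' s.offD s.offF).split ∧
      Side.Inv ξ Δ K ⟨C', s.S, s.H, s.M, F', s.offD, s.offF⟩ := by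
  obtain ⟨C', F', rfl, hc⟩ := h.core.envSteps hr.1
  exact ⟨C', F', rfl, hc, h.zones, h.high⟩

/-! ### Observable messages and forwards -/

theorem TNode.ext {n₁ n₂ : TNode L} (h₁ : n₁.ctx = n₂.ctx) (h₂ : n₁.node = n₂.node)
    (h₃ : n₁.dec = n₂.dec) : n₁ = n₂ := by
  cases n₁
  cases n₂
  cases h₁
  cases h₂
  cases h₃
  rfl

theorem NodeSim.msg_eq {lo : L → Prop} {n₁ n₂ : TNode L} {m : Msg L} (h : NodeSim lo n₁ n₂)
    (hw : n₁.Wf) (e : n₁.node = .msg m) (hl : lo n₁.dec.lvl) : n₂ = n₁ := by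
  have hctx := h.ctx_eq fun b hb => by rwa [h.ok_left.msg_lvl hw e b hb]
  have hdec := h.dec_eq hl
  have hnode : n₂.node = n₁.node := by
    have hlvl := h.ok_left.msg_lvl hw e
    obtain ⟨⟨Γ, o, k⟩, f₁, f₂, hok, rfl, rfl, hf⟩ := h
    have hk : k.ch ∉ Γ.names := by
      have h₁ := hw.1
      simp only [TNode.map_ctx, TNode.map_dec, names_map] at h₁
      exact fun h => h₁ (Multiset.mem_map_of_mem f₁ h)
    replace hf : ∀ b ∈ k ::ₘ Γ, f₁ b.ch = f₂ b.ch := by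
      intro b hb
      refine hf b hb ?_
      rcases Multiset.mem_cons.1 hb with rfl | hb
      · exact hl
      · have : b.lvl = k.lvl := hlvl (b.map f₁) (Multiset.mem_map_of_mem (Decl.map f₁) hb)
        rwa [this]
    cases o with
    | proc => cases e
    | msg m =>
      cases m with
      | close c y =>
        obtain ⟨rfl, rfl⟩ := NodeOk.close_inv hok
        simp only [Multiset.forall_mem_cons] at hf
        simp [TNode.map, Node.map, Msg.map, hf.1]
      | posLab c y l u =>
        obtain ⟨I, A, hl, rfl, rfl⟩ := NodeOk.posLab_inv hok hk
        simp only [Multiset.forall_mem_cons, Multiset.mem_singleton, forall_eq] at hf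
        simp [TNode.map, Node.map, Msg.map, hf.1, hf.2]
      | negLab y l u =>
        obtain ⟨I, A, hl, c, rfl, rfl⟩ := NodeOk.negLab_inv hok hk
        simp only [Multiset.forall_mem_cons, Multiset.mem_singleton, forall_eq] at hf
        simp [TNode.map, Node.map, Msg.map, hf.1, hf.2]
      | posSend c x y u =>
        obtain ⟨A, B, rfl, rfl⟩ := NodeOk.posSend_inv hok hk
        simp only [Multiset.forall_mem_cons, Multiset.mem_singleton, forall_eq] at hf
        simp [TNode.map, Node.map, Msg.map, hf.1, hf.2.1, hf.2.2]
      | negSend x y u =>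
        obtain ⟨A, B, c, rfl, rfl⟩ := NodeOk.negSend_inv hok hk
        simp only [Multiset.forall_mem_cons, Multiset.mem_singleton, forall_eq] at hf
        simp [TNode.map, Node.map, Msg.map, hf.1, hf.2.1, hf.2.2]
  exact TNode.ext hctx hnode hdec

theorem NodeSim.fwd_eq {lo : L → Prop} {n₁ n₂ : TNode L} {y x : Chan} {c d : L}
    (h : NodeSim lo n₁ n₂) (e : n₁.node = .proc y c (.fwd (.fv y) (.fv x)) d) (hl : lo c) :
    n₂ = n₁ := by
  have hnode := h.fwd e hl
  have := h.ok_left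
  rw [TNode.Ok, e] at this
  obtain ⟨h₁, h₂⟩ := this.fwd_inv
  have hctx := h.ctx_eq (by rw [h₁]; simpa using hl)
  have hdec := h.dec_eq (by rw [h₂]; exact hl)
  exact TNode.ext hctx hnode hdec

theorem rel_cons_of_mem {S T : Multiset (TNode L)} {n : TNode L}
    (h : Multiset.Rel (NodeSim (· ≤ ξ)) S T) (hn : n ∈ S)
    (he : ∀ n', NodeSim (· ≤ ξ) n n' → n' = n) :
    ∃ S' T', S = n ::ₘ S' ∧ T = n ::ₘ T' ∧ Multiset.Rel (NodeSim (· ≤ ξ)) S' T' := by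
  obtain ⟨S, rfl⟩ := Multiset.exists_cons_of_mem hn
  obtain ⟨n', T, hs, hr, rfl⟩ := Multiset.rel_cons_left.1 h
  obtain rfl := he _ hs
  exact ⟨S, T, rfl, rfl, hr⟩

open Classical in
theorem bal_iff {Θ Θ' : Ctx L} {T : Multiset (TNode L)} : Bal Θ T Θ' ↔
    ∀ a, count a (ctxs T) + count a Θ' = count a Θ + count a (decs T) := by
  rw [Bal, Multiset.ext]
  simp only [Multiset.count_add]

theorem Bal.split_zero {Δ₁ Δ₂ : Ctx L} {C : Multiset (TNode L)} (h : Bal 0 C (Δ₁ + Δ₂)) :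
    ∃ C₁ C₂, C = C₁ + C₂ ∧ Bal 0 C₁ Δ₁ ∧ Bal 0 C₂ Δ₂ := by
  obtain ⟨C₁, C₂, Θ₁, Θ₂, rfl, e, h₁, h₂⟩ := h.split
  obtain ⟨rfl, rfl⟩ := add_eq_zero.1 e.symm
  exact ⟨C₁, C₂, rfl, h₁, h₂⟩

section
variable {Δ : Ctx L} {K : Goal L} {C S H M F : Multiset (TNode L)} {offD offF : Ctx L}
  {n p : TNode L} {s t : Side L} {m : Msg L} {b k : Decl L}

theorem Side.Inv.mem_shared_of_dec (h : Side.Inv ξ Δ K ⟨C, S, H, M, F, offD, offF⟩)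
    (hK : ∀ b ∈ K.ctx, b.lvl ≤ ξ) (hn : n ∈ S + H + M) (hk : n.dec ∈ K.ctx) : n ∈ S := by
  have hl := hK _ hk
  rcases Multiset.mem_add.1 hn with hn | hn
  · rcases Multiset.mem_add.1 hn with hn | hn
    · exact hn
    · exact absurd hk ((h.zones.hi n hn).2 hl).2
  · have := h.zones.mem_ctxs_of_mem (dec_mem_decs hn) hl
    exact absurd (by simp only [ctxs_add, Multiset.mem_add]; exact Or.inr this)
      (h.core.notMem_ctxs (h.core.goal_mem hk))

theorem Side.Inv.mem_shared_of_awaits (h : Side.Inv ξ Δ K ⟨C, S, H, M, F, offD, offF⟩)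
    (hn : n ∈ S + H + M) (e : n.node = .msg m) (hb : b ∈ n.ctx) (hΔ : b ∈ Δ) (hl : b.lvl ≤ ξ)
    (ha : Awaits b n.node) : n ∈ S := by
  have hw : n.Wf := h.core.good.wf (by simp only [Multiset.mem_add] at hn ⊢; tauto)
  rcases Multiset.mem_add.1 hn with hn | hn
  · rcases Multiset.mem_add.1 hn with hn | hn
    · exact hn
    · obtain ⟨_, _, _, _, e', -⟩ := (h.zones.hi n hn).1.run_of_awaits hw hb hl ha
      rw [e] at e'; cases e'
  · have := h.zones.mem_decs_of_mem (ctx_mem_ctxs hn hb) hl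
    exact absurd rfl (h.core.good.dec_disjoint (S := C) (R := M)
      (Multiset.le_iff_exists_add.2 ⟨S + H + F, by simp only; abel⟩)
      (h.core.mem_decs_of_mem hΔ) this)

theorem Core.eq_goal (h : Core Δ K C S F offD offF) (hk : k ∈ K.ctx) (hn : n ∈ C + S + F)
    (e : n.dec.ch = k.ch) : n.dec = k :=
  h.good.decl_eq (dec_mem_decs hn) (h.offD_mem (h.goal_mem hk)) e

theorem Core.eq_ctx (h : Core Δ K C S F offD offF) (hk : k ∈ K.ctx ∨ k ∈ Δ) (hn : n ∈ C + S + F)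
    (hb : b ∈ n.ctx) (e : b.ch = k.ch) : b = k := by
  refine h.good.decl_eq (h.good.ctx_mem hn hb) ?_ e
  rcases hk with hk | hk
  · exact h.offD_mem (h.goal_mem hk)
  · have := h.mem_decs_of_mem hk
    simp [this]

theorem Core.eq_left (h : Core Δ K C S F offD offF) (hk : k ∈ Δ) (hn : n ∈ C + S + F)
    (e : n.dec.ch = k.ch) : n.dec = k := by
  have := h.mem_decs_of_mem hk
  exact h.good.decl_eq (dec_mem_decs hn) (by simp [this]) e

/-! ### Moving the interface -/

theorem Zones.of_shared_le {K' : Goal L} {S' : Multiset (TNode L)} (h : Zones ξ K S H M)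
    (hS : S' ≤ S) (hK : ∀ k ∈ K'.ctx, k ∈ ctxs S ∨ k ∈ K.ctx) : Zones ξ K' S' H M where
  hi n hn := by
    refine ⟨(h.hi n hn).1, fun hl => ⟨fun hb => ?_, fun hb => ?_⟩⟩
    · obtain ⟨V, rfl⟩ := Multiset.le_iff_exists_add.1 hS
      exact ((h.hi n hn).2 hl).1 (by simp [hb])
    · rcases hK _ hb with h' | h'
      · exact ((h.hi n hn).2 hl).1 h'
      · exact ((h.hi n hn).2 hl).2 h'
  priv := h.priv

theorem Zones.cons_shared {K' : Goal L} (h : Zones ξ K S H M)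
    (hn : ∀ b ∈ n.ctx, b ∈ K.ctx ∨ b ∉ decs H) (hK : ∀ b ∈ K'.ctx, b ∈ K.ctx ∨ b ∉ decs H) :
    Zones ξ K' (n ::ₘ S) H M where
  hi p hp := by
    refine ⟨(h.hi p hp).1, fun hl => ⟨fun hb => ?_, fun hb => ?_⟩⟩
    · rw [ctxs_cons] at hb
      rcases Multiset.mem_add.1 hb with hb | hb
      · rcases hn _ hb with h' | h'
        · exact ((h.hi p hp).2 hl).2 h'
        · exact h' (dec_mem_decs hp)
      · exact ((h.hi p hp).2 hl).1 hb
    · rcases hK _ hb with h' | h'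
      · exact ((h.hi p hp).2 hl).2 h'
      · exact h' (dec_mem_decs hp)
  priv := h.priv

theorem Core.offD_eq (h : Core Δ (some k) C S F offD offF) : offD = {k} := h.offersD

/-- The program hands a positive message over to its client. -/
theorem Side.Inv.emit_right (h : Side.Inv ξ Δ (some n.dec) ⟨C, n ::ₘ S, H, M, F, offD, offF⟩)
    (hk : n.ctx = {k}) : Side.Inv ξ Δ (some k) ⟨C, S, H, M, n ::ₘ F, {k}, offF⟩ := by
  have hc := h.core
  have hD := hc.balD
  have hF := hc.balF
  have hoff := hc.offD_eq
  simp only at hoff hD hF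
  subst hoff
  refine ⟨⟨hc.good_perm (by simp only [← Multiset.singleton_add]; abel), hc.balC, ?_, ?_, rfl,
    hc.offersF, nofun⟩, h.zones.of_shared_le (Multiset.le_cons_self _ _) ?_, nofun⟩
  · rw [bal_iff] at hD ⊢
    intro a
    have := hD a
    simp only [ctxs_add, decs_add, ctxs_singleton, decs_singleton,
      ← Multiset.singleton_add, Multiset.count_add, Multiset.count_zero, hk] at this ⊢
    omega
  · rw [bal_iff] at hF ⊢
    intro a
    have := hF a
    simp only [Goal.ctx, ctxs_add, decs_add, ctxs_singleton, decs_singleton,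
      ← Multiset.singleton_add, Multiset.count_add, Multiset.count_zero, hk] at this ⊢
    omega
  · intro b hb
    left
    rw [ctxs_cons, hk]
    exact Multiset.mem_add.2 (Or.inl hb)

/-- The program receives a negative message from its client. -/
theorem Side.Inv.absorb_right {Γ : Ctx L}
    (h : Side.Inv ξ Δ (some k) ⟨C, S, H, M, n ::ₘ F, offD, offF⟩) (hk : n.ctx = Γ + {k}) :
    ∃ F₁ F₂, F = F₁ + F₂ ∧
      Side.Inv ξ (Γ + Δ) (some n.dec) ⟨F₁ + C, n ::ₘ S, H, M, F₂, {n.dec}, offF⟩ := by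
  have hc := h.core
  have hC := hc.balC
  have hD := hc.balD
  have hF := hc.balF
  have hoff := hc.offD_eq
  simp only at hoff hC hD hF
  subst hoff
  have hF' : Bal {n.dec} F (Γ + offF) := by
    rw [bal_iff] at hF ⊢
    intro a
    have := hF a
    simp only [Goal.ctx, ctxs_add, decs_add, ctxs_singleton, decs_singleton,
      ← Multiset.singleton_add, Multiset.count_add, Multiset.count_zero, hk] at this ⊢
    omega
  obtain ⟨F₁, F₂, Θ₁, Θ₂, rfl, e, h₁, h₂⟩ := hF'.split
  obtain ⟨r, hr⟩ := hc.good.rank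
  have hΘ : Θ₁ = 0 := by
    by_contra hne
    obtain ⟨b, hb⟩ := Multiset.exists_mem_of_ne_zero hne
    have hb' : b = n.dec := Multiset.mem_singleton.1 (e ▸ Multiset.mem_add.2 (Or.inl hb))
    subst hb'
    obtain ⟨b', hb', h₃, -⟩ := h₁.climb (r := r) (fun n hn => hr n (by simp [hn]))
      (fun n hn => hc.good.ok n (by simp [hn])) (Multiset.mem_add.2 (Or.inl hb))
    have := hr n (by simp) b' (by rw [hk]; exact Multiset.mem_add.2 (Or.inl hb'))
    omega
  subst hΘ
  rw [zero_add] at e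
  subst e
  refine ⟨F₁, F₂, rfl, ⟨hc.good_perm (by simp only [← Multiset.singleton_add]; abel), ?_, ?_, h₂,
    rfl, hc.offersF, nofun⟩, h.zones.cons_shared ?_ ?_, nofun⟩
  · rw [bal_iff] at h₁ hC ⊢
    intro a
    have e₁ := h₁ a
    have e₂ := hC a
    simp only [ctxs_add, decs_add, ctxs_singleton, decs_singleton,
      ← Multiset.singleton_add, Multiset.count_add, Multiset.count_zero] at e₁ e₂ ⊢
    omega
  · rw [bal_iff] at hD ⊢
    intro a
    have := hD a
    simp only [ctxs_add, decs_add, ctxs_singleton, decs_singleton,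
      ← Multiset.singleton_add, Multiset.count_add, Multiset.count_zero, hk] at this ⊢
    omega
  · intro b hb
    rw [hk] at hb
    rcases Multiset.mem_add.1 hb with hb | hb
    · right
      intro hb'
      have : b ∈ decs F₁ := by
        rw [Bal, zero_add] at h₁
        exact h₁ ▸ Multiset.mem_add.2 (Or.inr hb)
      exact hc.good.dec_disjoint (S := F₁) (R := H) (Multiset.le_iff_exists_add.2
        ⟨C + S + M + {n} + F₂, by simp only [← Multiset.singleton_add]; abel⟩) this hb' rfl
    · exact Or.inl hb
  · intro b hb
    right
    intro hb'
    refine hc.good.dec_disjoint (S := {n}) (R := H) (Multiset.le_iff_exists_add.2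
        ⟨C + S + M + F₁ + F₂, by simp only [← Multiset.singleton_add]; abel⟩) ?_ hb' rfl
    rw [Multiset.mem_singleton.1 hb]
    simp

/-- The program receives a positive message from a provider. -/
theorem Side.Inv.absorb_left (h : Side.Inv ξ (n.dec ::ₘ Δ) K ⟨n ::ₘ C, S, H, M, F, offD, offF⟩) :
    Side.Inv ξ (n.ctx + Δ) K ⟨C, n ::ₘ S, H, M, F, offD, offF⟩ := by
  have hc := h.core
  have hC := hc.balC
  have hD := hc.balD
  simp only at hC hD
  have hC' : Bal 0 C (n.ctx + Δ) := by
    rw [bal_iff] at hC ⊢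
    intro a
    have := hC a
    simp only [ctxs_add, decs_add, ctxs_singleton, decs_singleton,
      ← Multiset.singleton_add, Multiset.count_add, Multiset.count_zero] at this ⊢
    omega
  refine ⟨⟨hc.good_perm (by simp only [← Multiset.singleton_add]; abel), hC', ?_, hc.balF,
    hc.offersD, hc.offersF, hc.none⟩, h.zones.cons_shared ?_ (fun b hb => Or.inl hb), h.high⟩
  · rw [bal_iff] at hD ⊢
    intro a
    have := hD a
    simp only [ctxs_add, decs_add, ctxs_singleton, decs_singleton,
      ← Multiset.singleton_add, Multiset.count_add, Multiset.count_zero] at this ⊢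
    omega
  · intro b hb
    right
    intro hb'
    have : b ∈ decs C := by
      rw [Bal, zero_add] at hC'
      rw [← hC']
      simp [hb]
    exact hc.good.dec_disjoint (S := C) (R := H) (Multiset.le_iff_exists_add.2
      ⟨{n} + S + M + F, by simp only [← Multiset.singleton_add]; abel⟩) this hb' rfl

/-- The program hands a negative message over to a provider. -/
theorem Side.Inv.emit_left (h : Side.Inv ξ (k ::ₘ Δ) K ⟨C, n ::ₘ S, H, M, F, offD, offF⟩)
    (hk : n.ctx = {k}) : Side.Inv ξ (n.dec ::ₘ Δ) K ⟨n ::ₘ C, S, H, M, F, offD, offF⟩ := by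
  have hc := h.core
  have hC := hc.balC
  have hD := hc.balD
  simp only at hC hD
  refine ⟨⟨hc.good_perm (by simp only [← Multiset.singleton_add]; abel), ?_, ?_, hc.balF,
    hc.offersD, hc.offersF, hc.none⟩, h.zones.of_shared_le (Multiset.le_cons_self _ _)
      (fun b hb => Or.inr hb), h.high⟩
  · rw [bal_iff] at hC ⊢
    intro a
    have := hC a
    simp only [ctxs_add, decs_add, ctxs_singleton, decs_singleton,
      ← Multiset.singleton_add, Multiset.count_add, Multiset.count_zero, hk] at this ⊢
    omega
  · rw [bal_iff] at hD ⊢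
    intro a
    have := hD a
    simp only [ctxs_add, decs_add, ctxs_singleton, decs_singleton,
      ← Multiset.singleton_add, Multiset.count_add, Multiset.count_zero, hk] at this ⊢
    omega

end

/-! ### Messages at the interface -/

namespace TNode.Ok
variable {n : TNode L} {I : Finset Label} {A : {k // k ∈ I} → Ty} {T V : Ty} {c c' : L}
  {x y u : Chan} {l : Label}

theorem close_ctx (h : n.Ok) (e : n.node = .msg (.close c y)) : n.ctx = 0 := by
  rw [TNode.Ok, e] at h
  exact h.close_inv.1

theorem posLab_ctx (h : n.Ok) (hw : n.Wf) (e : n.node = .msg (.posLab c y l u))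
    (hd : n.dec = ⟨y, .plus I A, c'⟩) : ∃ hl : l ∈ I, n.ctx = {⟨u, A ⟨l, hl⟩, c'⟩} := by
  rw [TNode.Ok, e] at h
  obtain ⟨I', A', hl, h₁, h₂⟩ := h.posLab_inv hw.1
  rw [hd] at h₂
  simp only [Decl.mk.injEq, Ty.plus.injEq, true_and] at h₂
  obtain ⟨⟨rfl, h₂⟩, rfl⟩ := h₂
  obtain rfl := eq_of_heq h₂
  exact ⟨hl, h₁⟩

theorem negLab_ctx (h : n.Ok) (hw : n.Wf) (e : n.node = .msg (.negLab y l u))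
    (hb : ⟨y, .wth I A, c⟩ ∈ n.ctx) :
    ∃ hl : l ∈ I, n.ctx = {⟨y, .wth I A, c⟩} ∧ n.dec = ⟨u, A ⟨l, hl⟩, c⟩ := by
  rw [TNode.Ok, e] at h
  obtain ⟨I', A', hl, c', h₁, h₂⟩ := h.negLab_inv hw.1
  rw [h₁] at hb
  simp only [Multiset.mem_singleton, Decl.mk.injEq, Ty.wth.injEq, true_and] at hb
  obtain ⟨⟨rfl, h₃⟩, rfl⟩ := hb
  obtain rfl := eq_of_heq h₃
  exact ⟨hl, h₁, h₂⟩

theorem posSend_ctx (h : n.Ok) (hw : n.Wf) (e : n.node = .msg (.posSend c x y u))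
    (hd : n.dec = ⟨y, .tensor T V, c'⟩) : n.ctx = {⟨x, T, c'⟩} + {⟨u, V, c'⟩} := by
  rw [TNode.Ok, e] at h
  obtain ⟨T', V', h₁, h₂⟩ := h.posSend_inv hw.1
  rw [hd] at h₂
  simp only [Decl.mk.injEq, Ty.tensor.injEq, true_and] at h₂
  obtain ⟨⟨rfl, rfl⟩, rfl⟩ := h₂
  rw [h₁, Multiset.singleton_add]

theorem negSend_ctx (h : n.Ok) (hw : n.Wf) (e : n.node = .msg (.negSend x y u))
    (hb : ⟨y, .lolli T V, c⟩ ∈ n.ctx) :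
    n.ctx = {⟨x, T, c⟩} + {⟨y, .lolli T V, c⟩} ∧ n.dec = ⟨u, V, c⟩ := by
  rw [TNode.Ok, e] at h
  obtain ⟨T', V', c', h₁, h₂⟩ := h.negSend_inv hw.1
  have hb' : (⟨y, .lolli T V, c⟩ : Decl L) = ⟨y, .lolli T' V', c'⟩ :=
    Ctx.eq_of_nodup hw.2 hb (by rw [h₁]; simp) rfl
  simp only [Decl.mk.injEq, Ty.lolli.injEq, true_and] at hb'
  obtain ⟨⟨rfl, rfl⟩, rfl⟩ := hb'
  exact ⟨by rw [h₁, Multiset.singleton_add], h₂⟩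

end TNode.Ok

section
variable {Δ : Ctx L} {K : Goal L} {C S H M F : Multiset (TNode L)} {offD offF : Ctx L}
  {n p : TNode L} {s t : Side L} {m : Msg L} {k x : Decl L}

/-- The program has a message or a forward ready for its client. -/
theorem Pair.take_right (h : Pair ξ Δ (some k) s t) {o : Node L} (ho : o ∈ s.split.D)
    (hk : o.provided = k.ch)
    (hm : (∃ m, o = .msg m) ∨ ∃ x d, o = .proc k.ch k.lvl (.fwd (.fv k.ch) (.fv x)) d) :
    ∃ n S T, n.node = o ∧ n.dec = k ∧ n.Ok ∧ n.Wf ∧ s.S = n ::ₘ S ∧ t.S = n ::ₘ T ∧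
      Multiset.Rel (NodeSim (· ≤ ξ)) S T := by
  obtain ⟨n, hn, rfl⟩ := Multiset.mem_map.1 ho
  have hn' : n ∈ s.C + (s.S + s.H + s.M) + s.F := by
    simp only [Multiset.mem_add] at hn ⊢; tauto
  have hok := h.left.core.good.ok n hn'
  have hw := h.left.core.good.wf hn'
  have hd : n.dec = k := h.left.core.eq_goal (Multiset.mem_singleton_self k) hn'
    (hok.provided.symm.trans hk)
  have hS : n ∈ s.S := h.left.mem_shared_of_dec h.lowK hn (by rw [hd]; exact Multiset.mem_singleton_self k)
  have hl : k.lvl ≤ ξ := h.lowK k (Multiset.mem_singleton_self k)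
  obtain ⟨S, T, h₁, h₂, h₃⟩ := rel_cons_of_mem h.rel hS fun n' hs => by
    rcases hm with ⟨m, e⟩ | ⟨x, d, e⟩
    · exact hs.msg_eq hw e (by rwa [hd])
    · exact hs.fwd_eq e hl
  exact ⟨n, S, T, rfl, hd, hok, hw, h₁, h₂, h₃⟩

/-- The program has a message ready for one of its providers. -/
theorem Pair.take_left (h : Pair ξ Δ K s t) (hm : .msg m ∈ s.split.D) (hk : k ∈ Δ)
    (ha : (Node.msg m).Attempts k.ch) :
    ∃ n S T, n.node = .msg m ∧ k ∈ n.ctx ∧ n.Ok ∧ n.Wf ∧ s.S = n ::ₘ S ∧ t.S = n ::ₘ T ∧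
      Multiset.Rel (NodeSim (· ≤ ξ)) S T := by
  obtain ⟨n, hn, e⟩ := Multiset.mem_map.1 hm
  have hn' : n ∈ s.C + (s.S + s.H + s.M) + s.F := by
    simp only [Multiset.mem_add] at hn ⊢; tauto
  have hok := h.left.core.good.ok n hn'
  have hw := h.left.core.good.wf hn'
  have hl := h.lowΔ k hk
  rw [← e] at ha
  rcases hok.msg_cases hw e with h' | ⟨b, hb, h'⟩
  · refine absurd (ha.unique h'.attempts) (h.left.core.good.dec_disjoint (S := s.C)
      (R := s.S + s.H + s.M) (Multiset.le_add_right _ _) (h.left.core.mem_decs_of_mem hk)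
      (dec_mem_decs hn))
  · obtain rfl := h.left.core.eq_ctx (.inr hk) hn' hb (h'.attempts.unique ha)
    have hS : n ∈ s.S := h.left.mem_shared_of_awaits hn e hb hk hl h'
    obtain ⟨S, T, h₁, h₂, h₃⟩ := rel_cons_of_mem h.rel hS fun n' hs =>
      hs.msg_eq hw e (by rwa [← hok.msg_lvl hw e _ hb])
    exact ⟨n, S, T, e, hb, hok, hw, h₁, h₂, h₃⟩

/-- The client has a message ready for the program. -/
theorem Core.take_client (h : Core Δ K C S F offD offF) (hm : .msg m ∈ nodes F) (hk : k ∈ K.ctx)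
    (ha : (Node.msg m).Attempts k.ch) :
    ∃ n F', n.node = .msg m ∧ k ∈ n.ctx ∧ n.Ok ∧ n.Wf ∧ F = n ::ₘ F' := by
  obtain ⟨n, hn, e⟩ := Multiset.mem_map.1 hm
  have hn' : n ∈ C + S + F := by simp [hn]
  have hok := h.good.ok n hn'
  have hw := h.good.wf hn'
  rw [← e] at ha
  rcases hok.msg_cases hw e with h' | ⟨b, hb, h'⟩
  · exact absurd (ha.unique h'.attempts) (h.good.dec_disjoint (S := C + S) (R := F) le_rfl
      (Multiset.mem_of_le (h.K_le.trans h.offD_le) hk) (dec_mem_decs hn))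
  · obtain rfl := h.eq_ctx (.inl hk) hn' hb (h'.attempts.unique ha)
    obtain ⟨F', rfl⟩ := Multiset.exists_cons_of_mem hn
    exact ⟨n, F', e, hb, hok, hw, rfl⟩

/-- A provider has a message or a forward ready for the program. -/
theorem Core.take_provider (h : Core Δ K C S F offD offF) {o : Node L} (ho : o ∈ nodes C)
    (hk : k ∈ Δ) (hp : o.provided = k.ch) :
    ∃ n C', n.node = o ∧ n.dec = k ∧ n.Ok ∧ n.Wf ∧ C = n ::ₘ C' := by
  obtain ⟨n, hn, rfl⟩ := Multiset.mem_map.1 ho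
  have hn' : n ∈ C + S + F := by simp [hn]
  have hok := h.good.ok n hn'
  obtain ⟨C', rfl⟩ := Multiset.exists_cons_of_mem hn
  exact ⟨n, C', rfl, h.eq_left hk hn' (hok.provided.symm.trans hp), hok, h.good.wf hn', rfl⟩

/-! ### The subtree of a channel that is sent -/

theorem Side.Inv.extract (h : Side.Inv ξ Δ K ⟨C, n ::ₘ S, H, M, F, offD, offF⟩)
    {T : Multiset (TNode L)} (hrel : Multiset.Rel (NodeSim (· ≤ ξ)) S T) (hx : x ∈ n.ctx)
    (hxl : x.lvl ≤ ξ) {Δ' A B : Ctx L}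
    (e : ctxs S + {x} + A = Δ' + decs S + (decs H + decs M + B)) (hB : ∀ b ∈ B, b = n.dec) :
    ∃ (S₁ R₁ S₂ R₂ : Multiset (TNode L)) (Δ₁ Δ₂ : Ctx L), S = S₁ + R₁ ∧ T = S₂ + R₂ ∧
      Δ' = Δ₁ + Δ₂ ∧ Multiset.Rel (NodeSim (· ≤ ξ)) S₁ S₂ ∧ Multiset.Rel (NodeSim (· ≤ ξ)) R₁ R₂ ∧
      Bal Δ₁ S₁ {x} ∧ Bal Δ₁ S₂ {x} := by
  obtain ⟨r, hr⟩ := h.core.good.rank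
  have hG := h.core.good
  have key : ∀ b ∈ ctxs (n ::ₘ S), b.lvl ≤ ξ ∧ r b.ch < r n.dec.ch →
      b ∉ decs H + decs M + B := by
    rintro b hb ⟨hl, hlt⟩ hb'
    rcases Multiset.mem_add.1 hb' with hb' | hb'
    · rcases Multiset.mem_add.1 hb' with hb' | hb'
      · obtain ⟨p, hp, rfl⟩ := mem_decs.1 hb'
        exact ((h.zones.hi p hp).2 hl).1 hb
      · exact hG.ctx_disjoint (S := n ::ₘ S) (R := M) (Multiset.le_iff_exists_add.2
          ⟨C + H + F, by simp only; abel⟩) hb (h.zones.mem_ctxs_of_mem hb' hl) rfl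
    · rw [hB b hb'] at hlt
      exact lt_irrefl _ hlt
  have hrel' : Multiset.Rel (fun n₁ n₂ => NodeSim (· ≤ ξ) n₁ n₂ ∧ n₁ ∈ S) S T :=
    hrel.mono fun n₁ h₁ _ _ hs => ⟨hs, h₁⟩
  have hΞ : ∀ b ∈ ({x} : Ctx L), (b.lvl ≤ ξ ∧ r b.ch < r n.dec.ch) ∧
      b ∉ decs H + decs M + B := by
    intro b hb
    obtain rfl := Multiset.mem_singleton.1 hb
    have hlo : b.lvl ≤ ξ ∧ r b.ch < r n.dec.ch := ⟨hxl, hr n (by simp) b hx⟩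
    exact ⟨hlo, key b (by simp [hx]) hlo⟩
  obtain ⟨S₁, R₁, S₂, R₂, Δ₁, Δ₂, h₁, h₂, h₃, h₄, h₅, h₆, h₇⟩ :=
    extract_joint (lo := fun b => b.lvl ≤ ξ ∧ r b.ch < r n.dec.ch)
      (fun n₁ n₂ ⟨hs, hn₁⟩ ⟨hl, hlt⟩ =>
        have hle : ∀ b ∈ n₁.ctx, b.lvl ≤ ξ := fun b hb => (hs.ok_left.lvl_le hb).trans hl
        ⟨hs.dec_eq hl, hs.ctx_eq hle, fun b hb =>
          ⟨hle b hb, (hr n₁ (by simp [hn₁]) b hb).trans hlt⟩⟩)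
      A (decs H + decs M + B) S T {x} Δ' e hΞ (fun b hb => key b (by simp [hb])) hrel'
  exact ⟨S₁, R₁, S₂, R₂, Δ₁, Δ₂, h₁, h₂, h₃, h₄.mono fun _ _ _ _ h => h.1,
    h₅.mono fun _ _ _ _ h => h.1, h₆, h₇⟩

theorem Core.subtree (h : Core Δ K C M F offD offF) {C₁ S₁ F' : Multiset (TNode L)} {Δ₁ : Ctx L}
    (e : C + M + F = C₁ + S₁ + F') (hC : Bal 0 C₁ Δ₁) (hS : Bal Δ₁ S₁ {x}) :
    ∃ Γ, Side.Inv ξ Δ₁ (some x) ⟨C₁, S₁, 0, 0, F', {x}, Γ⟩ := by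
  obtain ⟨Γ, hΓ, hB⟩ : ∃ Γ, Goal.Offers .none Γ ∧ Bal 0 (C + M + F) Γ := by
    have h₁ := h.balC
    have h₂ := h.balD
    have h₃ := h.balF
    have h₄ := h.offersD
    cases K with
    | none =>
      obtain ⟨rfl, -⟩ := h.none rfl
      refine ⟨offD, h₄, ?_⟩
      rw [bal_iff] at h₁ h₂ ⊢
      intro a
      have e₁ := h₁ a
      have e₂ := h₂ a
      simp only [ctxs_add, decs_add, add_zero, Multiset.count_add] at e₁ e₂ ⊢
      omega
    | some k =>
      replace h₄ : offD = {k} := h₄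
      refine ⟨offF, h.offersF, ?_⟩
      rw [bal_iff] at h₁ h₂ h₃ ⊢
      intro a
      have e₁ := h₁ a
      have e₂ := h₂ a
      have e₃ := h₃ a
      simp only [ctxs_add, decs_add, Multiset.count_add, Multiset.count_zero, h₄, Goal.ctx]
        at e₁ e₂ e₃ ⊢
      omega
  rw [e] at hB
  refine ⟨Γ, ⟨?_, hC, by simpa using hS, ?_, rfl, hΓ, nofun⟩, ⟨by simp, rfl⟩, nofun⟩
  · simp only [add_zero]
    exact h.good_perm e
  · rw [bal_iff] at hC hS hB ⊢
    intro a
    have e₁ := hC a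
    have e₂ := hS a
    have e₃ := hB a
    simp only [ctxs_add, decs_add, Multiset.count_add, Multiset.count_zero, Goal.ctx]
      at e₁ e₂ e₃ ⊢
    omega

/-- The program hands a sent channel and its continuation over to its client. -/
theorem Side.Inv.emit_right_send {R : Multiset (TNode L)} {Δ₁ Δ₂ : Ctx L}
    (h : Side.Inv ξ (Δ₁ + Δ₂) (some n.dec) ⟨C, n ::ₘ (S + R), H, M, F, offD, offF⟩)
    (hk : n.ctx = {x} + {k}) (hS : Bal Δ₁ S {x}) :
    (∃ C₁ F₁ Γ, Side.Inv ξ Δ₁ (some x) ⟨C₁, S, 0, 0, F₁, {x}, Γ⟩ ∧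
      C₁ + S + F₁ = C + (n ::ₘ (S + R) + H + M) + F) ∧
    ∃ C₂ F₂, Side.Inv ξ Δ₂ (some k) ⟨C₂, R, H, M, F₂, {k}, offF⟩ ∧
      C₂ + (R + H + M) + F₂ = C + (n ::ₘ (S + R) + H + M) + F := by
  have hc := h.core
  obtain ⟨C₁, C₂, rfl, h₁, h₂⟩ := hc.balC.split_zero
  constructor
  · have e : C₁ + C₂ + (n ::ₘ (S + R) + H + M) + F =
      C₁ + S + (C₂ + n ::ₘ R + H + M + F) := by
      simp only [← Multiset.singleton_add]; abel
    obtain ⟨Γ, h'⟩ := hc.subtree (ξ := ξ) e h₁ hS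
    exact ⟨_, _, Γ, h', e.symm⟩
  · have e : C₁ + C₂ + (n ::ₘ (S + R) + H + M) + F =
      C₂ + (R + H + M) + (C₁ + S + n ::ₘ F) := by
      simp only [← Multiset.singleton_add]; abel
    have hD := hc.balD
    have hF := hc.balF
    have hoff := hc.offD_eq
    simp only at hoff hD hF
    subst hoff
    refine ⟨_, _, ⟨⟨hc.good_perm e, h₂, ?_, ?_, rfl, hc.offersF, nofun⟩,
      h.zones.of_shared_le ?_ ?_, nofun⟩, e.symm⟩
    · rw [bal_iff] at hD hS ⊢
      intro a
      have e₁ := hD a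
      have e₂ := hS a
      simp only [ctxs_add, decs_add, ctxs_singleton, decs_singleton, ← Multiset.singleton_add,
        Multiset.count_add, Multiset.count_zero, hk] at e₁ e₂ ⊢
      omega
    · rw [bal_iff] at hF hS h₁ ⊢
      intro a
      have e₁ := hF a
      have e₂ := hS a
      have e₃ := h₁ a
      simp only [Goal.ctx, ctxs_add, decs_add, ctxs_singleton, decs_singleton,
        ← Multiset.singleton_add, Multiset.count_add, Multiset.count_zero, hk] at e₁ e₂ e₃ ⊢
      omega
    · exact (Multiset.le_add_left _ _).trans (Multiset.le_cons_self _ _)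
    · intro b hb
      left
      rw [ctxs_cons, hk]
      exact Multiset.mem_add.2 (.inl (Multiset.mem_add.2 (.inr hb)))

/-- The program hands a sent channel and its continuation over to a provider. -/
theorem Side.Inv.emit_left_send {R : Multiset (TNode L)} {Δ₁ Δ₂ : Ctx L}
    (h : Side.Inv ξ (k ::ₘ (Δ₁ + Δ₂)) K ⟨C, n ::ₘ (S + R), H, M, F, offD, offF⟩)
    (hk : n.ctx = {x} + {k}) (hS : Bal Δ₁ S {x}) :
    (∃ C₁ F₁ Γ, Side.Inv ξ Δ₁ (some x) ⟨C₁, S, 0, 0, F₁, {x}, Γ⟩ ∧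
      C₁ + S + F₁ = C + (n ::ₘ (S + R) + H + M) + F) ∧
    ∃ C₂, Side.Inv ξ (n.dec ::ₘ Δ₂) K ⟨C₂, R, H, M, F, offD, offF⟩ ∧
      C₂ + (R + H + M) + F = C + (n ::ₘ (S + R) + H + M) + F := by
  have hc := h.core
  have hC : Bal 0 C (Δ₁ + k ::ₘ Δ₂) := by rw [Multiset.add_cons]; exact hc.balC
  obtain ⟨C₁, C₂, rfl, h₁, h₂⟩ := hC.split_zero
  constructor
  · have e : C₁ + C₂ + (n ::ₘ (S + R) + H + M) + F =
      C₁ + S + (C₂ + n ::ₘ R + H + M + F) := by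
      simp only [← Multiset.singleton_add]; abel
    obtain ⟨Γ, h'⟩ := hc.subtree (ξ := ξ) e h₁ hS
    exact ⟨_, _, Γ, h', e.symm⟩
  · have e : C₁ + C₂ + (n ::ₘ (S + R) + H + M) + F =
      (C₁ + C₂ + n ::ₘ S) + (R + H + M) + F := by
      simp only [← Multiset.singleton_add]; abel
    have hD := hc.balD
    simp only at hD
    refine ⟨_, ⟨⟨hc.good_perm e, ?_, ?_, hc.balF, hc.offersD, hc.offersF, hc.none⟩,
      h.zones.of_shared_le ?_ (fun b hb => .inr hb), h.high⟩, e.symm⟩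
    · rw [bal_iff] at h₁ h₂ hS ⊢
      intro a
      have e₁ := h₁ a
      have e₂ := h₂ a
      have e₃ := hS a
      simp only [ctxs_add, decs_add, ctxs_singleton, decs_singleton, ← Multiset.singleton_add,
        Multiset.count_add, Multiset.count_zero, hk] at e₁ e₂ e₃ ⊢
      omega
    · rw [bal_iff] at hD hS ⊢
      intro a
      have e₁ := hD a
      have e₂ := hS a
      simp only [ctxs_add, decs_add, ctxs_singleton, decs_singleton, ← Multiset.singleton_add,
        Multiset.count_add, Multiset.count_zero, hk] at e₁ e₂ ⊢
      omega
    · exact (Multiset.le_add_left _ _).trans (Multiset.le_cons_self _ _)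

end

/-! ### Forwards at the interface -/

theorem Bal.map {Θ Θ' : Ctx L} {T : Multiset (TNode L)} (h : Bal Θ T Θ') (f : Chan → Chan) :
    Bal (Θ.map (Decl.map f)) (T.map (TNode.map f)) (Θ'.map (Decl.map f)) := by
  rw [Bal, ctxs_map, decs_map, ← Multiset.map_add, ← Multiset.map_add, h]

theorem Goal.Offers.map {K : Goal L} {Γ : Ctx L} (h : K.Offers Γ) (y x : Chan) :
    (K.rename y x).Offers (Γ.map (Decl.map (Chan.rename y x))) := by
  cases K with
  | none =>
    rcases h with rfl | ⟨z, c, rfl⟩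
    · exact .inl rfl
    · exact .inr ⟨_, c, rfl⟩
  | some k =>
    obtain rfl : Γ = {k} := h
    exact Multiset.map_singleton _ _

theorem Goal.ctx_rename (K : Goal L) (y x : Chan) :
    (K.rename y x).ctx = K.ctx.map (Decl.map (Chan.rename y x)) := by
  cases K <;> rfl

theorem Decl.map_rename_target (y x : Chan) (A : Ty) (c : L) :
    Decl.map (Chan.rename y x) (⟨x, A, c⟩ : Decl L) = ⟨x, A, c⟩ := by
  refine Decl.ext' ?_ rfl rfl
  by_cases e : x = y
  · simp [e]
  · exact Chan.rename_of_ne _ e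

theorem Decl.map_rename_source (y x : Chan) (A : Ty) (c : L) :
    Decl.map (Chan.rename y x) (⟨y, A, c⟩ : Decl L) = ⟨x, A, c⟩ := by simp

section
variable {Δ : Ctx L} {K : Goal L} {C S H M F : Multiset (TNode L)} {offD offF : Ctx L}
  {n : TNode L} {y x : Chan} {T : Ty} {c : L}

theorem Side.Inv.fwd_right
    (h : Side.Inv ξ Δ (some ⟨y, T, c⟩) ⟨C, n ::ₘ S, H, M, F, offD, offF⟩)
    (h₁ : n.ctx = {⟨x, T, c⟩}) (h₂ : n.dec = ⟨y, T, c⟩) :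
    Side.Inv ξ Δ (some ⟨x, T, c⟩) ⟨C.map (TNode.map (Chan.rename y x)),
      S.map (TNode.map (Chan.rename y x)), H.map (TNode.map (Chan.rename y x)),
      M.map (TNode.map (Chan.rename y x)), F.map (TNode.map (Chan.rename y x)), {⟨x, T, c⟩},
      offF.map (Decl.map (Chan.rename y x))⟩ := by
  have hc := h.core
  have hD := hc.balD
  have hF := hc.balF.map (Chan.rename y x)
  have hoff := hc.offD_eq
  simp only at hoff hD hF
  subst hoff
  have hG := hc.good_perm (S := n ::ₘ (C + S + H + M + F)) (R := 0)
    (by simp only [← Multiset.singleton_add, add_zero]; abel)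
  have hne : ∀ {p : TNode L}, p ∈ C + S + H + M + F →
      p.dec.map (Chan.rename y x) = p.dec := fun {p} hp => by
    refine Decl.map_rename_of_ne fun e => ?_
    rw [add_zero] at hG
    refine hG.dec_disjoint (S := {n}) (R := C + S + H + M + F) ?_ (b := n.dec) (by simp)
      (dec_mem_decs hp) (by rw [h₂, e])
    rw [Multiset.singleton_add]
  have hΔ : Δ.map (Decl.map (Chan.rename y x)) = Δ := by
    conv_rhs => rw [← Multiset.map_id Δ]
    refine Multiset.map_congr rfl fun b hb => ?_
    obtain ⟨p, hp, rfl⟩ := mem_decs.1 (hc.mem_decs_of_mem hb)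
    exact hne (by simp [hp])
  have hD' : Bal Δ (S + H + M) {⟨x, T, c⟩} := by
    rw [bal_iff] at hD ⊢
    intro a
    have := hD a
    simp only [ctxs_add, decs_add, ctxs_singleton, decs_singleton, ← Multiset.singleton_add,
      Multiset.count_add, h₁, h₂] at this ⊢
    omega
  refine ⟨⟨?_, ?_, ?_, ?_, rfl, hc.offersF.map y x, nofun⟩, ?_, nofun⟩
  · have := hG.contract h₁ h₂ (by simp [Ctx.names])
    simp only [Multiset.map_add, add_zero] at this ⊢
    rwa [← add_assoc, ← add_assoc]
  · have := hc.balC.map (Chan.rename y x)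
    rwa [hΔ] at this
  · have := hD'.map (Chan.rename y x)
    rwa [hΔ, Multiset.map_singleton, Decl.map_rename_target, Multiset.map_add,
      Multiset.map_add] at this
  · simpa [Goal.ctx] using hF
  · have hz := Zones.contract (g := Chan.rename y x) (S' := S) h.zones.hi
      (fun p hp => hne (by simp [hp])) ?_ (congrArg _ h.zones.priv)
    · refine ⟨fun p hp => ⟨(hz.hi p hp).1, fun hl => ⟨((hz.hi p hp).2 hl).1, fun hb => ?_⟩⟩,
        hz.priv⟩
      obtain ⟨p, hpH, rfl⟩ := Multiset.mem_map.1 hp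
      have hb' : (p.map (Chan.rename y x)).dec = ⟨x, T, c⟩ := Multiset.mem_singleton.1 hb
      rw [TNode.map_dec, hne (by simp [hpH])] at hb' hl
      exact ((h.zones.hi p hpH).2 hl).1 (by simp [hb', h₁])
    · intro b hb hl
      by_cases e : b.ch = y
      · have : b = n.dec := hG.decl_eq (Multiset.mem_of_le hG.closed (by simp [hb])) (by simp)
          (by rw [h₂, e])
        rw [this, h₂, Decl.map_rename_source, ctxs_cons, h₁]
        simp
      · rw [Decl.map_rename_of_ne e]
        simp [hb]

theorem Side.Inv.fwd_left
    (h : Side.Inv ξ (⟨y, T, c⟩ ::ₘ Δ) K ⟨n ::ₘ C, S, H, M, F, offD, offF⟩)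
    (h₁ : n.ctx = {⟨x, T, c⟩}) (h₂ : n.dec = ⟨y, T, c⟩) :
    Side.Inv ξ (⟨x, T, c⟩ ::ₘ Δ) (K.rename y x) ⟨C.map (TNode.map (Chan.rename y x)),
      S.map (TNode.map (Chan.rename y x)), H.map (TNode.map (Chan.rename y x)),
      M.map (TNode.map (Chan.rename y x)), F.map (TNode.map (Chan.rename y x)),
      offD.map (Decl.map (Chan.rename y x)), offF.map (Decl.map (Chan.rename y x))⟩ := by
  have hc := h.core
  have hC := hc.balC
  have hD := hc.balD.map (Chan.rename y x)
  have hF := hc.balF.map (Chan.rename y x)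
  simp only at hC hD hF
  have hG := hc.good_perm (S := n ::ₘ (C + S + H + M + F)) (R := 0)
    (by simp only [← Multiset.singleton_add, add_zero]; abel)
  have hne' : ∀ {p : TNode L}, p ∈ C + S + H + M + F → p.dec.ch ≠ y := fun {p} hp e => by
    rw [add_zero] at hG
    refine hG.dec_disjoint (S := {n}) (R := C + S + H + M + F) ?_ (b := n.dec) (by simp)
      (dec_mem_decs hp) (by rw [h₂, e])
    rw [Multiset.singleton_add]
  have hne : ∀ {p : TNode L}, p ∈ C + S + H + M + F →
      p.dec.map (Chan.rename y x) = p.dec := fun hp => Decl.map_rename_of_ne (hne' hp)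
  have hC' : Bal 0 C (⟨x, T, c⟩ ::ₘ Δ) := by
    rw [bal_iff] at hC ⊢
    intro a
    have := hC a
    simp only [ctxs_add, decs_add, ctxs_singleton, decs_singleton, ← Multiset.singleton_add,
      Multiset.count_add, h₁, h₂] at this ⊢
    omega
  have mem_C : ∀ b ∈ (⟨x, T, c⟩ : Decl L) ::ₘ Δ, b ∈ decs C := fun b hb => by
    rw [Bal, zero_add] at hC'
    rw [← hC']
    exact Multiset.mem_add.2 (.inr hb)
  have hΔ : Δ.map (Decl.map (Chan.rename y x)) = Δ := by
    conv_rhs => rw [← Multiset.map_id Δ]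
    refine Multiset.map_congr rfl fun b hb => ?_
    obtain ⟨p, hp, rfl⟩ := mem_decs.1 (mem_C b (Multiset.mem_cons_of_mem hb))
    exact hne (by simp [hp])
  have target : ∀ {p : TNode L}, p ∈ H → ∀ {b : Decl L}, b.map (Chan.rename y x) = p.dec →
      b = p.dec ∨ b.ch = y ∧ p.dec.ch = x := by
    intro p hp b e
    by_cases e' : b.ch = y
    · right
      refine ⟨e', ?_⟩
      rw [← e]
      show Chan.rename y x b.ch = x
      rw [e', Chan.rename_self]
    · left
      rwa [Decl.map_rename_of_ne e'] at e
  have x_H : ∀ {p : TNode L}, p ∈ H → p.dec.ch ≠ x := fun {p} hp e =>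
    hc.good.dec_disjoint (S := C) (R := H) (Multiset.le_iff_exists_add.2
      ⟨{n} + S + M + F, by simp only [← Multiset.singleton_add]; abel⟩)
      (mem_C _ (Multiset.mem_cons_self _ _)) (dec_mem_decs hp) e.symm
  refine ⟨⟨?_, ?_, ?_, ?_, hc.offersD.map y x, hc.offersF.map y x, ?_⟩,
    Zones.contract (S := S.map (TNode.map (Chan.rename y x))) ?_ (fun p hp => hne (by simp [hp])) ?_
      (congrArg _ h.zones.priv), ?_⟩
  · have := hG.contract h₁ h₂ (by simp [Ctx.names])
    simp only [Multiset.map_add, add_zero] at this ⊢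
    rwa [← add_assoc, ← add_assoc]
  · have := hC'.map (Chan.rename y x)
    rwa [Multiset.map_cons, hΔ, Decl.map_rename_target] at this
  · rwa [Multiset.map_cons, hΔ, Decl.map_rename_source, Multiset.map_add,
      Multiset.map_add] at hD
  · rwa [Goal.ctx_rename]
  · intro e
    have : K = none := by cases K; rfl; cases e
    obtain ⟨rfl, rfl⟩ := hc.none this
    exact ⟨rfl, rfl⟩
  · intro p hp
    refine ⟨(h.zones.hi p hp).1, fun hl => ⟨fun hb => ?_, fun hb => ?_⟩⟩
    · rw [ctxs_map] at hb
      obtain ⟨b, hb, e⟩ := Multiset.mem_map.1 hb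
      rcases target hp e with rfl | ⟨-, e⟩
      · exact ((h.zones.hi p hp).2 hl).1 hb
      · exact x_H hp e
    · rw [Goal.ctx_rename] at hb
      obtain ⟨b, hb, e⟩ := Multiset.mem_map.1 hb
      rcases target hp e with rfl | ⟨-, e⟩
      · exact ((h.zones.hi p hp).2 hl).2 hb
      · exact x_H hp e
  · intro b hb _
    rw [ctxs_map]
    exact Multiset.mem_map_of_mem _ hb
  · intro e b hb
    have : K = none := by cases K; rfl; cases e
    obtain ⟨b, hb', rfl⟩ := Multiset.mem_map.1 hb
    exact h.high this b hb'

/-- A program that has closed is the closing message. -/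
theorem Side.Inv.closed (h : Side.Inv ξ Δ (some n.dec) ⟨C, n ::ₘ S, H, M, F, offD, offF⟩)
    (hn : n.ctx = 0) : Δ = 0 ∧ C = 0 ∧ S + H + M = 0 := by
  have hc := h.core
  have hC := hc.balC
  have hD := hc.balD
  have hoff := hc.offD_eq
  simp only at hoff hC hD
  subst hoff
  have hD' : Bal Δ (S + H + M) 0 := by
    rw [bal_iff] at hD ⊢
    intro a
    have := hD a
    simp only [ctxs_add, decs_add, ctxs_singleton, decs_singleton, ← Multiset.singleton_add,
      Multiset.count_add, hn, Multiset.count_zero] at this ⊢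
    omega
  obtain ⟨r, hr⟩ := hc.good.rank
  obtain ⟨rfl, h₀⟩ := hD'.eq_zero (r := r)
    (fun p hp => hr p (by simp only [Multiset.mem_add, Multiset.mem_cons] at hp ⊢; tauto))
    (fun p hp => hc.good.ok p (by simp only [Multiset.mem_add, Multiset.mem_cons] at hp ⊢; tauto))
  exact ⟨rfl, (hC.eq_zero (r := r) (fun p hp => hr p (by simp [hp]))
    (fun p hp => hc.good.ok p (by simp [hp]))).2, h₀⟩

end

/-! ### Related configurations -/

/-- `B₁` and `B₂` have splittings that share their observable nodes. -/
def Linked (ξ : L) : Rel L := fun Δ K B₁ B₂ =>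
  ∃ s t : Side L, Pair ξ Δ K s t ∧ s.split.all = B₁ ∧ t.split.all = B₂

theorem Linked.symm {Δ : Ctx L} {K : Goal L} {B₁ B₂ : Config L} (h : Linked ξ Δ K B₁ B₂) :
    Linked ξ Δ K B₂ B₁ := by
  obtain ⟨s, t, h, h₁, h₂⟩ := h
  exact ⟨t, s, h.symm, h₂, h₁⟩

theorem Side.split_all (s : Side L) : s.split.all = nodes (s.C + (s.S + s.H + s.M) + s.F) := by
  simp only [Side.split, Split.all, nodes_add]

theorem Linked.of {Δ : Ctx L} {K : Goal L} {s t s' t' : Side L} (h : Pair ξ Δ K s' t')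
    (hs : s'.C + (s'.S + s'.H + s'.M) + s'.F = s.C + (s.S + s.H + s.M) + s.F)
    (ht : t'.C + (t'.S + t'.H + t'.M) + t'.F = t.C + (t.S + t.H + t.M) + t.F) :
    Linked ξ Δ K s.split.all t.split.all :=
  ⟨s', t', h, by rw [Side.split_all, Side.split_all, hs], by rw [Side.split_all, Side.split_all, ht]⟩

section
variable {Δ : Ctx L} {K : Goal L} {s t : Side L} {y x u : Chan} {c d : L} {I : Finset Label}
  {A : {k // k ∈ I} → Ty} {T V : Ty} {l : Label}

theorem Pair.right_one (h : Pair ξ Δ (some ⟨y, .one, c⟩) s t) (hm : .msg (.close c y) ∈ s.split.D) :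
    Δ = 0 ∧ s.split.C = 0 ∧ t.split.C = 0 ∧ s.split.D = {.msg (.close c y)} ∧
      t.split.D = {.msg (.close c y)} := by
  obtain ⟨n, S₁, S₂, e, hd, hok, hw, h₁, h₂, hr⟩ := h.take_right hm rfl (.inl ⟨_, rfl⟩)
  obtain ⟨C, S, H, M, F, offD, offF⟩ := s
  obtain ⟨C', S', H', M', F', offD', offF'⟩ := t
  simp only at h₁ h₂
  subst h₁ h₂
  rw [← hd] at h
  obtain ⟨h₀, h₁, h₂⟩ := h.left.closed (hok.close_ctx e)
  obtain ⟨-, h₃, h₄⟩ := h.right.closed (hok.close_ctx e)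
  refine ⟨h₀, by rw [Side.split, h₁]; rfl, by rw [Side.split, h₃]; rfl, ?_, ?_⟩
  · rw [Side.split, Multiset.cons_add, Multiset.cons_add, h₂]
    simp [e]
  · rw [Side.split, Multiset.cons_add, Multiset.cons_add, h₄]
    simp [e]

theorem Pair.right_plus (h : Pair ξ Δ (some ⟨y, .plus I A, c⟩) s t)
    (hm : .msg (.posLab c y l u) ∈ s.split.D) : .msg (.posLab c y l u) ∈ t.split.D ∧
      ∃ hl : l ∈ I, Linked ξ Δ (some ⟨u, A ⟨l, hl⟩, c⟩) s.split.all t.split.all := by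
  obtain ⟨n, S₁, S₂, e, hd, hok, hw, h₁, h₂, hr⟩ := h.take_right hm rfl (.inl ⟨_, rfl⟩)
  obtain ⟨C, S, H, M, F, offD, offF⟩ := s
  obtain ⟨C', S', H', M', F', offD', offF'⟩ := t
  simp only at h₁ h₂
  subst h₁ h₂
  obtain ⟨hl, hctx⟩ := hok.posLab_ctx hw e hd
  have hK := h.lowK _ (Multiset.mem_singleton_self _)
  rw [← hd] at h
  refine ⟨by simp [Side.split, e], hl, .of ⟨h.lowΔ, ?_, h.left.emit_right hctx,
    h.right.emit_right hctx, hr⟩ ?_ ?_⟩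
  · intro b hb
    obtain rfl := Multiset.mem_singleton.1 hb
    exact hK
  all_goals simp only [← Multiset.singleton_add]; abel

theorem Pair.right_tensor (h : Pair ξ Δ (some ⟨y, .tensor T V, c⟩) s t)
    (hm : .msg (.posSend c x y u) ∈ s.split.D) : .msg (.posSend c x y u) ∈ t.split.D ∧
      ∃ Δ' Δ'', Δ = Δ' + Δ'' ∧ Linked ξ Δ'' (some ⟨x, T, c⟩) s.split.all t.split.all ∧
        Linked ξ Δ' (some ⟨u, V, c⟩) s.split.all t.split.all := by
  obtain ⟨n, S₁, S₂, e, hd, hok, hw, h₁, h₂, hr⟩ := h.take_right hm rfl (.inl ⟨_, rfl⟩)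
  obtain ⟨C, S, H, M, F, offD, offF⟩ := s
  obtain ⟨C', S', H', M', F', offD', offF'⟩ := t
  simp only at h₁ h₂
  subst h₁ h₂
  have hctx := hok.posSend_ctx hw e hd
  have hK : c ≤ ξ := h.lowK _ (Multiset.mem_singleton_self _)
  rw [← hd] at h
  have hD := h.left.core.balD
  have hoff := h.left.core.offD_eq
  simp only at hoff hD
  obtain ⟨S₁, R₁, S₂, R₂, Δ₁, Δ₂, rfl, rfl, rfl, hS, hR, b₁, b₂⟩ := h.left.extract hr
    (x := ⟨x, T, c⟩) (Δ' := Δ) (A := ctxs H + ctxs M + {⟨u, V, c⟩}) (B := 0)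
    (by rw [hctx]; simp) hK (by
      classical
      ext a
      have := congrArg (count a) hD
      simp only [ctxs_add, decs_add, ctxs_singleton, decs_singleton, ← Multiset.singleton_add,
        Multiset.count_add, Multiset.count_zero, hctx, hoff] at this ⊢
      omega) (by simp)
  obtain ⟨⟨_, _, _, i₁, e₁⟩, _, _, j₁, f₁⟩ := h.left.emit_right_send hctx b₁
  obtain ⟨⟨_, _, _, i₂, e₂⟩, _, _, j₂, f₂⟩ := h.right.emit_right_send hctx b₂
  refine ⟨by simp [Side.split, e], Δ₂, Δ₁, add_comm _ _,
    .of ⟨fun b hb => h.lowΔ b (by simp [hb]), ?_, i₁, i₂, hS⟩ ?_ ?_,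
    .of ⟨fun b hb => h.lowΔ b (by simp [hb]), ?_, j₁, j₂, hR⟩ f₁ f₂⟩
  · intro b hb
    obtain rfl := Multiset.mem_singleton.1 hb
    exact hK
  · simpa only [add_zero] using e₁
  · simpa only [add_zero] using e₂
  · intro b hb
    obtain rfl := Multiset.mem_singleton.1 hb
    exact hK

theorem Pair.right_wth (h : Pair ξ Δ (some ⟨y, .wth I A, c⟩) s t)
    (hs : .msg (.negLab y l u) ∈ s.split.F) (ht : .msg (.negLab y l u) ∈ t.split.F) :
    ∃ hl : l ∈ I, Linked ξ Δ (some ⟨u, A ⟨l, hl⟩, c⟩) s.split.all t.split.all := by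
  obtain ⟨n, F₁, e₁, m₁, ok₁, w₁, rfl'⟩ := h.left.core.take_client hs
    (Multiset.mem_singleton_self _) rfl
  obtain ⟨n', F₂, e₂, m₂, ok₂, w₂, rfl''⟩ := h.right.core.take_client ht
    (Multiset.mem_singleton_self _) rfl
  obtain ⟨hl, c₁, d₁⟩ := ok₁.negLab_ctx w₁ e₁ m₁
  obtain ⟨_, c₂, d₂⟩ := ok₂.negLab_ctx w₂ e₂ m₂
  obtain rfl : n = n' := TNode.ext (c₁.trans c₂.symm) (e₁.trans e₂.symm) (d₁.trans d₂.symm)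
  obtain ⟨C, S, H, M, F, offD, offF⟩ := s
  obtain ⟨C', S', H', M', F', offD', offF'⟩ := t
  simp only at rfl' rfl''
  subst rfl' rfl''
  obtain ⟨G₁, F₁, rfl, i₁⟩ := h.left.absorb_right (Γ := 0) (c₁.trans (zero_add _).symm)
  obtain ⟨G₂, F₂, rfl, i₂⟩ := h.right.absorb_right (Γ := 0) (c₁.trans (zero_add _).symm)
  rw [zero_add] at i₁ i₂
  rw [d₁] at i₁ i₂
  refine ⟨hl, .of ⟨h.lowΔ, ?_, i₁, i₂, .cons (.refl ok₁) h.rel⟩ ?_ ?_⟩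
  · intro b hb
    obtain rfl := Multiset.mem_singleton.1 hb
    exact h.lowK ⟨y, _, c⟩ (Multiset.mem_singleton_self _)
  all_goals simp only [← Multiset.singleton_add]; abel

theorem Pair.right_lolli (h : Pair ξ Δ (some ⟨y, .lolli T V, c⟩) s t)
    (hs : .msg (.negSend x y u) ∈ s.split.F) (ht : .msg (.negSend x y u) ∈ t.split.F) :
    Linked ξ (⟨x, T, c⟩ ::ₘ Δ) (some ⟨u, V, c⟩) s.split.all t.split.all := by
  obtain ⟨n, F₁, e₁, m₁, ok₁, w₁, rfl'⟩ := h.left.core.take_client hs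
    (Multiset.mem_singleton_self _) rfl
  obtain ⟨n', F₂, e₂, m₂, ok₂, w₂, rfl''⟩ := h.right.core.take_client ht
    (Multiset.mem_singleton_self _) rfl
  obtain ⟨c₁, d₁⟩ := ok₁.negSend_ctx w₁ e₁ m₁
  obtain ⟨c₂, d₂⟩ := ok₂.negSend_ctx w₂ e₂ m₂
  obtain rfl : n = n' := TNode.ext (c₁.trans c₂.symm) (e₁.trans e₂.symm) (d₁.trans d₂.symm)
  obtain ⟨C, S, H, M, F, offD, offF⟩ := s
  obtain ⟨C', S', H', M', F', offD', offF'⟩ := t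
  simp only at rfl' rfl''
  subst rfl' rfl''
  have hK : c ≤ ξ := h.lowK _ (Multiset.mem_singleton_self _)
  obtain ⟨G₁, F₁, rfl, i₁⟩ := h.left.absorb_right c₁
  obtain ⟨G₂, F₂, rfl, i₂⟩ := h.right.absorb_right c₁
  rw [d₁, Multiset.singleton_add] at i₁ i₂
  refine .of ⟨?_, ?_, i₁, i₂, .cons (.refl ok₁) h.rel⟩ ?_ ?_
  · simpa only [Multiset.forall_mem_cons] using ⟨hK, h.lowΔ⟩
  · intro b hb
    obtain rfl := Multiset.mem_singleton.1 hb
    exact hK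
  all_goals simp only [← Multiset.singleton_add]; abel

theorem Pair.right_fwd (h : Pair ξ Δ (some ⟨y, T, c⟩) s t)
    (hm : .proc y c (.fwd (.fv y) (.fv x)) d ∈ s.split.D) : ∃ D₁ D₂,
      s.split.D = .proc y c (.fwd (.fv y) (.fv x)) d ::ₘ D₁ ∧
      t.split.D = .proc y c (.fwd (.fv y) (.fv x)) d ::ₘ D₂ ∧
      Linked ξ Δ (some ⟨x, T, c⟩) (Config.rename y x (s.split.C + D₁ + s.split.F))
        (Config.rename y x (t.split.C + D₂ + t.split.F)) := by
  obtain ⟨n, S₁, S₂, e, hd, hok, hw, h₁, h₂, hr⟩ := h.take_right hm rfl (.inr ⟨_, _, rfl⟩)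
  obtain ⟨C, S, H, M, F, offD, offF⟩ := s
  obtain ⟨C', S', H', M', F', offD', offF'⟩ := t
  simp only at h₁ h₂
  subst h₁ h₂
  have hctx : n.ctx = {⟨x, T, c⟩} := by
    rw [TNode.Ok, e] at hok
    rw [hok.fwd_inv.1, hd]
  refine ⟨nodes (S₁ + H + M), nodes (S₂ + H' + M'), by simp [Side.split, e],
    by simp [Side.split, e], _, _,
    ⟨h.lowΔ, ?_, h.left.fwd_right hctx hd, h.right.fwd_right hctx hd, rel_map hr _⟩, ?_, ?_⟩
  · intro b hb
    obtain rfl := Multiset.mem_singleton.1 hb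
    exact h.lowK ⟨y, _, c⟩ (Multiset.mem_singleton_self _)
  all_goals
    rw [Side.split_all]
    simp only [Side.split, ← nodes_add, ← nodes_contract, Multiset.map_add]

/-! ### Left -/

theorem Pair.left_absorb {n : TNode L} {C C' : Multiset (TNode L)}
    (h : Pair ξ (n.dec ::ₘ Δ) K s t) (hs : s.C = n ::ₘ C) (ht : t.C = n ::ₘ C') (hok : n.Ok) :
    Linked ξ (n.ctx + Δ) K s.split.all t.split.all := by
  obtain ⟨C₁, S, H, M, F, offD, offF⟩ := s
  obtain ⟨C₂, S', H', M', F', offD', offF'⟩ := t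
  simp only at hs ht
  subst hs ht
  refine .of ⟨?_, h.lowK, h.left.absorb_left, h.right.absorb_left, .cons (.refl hok) h.rel⟩ ?_ ?_
  · intro b hb
    rcases Multiset.mem_add.1 hb with hb | hb
    · exact (hok.lvl_le hb).trans (h.lowΔ _ (Multiset.mem_cons_self _ _))
    · exact h.lowΔ b (Multiset.mem_cons_of_mem hb)
  all_goals simp only [← Multiset.singleton_add]; abel

theorem Pair.left_one (h : Pair ξ (⟨y, .one, c⟩ ::ₘ Δ) K s t)
    (hs : .msg (.close c y) ∈ s.split.C) (ht : .msg (.close c y) ∈ t.split.C) :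
    Linked ξ Δ K s.split.all t.split.all := by
  obtain ⟨n, F₁, e₁, d₁, ok₁, w₁, h₁⟩ := h.left.core.take_provider hs
    (Multiset.mem_cons_self _ _) rfl
  obtain ⟨n', F₂, e₂, d₂, ok₂, w₂, h₂⟩ := h.right.core.take_provider ht
    (Multiset.mem_cons_self _ _) rfl
  have c₁ := ok₁.close_ctx e₁
  have c₂ := ok₂.close_ctx e₂
  obtain rfl : n = n' := TNode.ext (c₁.trans c₂.symm) (e₁.trans e₂.symm) (d₁.trans d₂.symm)
  rw [← d₁] at h
  have := h.left_absorb h₁ h₂ ok₁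
  rwa [c₁, zero_add] at this

theorem Pair.left_plus (h : Pair ξ (⟨y, .plus I A, c⟩ ::ₘ Δ) K s t)
    (hs : .msg (.posLab c y l u) ∈ s.split.C) (ht : .msg (.posLab c y l u) ∈ t.split.C) :
    ∃ hl : l ∈ I, Linked ξ (⟨u, A ⟨l, hl⟩, c⟩ ::ₘ Δ) K s.split.all t.split.all := by
  obtain ⟨n, F₁, e₁, d₁, ok₁, w₁, h₁⟩ := h.left.core.take_provider hs
    (Multiset.mem_cons_self _ _) rfl
  obtain ⟨n', F₂, e₂, d₂, ok₂, w₂, h₂⟩ := h.right.core.take_provider ht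
    (Multiset.mem_cons_self _ _) rfl
  obtain ⟨hl, c₁⟩ := ok₁.posLab_ctx w₁ e₁ d₁
  obtain ⟨_, c₂⟩ := ok₂.posLab_ctx w₂ e₂ d₂
  obtain rfl : n = n' := TNode.ext (c₁.trans c₂.symm) (e₁.trans e₂.symm) (d₁.trans d₂.symm)
  rw [← d₁] at h
  have := h.left_absorb h₁ h₂ ok₁
  rw [c₁, Multiset.singleton_add] at this
  exact ⟨hl, this⟩

theorem Pair.left_tensor (h : Pair ξ (⟨y, .tensor T V, c⟩ ::ₘ Δ) K s t)
    (hs : .msg (.posSend c x y u) ∈ s.split.C) (ht : .msg (.posSend c x y u) ∈ t.split.C) :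
    Linked ξ (⟨x, T, c⟩ ::ₘ ⟨u, V, c⟩ ::ₘ Δ) K s.split.all t.split.all := by
  obtain ⟨n, F₁, e₁, d₁, ok₁, w₁, h₁⟩ := h.left.core.take_provider hs
    (Multiset.mem_cons_self _ _) rfl
  obtain ⟨n', F₂, e₂, d₂, ok₂, w₂, h₂⟩ := h.right.core.take_provider ht
    (Multiset.mem_cons_self _ _) rfl
  have c₁ := ok₁.posSend_ctx w₁ e₁ d₁
  have c₂ := ok₂.posSend_ctx w₂ e₂ d₂
  obtain rfl : n = n' := TNode.ext (c₁.trans c₂.symm) (e₁.trans e₂.symm) (d₁.trans d₂.symm)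
  rw [← d₁] at h
  have := h.left_absorb h₁ h₂ ok₁
  rwa [c₁, add_assoc, Multiset.singleton_add, Multiset.singleton_add] at this

theorem Pair.left_wth (h : Pair ξ (⟨y, .wth I A, c⟩ ::ₘ Δ) K s t)
    (hm : .msg (.negLab y l u) ∈ s.split.D) : .msg (.negLab y l u) ∈ t.split.D ∧
      ∃ hl : l ∈ I, Linked ξ (⟨u, A ⟨l, hl⟩, c⟩ ::ₘ Δ) K s.split.all t.split.all := by
  obtain ⟨n, S₁, S₂, e, hd, hok, hw, h₁, h₂, hr⟩ := h.take_left hm (Multiset.mem_cons_self _ _) rfl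
  obtain ⟨C, S, H, M, F, offD, offF⟩ := s
  obtain ⟨C', S', H', M', F', offD', offF'⟩ := t
  simp only at h₁ h₂
  subst h₁ h₂
  obtain ⟨hl, hctx, hdec⟩ := hok.negLab_ctx hw e hd
  refine ⟨by simp [Side.split, e], hl, ?_⟩
  rw [← hdec]
  refine .of ⟨?_, h.lowK, h.left.emit_left hctx, h.right.emit_left hctx, hr⟩ ?_ ?_
  · rw [hdec]
    have := h.lowΔ
    simp only [Multiset.forall_mem_cons] at this ⊢
    exact this
  all_goals simp only [← Multiset.singleton_add]; abel

theorem Pair.left_lolli (h : Pair ξ (⟨y, .lolli T V, c⟩ ::ₘ Δ) K s t)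
    (hm : .msg (.negSend x y u) ∈ s.split.D) : .msg (.negSend x y u) ∈ t.split.D ∧
      ∃ Δ' Δ'', Δ = Δ' + Δ'' ∧ Linked ξ Δ'' (some ⟨x, T, c⟩) s.split.all t.split.all ∧
        Linked ξ (⟨u, V, c⟩ ::ₘ Δ') K s.split.all t.split.all := by
  obtain ⟨n, S₁, S₂, e, hd, hok, hw, h₁, h₂, hr⟩ := h.take_left hm (Multiset.mem_cons_self _ _) rfl
  obtain ⟨C, S, H, M, F, offD, offF⟩ := s
  obtain ⟨C', S', H', M', F', offD', offF'⟩ := t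
  simp only at h₁ h₂
  subst h₁ h₂
  obtain ⟨hctx, hdec⟩ := hok.negSend_ctx hw e hd
  have hK : c ≤ ξ := h.lowΔ _ (Multiset.mem_cons_self _ _)
  have hD := h.left.core.balD
  simp only at hD
  obtain ⟨S₁, R₁, S₂, R₂, Δ₁, Δ₂, rfl, rfl, rfl, hS, hR, b₁, b₂⟩ := h.left.extract hr
    (x := ⟨x, T, c⟩) (Δ' := Δ) (A := ctxs H + ctxs M + offD) (B := {n.dec})
    (by rw [hctx]; simp) hK (by
      classical
      ext a
      have := congrArg (count a) hD
      simp only [ctxs_add, decs_add, ctxs_singleton, decs_singleton, ← Multiset.singleton_add,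
        Multiset.count_add, Multiset.count_zero, hctx] at this ⊢
      omega) (by simp)
  obtain ⟨⟨_, _, _, i₁, e₁⟩, _, j₁, f₁⟩ := h.left.emit_left_send hctx b₁
  obtain ⟨⟨_, _, _, i₂, e₂⟩, _, j₂, f₂⟩ := h.right.emit_left_send hctx b₂
  rw [hdec] at j₁ j₂
  refine ⟨by simp [Side.split, e], Δ₂, Δ₁, add_comm _ _,
    .of ⟨fun b hb => h.lowΔ b (by simp [hb]), ?_, i₁, i₂, hS⟩ ?_ ?_,
    .of ⟨?_, h.lowK, j₁, j₂, hR⟩ f₁ f₂⟩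
  · intro b hb
    obtain rfl := Multiset.mem_singleton.1 hb
    exact hK
  · simpa only [add_zero] using e₁
  · simpa only [add_zero] using e₂
  · simp only [Multiset.forall_mem_cons]
    exact ⟨hK, fun b hb => h.lowΔ b (by simp [hb])⟩

theorem Pair.left_fwd (h : Pair ξ (⟨y, T, c⟩ ::ₘ Δ) K s t) {d₁ d₂ : L} {C₁ C₂ : Config L}
    (hs : s.split.C = .proc y c (.fwd (.fv y) (.fv x)) d₁ ::ₘ C₁)
    (ht : t.split.C = .proc y c (.fwd (.fv y) (.fv x)) d₂ ::ₘ C₂) :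
    Linked ξ (⟨x, T, c⟩ ::ₘ Δ) (Goal.rename y x K)
      (Config.rename y x (C₁ + s.split.D + s.split.F))
      (Config.rename y x (C₂ + t.split.D + t.split.F)) := by
  have inv : ∀ {s : Side L} {d : L} {C : Config L}, s.Inv ξ (⟨y, T, c⟩ ::ₘ Δ) K →
      s.split.C = .proc y c (.fwd (.fv y) (.fv x)) d ::ₘ C →
      ∃ s' : Side L, s'.Inv ξ (⟨x, T, c⟩ ::ₘ Δ) (K.rename y x) ∧
        s'.S = s.S.map (TNode.map (Chan.rename y x)) ∧
        s'.split.all = Config.rename y x (C + s.split.D + s.split.F) := by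
    intro s d C h hs
    obtain ⟨n, C', e, hd, hok, hw, h₁⟩ := h.core.take_provider
      (o := .proc y c (.fwd (.fv y) (.fv x)) d) (by
        show _ ∈ s.split.C
        rw [hs]; exact Multiset.mem_cons_self _ _) (Multiset.mem_cons_self _ _) rfl
    obtain ⟨C₀, S, H, M, F, offD, offF⟩ := s
    simp only at h₁
    subst h₁
    have hctx : n.ctx = {⟨x, T, c⟩} := by
      rw [TNode.Ok, e] at hok
      rw [hok.fwd_inv.1, hd]
    have hC : nodes C' = C := by
      rw [Side.split, nodes_cons, e] at hs
      exact (Multiset.cons_inj_right _).1 hs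
    refine ⟨_, h.fwd_left hctx hd, rfl, ?_⟩
    rw [Side.split_all]
    simp only [Side.split, ← hC, ← nodes_add, ← nodes_contract, Multiset.map_add]
  obtain ⟨s', i₁, r₁, e₁⟩ := inv h.left hs
  obtain ⟨t', i₂, r₂, e₂⟩ := inv h.right ht
  refine ⟨s', t', ⟨?_, ?_, i₁, i₂, ?_⟩, e₁, e₂⟩
  · have := h.lowΔ
    simp only [Multiset.forall_mem_cons] at this ⊢
    exact this
  · intro b hb
    rw [Goal.ctx_rename] at hb
    obtain ⟨b, hb', rfl⟩ := Multiset.mem_map.1 hb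
    exact h.lowK b hb'
  · rw [r₁, r₂]
    exact rel_map h.rel _

end

/-! ### The measure -/

def Ty.weight : Ty → ℕ
  | .one => 1
  | .plus I A => 1 + ∑ k : {k // k ∈ I}, (A k).weight
  | .wth I A => 1 + ∑ k : {k // k ∈ I}, (A k).weight
  | .tensor A B => 1 + A.weight + B.weight
  | .lolli A B => 1 + A.weight + B.weight

theorem Ty.weight_le_sum {I : Finset Label} (A : {k // k ∈ I} → Ty) (k : {k // k ∈ I}) :
    (A k).weight ≤ ∑ k : {k // k ∈ I}, (A k).weight :=
  Finset.single_le_sum (f := fun k => (A k).weight) (fun _ _ => Nat.zero_le _) (Finset.mem_univ k)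

def Ctx.weight (Δ : Ctx L) : ℕ := (Δ.map fun b => b.ty.weight).sum

theorem Ctx.weight_cons (b : Decl L) (Δ : Ctx L) :
    Ctx.weight (b ::ₘ Δ) = b.ty.weight + Δ.weight := by simp [Ctx.weight]

theorem Ctx.weight_add (Γ Δ : Ctx L) : Ctx.weight (Γ + Δ) = Γ.weight + Δ.weight := by
  simp [Ctx.weight]

def Goal.weight (K : Goal L) : ℕ := (K.map fun k => k.ty.weight).getD 0

theorem Goal.weight_some (k : Decl L) : Goal.weight (some k) = k.ty.weight := rfl

theorem Goal.weight_rename (y x : Chan) (K : Goal L) : (K.rename y x).weight = K.weight := by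
  cases K <;> rfl

def weight (Δ : Ctx L) (K : Goal L) (B₁ B₂ : Config L) : ℕ :=
  B₁.size + B₂.size + Ctx.weight Δ + K.weight

theorem Config.size_rename (y x : Chan) (C : Config L) : (C.rename y x).size = C.size := by
  rw [Config.rename_eq, Config.size_map]

/-- Linked configurations of smaller weight. -/
def LinkedBelow (ξ : L) (N : ℕ) : Rel L := fun Δ K B₁ B₂ =>
  Linked ξ Δ K B₁ B₂ ∧ weight Δ K B₁ B₂ < N

section
variable {Δ : Ctx L} {K : Goal L} {s t : Side L} {y : Chan} {T : Ty} {c : L}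

theorem Pair.rightRel (h : Pair ξ Δ (some ⟨y, T, c⟩) s t) :
    RightRel (LinkedBelow ξ (weight Δ (some ⟨y, T, c⟩) s.split.all t.split.all)) Δ y T c
      s.split t.split := by
  constructor
  · cases T with
    | one =>
      rintro (hm | hm)
      · exact h.right_one hm
      · obtain ⟨h₀, h₁, h₂, h₃, h₄⟩ := h.symm.right_one hm
        exact ⟨h₀, h₂, h₁, h₄, h₃⟩
    | plus I A =>
      have key : ∀ k u, .msg (.posLab c y k u) ∈ s.split.D → .msg (.posLab c y k u) ∈ t.split.D →
          .msg (.posLab c y k u) ∈ s.split.D ∧ .msg (.posLab c y k u) ∈ t.split.D ∧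
          ∃ h : k ∈ I, LinkedBelow ξ (weight Δ (some ⟨y, .plus I A, c⟩) s.split.all t.split.all) Δ
            (some ⟨u, A ⟨k, h⟩, c⟩) s.split.all t.split.all := by
        intro k u hm hm'
        obtain ⟨-, hk, hl⟩ := h.right_plus hm
        refine ⟨hm, hm', hk, hl, ?_⟩
        have := Ty.weight_le_sum A ⟨k, hk⟩
        simp only [weight, Goal.weight_some, Ty.weight]
        omega
      rintro k u (hm | hm)
      · exact key k u hm (h.right_plus hm).1
      · exact key k u (h.symm.right_plus hm).1 hm
    | wth I A =>
      intro k u hm hm'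
      obtain ⟨hk, hl⟩ := h.right_wth hm hm'
      refine ⟨hk, hl, ?_⟩
      have := Ty.weight_le_sum A ⟨k, hk⟩
      simp only [weight, Goal.weight_some, Ty.weight]
      omega
    | tensor A B =>
      have key : ∀ x u, .msg (.posSend c x y u) ∈ s.split.D →
          .msg (.posSend c x y u) ∈ t.split.D →
          .msg (.posSend c x y u) ∈ s.split.D ∧ .msg (.posSend c x y u) ∈ t.split.D ∧
          ∃ Δ' Δ'', Δ = Δ' + Δ'' ∧
            LinkedBelow ξ (weight Δ (some ⟨y, .tensor A B, c⟩) s.split.all t.split.all) Δ''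
              (some ⟨x, A, c⟩) s.split.all t.split.all ∧
            LinkedBelow ξ (weight Δ (some ⟨y, .tensor A B, c⟩) s.split.all t.split.all) Δ'
              (some ⟨u, B, c⟩) s.split.all t.split.all := by
        intro x u hm hm'
        obtain ⟨-, Δ', Δ'', rfl, h₁, h₂⟩ := h.right_tensor hm
        refine ⟨hm, hm', Δ', Δ'', rfl, ⟨h₁, ?_⟩, h₂, ?_⟩ <;>
        · simp only [weight, Goal.weight_some, Ty.weight, Ctx.weight_add]
          omega
      rintro x u (hm | hm)
      · exact key x u hm (h.right_tensor hm).1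
      · exact key x u (h.symm.right_tensor hm).1 hm
    | lolli A B =>
      intro x u hm hm'
      refine ⟨h.right_lolli hm hm', ?_⟩
      simp only [weight, Goal.weight_some, Ty.weight, Ctx.weight_cons]
      omega
  · have small : ∀ {x d D₁ D₂ T}, s.split.D = .proc y c (.fwd (.fv y) (.fv x)) d ::ₘ D₁ →
        t.split.D = .proc y c (.fwd (.fv y) (.fv x)) d ::ₘ D₂ →
        weight Δ (some ⟨x, T, c⟩) (Config.rename y x (s.split.C + D₁ + s.split.F))
          (Config.rename y x (t.split.C + D₂ + t.split.F)) <
        weight Δ (some ⟨y, T, c⟩) s.split.all t.split.all := by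
      intro x d D₁ D₂ T e₁ e₂
      simp only [weight, Config.size_rename, Split.all, e₁, e₂, Config.size_add, Config.size_cons,
        Node.size, Proc.size, Goal.weight_some]
      omega
    rintro x (⟨d, hm⟩ | ⟨d, hm⟩)
    · obtain ⟨D₁, D₂, e₁, e₂, hl⟩ := h.right_fwd hm
      exact ⟨d, d, D₁, D₂, e₁, e₂, hl, small e₁ e₂⟩
    · obtain ⟨D₂, D₁, e₂, e₁, hl⟩ := h.symm.right_fwd hm
      exact ⟨d, d, D₁, D₂, e₁, e₂, hl.symm, small e₁ e₂⟩

theorem Pair.leftRel (h : Pair ξ (⟨y, T, c⟩ ::ₘ Δ) K s t) :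
    LeftRel (LinkedBelow ξ (weight (⟨y, T, c⟩ ::ₘ Δ) K s.split.all t.split.all)) Δ K y T c
      s.split t.split := by
  constructor
  · cases T with
    | one =>
      intro hm hm'
      refine ⟨h.left_one hm hm', ?_⟩
      simp only [weight, Ty.weight, Ctx.weight_cons]
      omega
    | plus I A =>
      intro k u hm hm'
      obtain ⟨hk, hl⟩ := h.left_plus hm hm'
      refine ⟨hk, hl, ?_⟩
      have := Ty.weight_le_sum A ⟨k, hk⟩
      simp only [weight, Ty.weight, Ctx.weight_cons]
      omega
    | wth I A =>
      have key : ∀ k u, .msg (.negLab y k u) ∈ s.split.D → .msg (.negLab y k u) ∈ t.split.D →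
          .msg (.negLab y k u) ∈ s.split.D ∧ .msg (.negLab y k u) ∈ t.split.D ∧
          ∃ h : k ∈ I, LinkedBelow ξ (weight (⟨y, .wth I A, c⟩ ::ₘ Δ) K s.split.all t.split.all)
            (⟨u, A ⟨k, h⟩, c⟩ ::ₘ Δ) K s.split.all t.split.all := by
        intro k u hm hm'
        obtain ⟨-, hk, hl⟩ := h.left_wth hm
        refine ⟨hm, hm', hk, hl, ?_⟩
        have := Ty.weight_le_sum A ⟨k, hk⟩
        simp only [weight, Ty.weight, Ctx.weight_cons]
        omega
      rintro k u (hm | hm)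
      · exact key k u hm (h.left_wth hm).1
      · exact key k u (h.symm.left_wth hm).1 hm
    | tensor A B =>
      intro x u hm hm'
      refine ⟨h.left_tensor hm hm', ?_⟩
      simp only [weight, Ty.weight, Ctx.weight_cons]
      omega
    | lolli A B =>
      have key : ∀ x u, .msg (.negSend x y u) ∈ s.split.D → .msg (.negSend x y u) ∈ t.split.D →
          .msg (.negSend x y u) ∈ s.split.D ∧ .msg (.negSend x y u) ∈ t.split.D ∧
          ∃ Δ' Δ'', Δ = Δ' + Δ'' ∧
            LinkedBelow ξ (weight (⟨y, .lolli A B, c⟩ ::ₘ Δ) K s.split.all t.split.all) Δ''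
              (some ⟨x, A, c⟩) s.split.all t.split.all ∧
            LinkedBelow ξ (weight (⟨y, .lolli A B, c⟩ ::ₘ Δ) K s.split.all t.split.all)
              (⟨u, B, c⟩ ::ₘ Δ') K s.split.all t.split.all := by
        intro x u hm hm'
        obtain ⟨-, Δ', Δ'', rfl, h₁, h₂⟩ := h.left_lolli hm
        refine ⟨hm, hm', Δ', Δ'', rfl, ⟨h₁, ?_⟩, h₂, ?_⟩ <;>
        · simp only [weight, Goal.weight_some, Ty.weight, Ctx.weight_add, Ctx.weight_cons]
          omega
      rintro x u (hm | hm)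
      · exact key x u hm (h.left_lolli hm).1
      · exact key x u (h.symm.left_lolli hm).1 hm
  · intro x d₁ d₂ C₁ C₂ e₁ e₂
    refine ⟨h.left_fwd e₁ e₂, ?_⟩
    simp only [weight, Config.size_rename, Split.all, e₁, e₂, Config.size_add, Config.size_cons,
      Node.size, Proc.size, Goal.weight_rename, Ctx.weight_cons]
    omega

theorem Pair.valRel (h : Pair ξ Δ K s t) :
    ValRel (LinkedBelow ξ (weight Δ K s.split.all t.split.all)) Δ K s.split t.split := by
  refine ⟨h.left.core.inTree, h.right.core.inTree, ?_, ?_⟩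
  · rintro y T c rfl
    exact h.rightRel
  · rintro y T c Δ₀ rfl
    exact h.leftRel

end

theorem ValRel.mono {R R' : Rel L} (hR : ∀ Δ K B₁ B₂, R Δ K B₁ B₂ → R' Δ K B₁ B₂) {Δ : Ctx L}
    {K : Goal L} {s t : Split L} (h : ValRel R Δ K s t) : ValRel R' Δ K s t := by
  obtain ⟨h₁, h₂, h₃, h₄⟩ := h
  refine ⟨h₁, h₂, fun y T c e => ?_, fun y T c Δ₀ e => ?_⟩
  · obtain ⟨h₅, h₆⟩ := h₃ y T c e
    refine ⟨?_, fun x hx => ?_⟩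
    · cases T with
      | one => exact h₅
      | plus => exact fun k u hm => (h₅ k u hm).imp_right (.imp_right fun ⟨hk, h⟩ => ⟨hk, hR _ _ _ _ h⟩)
      | wth => exact fun k u hm hm' => (h₅ k u hm hm').imp fun _ => hR _ _ _ _
      | tensor =>
        intro x u hm
        obtain ⟨m₁, m₂, Δ', Δ'', e, r₁, r₂⟩ := h₅ x u hm
        exact ⟨m₁, m₂, Δ', Δ'', e, hR _ _ _ _ r₁, hR _ _ _ _ r₂⟩
      | lolli => exact fun x u hm hm' => hR _ _ _ _ (h₅ x u hm hm')
    · obtain ⟨d₁, d₂, D₁, D₂, e₁, e₂, r⟩ := h₆ x hx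
      exact ⟨d₁, d₂, D₁, D₂, e₁, e₂, hR _ _ _ _ r⟩
  · obtain ⟨h₅, h₆⟩ := h₄ y T c Δ₀ e
    refine ⟨?_, fun x d₁ d₂ C₁ C₂ e₁ e₂ => hR _ _ _ _ (h₆ x d₁ d₂ C₁ C₂ e₁ e₂)⟩
    cases T with
    | one => exact fun hm hm' => hR _ _ _ _ (h₅ hm hm')
    | plus => exact fun k u hm hm' => (h₅ k u hm hm').imp fun _ => hR _ _ _ _
    | wth => exact fun k u hm => (h₅ k u hm).imp_right (.imp_right fun ⟨hk, h⟩ => ⟨hk, hR _ _ _ _ h⟩)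
    | tensor => exact fun x u hm hm' => hR _ _ _ _ (h₅ x u hm hm')
    | lolli =>
      intro x u hm
      obtain ⟨m₁, m₂, Δ', Δ'', e, r₁, r₂⟩ := h₅ x u hm
      exact ⟨m₁, m₂, Δ', Δ'', e, hR _ _ _ _ r₁, hR _ _ _ _ r₂⟩

/-- The fundamental property: linked configurations are related. -/
theorem Linked.termRel : ∀ (N : ℕ) {Δ : Ctx L} {K : Goal L} {B₁ B₂ : Config L},
    Linked ξ Δ K B₁ B₂ → weight Δ K B₁ B₂ < N → TermRel Δ K B₁ B₂ := by
  intro N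
  induction N with
  | zero => exact fun _ h => absurd h (Nat.not_lt_zero _)
  | succ N ih =>
    rintro Δ K _ _ ⟨s, t, h, rfl, rfl⟩ hN
    refine .mk (LinkedBelow ξ N) Δ K _ _ (fun _ _ _ _ h => ih h.1 h.2)
      ⟨s.split, t.split, rfl, rfl, h.left.core.inTree, h.right.core.inTree,
        h.left.core.exists_envRun _ le_rfl, h.right.core.exists_envRun _ le_rfl, ?_⟩
    intro s' t' hs ht
    obtain ⟨C₁, F₁, rfl, i₁⟩ := h.left.envRun hs
    obtain ⟨C₂, F₂, rfl, i₂⟩ := h.right.envRun ht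
    have h' : Pair ξ Δ K ⟨C₁, s.S, s.H, s.M, F₁, s.offD, s.offF⟩
      ⟨C₂, t.S, t.H, t.M, F₂, t.offD, t.offF⟩ := ⟨h.lowΔ, h.lowK, i₁, i₂, h.rel⟩
    obtain ⟨s'', t'', h'', r₁, r₂⟩ := h'.run _ le_rfl
    refine ⟨_, _, r₁, r₂, h''.valRel.mono fun _ _ _ _ h => ⟨h.1, h.2.trans_le ?_⟩⟩
    have e₁ := EnvStep.size_le hs.1
    have e₂ := EnvStep.size_le ht.1
    have e₃ := ProgStep.size_le r₁.1
    have e₄ := ProgStep.size_le r₂.1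
    simp only [weight] at hN ⊢
    omega

/-! ### Noninterference -/

/-- Typed nodes for a closing of a program. -/
theorem exists_closing {Δ Γ : Ctx L} {k : Decl L} {C D F : Config L} {TD : Multiset (TNode L)}
    (hDT : nodes TD = D) (okD : ∀ n ∈ TD, n.Ok) (bD : Bal Δ TD {k})
    (rD : ∀ r₀ : Chan → ℕ, ∃ r : Chan → ℕ, (∀ a, a ∉ D.provided → r a = r₀ a) ∧ RankOk r TD)
    (hC : CfgOk 0 C Δ) (hF : CfgOk {k} F Γ) (hn : (Config.provided (C + D + F)).Nodup) :
    ∃ TC TF, nodes TC = C ∧ nodes TF = F ∧ Bal 0 TC Δ ∧ Bal {k} TF Γ ∧ Good (TC + TD + TF) := by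
  obtain ⟨TC, rfl, okC, bC, rC⟩ := hC.1.flatten hC.2
  obtain ⟨TF, rfl, okF, bF, rF⟩ := hF.1.flatten hF.2
  subst hDT
  refine ⟨TC, TF, rfl, rfl, bC, bF, ?_⟩
  have hok : ∀ n ∈ TC + TD + TF, n.Ok := by
    intro n hn
    rcases Multiset.mem_add.1 hn with hn | hn
    · rcases Multiset.mem_add.1 hn with hn | hn
      · exact okC n hn
      · exact okD n hn
    · exact okF n hn
  have hnames : (decs (TC + TD + TF)).names = Config.provided (nodes TC + nodes TD + nodes TF) := by
    rw [names_decs hok, nodes_add, nodes_add]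
  have hnd : (decs (TC + TD + TF)).names.Nodup := by rwa [hnames]
  refine ⟨hok, hnd, ?_, ?_⟩
  · have C_names : ∀ {b : Decl L}, b ∈ ctxs TC + decs TC → b.ch ∈ (nodes TC).provided := by
      intro b hb
      rw [← names_decs okC]
      refine Ctx.mem_names_of ?_
      rcases Multiset.mem_add.1 hb with hb | hb
      · rw [Bal, zero_add] at bC
        exact bC ▸ Multiset.mem_add.2 (.inl hb)
      · exact hb
    have D_names : ∀ {b : Decl L}, b ∈ ctxs TD + decs TD →
        b.ch ∈ (nodes TC).provided ∨ b.ch ∈ (nodes TD).provided := by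
      intro b hb
      have : b ∈ Δ + decs TD := by
        rcases Multiset.mem_add.1 hb with hb | hb
        · rw [← bD]
          exact Multiset.mem_add.2 (.inl hb)
        · exact Multiset.mem_add.2 (.inr hb)
      rcases Multiset.mem_add.1 this with hb | hb
      · left
        rw [← names_decs okC]
        rw [Bal, zero_add] at bC
        exact Ctx.mem_names_of (bC ▸ Multiset.mem_add.2 (.inr hb))
      · right
        rw [← names_decs okD]
        exact Ctx.mem_names_of hb
    have hdisj := hn
    simp only [Config.provided, Multiset.map_add] at hdisj
    obtain ⟨h₁, -, h₂⟩ := Multiset.nodup_add.1 hdisj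
    have h₁ := (Multiset.nodup_add.1 h₁).2.2
    simp only [Multiset.disjoint_left, Multiset.mem_add] at h₁ h₂
    obtain ⟨r₁, -, k₁⟩ := rC fun _ => 0
    obtain ⟨r₂, a₂, k₂⟩ := rD r₁
    obtain ⟨r₃, a₃, k₃⟩ := rF r₂
    have e₁ : ∀ b ∈ ctxs TC + decs TC, r₃ b.ch = r₁ b.ch := fun b hb => by
      rw [a₃ _ (h₂ (.inl (C_names hb))), a₂ _ (h₁ (C_names hb))]
    have e₂ : ∀ b ∈ ctxs TD + decs TD, r₃ b.ch = r₂ b.ch := fun b hb =>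
      a₃ _ (h₂ (D_names hb))
    refine ⟨r₃, fun n hn b hb => ?_⟩
    rcases Multiset.mem_add.1 hn with hn | hn
    · rcases Multiset.mem_add.1 hn with hn | hn
      · rw [e₁ b (by simp [ctx_mem_ctxs hn hb]), e₁ n.dec (by simp [dec_mem_decs hn])]
        exact k₁ n hn b hb
      · rw [e₂ b (by simp [ctx_mem_ctxs hn hb]), e₂ n.dec (by simp [dec_mem_decs hn])]
        exact k₂ n hn b hb
    · exact k₃ n hn b hb
  · refine Multiset.le_iff_exists_add.2 ⟨Γ, ?_⟩
    classical
    ext a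
    rw [bal_iff] at bC bD bF
    have e₁ := bC a
    have e₂ := bD a
    have e₃ := bF a
    simp only [ctxs_add, decs_add, Multiset.count_add, Multiset.count_zero] at e₁ e₂ e₃ ⊢
    omega

theorem Side.Inv.of_low {Δ Γ : Ctx L} {k : Decl L} {C S F : Multiset (TNode L)}
    (hG : Good (C + S + F)) (hC : Bal 0 C Δ) (hS : Bal Δ S {k}) (hF : Bal {k} F Γ)
    (hΓ : Goal.Offers none Γ) : Side.Inv ξ Δ (some k) ⟨C, S, 0, 0, F, {k}, Γ⟩ :=
  ⟨⟨by simpa using hG, hC, by simpa using hS, hF, rfl, hΓ, nofun⟩, ⟨by simp, rfl⟩, nofun⟩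

open Classical in
theorem Side.Inv.of_high {Δ Γ : Ctx L} {k : Decl L} {C S F : Multiset (TNode L)}
    (hk : ¬ k.lvl ≤ ξ) (hG : Good (C + S + F)) (hC : Bal 0 C Δ) (hS : Bal Δ S {k})
    (hF : Bal {k} F Γ) (hΓ : Goal.Offers none Γ) : ∃ C₁ M,
      Side.Inv ξ (Ctx.proj ξ Δ) none ⟨C₁, S, 0, M, 0, Γ, 0⟩ ∧ C₁ + (S + M) = C + S + F := by
  have hΔ : Δ = Ctx.proj ξ Δ + Δ.filter fun b => ¬ b.lvl ≤ ξ :=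
    (Multiset.filter_add_not _ _).symm
  obtain ⟨C₁, C₂, rfl, h₁, h₂⟩ : ∃ C₁ C₂, C = C₁ + C₂ ∧ Bal 0 C₁ (Ctx.proj ξ Δ) ∧
      Bal 0 C₂ (Δ.filter fun b => ¬ b.lvl ≤ ξ) := by
    rw [hΔ] at hC
    exact hC.split_zero
  have hΓ' : ∀ b ∈ Γ, ¬ b.lvl ≤ ξ := by
    obtain ⟨r, hr⟩ := hG.rank
    obtain ⟨b, hb, -, hl⟩ := hF.climb (r := r) (b := k) (fun n hn => hr n (by simp [hn]))
      (fun n hn => hG.ok n (by simp [hn])) (by simp)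
    rcases hΓ with rfl | ⟨z, c, rfl⟩
    · simp
    · obtain rfl := Multiset.mem_singleton.1 hb
      intro b hb
      obtain rfl := Multiset.mem_singleton.1 hb
      exact fun h => hk (hl.trans h)
  have e : C₁ + C₂ + S + F = C₁ + (S + (C₂ + F)) := by abel
  refine ⟨C₁, C₂ + F, ⟨⟨?_, h₁, ?_, rfl, hΓ, .inl rfl, fun _ => ⟨rfl, rfl⟩⟩, ⟨by simp, ?_⟩,
    fun _ => hΓ'⟩, e.symm⟩
  · simpa [← e] using hG
  · rw [bal_iff] at hC hS hF h₁ ⊢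
    intro a
    have e₀ := hC a
    have e₁ := h₁ a
    have e₂ := hS a
    have e₃ := hF a
    simp only [ctxs_add, decs_add, Multiset.count_add, Multiset.count_zero, add_zero]
      at e₀ e₁ e₂ e₃ ⊢
    omega
  · have p₁ := congrArg (Ctx.proj ξ) h₂
    have p₂ := congrArg (Ctx.proj ξ) hF
    rw [Ctx.proj_add, Ctx.proj_add, Ctx.proj_eq_zero hΓ', Ctx.proj_eq_zero (Δ := {k}) (by simpa),
      zero_add, add_zero] at p₂
    rw [Ctx.proj_add, Ctx.proj_eq_zero (Δ := Δ.filter _) (by simp), add_zero, zero_add] at p₁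
    simp only [ctxs_add, decs_add, Ctx.proj_add, p₁, p₂]

theorem ObsEquiv.refl (ξ : L) {Δ : Ctx L} {D : Config L} {k : Decl L} (hD : CfgOk Δ D {k}) :
    ObsEquiv ξ Δ D k Δ D k := by
  refine ⟨hD, hD, rfl, rfl, ?_⟩
  intro C₁ C₂ F₁ F₂ Γ₁ Γ₂ hC₁ hC₂ o₁ o₂ hF₁ hF₂ n₁ n₂
  obtain ⟨TD, hDT, okD, bD, rD⟩ := hD.1.flatten hD.2
  obtain ⟨TC₁, TF₁, rfl, rfl, bC₁, bF₁, g₁⟩ := exists_closing hDT okD bD rD hC₁ hF₁ n₁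
  obtain ⟨TC₂, TF₂, rfl, rfl, bC₂, bF₂, g₂⟩ := exists_closing hDT okD bD rD hC₂ hF₂ n₂
  subst hDT
  have hrel : Multiset.Rel (NodeSim (· ≤ ξ)) TD TD :=
    Multiset.rel_refl_of_refl_on fun n hn => .refl (okD n hn)
  refine Linked.termRel (ξ := ξ) _ ?_ (Nat.lt_succ_self _)
  rw [← nodes_add, ← nodes_add, ← nodes_add, ← nodes_add]
  by_cases hk : k.lvl ≤ ξ
  · have hΔ : ∀ b ∈ Δ, b.lvl ≤ ξ := by
      intro b hb
      obtain ⟨r, hr⟩ := g₁.rank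
      obtain ⟨b', hb', -, hl⟩ := bD.climb (r := r) (b := b) (fun n hn => hr n (by simp [hn])) okD
        (by simp [hb])
      obtain rfl := Multiset.mem_singleton.1 hb'
      exact hl.trans hk
    rw [Ctx.proj_eq_self hΔ, Decl.proj, if_pos hk]
    refine ⟨_, _, ⟨hΔ, ?_, .of_low g₁ bC₁ bD bF₁ o₁, .of_low g₂ bC₂ bD bF₂ o₂, hrel⟩, ?_, ?_⟩
    · intro b hb
      obtain rfl := Multiset.mem_singleton.1 hb
      exact hk
    all_goals rw [Side.split_all]; simp only [add_zero]
  · rw [Decl.proj, if_neg hk]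
    obtain ⟨_, _, i₁, e₁⟩ := Side.Inv.of_high hk g₁ bC₁ bD bF₁ o₁
    obtain ⟨_, _, i₂, e₂⟩ := Side.Inv.of_high hk g₂ bC₂ bD bF₂ o₂
    refine ⟨_, _, ⟨fun b hb => (Ctx.mem_proj.1 hb).2, by simp [Goal.ctx], i₁, i₂, hrel⟩, ?_, ?_⟩
    · rw [Side.split_all, ← e₁]; simp only [add_zero]
    · rw [Side.split_all, ← e₂]; simp only [add_zero]

end

end IFC

theorem mainTheorem1 {L : Type*} [Lattice L] (ξ : L) (Δ : IFC.Ctx L) (D : IFC.Config L)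
    (x : IFC.Chan) (T : IFC.Ty) (c : L) (hD : IFC.CfgOk Δ D {⟨x, T, c⟩}) :
    IFC.ObsEquiv ξ Δ D ⟨x, T, c⟩ Δ D ⟨x, T, c⟩ :=
  IFC.ObsEquiv.refl ξ hD
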